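/- Let $Q$ be an oriented (effective, Hausdorff, second countable, smooth) $4$-orbifold with a self-dual Einstein metric $g$ of positive scalar curvature: $W^-=0$ and $\mathrm{Ric}=\lambda g$ with $\lambda>0$. Let $B=\Lambda^-T^*Q$ be the total space of the orbibundle of anti-self-dual $2$-forms, a $7$-orbifold. Let $\varphi_0$ be the Bryant--Salamon $3$-form on $B$ with scale $r>0$: in a uniformising chart $U$ of $Q$ with a positive orthonormal coframe $\theta^0,\dots,\theta^3$ put $\omega_1=\theta^{01}-\theta^{23}$, $\omega_2=\theta^{02}-\theta^{31}$, $\omega_3=\theta^{03}-\theta^{12}$, let $(a_1,a_2,a_3)$ be the fibre coordinates of $\Lambda^-T^*U$ with respect to $\omega_1,\omega_2,\omega_3$, and let $\alpha_k=da_k+\sum_l\psi_{kl}a_l$, where $\nabla\omega_l=\sum_k\psi_{kl}\,\omega_k$ for the Levi-Civita connection $\nabla$; then $$\varphi_0=\bigl(r+\tfrac23\lambda|a|^2\bigr)^{-3/4}\,\alpha_1\wedge\alpha_2\wedge\alpha_3+\bigl(r+\tfrac23\lambda|a|^2\bigr)^{1/4}\sum_{k}\alpha_k\wedge\omega_k .$$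 A principal Seifert circle bundle over an orbifold $O$ is a smooth (Hausdorff, second countable) manifold $M$ of dimension $\dim O+1$ with a smooth, effective (on every connected component), almost free circle action, together with an identification of the orbit space $M/S^1$, as an orbifold, with $O$. Its real orbifold first Chern class $c_1^{orb}(M)\in H^2_{orb}(O;\mathbb R)$ is represented (up to a factor $2\pi$) by the basic form $d\theta$, where $\theta$ is any connection, i.e. an invariant $1$-form on $M$ whose value on the generator of the action is $1$. Here $H^\bullet_{orb}(O;\mathbb R)$ is the cohomology of the complex of differential forms on $O$. Then $\varphi_0$ is a closed $3$-form on the orbifold $B$, $H^5_{orb}(B;\mathbb R)=0$, and the following are equivalent: 1. there is a principal Seifert circle bundle $S\to Q$; 2. there is a principal Seifert circle bundle $M\to B$ with $c_1^{orb}(M)\cup[\varphi_0]=0$ in $H^5_{orb}(B;\mathbb R)$. Moreover, every principal Seifert circle bundle $M\to B$ satisfies $c_1^{orb}(M)\cup[\varphi_0]=0$. -/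

import Mathlib

open scoped Manifold ContDiff Topology

noncomputable section

universe u v

/-! ### Exterior algebra -/

section Exterior

variable {E : Type v} [NormedAddCommGroup E] [NormedSpace ℝ E]

/-- The multilinear form `(v₁, …, v_{p+q}) ↦ α(v₁, …, v_p) β(v_{p+1}, …, v_{p+q})`. -/
def tensorForm {p q : ℕ} (α : E [⋀^Fin p]→L[ℝ] ℝ) (β : E [⋀^Fin q]→L[ℝ] ℝ) :
    ContinuousMultilinearMap ℝ (fun _ : Fin (p + q) => E) ℝ where
  toMultilinearMap := ((LinearMap.mul' ℝ ℝ).compMultilinearMap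
    (α.toMultilinearMap.domCoprod β.toMultilinearMap)).domDomCongr finSumFinEquiv
  cont := by
    have h : Continuous fun v : Fin (p + q) → E =>
        α (fun a => v (Fin.castAdd q a)) * β (fun b => v (Fin.natAdd p b)) := by fun_prop
    exact h

theorem tensorForm_apply {p q : ℕ} (α : E [⋀^Fin p]→L[ℝ] ℝ) (β : E [⋀^Fin q]→L[ℝ] ℝ)
    (v : Fin (p + q) → E) :
    tensorForm α β v = α (fun a => v (Fin.castAdd q a)) * β (fun b => v (Fin.natAdd p b)) := rfl

/-- The wedge product, `(α ∧ β)(v) = (p! q!)⁻¹ ∑_σ sgn(σ) α(v_{σ1}, …) β(v_{σ(p+1)}, …)`. -/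
def wedge {p q : ℕ} (α : E [⋀^Fin p]→L[ℝ] ℝ) (β : E [⋀^Fin q]→L[ℝ] ℝ) :
    E [⋀^Fin (p + q)]→L[ℝ] ℝ :=
  ((p.factorial * q.factorial : ℝ)⁻¹) • ContinuousMultilinearMap.alternatization (tensorForm α β)

/-- A linear functional as an alternating form of degree one. -/
def oneForm (θ : E →L[ℝ] ℝ) : E [⋀^Fin 1]→L[ℝ] ℝ :=
  ContinuousAlternatingMap.ofSubsingleton ℝ E ℝ 0 θ

theorem wedge_oneForm (θ η : E →L[ℝ] ℝ) (v : Fin 2 → E) :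
    wedge (oneForm θ) (oneForm η) v = θ (v 0) * η (v 1) - θ (v 1) * η (v 0) := by
  have h : (Finset.univ : Finset (Equiv.Perm (Fin (1 + 1)))) = {1, Equiv.swap 0 1} := by decide
  have h1 : wedge (oneForm θ) (oneForm η) v =
      ContinuousMultilinearMap.alternatization (tensorForm (oneForm θ) (oneForm η)) v := by
    simp [wedge]
  rw [h1, ContinuousMultilinearMap.alternatization_apply_apply, h, Finset.sum_pair (by decide),
    Equiv.Perm.sign_swap (by decide)]
  simp only [tensorForm_apply, oneForm, Equiv.Perm.sign_one, one_smul, Units.neg_smul]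
  rw [sub_eq_add_neg]
  rfl

end Exterior

/-! ### Anti-self-dual two-forms on a four-dimensional oriented Euclidean vector space -/

/-- `ℝ⁴`. -/
abbrev E4 : Type := EuclideanSpace ℝ (Fin 4)

/-- `ℝ³`. -/
abbrev E3 : Type := EuclideanSpace ℝ (Fin 3)

/-- The standard basis of `ℝ⁴`. -/
def stdVec (a : Fin 4) : E4 := EuclideanSpace.single a 1

/-- The coframe `θᵃ = g(e_a, ·)` dual to the `g`-orthonormal frame `e_a = f(stdVec a)`. -/
def coframe (g : E4 →L[ℝ] E4 →L[ℝ] ℝ) (f : E4 →L[ℝ] E4) (a : Fin 4) : E4 →L[ℝ] ℝ :=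
  g (f (stdVec a))

/-- The basis `θ⁰¹ - θ²³, θ⁰² - θ³¹, θ⁰³ - θ¹²` of the space of anti-self-dual two-forms of the
inner product `g` and the orientation for which the orthonormal frame `f` is positive. -/
def asdBasis (g : E4 →L[ℝ] E4 →L[ℝ] ℝ) (f : E4 →L[ℝ] E4) : Fin 3 → E4 [⋀^Fin 2]→L[ℝ] ℝ :=
  let θ := fun a b => wedge (oneForm (coframe g f a)) (oneForm (coframe g f b))
  ![θ 0 1 - θ 2 3, θ 0 2 - θ 3 1, θ 0 3 - θ 1 2]

/-- The anti-self-dual two-form with components `a`. -/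
def asdForm (g : E4 →L[ℝ] E4 →L[ℝ] ℝ) (f : E4 →L[ℝ] E4) (a : E3) : E4 [⋀^Fin 2]→L[ℝ] ℝ :=
  ∑ k, a k • asdBasis g f k

/-- The value of the standard anti-self-dual form of `ℝ⁴` with components `a`. -/
def stdAsd (a : E3) (y z : E4) : ℝ :=
  a 0 * (y 0 * z 1 - y 1 * z 0 - (y 2 * z 3 - y 3 * z 2)) +
  a 1 * (y 0 * z 2 - y 2 * z 0 - (y 3 * z 1 - y 1 * z 3)) +
  a 2 * (y 0 * z 3 - y 3 * z 0 - (y 1 * z 2 - y 2 * z 1))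

/-- The coordinates of a vector in the `g`-orthonormal frame `f`. -/
def frameCoords (g : E4 →L[ℝ] E4 →L[ℝ] ℝ) (f : E4 →L[ℝ] E4) (w : E4) : E4 :=
  WithLp.toLp 2 fun a => coframe g f a w

theorem asdForm_apply (g : E4 →L[ℝ] E4 →L[ℝ] ℝ) (f : E4 →L[ℝ] E4) (a : E3) (v : Fin 2 → E4) :
    asdForm g f a v = stdAsd a (frameCoords g f (v 0)) (frameCoords g f (v 1)) := by
  simp only [asdForm, Fin.sum_univ_three, asdBasis, ContinuousAlternatingMap.add_apply,
    ContinuousAlternatingMap.smul_apply, Matrix.cons_val_zero, Matrix.cons_val_one,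
    Matrix.cons_val, ContinuousAlternatingMap.sub_apply, wedge_oneForm, stdAsd, frameCoords,
    smul_eq_mul]
  ring

theorem stdAsd_gram (u v w z : E4) :
    ((u 0 * v 1 - u 1 * v 0 - (u 2 * v 3 - u 3 * v 2)) *
        (w 0 * z 1 - w 1 * z 0 - (w 2 * z 3 - w 3 * z 2)) +
      (u 0 * v 2 - u 2 * v 0 - (u 3 * v 1 - u 1 * v 3)) *
        (w 0 * z 2 - w 2 * z 0 - (w 3 * z 1 - w 1 * z 3)) +
      (u 0 * v 3 - u 3 * v 0 - (u 1 * v 2 - u 2 * v 1)) *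
        (w 0 * z 3 - w 3 * z 0 - (w 1 * z 2 - w 2 * z 1))) =
      inner ℝ u w * inner ℝ v z - inner ℝ u z * inner ℝ v w -
        Matrix.det (Matrix.of fun r c : Fin 4 => (![u, v, w, z] c) r) := by
  simp [Matrix.det_succ_row_zero, Fin.sum_univ_succ, PiLp.inner_apply, Fin.succAbove]
  ring

theorem stdAsd_aux {a0 a1 a2 p0 p1 p2 q0 q1 q2 : ℝ}
    (h1 : p0 * p0 + p1 * p1 + p2 * p2 = 1 * 1 - 0 * 0 - 0)
    (h2 : q0 * q0 + q1 * q1 + q2 * q2 = 1 * 1 - 0 * 0 - 0)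
    (h3 : p0 * q0 + p1 * q1 + p2 * q2 = 0 * 0 - 0 * 0 - 1) :
    a0 * q0 + a1 * q1 + a2 * q2 = -(a0 * p0 + a1 * p1 + a2 * p2) := by
  have e0 : p0 + q0 = 0 := by
    nlinarith [sq_nonneg (p0 + q0), sq_nonneg (p1 + q1), sq_nonneg (p2 + q2)]
  have e1 : p1 + q1 = 0 := by
    nlinarith [sq_nonneg (p0 + q0), sq_nonneg (p1 + q1), sq_nonneg (p2 + q2)]
  have e2 : p2 + q2 = 0 := by
    nlinarith [sq_nonneg (p0 + q0), sq_nonneg (p1 + q1), sq_nonneg (p2 + q2)]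
  linear_combination a0 * e0 + a1 * e1 + a2 * e2

/-- A sum of two decomposable forms of an oriented orthonormal frame that is self-dual has no
anti-self-dual components. -/
theorem stdAsd_opposite (a : E3) (u v w z : E4) (huu : inner ℝ u u = (1 : ℝ))
    (hvv : inner ℝ v v = (1 : ℝ)) (hww : inner ℝ w w = (1 : ℝ)) (hzz : inner ℝ z z = (1 : ℝ))
    (huv : inner ℝ u v = (0 : ℝ)) (huw : inner ℝ u w = (0 : ℝ)) (huz : inner ℝ u z = (0 : ℝ))
    (hvw : inner ℝ v w = (0 : ℝ)) (hvz : inner ℝ v z = (0 : ℝ)) (hwz : inner ℝ w z = (0 : ℝ))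
    (hd : Matrix.det (Matrix.of fun r c : Fin 4 => (![u, v, w, z] c) r) = 1) :
    stdAsd a w z = - stdAsd a u v := by
  have h1 := stdAsd_gram u v u v
  have h2 := stdAsd_gram w z w z
  have h3 := stdAsd_gram u v w z
  have d1 : Matrix.det (Matrix.of fun r c : Fin 4 => (![u, v, u, v] c) r) = 0 :=
    Matrix.det_zero_of_column_eq (i := 0) (j := 2) (by decide) (fun _ => rfl)
  have d2 : Matrix.det (Matrix.of fun r c : Fin 4 => (![w, z, w, z] c) r) = 0 :=
    Matrix.det_zero_of_column_eq (i := 0) (j := 2) (by decide) (fun _ => rfl)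
  rw [d1, huu, hvv, real_inner_comm u v, huv] at h1
  rw [d2, hww, hzz, real_inner_comm w z, hwz] at h2
  rw [hd, huw, hvz, huz, hvw] at h3
  rw [stdAsd, stdAsd]
  exact stdAsd_aux h1 h2 h3

theorem E4_eq_sum (y : E4) :
    y = y 0 • stdVec 0 + y 1 • stdVec 1 + y 2 • stdVec 2 + y 3 • stdVec 3 := by
  ext i; fin_cases i <;> simp [stdVec]

theorem stdVec_inner (a b : Fin 4) : inner ℝ (stdVec a) (stdVec b) = if a = b then (1 : ℝ) else 0 := by
  simp [stdVec, EuclideanSpace.inner_single_left]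

theorem det_cols (n : E4 →L[ℝ] E4) :
    Matrix.det (Matrix.of fun r c : Fin 4 => (n (stdVec c)) r) = n.det := by
  have h := LinearMap.det_toMatrix (EuclideanSpace.basisFun (Fin 4) ℝ).toBasis (n : E4 →ₗ[ℝ] E4)
  rw [ContinuousLinearMap.det, ← h]
  congr 1

theorem stdAsd_rotate (n : E4 →L[ℝ] E4) (hn : ∀ y z, inner ℝ (n y) (n z) = (inner ℝ y z : ℝ))
    (hd : 0 < n.det) (a : E3) (y z : E4) :
    stdAsd a (n y) (n z) =
      stdAsd (WithLp.toLp 2 fun k : Fin 3 => stdAsd a (n (stdVec 0)) (n (stdVec k.succ))) y z := by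
  have hI : ∀ b c, inner ℝ (n (stdVec b)) (n (stdVec c)) = if b = c then (1 : ℝ) else 0 :=
    fun b c => by rw [hn, stdVec_inner]
  have hM : n.det = 1 := by
    set N := Matrix.of fun r c : Fin 4 => (n (stdVec c)) r
    have h1 : N.transpose * N = 1 := by
      ext b c
      have := hI b c
      rw [PiLp.inner_apply] at this
      simp only [Matrix.mul_apply, Matrix.transpose_apply, Matrix.one_apply, ← this, N,
        Matrix.of_apply]
      refine Finset.sum_congr rfl fun r _ => ?_
      simp [mul_comm]
    have h2 : N.det * N.det = 1 := by
      have := congrArg Matrix.det h1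
      simpa using this
    have h3 : N.det = n.det := det_cols n
    rw [h3] at h2
    nlinarith
  have hdet : ∀ p : Equiv.Perm (Fin 4), Equiv.Perm.sign p = 1 →
      Matrix.det (Matrix.of fun r c : Fin 4 =>
        (![n (stdVec (p 0)), n (stdVec (p 1)), n (stdVec (p 2)), n (stdVec (p 3))] c) r) = 1 := by
    intro p hp
    have := Matrix.det_permute' p (Matrix.of fun r c : Fin 4 => (n (stdVec c)) r)
    rw [hp, det_cols, hM] at this
    simp only [Units.val_one, Int.cast_one, mul_one] at this
    rw [← this]
    congr 1
    ext r c
    fin_cases c <;> rfl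
  have opp : ∀ p : Equiv.Perm (Fin 4), Equiv.Perm.sign p = 1 →
      stdAsd a (n (stdVec (p 2))) (n (stdVec (p 3))) =
        - stdAsd a (n (stdVec (p 0))) (n (stdVec (p 1))) := by
    intro p hp
    apply stdAsd_opposite a _ _ _ _ _ _ _ _ _ _ _ _ _ _ (hdet p hp) <;>
      rw [hI] <;> simp
  have o1 : stdAsd a (n (stdVec 2)) (n (stdVec 3)) = - stdAsd a (n (stdVec 0)) (n (stdVec 1)) :=
    opp 1 (by decide)
  have o2 : stdAsd a (n (stdVec 3)) (n (stdVec 1)) = - stdAsd a (n (stdVec 0)) (n (stdVec 2)) := by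
    have h := opp (Equiv.swap 1 2 * Equiv.swap 2 3) (by decide)
    rwa [show (Equiv.swap 1 2 * Equiv.swap 2 3 : Equiv.Perm (Fin 4)) 0 = 0 by decide, show (Equiv.swap 1 2 * Equiv.swap 2 3 : Equiv.Perm (Fin 4)) 1 = 2 by decide, show (Equiv.swap 1 2 * Equiv.swap 2 3 : Equiv.Perm (Fin 4)) 2 = 3 by decide, show (Equiv.swap 1 2 * Equiv.swap 2 3 : Equiv.Perm (Fin 4)) 3 = 1 by decide] at h
  have o3 : stdAsd a (n (stdVec 1)) (n (stdVec 2)) = - stdAsd a (n (stdVec 0)) (n (stdVec 3)) := by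
    have h := opp (Equiv.swap 2 3 * Equiv.swap 1 2) (by decide)
    rwa [show (Equiv.swap 2 3 * Equiv.swap 1 2 : Equiv.Perm (Fin 4)) 0 = 0 by decide, show (Equiv.swap 2 3 * Equiv.swap 1 2 : Equiv.Perm (Fin 4)) 1 = 3 by decide, show (Equiv.swap 2 3 * Equiv.swap 1 2 : Equiv.Perm (Fin 4)) 2 = 1 by decide, show (Equiv.swap 2 3 * Equiv.swap 1 2 : Equiv.Perm (Fin 4)) 3 = 2 by decide] at h
  have ey : n y = y 0 • n (stdVec 0) + y 1 • n (stdVec 1) + y 2 • n (stdVec 2) +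
      y 3 • n (stdVec 3) := by
    conv_lhs => rw [E4_eq_sum y]
    simp only [map_add, map_smul]
  have ez : n z = z 0 • n (stdVec 0) + z 1 • n (stdVec 1) + z 2 • n (stdVec 2) +
      z 3 • n (stdVec 3) := by
    conv_lhs => rw [E4_eq_sum z]
    simp only [map_add, map_smul]
  rw [ey, ez]
  have bil : ∀ n0 n1 n2 n3 : E4, stdAsd a (y 0 • n0 + y 1 • n1 + y 2 • n2 + y 3 • n3)
      (z 0 • n0 + z 1 • n1 + z 2 • n2 + z 3 • n3) =
      stdAsd a n0 n1 * (y 0 * z 1 - y 1 * z 0) + stdAsd a n2 n3 * (y 2 * z 3 - y 3 * z 2) +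
      stdAsd a n0 n2 * (y 0 * z 2 - y 2 * z 0) + stdAsd a n3 n1 * (y 3 * z 1 - y 1 * z 3) +
      stdAsd a n0 n3 * (y 0 * z 3 - y 3 * z 0) + stdAsd a n1 n2 * (y 1 * z 2 - y 2 * z 1) := by
    intro n0 n1 n2 n3
    simp only [stdAsd, PiLp.add_apply, PiLp.smul_apply, smul_eq_mul]
    ring
  rw [bil, o1, o2, o3]
  change _ = stdAsd a (n (stdVec 0)) (n (stdVec 1)) * _ + stdAsd a (n (stdVec 0)) (n (stdVec 2)) * _ +
    stdAsd a (n (stdVec 0)) (n (stdVec 3)) * _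
  ring

/-- Pull-back of anti-self-dual forms by an orientation preserving linear isometry `T` with
inverse `T'`. -/
theorem asdForm_pullback (g g' : E4 →L[ℝ] E4 →L[ℝ] ℝ) (f f' T T' : E4 →L[ℝ] E4)
    (hf : ∀ y z, g (f y) (f z) = (inner ℝ y z : ℝ)) (hf' : ∀ y z, g' (f' y) (f' z) = (inner ℝ y z : ℝ))
    (df : 0 < f.det) (df' : 0 < f'.det) (dT : 0 < T.det) (hT : ∀ y z, g' (T y) (T z) = g y z)
    (h1 : ∀ y, T' (T y) = y) (h2 : ∀ y, T (T' y) = y) (a : E3) :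
    (asdForm g' f' (WithLp.toLp 2 fun k : Fin 3 =>
      asdForm g f a ![T' (f' (stdVec 0)), T' (f' (stdVec k.succ))])).compContinuousLinearMap T =
      asdForm g f a := by
  have coords : ∀ (g : E4 →L[ℝ] E4 →L[ℝ] ℝ) (f : E4 →L[ℝ] E4),
      (∀ y z, g (f y) (f z) = (inner ℝ y z : ℝ)) → ∀ y, frameCoords g f (f y) = y := by
    intro g f hf y
    ext r
    simp only [frameCoords, coframe, hf]
    simp [stdVec, EuclideanSpace.inner_single_left]
  have surj : ∀ (f : E4 →L[ℝ] E4), 0 < f.det → Function.Surjective f := by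
    intro f df
    have hu : IsUnit (LinearMap.det (f : E4 →ₗ[ℝ] E4)) := by
      rw [isUnit_iff_ne_zero]; exact df.ne'
    rw [← LinearMap.isUnit_iff_isUnit_det, Module.End.isUnit_iff] at hu
    exact hu.2
  -- the rotation `n = f⁻¹ T' f'`
  let c : E4 →ₗ[ℝ] E4 :=
    { toFun := frameCoords g f
      map_add' := by intro x y; ext r; simp [frameCoords]
      map_smul' := by intro t x; ext r; simp [frameCoords] }
  let n : E4 →L[ℝ] E4 := (LinearMap.toContinuousLinearMap c).comp (T'.comp f')
  have hn : ∀ y, n y = frameCoords g f (T' (f' y)) := fun y => rfl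
  have fn : ∀ y, f (n y) = T' (f' y) := by
    intro y
    obtain ⟨w, hw⟩ := surj f df (T' (f' y))
    rw [hn, ← hw, coords g f hf]
  have niso : ∀ y z, inner ℝ (n y) (n z) = (inner ℝ y z : ℝ) := by
    intro y z
    rw [← hf, fn, fn, ← hT, h2, h2, hf']
  have dn : 0 < n.det := by
    have e1 : f.comp n = T'.comp f' := by ext1 y; exact fn y
    have e2 : T.comp T' = ContinuousLinearMap.id ℝ E4 := by ext1 y; exact h2 y
    have m : ∀ A B : E4 →L[ℝ] E4, (A.comp B).det = A.det * B.det := fun A B => by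
      simp only [ContinuousLinearMap.det]
      exact LinearMap.det_comp _ _
    have d1 := congrArg ContinuousLinearMap.det e1
    have d2 := congrArg ContinuousLinearMap.det e2
    rw [m f n, m T' f'] at d1
    rw [m T T'] at d2
    have d3 : (ContinuousLinearMap.id ℝ E4).det = 1 := by
      simp [ContinuousLinearMap.det]
    rw [d3] at d2
    have dT' : 0 < T'.det := by
      by_contra hc
      nlinarith [mul_nonneg dT.le (neg_nonneg.mpr (not_lt.mp hc))]
    by_contra hc
    nlinarith [mul_nonneg df.le (neg_nonneg.mpr (not_lt.mp hc)), mul_pos dT' df']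
  ext v
  rw [ContinuousAlternatingMap.compContinuousLinearMap_apply, asdForm_apply, asdForm_apply]
  simp only [Function.comp_apply]
  have key : ∀ w, frameCoords g f w = n (frameCoords g' f' (T w)) := by
    intro w
    obtain ⟨y, hy⟩ := surj f' df' (T w)
    rw [← hy, coords g' f' hf', hn, hy, h1]
  rw [key (v 0), key (v 1), stdAsd_rotate n niso dn]
  congr 1
  ext k
  simp only [asdForm_apply, hn]
  rfl

theorem asdForm_injective (g : E4 →L[ℝ] E4 →L[ℝ] ℝ) (f : E4 →L[ℝ] E4)
    (hf : ∀ y z, g (f y) (f z) = (inner ℝ y z : ℝ)) (a b : E3) (h : asdForm g f a = asdForm g f b) :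
    a = b := by
  have coords : ∀ y, frameCoords g f (f y) = y := by
    intro y
    ext r
    simp only [frameCoords, coframe, hf]
    simp [stdVec, EuclideanSpace.inner_single_left]
  ext k
  have h1 := congrArg (fun β => β ![f (stdVec 0), f (stdVec k.succ)]) h
  simp only [asdForm_apply, Matrix.cons_val_zero, Matrix.cons_val_one, coords] at h1
  fin_cases k <;> simpa [stdAsd, stdVec] using h1

/-! ### Orbifolds -/

section Orbifolds

variable {E : Type v} [NormedAddCommGroup E] [NormedSpace ℝ E] {X : Type u}

/-- A local change of charts between two parametrisations `φ : U → X` and `ψ : V → X`: a smooth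
diffeomorphism `h` of an open subset of `U` onto an open subset of `V` with `ψ ∘ h = φ`. -/
structure IsChartChange (U V : Set E) (φ ψ : E → X) (h : OpenPartialHomeomorph E E) : Prop where
  source_subset : h.source ⊆ U
  target_subset : h.target ⊆ V
  contDiffOn : ContDiffOn ℝ ∞ h h.source
  contDiffOn_symm : ContDiffOn ℝ ∞ h.symm h.target
  map : ∀ x ∈ h.source, ψ (h x) = φ x

theorem IsChartChange.refl {U : Set E} (hU : IsOpen U) (φ : E → X) :
    IsChartChange U U φ φ (OpenPartialHomeomorph.ofSet U hU) where
  source_subset := subset_rfl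
  target_subset := subset_rfl
  contDiffOn := contDiffOn_id
  contDiffOn_symm := contDiffOn_id
  map _ _ := rfl

theorem IsChartChange.symm {U V : Set E} {φ ψ : E → X} {h : OpenPartialHomeomorph E E}
    (H : IsChartChange U V φ ψ h) : IsChartChange V U ψ φ h.symm where
  source_subset := H.target_subset
  target_subset := H.source_subset
  contDiffOn := H.contDiffOn_symm
  contDiffOn_symm := H.contDiffOn
  map y hy := by
    have := H.map (h.symm y) (h.map_target hy)
    rw [h.right_inv hy] at this
    exact this.symm

theorem IsChartChange.trans {U V W : Set E} {φ ψ χ : E → X} {h k : OpenPartialHomeomorph E E}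
    (H : IsChartChange U V φ ψ h) (K : IsChartChange V W ψ χ k) :
    IsChartChange U W φ χ (h.trans k) where
  source_subset x hx := H.source_subset (by simp at hx; exact hx.1)
  target_subset x hx := K.target_subset (by simp at hx; exact hx.1)
  contDiffOn := K.contDiffOn.comp (H.contDiffOn.mono fun x hx => by simp at hx; exact hx.1)
    (fun x hx => by simp at hx; exact hx.2)
  contDiffOn_symm := H.contDiffOn_symm.comp
    (K.contDiffOn_symm.mono fun x hx => by simp at hx; exact hx.1)
    (fun x hx => by simp at hx; exact hx.2)
  map x hx := by
    simp only [OpenPartialHomeomorph.trans_source, Set.mem_inter_iff, Set.mem_preimage] at hx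
    simp only [OpenPartialHomeomorph.coe_trans, Function.comp_apply]
    rw [K.map _ hx.2, H.map _ hx.1]

theorem IsChartChange.differentiableAt {U V : Set E} {φ ψ : E → X} {h : OpenPartialHomeomorph E E}
    (H : IsChartChange U V φ ψ h) {x : E} (hx : x ∈ h.source) : DifferentiableAt ℝ h x :=
  (H.contDiffOn.contDiffAt (h.open_source.mem_nhds hx)).differentiableAt (by simp)

theorem IsChartChange.fderiv_symm {U V : Set E} {φ ψ : E → X} {h : OpenPartialHomeomorph E E}
    (H : IsChartChange U V φ ψ h) {x : E} (hx : x ∈ h.source) (w : E) :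
    fderiv ℝ h.symm (h x) (fderiv ℝ h x w) = w := by
  have h1 : h.symm ∘ h =ᶠ[𝓝 x] id := by
    filter_upwards [h.open_source.mem_nhds hx] with y hy
    exact h.left_inv hy
  have h2 := h1.fderiv_eq (𝕜 := ℝ)
  rw [fderiv_comp x (H.symm.differentiableAt (h.map_source hx)) (H.differentiableAt hx),
    fderiv_id] at h2
  exact congrArg (fun A => A w) h2

variable [TopologicalSpace X]

/-- An effective orbifold structure on the space `X`, modelled on the vector space `E`. A chart
consists of an open set `U i` of `E`, a finite group `G i` acting effectively on `U i` by
diffeomorphisms (`act i`), and a map `φ i : U i → X` that induces a homeomorphism of `U i / G i`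
with an open subset of `X`. Two points of charts with the same image in `X` are related by a local
change of charts. The functions `act i γ` and `φ i` are relevant only on `U i`. Effectiveness is
required in the form that only the identity of `G i` fixes a nonempty open set pointwise; for a
connected `U i` this is the same as effectiveness of the action. -/
structure Orbifold (E : Type v) [NormedAddCommGroup E] [NormedSpace ℝ E]
    (X : Type u) [TopologicalSpace X] : Type (max (u + 1) v) where
  ι : Type u
  U : ι → Set E
  isOpen_U : ∀ i, IsOpen (U i)
  G : ι → Type u
  [group : ∀ i, Group (G i)]
  [finite : ∀ i, Finite (G i)]
  act : ∀ i, G i → E → E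
  act_mapsTo : ∀ i γ, Set.MapsTo (act i γ) (U i) (U i)
  act_contDiffOn : ∀ i γ, ContDiffOn ℝ ∞ (act i γ) (U i)
  act_one : ∀ i, ∀ x ∈ U i, act i 1 x = x
  act_mul : ∀ i γ γ', ∀ x ∈ U i, act i (γ * γ') x = act i γ (act i γ' x)
  effective : ∀ i γ, γ ≠ 1 → interior {x ∈ U i | act i γ x = x} = ∅
  φ : ι → E → X
  continuousOn_φ : ∀ i, ContinuousOn (φ i) (U i)
  isOpen_image : ∀ i, ∀ V ⊆ U i, IsOpen V → IsOpen (φ i '' V)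
  fiber : ∀ i, ∀ x ∈ U i, ∀ y ∈ U i, φ i x = φ i y ↔ ∃ γ, act i γ x = y
  cover : ∀ p, ∃ i, ∃ x ∈ U i, φ i x = p
  compat : ∀ i j, ∀ x ∈ U i, ∀ y ∈ U j, φ i x = φ j y →
    ∃ h, IsChartChange (U i) (U j) (φ i) (φ j) h ∧ x ∈ h.source ∧ h x = y

attribute [instance] Orbifold.group Orbifold.finite

namespace Orbifold

/-- The changes of charts of an orbifold. -/
abbrev IsTransition (O : Orbifold E X) (i j : O.ι) (h : OpenPartialHomeomorph E E) : Prop :=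
  IsChartChange (O.U i) (O.U j) (O.φ i) (O.φ j) h

/-- The action of a group element as a change of charts. -/
def actHomeo (O : Orbifold E X) (i : O.ι) (γ : O.G i) : OpenPartialHomeomorph E E where
  toFun := O.act i γ
  invFun := O.act i γ⁻¹
  source := O.U i
  target := O.U i
  map_source' := O.act_mapsTo i γ
  map_target' := O.act_mapsTo i γ⁻¹
  left_inv' x hx := by rw [← O.act_mul i _ _ x hx, inv_mul_cancel, O.act_one i x hx]
  right_inv' x hx := by rw [← O.act_mul i _ _ x hx, mul_inv_cancel, O.act_one i x hx]
  open_source := O.isOpen_U i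
  open_target := O.isOpen_U i
  continuousOn_toFun := (O.act_contDiffOn i γ).continuousOn
  continuousOn_invFun := (O.act_contDiffOn i γ⁻¹).continuousOn

theorem actHomeo_isTransition (O : Orbifold E X) (i : O.ι) (γ : O.G i) :
    O.IsTransition i i (O.actHomeo i γ) where
  source_subset := subset_rfl
  target_subset := subset_rfl
  contDiffOn := O.act_contDiffOn i γ
  contDiffOn_symm := O.act_contDiffOn i γ⁻¹
  map x hx := ((O.fiber i x hx _ (O.act_mapsTo i γ hx)).2 ⟨γ, rfl⟩).symm

/-- To first order, a change of charts of a chart with itself is an element of the group. -/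
theorem exists_act_eq (O : Orbifold E X) {i : O.ι} {h : OpenPartialHomeomorph E E}
    (H : O.IsTransition i i h) {x : E} (hx : x ∈ h.source) :
    ∃ γ, O.act i γ x = h x ∧ fderiv ℝ (O.act i γ) x = fderiv ℝ h x := by
  classical
  -- the sets on which `h` agrees with a group element, relative to the source of `h`
  let F : O.G i → Set h.source := fun γ => {y | O.act i γ y = h y}
  have hF : ∀ γ, IsClosed (F γ) := by
    intro γ
    refine isClosed_eq ?_ ?_
    · exact ((O.act_contDiffOn i γ).continuousOn.mono H.source_subset).domRestrict
    · exact H.contDiffOn.continuousOn.domRestrict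
  have hU : ⋃ γ, F γ = Set.univ := by
    refine Set.eq_univ_of_forall fun y => ?_
    have := (O.fiber i y (H.source_subset y.2) _ (H.target_subset (h.map_source y.2))).1
      (H.map y y.2).symm
    obtain ⟨γ, hγ⟩ := this
    exact Set.mem_iUnion.2 ⟨γ, hγ⟩
  have hd : Dense (⋃ γ, interior (F γ)) := by
    have aux : ∀ s : Finset (O.G i), closure (⋃ γ ∈ s, interior (F γ)) ⊇ interior (⋃ γ ∈ s, F γ) := by
      intro s
      induction s using Finset.induction_on with
      | empty => simp
      | insert a s _ ih =>
        rw [Finset.set_biUnion_insert, Finset.set_biUnion_insert, closure_union]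
        intro y hy
        by_contra hc
        rw [Set.mem_union, not_or] at hc
        have hc2 : y ∉ interior (⋃ γ ∈ s, F γ) := fun h' => hc.2 (ih h')
        -- near `y` there are points of the open set `interior (F a ∪ R)` outside `R`
        set R := ⋃ γ ∈ s, F γ
        have hR : IsClosed R := s.finite_toSet.isClosed_biUnion fun γ _ => hF γ
        have hO : IsOpen (interior (F a ∪ R) ∩ Rᶜ) := isOpen_interior.inter hR.isOpen_compl
        have hsub : interior (F a ∪ R) ∩ Rᶜ ⊆ interior (F a) := by
          refine interior_maximal ?_ hO
          rintro z ⟨hz1, hz2⟩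
          exact (interior_subset hz1).resolve_right hz2
        have hy' : y ∈ closure (interior (F a ∪ R) ∩ Rᶜ) := by
          rw [interior_eq_compl_closure_compl, Set.mem_compl_iff, not_not] at hc2
          exact isOpen_interior.inter_closure ⟨hy, hc2⟩
        exact hc.1 (closure_mono hsub hy')
    have := Fintype.ofFinite (O.G i)
    have h1 := aux Finset.univ
    simp only [Finset.mem_univ, Set.iUnion_true, hU, interior_univ] at h1
    intro y
    exact h1 (Set.mem_univ y)
  have hx' := hd ⟨x, hx⟩
  rw [closure_iUnion_of_finite] at hx'
  obtain ⟨γ, hγ⟩ := Set.mem_iUnion.1 hx'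
  refine ⟨γ, ?_, ?_⟩
  · have := closure_minimal interior_subset (hF γ) hγ
    exact this
  · let D : Set h.source := {y | fderiv ℝ (O.act i γ) y = fderiv ℝ h y}
    have hD : IsClosed D := by
      refine isClosed_eq ?_ ?_
      · exact ((((O.act_contDiffOn i γ).continuousOn_fderiv_of_isOpen (O.isOpen_U i)
          (by simp))).mono H.source_subset).domRestrict
      · exact (H.contDiffOn.continuousOn_fderiv_of_isOpen h.open_source (by simp)).domRestrict
    refine closure_minimal ?_ hD hγ
    intro y hy
    refine Filter.EventuallyEq.fderiv_eq ?_
    have hop : IsOpen (Subtype.val '' interior (F γ)) :=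
      h.open_source.isOpenMap_subtype_val _ isOpen_interior
    filter_upwards [hop.mem_nhds ⟨y, hy, rfl⟩] with z hz
    obtain ⟨z', hz', rfl⟩ := hz
    exact (interior_subset hz' : z' ∈ F γ)

end Orbifold

end Orbifolds

/-! ### Oriented Riemannian orbifolds and the orbibundle of anti-self-dual two-forms -/

section Riemannian

namespace Orbifold

variable {E : Type v} [NormedAddCommGroup E] [NormedSpace ℝ E] {X : Type u} [TopologicalSpace X]

/-- The charts of `O` are oriented: all changes of charts preserve the orientation of `E`. -/
def IsOriented (O : Orbifold E X) : Prop :=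
  ∀ i j h, O.IsTransition i j h → ∀ x ∈ h.source, 0 < (fderiv ℝ h x).det

/-- A Riemannian metric on an orbifold: a Riemannian metric on every chart, invariant under all
changes of charts (in particular under the groups of the charts). -/
structure RiemannianMetric (O : Orbifold E X) where
  val : ∀ _ : O.ι, E → E →L[ℝ] E →L[ℝ] ℝ
  contDiffOn : ∀ i, ContDiffOn ℝ ∞ (val i) (O.U i)
  symm : ∀ i, ∀ x ∈ O.U i, ∀ w z, val i x w z = val i x z w
  pos : ∀ i, ∀ x ∈ O.U i, ∀ w, w ≠ 0 → 0 < val i x w w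
  invariant : ∀ i j h, O.IsTransition i j h → ∀ x ∈ h.source, ∀ w z,
    val j (h x) (fderiv ℝ h x w) (fderiv ℝ h x z) = val i x w z

/-- An auxiliary choice, for every chart, of a smooth positively oriented orthonormal frame, given
as the linear map that takes the standard basis of `ℝ⁴` to the frame. (Orthonormalisation of the
coordinate vector fields shows that such a choice always exists; no compatibility between different
charts is required.) -/
structure OrthonormalFrame {Q : Orbifold E4 X} (g : Q.RiemannianMetric) where
  val : ∀ _ : Q.ι, E4 → E4 →L[ℝ] E4
  contDiffOn : ∀ i, ContDiffOn ℝ ∞ (val i) (Q.U i)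
  orthonormal : ∀ i, ∀ x ∈ Q.U i, ∀ y z, g.val i x (val i x y) (val i x z) = inner ℝ y z
  oriented : ∀ i, ∀ x ∈ Q.U i, 0 < (val i x).det

end Orbifold

variable {X : Type u} [TopologicalSpace X] {Q : Orbifold E4 X} {g : Q.RiemannianMetric}

namespace Orbifold.OrthonormalFrame

variable (e : Orbifold.OrthonormalFrame g)

/-- The anti-self-dual two-form at the point `x` of the chart `i` with components `a`. -/
abbrev asd (i : Q.ι) (x : E4) (a : E3) : E4 [⋀^Fin 2]→L[ℝ] ℝ :=
  asdForm (g.val i x) (e.val i x) a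

/-- The components, in the chart `j`, of the push-forward under the change of charts `h` of the
anti-self-dual two-form at `x` with components `a` in the chart `i`. -/
def liftFibre (i j : Q.ι) (h : OpenPartialHomeomorph E4 E4) (x : E4) (a : E3) : E3 :=
  WithLp.toLp 2 fun k : Fin 3 => e.asd i x a
    ![fderiv ℝ h.symm (h x) (e.val j (h x) (stdVec 0)),
      fderiv ℝ h.symm (h x) (e.val j (h x) (stdVec k.succ))]

theorem asd_inj {i : Q.ι} {x : E4} (hx : x ∈ Q.U i) {a b : E3} (h : e.asd i x a = e.asd i x b) :
    a = b :=
  asdForm_injective _ _ (e.orthonormal i x hx) a b h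

theorem liftFibre_spec (hQ : Q.IsOriented) {i j : Q.ι} {h : OpenPartialHomeomorph E4 E4}
    (H : Q.IsTransition i j h) {x : E4} (hx : x ∈ h.source) (a : E3) :
    (e.asd j (h x) (e.liftFibre i j h x a)).compContinuousLinearMap (fderiv ℝ h x) =
      e.asd i x a := by
  have hy := h.map_source hx
  refine asdForm_pullback _ _ _ _ _ (fderiv ℝ h.symm (h x)) (e.orthonormal i x (H.source_subset hx))
    (e.orthonormal j _ (H.target_subset hy)) (e.oriented i x (H.source_subset hx))
    (e.oriented j _ (H.target_subset hy)) (hQ i j h H x hx) (g.invariant i j h H x hx)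
    (H.fderiv_symm hx) ?_ a
  intro w
  have := H.symm.fderiv_symm hy w
  rw [h.left_inv hx] at this
  exact this

/-- The push-forward of an anti-self-dual form is determined by the derivative of the change of
charts. -/
theorem liftFibre_unique (hQ : Q.IsOriented) {i j : Q.ι} {h : OpenPartialHomeomorph E4 E4}
    (H : Q.IsTransition i j h) {x : E4} (hx : x ∈ h.source) {a b : E3}
    (hb : (e.asd j (h x) b).compContinuousLinearMap (fderiv ℝ h x) = e.asd i x a) :
    b = e.liftFibre i j h x a := by
  refine e.asd_inj (H.target_subset (h.map_source hx)) ?_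
  rw [← e.liftFibre_spec hQ H hx a] at hb
  ext v
  have h1 := congrArg (fun β => β fun r => fderiv ℝ h.symm (h x) (v r)) hb
  simp only [ContinuousAlternatingMap.compContinuousLinearMap_apply] at h1
  have h2 : (fderiv ℝ h x ∘ fun r => fderiv ℝ h.symm (h x) (v r)) = v := by
    funext r
    have := H.symm.fderiv_symm (h.map_source hx) (v r)
    rw [h.left_inv hx] at this
    exact this
  rwa [h2] at h1

theorem contDiffOn_liftFibre {i j : Q.ι} {h : OpenPartialHomeomorph E4 E4}
    (H : Q.IsTransition i j h) :
    ContDiffOn ℝ ∞ (fun p : E4 × E3 => e.liftFibre i j h p.1 p.2) (h.source ×ˢ Set.univ) := by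
  have hfst : ContDiffOn ℝ ∞ (fun p : E4 × E3 => p.1) (h.source ×ˢ Set.univ) :=
    contDiff_fst.contDiffOn
  have hg : ContDiffOn ℝ ∞ (fun p : E4 × E3 => g.val i p.1) (h.source ×ˢ Set.univ) :=
    (g.contDiffOn i).comp hfst fun p hp => H.source_subset hp.1
  have he : ContDiffOn ℝ ∞ (fun p : E4 × E3 => e.val i p.1) (h.source ×ˢ Set.univ) :=
    (e.contDiffOn i).comp hfst fun p hp => H.source_subset hp.1
  have hh : ContDiffOn ℝ ∞ (fun p : E4 × E3 => h p.1) (h.source ×ˢ Set.univ) :=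
    H.contDiffOn.comp hfst fun p hp => hp.1
  have hej : ContDiffOn ℝ ∞ (fun p : E4 × E3 => e.val j (h p.1)) (h.source ×ˢ Set.univ) :=
    (e.contDiffOn j).comp hh fun p hp => H.target_subset (h.map_source hp.1)
  have hD : ContDiffOn ℝ ∞ (fun p : E4 × E3 => fderiv ℝ h.symm (h p.1)) (h.source ×ˢ Set.univ) :=
    (H.contDiffOn_symm.fderiv_of_isOpen h.open_target (by simp)).comp hh
      fun p hp => h.map_source hp.1
  have hc : ∀ (c a : Fin 4), ContDiffOn ℝ ∞ (fun p : E4 × E3 =>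
      g.val i p.1 (e.val i p.1 (stdVec c)) (fderiv ℝ h.symm (h p.1) (e.val j (h p.1) (stdVec a))))
      (h.source ×ˢ Set.univ) := by
    intro c a
    exact (hg.clm_apply (he.clm_apply contDiffOn_const)).clm_apply
      (hD.clm_apply (hej.clm_apply contDiffOn_const))
  have ha : ∀ k : Fin 3, ContDiffOn ℝ ∞ (fun p : E4 × E3 => p.2 k) (h.source ×ˢ Set.univ) := by
    intro k
    exact ((EuclideanSpace.proj k : E3 →L[ℝ] ℝ).contDiff.comp contDiff_snd).contDiffOn
  rw [contDiffOn_piLp]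
  intro k
  simp only [liftFibre, asd, asdForm_apply, Matrix.cons_val_zero, Matrix.cons_val_one, stdAsd,
    frameCoords, coframe]
  exact (((ha 0).mul ((((hc 0 0).mul (hc 1 k.succ)).sub ((hc 1 0).mul (hc 0 k.succ))).sub
      (((hc 2 0).mul (hc 3 k.succ)).sub ((hc 3 0).mul (hc 2 k.succ))))).add
    ((ha 1).mul ((((hc 0 0).mul (hc 2 k.succ)).sub ((hc 2 0).mul (hc 0 k.succ))).sub
      (((hc 3 0).mul (hc 1 k.succ)).sub ((hc 1 0).mul (hc 3 k.succ)))))).add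
    ((ha 2).mul ((((hc 0 0).mul (hc 3 k.succ)).sub ((hc 3 0).mul (hc 0 k.succ))).sub
      (((hc 1 0).mul (hc 2 k.succ)).sub ((hc 2 0).mul (hc 1 k.succ)))))

/-- The points of the charts `Λ⁻T*U_i` of the orbibundle of anti-self-dual two-forms, which the
frames identify with `U_i × ℝ³`. -/
abbrev ChartPoint (_ : Orbifold.OrthonormalFrame g) : Type u :=
  Σ i : Q.ι, {p : E4 × E3 // p.1 ∈ Q.U i}

/-- Two points `(x, α)` and `(y, β)` of the charts represent the same point of the orbibundle if a
change of charts takes `x` to `y` and pulls `β` back to `α`. -/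
def ChartPoint.Rel (e : Orbifold.OrthonormalFrame g) (p q : e.ChartPoint) : Prop :=
  ∃ h, Q.IsTransition p.1 q.1 h ∧ p.2.1.1 ∈ h.source ∧ h p.2.1.1 = q.2.1.1 ∧
    (e.asd q.1 q.2.1.1 q.2.1.2).compContinuousLinearMap (fderiv ℝ h p.2.1.1) =
      e.asd p.1 p.2.1.1 p.2.1.2

theorem ChartPoint.rel_refl (p : e.ChartPoint) : ChartPoint.Rel e p p := by
  refine ⟨OpenPartialHomeomorph.ofSet _ (Q.isOpen_U p.1), IsChartChange.refl _ _, p.2.2, rfl, ?_⟩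
  have : fderiv ℝ (OpenPartialHomeomorph.ofSet (Q.U p.1) (Q.isOpen_U p.1)) p.2.1.1 =
      ContinuousLinearMap.id ℝ E4 := fderiv_id
  rw [this]
  rfl

theorem ChartPoint.rel_symm {p q : e.ChartPoint} (H : ChartPoint.Rel e p q) :
    ChartPoint.Rel e q p := by
  obtain ⟨h, hT, hs, hm, hp⟩ := H
  have ht : q.2.1.1 ∈ h.target := hm ▸ h.map_source hs
  have hm' : h.symm q.2.1.1 = p.2.1.1 := by rw [← hm, h.left_inv hs]
  refine ⟨h.symm, hT.symm, ht, hm', ?_⟩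
  rw [← hp]
  ext v
  simp only [ContinuousAlternatingMap.compContinuousLinearMap_apply]
  congr 1
  funext r
  have := hT.symm.fderiv_symm ht (v r)
  rw [hm'] at this
  exact this

theorem ChartPoint.rel_trans {p q r : e.ChartPoint} (H : ChartPoint.Rel e p q)
    (K : ChartPoint.Rel e q r) : ChartPoint.Rel e p r := by
  obtain ⟨h, hT, hs, hm, hp⟩ := H
  obtain ⟨k, kT, ks, km, kp⟩ := K
  have hks : h p.2.1.1 ∈ k.source := hm ▸ ks
  refine ⟨h.trans k, hT.trans kT, by simp [hs, hks], by simp [hm, km], ?_⟩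
  have hd : fderiv ℝ (h.trans k) p.2.1.1 =
      (fderiv ℝ k q.2.1.1).comp (fderiv ℝ h p.2.1.1) := by
    rw [OpenPartialHomeomorph.coe_trans,
      fderiv_comp _ (kT.differentiableAt hks) (hT.differentiableAt hs), hm]
  rw [hd, ← hp, ← kp]
  rfl

/-- The equivalence relation that glues the charts. -/
abbrev ChartPoint.setoid : Setoid e.ChartPoint where
  r := ChartPoint.Rel e
  iseqv := ⟨ChartPoint.rel_refl e, ChartPoint.rel_symm e, ChartPoint.rel_trans e⟩

/-- The underlying space of the total space `Λ⁻T*Q` of the orbibundle of anti-self-dual two-forms: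
the quotient of the disjoint union of the `Λ⁻T*U_i` by the changes of charts. -/
def AsdSpace : Type u := Quotient (ChartPoint.setoid e)

instance : TopologicalSpace e.AsdSpace :=
  inferInstanceAs (TopologicalSpace (Quotient (ChartPoint.setoid e)))

/-- The class of a point of a chart. -/
def mkPoint (p : e.ChartPoint) : e.AsdSpace := Quotient.mk (ChartPoint.setoid e) p

theorem continuous_mkPoint : Continuous e.mkPoint := continuous_quotient_mk'

theorem mkPoint_eq {p q : e.ChartPoint} : e.mkPoint p = e.mkPoint q ↔ ChartPoint.Rel e p q :=
  Quotient.eq (r := ChartPoint.setoid e)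

/-- A point over `φ i x`, for arbitrary `x`. -/
theorem exists_chartPoint (i : Q.ι) (x : E4) : ∃ p : e.ChartPoint, Q.φ p.1 p.2.1.1 = Q.φ i x := by
  obtain ⟨j, y, hy, h⟩ := Q.cover (Q.φ i x)
  exact ⟨⟨j, (y, 0), hy⟩, h⟩

open Classical in
/-- The parametrisation `U_i × ℝ³ → Λ⁻T*Q`; its values outside `U_i × ℝ³` are arbitrary. -/
def asdChart (i : Q.ι) (p : E4 × E3) : e.AsdSpace :=
  if hp : p.1 ∈ Q.U i then e.mkPoint ⟨i, p, hp⟩ else e.mkPoint (e.exists_chartPoint i p.1).choose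

theorem asdChart_of_mem {i : Q.ι} {p : E4 × E3} (hp : p.1 ∈ Q.U i) :
    e.asdChart i p = e.mkPoint ⟨i, p, hp⟩ := dif_pos hp

/-- The lift of a change of charts to anti-self-dual two-forms. -/
def liftHomeo (hQ : Q.IsOriented) {i j : Q.ι} {h : OpenPartialHomeomorph E4 E4}
    (H : Q.IsTransition i j h) : OpenPartialHomeomorph (E4 × E3) (E4 × E3) where
  toFun p := (h p.1, e.liftFibre i j h p.1 p.2)
  invFun p := (h.symm p.1, e.liftFibre j i h.symm p.1 p.2)
  source := h.source ×ˢ Set.univ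
  target := h.target ×ˢ Set.univ
  map_source' p hp := ⟨h.map_source hp.1, trivial⟩
  map_target' p hp := ⟨h.map_target hp.1, trivial⟩
  left_inv' p hp := by
    have h1 : h.symm (h p.1) = p.1 := h.left_inv hp.1
    refine Prod.ext h1 ?_
    refine (e.liftFibre_unique hQ H.symm (h.map_source hp.1) ?_).symm
    rw [h1, ← e.liftFibre_spec hQ H hp.1 p.2]
    ext v
    simp only [ContinuousAlternatingMap.compContinuousLinearMap_apply]
    congr 1
    funext r
    have := H.symm.fderiv_symm (h.map_source hp.1) (v r)
    rw [h1] at this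
    exact this
  right_inv' p hp := by
    have h1 : h (h.symm p.1) = p.1 := h.right_inv hp.1
    refine Prod.ext h1 ?_
    refine (e.liftFibre_unique hQ H (h.map_target hp.1) ?_).symm
    rw [h1, ← e.liftFibre_spec hQ H.symm hp.1 p.2]
    ext v
    simp only [ContinuousAlternatingMap.compContinuousLinearMap_apply]
    congr 1
    funext r
    have := H.fderiv_symm (h.map_target hp.1) (v r)
    rw [h1] at this
    exact this
  open_source := h.open_source.prod isOpen_univ
  open_target := h.open_target.prod isOpen_univ
  continuousOn_toFun := (h.continuousOn.comp continuousOn_fst fun _ hp => hp.1).prodMk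
    (e.contDiffOn_liftFibre H).continuousOn
  continuousOn_invFun := (h.symm.continuousOn.comp continuousOn_fst fun _ hp => hp.1).prodMk
    (e.contDiffOn_liftFibre H.symm).continuousOn

theorem rel_liftFibre (hQ : Q.IsOriented) {i j : Q.ι} {h : OpenPartialHomeomorph E4 E4}
    (H : Q.IsTransition i j h) {p : E4 × E3} (hp : p.1 ∈ h.source) :
    e.asdChart j (h p.1, e.liftFibre i j h p.1 p.2) = e.asdChart i p := by
  rw [e.asdChart_of_mem (H.source_subset hp),
    e.asdChart_of_mem (p := (h p.1, e.liftFibre i j h p.1 p.2))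
      (H.target_subset (h.map_source hp)), eq_comm, e.mkPoint_eq]
  exact ⟨h, H, hp, rfl, e.liftFibre_spec hQ H hp p.2⟩

theorem liftHomeo_isChartChange (hQ : Q.IsOriented) {i j : Q.ι} {h : OpenPartialHomeomorph E4 E4}
    (H : Q.IsTransition i j h) :
    IsChartChange (Q.U i ×ˢ Set.univ) (Q.U j ×ˢ Set.univ) (e.asdChart i) (e.asdChart j)
      (e.liftHomeo hQ H) where
  source_subset := Set.prod_mono H.source_subset subset_rfl
  target_subset := Set.prod_mono H.target_subset subset_rfl
  contDiffOn := (H.contDiffOn.comp contDiffOn_fst fun _ hp => hp.1).prodMk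
    (e.contDiffOn_liftFibre H)
  contDiffOn_symm := (H.contDiffOn_symm.comp contDiffOn_fst fun _ hp => hp.1).prodMk
    (e.contDiffOn_liftFibre H.symm)
  map _ hp := e.rel_liftFibre hQ H hp.1

/-- The total space `B = Λ⁻T*Q` of the orbibundle of anti-self-dual two-forms of the oriented
Riemannian four-orbifold `Q`, as a seven-dimensional orbifold with charts `U_i × ℝ³`. -/
def asdOrbifold (hQ : Q.IsOriented) : Orbifold (E4 × E3) e.AsdSpace where
  ι := Q.ι
  U i := Q.U i ×ˢ Set.univ
  isOpen_U i := (Q.isOpen_U i).prod isOpen_univ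
  G := Q.G
  act i γ p := (Q.act i γ p.1, e.liftFibre i i (Q.actHomeo i γ) p.1 p.2)
  act_mapsTo i γ p hp := ⟨Q.act_mapsTo i γ hp.1, trivial⟩
  act_contDiffOn i γ := (e.liftHomeo_isChartChange hQ (Q.actHomeo_isTransition i γ)).contDiffOn
  act_one i p hp := by
    refine Prod.ext (Q.act_one i p.1 hp.1) ?_
    refine (e.liftFibre_unique hQ (Q.actHomeo_isTransition i 1) hp.1 ?_).symm
    have h1 : (Q.actHomeo i 1) p.1 = p.1 := Q.act_one i p.1 hp.1
    have h2 : fderiv ℝ (Q.actHomeo i 1) p.1 = ContinuousLinearMap.id ℝ E4 := by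
      have : (Q.actHomeo i 1 : E4 → E4) =ᶠ[𝓝 p.1] id := by
        filter_upwards [(Q.isOpen_U i).mem_nhds hp.1] with y hy
        exact Q.act_one i y hy
      rw [this.fderiv_eq, fderiv_id]
    rw [h1, h2]
    rfl
  act_mul i γ γ' p hp := by
    refine Prod.ext (Q.act_mul i γ γ' p.1 hp.1) ?_
    refine (e.liftFibre_unique hQ (Q.actHomeo_isTransition i (γ * γ')) hp.1 ?_).symm
    have hp' : Q.act i γ' p.1 ∈ Q.U i := Q.act_mapsTo i γ' hp.1
    have h1 : (Q.actHomeo i (γ * γ')) p.1 = Q.actHomeo i γ (Q.act i γ' p.1) :=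
      Q.act_mul i γ γ' p.1 hp.1
    have h2 : fderiv ℝ (Q.actHomeo i (γ * γ')) p.1 =
        (fderiv ℝ (Q.actHomeo i γ) (Q.act i γ' p.1)).comp (fderiv ℝ (Q.actHomeo i γ') p.1) := by
      have : (Q.actHomeo i (γ * γ') : E4 → E4) =ᶠ[𝓝 p.1] Q.actHomeo i γ ∘ Q.actHomeo i γ' := by
        filter_upwards [(Q.isOpen_U i).mem_nhds hp.1] with y hy
        exact Q.act_mul i γ γ' y hy
      rw [this.fderiv_eq]
      exact fderiv_comp p.1 ((Q.actHomeo_isTransition i γ).differentiableAt hp')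
        ((Q.actHomeo_isTransition i γ').differentiableAt hp.1)
    rw [h1, h2, ← e.liftFibre_spec hQ (Q.actHomeo_isTransition i γ') hp.1 p.2]
    have h3 := e.liftFibre_spec hQ (Q.actHomeo_isTransition i γ) hp'
      (e.liftFibre i i (Q.actHomeo i γ') p.1 p.2)
    change _ = (e.asd i (Q.act i γ' p.1) (e.liftFibre i i (Q.actHomeo i γ') p.1 p.2)).compContinuousLinearMap _
    rw [← h3]
    rfl
  effective i γ hγ := by
    refine Set.eq_empty_of_forall_notMem fun p hp => ?_
    have h1 : IsOpen (Prod.fst '' interior {q : E4 × E3 | q ∈ Q.U i ×ˢ Set.univ ∧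
        (Q.act i γ q.1, e.liftFibre i i (Q.actHomeo i γ) q.1 q.2) = q}) :=
      isOpenMap_fst _ isOpen_interior
    have h2 : p.1 ∈ interior {x ∈ Q.U i | Q.act i γ x = x} := by
      refine interior_maximal ?_ h1 ⟨p, hp, rfl⟩
      rintro _ ⟨q, hq, rfl⟩
      have := interior_subset hq
      exact ⟨this.1.1, congrArg Prod.fst this.2⟩
    rw [Q.effective i γ hγ] at h2
    exact h2
  φ := e.asdChart
  continuousOn_φ i := by
    rw [continuousOn_iff_continuous_domRestrict]
    have h1 : Continuous fun p : (Q.U i ×ˢ (Set.univ : Set E3) : Set (E4 × E3)) =>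
        e.mkPoint ⟨i, p.1, p.2.1⟩ := by
      refine e.continuous_mkPoint.comp ?_
      exact continuous_sigmaMk.comp (continuous_subtype_val.subtype_mk _)
    convert h1 using 1
    funext p
    exact e.asdChart_of_mem p.2.1
  isOpen_image i V hV hVo := by
    have h1 : IsOpen (e.mkPoint ⁻¹' (e.asdChart i '' V)) := by
      rw [isOpen_sigma_iff]
      intro j
      rw [isOpen_iff_mem_nhds]
      rintro q ⟨p, hp, hpq⟩
      rw [e.asdChart_of_mem (hV hp).1, e.mkPoint_eq] at hpq
      obtain ⟨h, H, hs, hm, hb⟩ := hpq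
      simp only at H hs hm hb
      have hq : (e.liftHomeo hQ H) p = q.1 := by
        refine Prod.ext hm ?_
        rw [← hm] at hb
        exact (e.liftFibre_unique hQ H hs hb).symm
      have hpS : p ∈ (e.liftHomeo hQ H).source := ⟨hs, trivial⟩
      have hN : (e.liftHomeo hQ H) '' ((e.liftHomeo hQ H).source ∩ V) ∈ 𝓝 q.1 := by
        refine ((e.liftHomeo hQ H).isOpen_image_source_inter hVo).mem_nhds ?_
        exact ⟨p, ⟨hpS, hp⟩, hq⟩
      have hN' := continuous_subtype_val.continuousAt.preimage_mem_nhds hN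
      filter_upwards [hN'] with q' hq'
      obtain ⟨p', ⟨hp'S, hp'V⟩, hpe⟩ := hq'
      refine ⟨p', hp'V, ?_⟩
      rw [← e.rel_liftFibre hQ H hp'S.1]
      have : (h p'.1, e.liftFibre i j h p'.1 p'.2) = q'.1 := hpe
      rw [this, e.asdChart_of_mem q'.2]
    exact h1
  fiber i p hp q hq := by
    rw [e.asdChart_of_mem hp.1, e.asdChart_of_mem hq.1, e.mkPoint_eq]
    constructor
    · rintro ⟨h, H, hs, hm, hb⟩
      simp only at H hs hm hb
      obtain ⟨γ, hγ, hd⟩ := Q.exists_act_eq H hs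
      refine ⟨γ, Prod.ext (hγ.trans hm) ?_⟩
      refine (e.liftFibre_unique hQ (Q.actHomeo_isTransition i γ) hp.1 ?_).symm
      have h1 : (Q.actHomeo i γ) p.1 = q.1 := hγ.trans hm
      have h2 : fderiv ℝ (Q.actHomeo i γ) p.1 = fderiv ℝ h p.1 := hd
      rw [h1, h2, hb]
    · rintro ⟨γ, rfl⟩
      exact ⟨Q.actHomeo i γ, Q.actHomeo_isTransition i γ, hp.1, rfl,
        e.liftFibre_spec hQ (Q.actHomeo_isTransition i γ) hp.1 p.2⟩
  cover p := by
    obtain ⟨⟨i, q, hq⟩, rfl⟩ := Quotient.exists_rep p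
    exact ⟨i, q, ⟨hq, trivial⟩, e.asdChart_of_mem hq⟩
  compat i j p hp q hq hpq := by
    rw [e.asdChart_of_mem hp.1, e.asdChart_of_mem hq.1, e.mkPoint_eq] at hpq
    obtain ⟨h, H, hs, hm, hb⟩ := hpq
    simp only at H hs hm hb
    refine ⟨e.liftHomeo hQ H, e.liftHomeo_isChartChange hQ H, ⟨hs, trivial⟩, ?_⟩
    refine Prod.ext hm ?_
    rw [← hm] at hb
    exact (e.liftFibre_unique hQ H hs hb).symm

end Orbifold.OrthonormalFrame

end Riemannian

/-! ### Curvature of an oriented Riemannian four-orbifold -/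

section Curvature

variable {X : Type u} [TopologicalSpace X] {Q : Orbifold E4 X} {g : Q.RiemannianMetric}

namespace Orbifold.OrthonormalFrame

variable (e : Orbifold.OrthonormalFrame g) (i : Q.ι) (x : E4)

/-- The vectors of the frame. -/
def vec (a : Fin 4) : E4 := e.val i x (stdVec a)

/-- The Christoffel symbols: `g(Γ(w, z), y) = ½ (∂_w g(z, y) + ∂_z g(w, y) - ∂_y g(w, z))`, so that
the Levi-Civita connection is `∇_w Z = ∂_w Z + Γ(w, Z)`. -/
def christoffel (w z : E4) : E4 :=
  ∑ a, ((1 / 2 : ℝ) * (fderiv ℝ (g.val i) x w z (e.vec i x a) +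
    fderiv ℝ (g.val i) x z w (e.vec i x a) - fderiv ℝ (g.val i) x (e.vec i x a) w z)) • e.vec i x a

/-- The Riemann curvature `R(w, z)y = ∇_w ∇_z y - ∇_z ∇_w y - ∇_{[w, z]} y`. -/
def curvature (w z y : E4) : E4 :=
  fderiv ℝ (fun t => e.christoffel i t z y) x w - fderiv ℝ (fun t => e.christoffel i t w y) x z +
    e.christoffel i x w (e.christoffel i x z y) - e.christoffel i x z (e.christoffel i x w y)

/-- The Ricci curvature `Ric(z, y) = tr(w ↦ R(w, z)y)`. -/
def ricci (z y : E4) : ℝ := ∑ a, g.val i x (e.curvature i x (e.vec i x a) z y) (e.vec i x a)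

/-- The scalar curvature. -/
def scal : ℝ := ∑ a, e.ricci i x (e.vec i x a) (e.vec i x a)

/-- The Weyl tensor `W(w, z, y, t)`, the trace free part of `R(w, z, y, t) = g(R(w, z)t, y)`. -/
def weyl (w z y t : E4) : ℝ :=
  g.val i x (e.curvature i x w z t) y -
    (1 / 2 : ℝ) * (e.ricci i x w y * g.val i x z t - e.ricci i x w t * g.val i x z y -
      e.ricci i x z y * g.val i x w t + e.ricci i x z t * g.val i x w y) +
    e.scal i x / 6 * (g.val i x w y * g.val i x z t - g.val i x w t * g.val i x z y)

/-- The metric is Einstein, `Ric = l g`. -/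
def IsEinstein (l : ℝ) : Prop :=
  ∀ i, ∀ x ∈ Q.U i, ∀ w z, e.ricci i x w z = l * g.val i x w z

/-- The metric is self-dual: the Weyl curvature operator vanishes on anti-self-dual two-forms. -/
def IsSelfDual : Prop :=
  ∀ i, ∀ x ∈ Q.U i, ∀ (w z : E4) (k : Fin 3),
    ∑ a, ∑ b, e.weyl i x w z (e.vec i x a) (e.vec i x b) *
      asdBasis (g.val i x) (e.val i x) k ![e.vec i x a, e.vec i x b] = 0

/-! ### The Bryant–Salamon three-form -/

/-- The covariant derivative `(∇_w ω_k)(z, y)` of the two-forms `ω_k` of the frame of `Λ⁻T*Q`. -/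
def covDerivAsd (k : Fin 3) (w z y : E4) : ℝ :=
  fderiv ℝ (fun t => asdBasis (g.val i t) (e.val i t) k ![z, y]) x w -
    asdBasis (g.val i x) (e.val i x) k ![e.christoffel i x w z, y] -
    asdBasis (g.val i x) (e.val i x) k ![z, e.christoffel i x w y]

/-- The coefficients `ψ_{lk}(w) = ½ ⟨∇_w ω_k, ω_l⟩` of the Levi-Civita connection on `Λ⁻T*Q`, so
that `∇ω_k = ∑_l ψ_{lk} ω_l`; here `⟨α, β⟩ = ½ ∑_{a,b} α(e_a, e_b) β(e_a, e_b)` and `|ω_k|² = 2`. -/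
def asdConnection (l k : Fin 3) (w : E4) : ℝ :=
  (1 / 4 : ℝ) * ∑ a, ∑ b, e.covDerivAsd i x k w (e.vec i x a) (e.vec i x b) *
    asdBasis (g.val i x) (e.val i x) l ![e.vec i x a, e.vec i x b]

/-- The one-forms `α_k = da_k + ∑_l a_l ψ_{kl}` on the total space of `Λ⁻T*U_i`: their common kernel
is the horizontal space of the Levi-Civita connection. -/
def verticalForm (k : Fin 3) (p : E4 × E3) : (E4 × E3) →L[ℝ] ℝ :=
  (EuclideanSpace.proj k : E3 →L[ℝ] ℝ).comp (ContinuousLinearMap.snd ℝ E4 E3) +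
    ∑ l, ∑ m, (p.2 l * e.asdConnection i p.1 k l (stdVec m)) •
      (EuclideanSpace.proj m : E4 →L[ℝ] ℝ).comp (ContinuousLinearMap.fst ℝ E4 E3)

/-- The three-form of the Bryant–Salamon torsion-free `G₂`-structure on `Λ⁻T*Q`, where `Q` is
self-dual Einstein with Einstein constant `l > 0` (scalar curvature `4l`):
`φ₀ = (r + ⅔ l |a|²)^{-3/4} α₁ ∧ α₂ ∧ α₃ + (r + ⅔ l |a|²)^{1/4} ∑_k α_k ∧ ω_k`.
The parameter `r > 0` fixes the scale. -/
def bryantSalamon (l r : ℝ) (i : Q.ι) (p : E4 × E3) : (E4 × E3) [⋀^Fin 3]→L[ℝ] ℝ :=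
  let α := fun k => oneForm (e.verticalForm i k p)
  let ω' := fun k => (asdBasis (g.val i p.1) (e.val i p.1) k).compContinuousLinearMap
    (ContinuousLinearMap.fst ℝ E4 E3)
  (r + 2 / 3 * l * ‖p.2‖ ^ 2) ^ (-(3 / 4) : ℝ) • wedge (wedge (α 0) (α 1)) (α 2) +
    (r + 2 / 3 * l * ‖p.2‖ ^ 2) ^ (1 / 4 : ℝ) • ∑ k, wedge (α k) (ω' k)

end Orbifold.OrthonormalFrame

end Curvature

/-! ### Differential forms and real cohomology of orbifolds -/

section DeRham

variable {E : Type v} [NormedAddCommGroup E] [NormedSpace ℝ E] {X : Type u} [TopologicalSpace X]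

namespace Orbifold

variable (O : Orbifold E X)

/-- Families of `k`-forms on the charts; only the values on the sets `U i` are relevant. -/
def LocalForms (k : ℕ) : Type (max u v) := ∀ _ : O.ι, E → E [⋀^Fin k]→L[ℝ] ℝ

instance (k : ℕ) : AddCommGroup (O.LocalForms k) :=
  inferInstanceAs (AddCommGroup (∀ _ : O.ι, E → E [⋀^Fin k]→L[ℝ] ℝ))

instance (k : ℕ) : Module ℝ (O.LocalForms k) :=
  inferInstanceAs (Module ℝ (∀ _ : O.ι, E → E [⋀^Fin k]→L[ℝ] ℝ))

variable {O} in
theorem LocalForms.add_apply {k : ℕ} (α β : O.LocalForms k) (i : O.ι) : (α + β) i = α i + β i := rfl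

variable {O} in
theorem LocalForms.smul_apply {k : ℕ} (c : ℝ) (α : O.LocalForms k) (i : O.ι) :
    (c • α) i = c • α i := rfl

/-- The differential `k`-forms of an orbifold: families of smooth `k`-forms on the charts that are
invariant under all changes of charts. -/
def forms (k : ℕ) : Submodule ℝ (O.LocalForms k) where
  carrier := {α | (∀ i, ContDiffOn ℝ ∞ (α i) (O.U i)) ∧
    ∀ i j h, O.IsTransition i j h → ∀ x ∈ h.source,
      (α j (h x)).compContinuousLinearMap (fderiv ℝ h x) = α i x}
  zero_mem' := ⟨fun i => contDiffOn_const, fun i j h _ x _ => rfl⟩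
  add_mem' := by
    rintro α β ⟨ha, ha'⟩ ⟨hb, hb'⟩
    refine ⟨fun i => (ha i).add (hb i), fun i j h H x hx => ?_⟩
    rw [LocalForms.add_apply, LocalForms.add_apply, Pi.add_apply, Pi.add_apply, ← ha' i j h H x hx,
      ← hb' i j h H x hx]
    rfl
  smul_mem' := by
    rintro c α ⟨ha, ha'⟩
    refine ⟨fun i => (ha i).const_smul c, fun i j h H x hx => ?_⟩
    rw [LocalForms.smul_apply, LocalForms.smul_apply, Pi.smul_apply, Pi.smul_apply, ← ha' i j h H x hx]
    rfl

variable {O} in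
theorem forms_differentiableAt {k : ℕ} {α : O.LocalForms k} (hα : α ∈ O.forms k) {i : O.ι} {x : E}
    (hx : x ∈ O.U i) : DifferentiableAt ℝ (α i) x :=
  ((hα.1 i).contDiffAt ((O.isOpen_U i).mem_nhds hx)).differentiableAt (by simp)

theorem extDeriv_zero_form {k : ℕ} (x : E) :
    extDeriv (0 : E → E [⋀^Fin k]→L[ℝ] ℝ) x = 0 := by
  have := extDeriv_smul (x := x) (0 : ℝ) (0 : E → E [⋀^Fin k]→L[ℝ] ℝ)
  simpa using this

/-- The closed `k`-forms. -/
def closedForms (k : ℕ) : Submodule ℝ (O.LocalForms k) where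
  carrier := {α | α ∈ O.forms k ∧ ∀ i, ∀ x ∈ O.U i, extDeriv (α i) x = 0}
  zero_mem' := ⟨zero_mem _, fun _ x _ =>
    extDeriv_zero_form x⟩
  add_mem' := by
    rintro α β ⟨ha, ha'⟩ ⟨hb, hb'⟩
    refine ⟨add_mem ha hb, fun i x hx => ?_⟩
    rw [LocalForms.add_apply, extDeriv_add (forms_differentiableAt ha hx) (forms_differentiableAt hb hx),
      ha' i x hx, hb' i x hx, add_zero]
  smul_mem' := by
    rintro c α ⟨ha, ha'⟩
    refine ⟨Submodule.smul_mem _ c ha, fun i x hx => ?_⟩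
    rw [LocalForms.smul_apply, extDeriv_smul, ha' i x hx, smul_zero]

/-- The exact `k`-forms: those of the form `dη` with a `(k-1)`-form `η`. -/
def exactForms : (k : ℕ) → Submodule ℝ (O.LocalForms k)
  | 0 =>
    { carrier := {α | ∀ i, ∀ x ∈ O.U i, α i x = 0}
      zero_mem' := fun _ _ _ => rfl
      add_mem' := by
        intro α β ha hb i x hx
        rw [LocalForms.add_apply, Pi.add_apply, ha i x hx, hb i x hx, add_zero]
      smul_mem' := by
        intro c α ha i x hx
        rw [LocalForms.smul_apply, Pi.smul_apply, ha i x hx, smul_zero] }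
  | k + 1 =>
    { carrier := {α | ∃ η ∈ O.forms k, ∀ i, ∀ x ∈ O.U i, α i x = extDeriv (η i) x}
      zero_mem' := ⟨0, zero_mem _, fun _ x _ =>
        (extDeriv_zero_form x).symm⟩
      add_mem' := by
        rintro α β ⟨η, hη, ha⟩ ⟨ζ, hζ, hb⟩
        refine ⟨η + ζ, add_mem hη hζ, fun i x hx => ?_⟩
        rw [LocalForms.add_apply, LocalForms.add_apply, Pi.add_apply, extDeriv_add (forms_differentiableAt hη hx)
          (forms_differentiableAt hζ hx), ha i x hx, hb i x hx]
      smul_mem' := by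
        rintro c α ⟨η, hη, ha⟩
        refine ⟨c • η, Submodule.smul_mem _ c hη, fun i x hx => ?_⟩
        rw [LocalForms.smul_apply, LocalForms.smul_apply, Pi.smul_apply, extDeriv_smul, ha i x hx] }

/-- The orbifold cohomology `H^k_orb(O; ℝ)`, in its de Rham model. Families that agree on all the
`U i` have the same class, because their difference lies in `exactForms`. -/
abbrev cohomology (k : ℕ) : Type (max u v) :=
  O.closedForms k ⧸ (O.exactForms k).submoduleOf (O.closedForms k)

end Orbifold

end DeRham

/-! ### Principal Seifert circle bundles -/

section Seifert

variable {E : Type v} [NormedAddCommGroup E] [NormedSpace ℝ E] {X : Type u} [TopologicalSpace X]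

/-- A principal Seifert circle bundle over the orbifold `O`: a smooth manifold `M` of dimension
`dim O + 1` with a smooth effective almost free circle action and an identification of the orbit
space with `O`. As a space the identification is given by the projection `π`, whose fibres are the
orbits. That it is one of orbifolds is expressed by `slice`: near every point the charts of `O` lift
to slices of the action, that is, to maps `σ` into `M` such that `(y, t) ↦ e^{it} σ(y)` is a local
diffeomorphism; in particular the stabilisers are finite. Effectiveness is
required in the form that only `1` fixes a nonempty open set pointwise; for a connected `M` this is
the same as effectiveness of the action. -/
structure SeifertBundle (O : Orbifold E X) where
  M : Type u
  [topology : TopologicalSpace M]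
  [t2 : T2Space M]
  [secondCountable : SecondCountableTopology M]
  [charted : ChartedSpace (E × ℝ) M]
  [manifold : IsManifold 𝓘(ℝ, E × ℝ) ∞ M]
  [action : MulAction Circle M]
  [smooth : ContMDiffSMul (𝓡 1) 𝓘(ℝ, E × ℝ) ∞ Circle M]
  effective : ∀ z : Circle, z ≠ 1 → interior {m : M | z • m = m} = ∅
  π : M → X
  surjective : Function.Surjective π
  fiber : ∀ m m', π m = π m' ↔ ∃ z : Circle, z • m = m'
  slice : ∀ i, ∀ x ∈ O.U i, ∃ σ : E → M, (∀ᶠ y in 𝓝 x, π (σ y) = O.φ i y) ∧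
    IsLocalDiffeomorphAt 𝓘(ℝ, E × ℝ) 𝓘(ℝ, E × ℝ) ∞
      (fun p : E × ℝ => Circle.exp p.2 • σ p.1) (x, 0)

namespace SeifertBundle

attribute [instance] topology t2 secondCountable charted manifold action smooth

variable {O : Orbifold E X} (P : SeifertBundle O)

/-- The vector field generating the circle action (with period `2π`): the velocity at `t = 0` of
the curve `t ↦ e^{it} m`, which starts at `m`. -/
def generator (m : P.M) : TangentSpace 𝓘(ℝ, E × ℝ) m :=
  mfderiv 𝓘(ℝ, ℝ) 𝓘(ℝ, E × ℝ) (fun t : ℝ => Circle.exp t • m) 0 (1 : ℝ)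

/-- A connection: a smooth invariant one-form on `M` whose value on the generator is `1`. -/
structure Connection where
  form : ∀ m : P.M, TangentSpace 𝓘(ℝ, E × ℝ) m →L[ℝ] ℝ
  smooth : ContMDiff 𝓘(ℝ, E × ℝ) (𝓘(ℝ, E × ℝ).prod 𝓘(ℝ, (E × ℝ) →L[ℝ] ℝ)) ∞
    (fun m => Bundle.TotalSpace.mk' ((E × ℝ) →L[ℝ] ℝ)
      (E := fun m : P.M => TangentSpace 𝓘(ℝ, E × ℝ) m →L[ℝ] ℝ) m (form m))
  generator : ∀ m, form m (P.generator m) = 1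
  invariant : ∀ (z : Circle) (m : P.M) (w : TangentSpace 𝓘(ℝ, E × ℝ) m),
    form (z • m) (mfderiv 𝓘(ℝ, E × ℝ) 𝓘(ℝ, E × ℝ) (fun m' : P.M => z • m') m w) = form m w

variable {P}

/-- The pull-back of a connection form `θ` by a map `σ` of a chart into `M`. -/
def Connection.pullback (θ : P.Connection) (σ : E → P.M) (y : E) : E [⋀^Fin 1]→L[ℝ] ℝ :=
  oneForm ((θ.form (σ y)).comp (mfderiv 𝓘(ℝ, E) 𝓘(ℝ, E × ℝ) σ y))

/-- The two-form `F` on the orbifold is the curvature of `θ`, i.e. the basic form `dθ` is the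
pull-back of `F`: for every smooth lift `σ` of a chart, `F = σ^*dθ = d(σ^*θ)`. -/
def Connection.IsCurvature (θ : P.Connection) (F : O.LocalForms 2) : Prop :=
  F ∈ O.forms 2 ∧ ∀ i, ∀ V ⊆ O.U i, IsOpen V → ∀ σ : E → P.M,
    ContMDiffOn 𝓘(ℝ, E) 𝓘(ℝ, E × ℝ) ∞ σ V → (∀ y ∈ V, P.π (σ y) = O.φ i y) →
      ∀ y ∈ V, F i y = extDeriv (θ.pullback σ) y

variable (P)

/-- The condition `c₁^orb(P) ∪ [φ] = 0` in `H⁵_orb(O; ℝ)` for a closed three-form `φ`. The real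
first Chern class is, up to a factor `2π`, the class of the curvature `F = dθ` of any connection `θ`
(connections exist, and their curvatures differ by exact forms), so the condition says that the
closed five-form `F ∧ φ` is exact. -/
def ChernCupVanishes (φ : O.LocalForms 3) : Prop :=
  ∃ (θ : P.Connection) (F : O.LocalForms 2), θ.IsCurvature F ∧
    (fun i x => wedge (F i x) (φ i x)) ∈ O.exactForms 5

end SeifertBundle

end Seifert

end

open scoped Manifold ContDiff Topology

noncomputable section

universe u v

set_option linter.unusedSectionVars false

/-! ### Alternating forms: smoothness, pull-back, associativity and the Leibniz rule -/

section AlternatingCalculus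

variable {E : Type v} [NormedAddCommGroup E] [NormedSpace ℝ E]

/-! The vanishing statements hold for a dimensional reason. Fibrewise dilation retracts B = Λ⁻T*Q
onto its zero section, so a closed form differs from the pull-back of its restriction to the zero
section by the derivative of its cone form (`extDeriv_coneForm`). A five-form restricts to zero on
the four-dimensional zero section (`five_form_horizontal`), hence closed five-forms are exact
(`closed_five_form_exact`) and H⁵ = 0. The cone is again a form on the orbifold B because changes of
charts act linearly on the fibres and so commute with dilations (`coneIntegrand_lift`).

Every Seifert bundle carries a connection, obtained from slices by a partition of unity and averaged
over the circle (`nonempty_connection`). Its curvature F descends to the orbifold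
(`isCurvature_curvature`), and locally F ∧ φ = d(η ∧ φ) when φ is closed. Over B this closed
five-form is exact, so the cup product condition holds for every bundle over B (`chernCupVanishes`).

It remains to move bundles between Q and B. A bundle over B is restricted to the zero section
(`restrictZero`); effectiveness survives because the zero vector over a point with trivial isotropy
has trivial isotropy in B, and stabilisers over such points are trivial (`eq_one_of_smul_eq`). A
bundle M → Q is pulled back to B (`lift`). The topological fibre product is the wrong space at
singular points, since the fibres of B → Q are ℝ³ modulo isotropy there. Instead the products of
slices with ℝ³ are glued: two slices through one point of M determine the germ of a change of charts
of Q, and its lift to anti-self-dual forms glues the fibres.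

That φ₀ is closed follows from the structure equations. For a self-dual Einstein metric the
curvature of Λ⁻ is (λ/3)ω_k (`curvature_asdConn`), whence d(α₁∧α₂∧α₃) = -(λ/3)(∑ a_k α_k) ∧ ∑
α_k∧ω_k and d(∑ α_k∧ω_k) = 0, while ∑ a_k α_k = ½ d|a|²; the exponents -3/4 and 1/4 make the
remaining terms cancel (`extDeriv_bryantSalamon`). That φ₀ is a form on the orbifold B comes from
the equivariance of the vertical projection (`verticalPart_lift`) and from the lifts acting on
fibres with norm and determinant preserved.

Two devices recur. Points with trivial isotropy are dense (`subset_closure_generic`), and near them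
a lift of the identity that fixes the point is the identity, so statements are checked there and
extended by continuity. To first order every change of a chart with itself is a group element
(`exists_act_eq`), so invariance of forms on B need only be tested on lifts of changes of charts of
Q (`mem_forms_of_lift`). -/

/-- Evaluation of an alternating form on a fixed family of vectors, as a continuous linear map. -/
def evalForm (k : ℕ) (v : Fin k → E) : (E [⋀^Fin k]→L[ℝ] ℝ) →L[ℝ] ℝ :=
  LinearMap.mkContinuous
    { toFun := fun f => f v
      map_add' := fun _ _ => rfl
      map_smul' := fun _ _ => rfl } (∏ i, ‖v i‖) fun f => by
    rw [mul_comm]; exact f.le_opNorm v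

theorem wedge_apply {p q : ℕ} (α : E [⋀^Fin p]→L[ℝ] ℝ) (β : E [⋀^Fin q]→L[ℝ] ℝ)
    (v : Fin (p + q) → E) :
    wedge α β v = (p.factorial * q.factorial : ℝ)⁻¹ * ∑ σ : Equiv.Perm (Fin (p + q)),
      (Equiv.Perm.sign σ : ℝ) * (α (fun a => v (σ (Fin.castAdd q a))) *
        β (fun b => v (σ (Fin.natAdd p b)))) := by
  rw [wedge, ContinuousAlternatingMap.smul_apply,
    ContinuousMultilinearMap.alternatization_apply_apply, smul_eq_mul]
  congr 1
  refine Finset.sum_congr rfl fun σ _ => ?_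
  rw [tensorForm_apply, Units.smul_def, zsmul_eq_mul]
  rfl

variable [FiniteDimensional ℝ E]

/-- The values of an alternating form on the vectors of a basis. -/
def basisValues (E : Type v) [NormedAddCommGroup E] [NormedSpace ℝ E] [FiniteDimensional ℝ E]
    (k : ℕ) : (E [⋀^Fin k]→L[ℝ] ℝ) →L[ℝ] ((Fin k → Fin (Module.finrank ℝ E)) → ℝ) :=
  ContinuousLinearMap.pi fun s => evalForm k fun a => Module.finBasis ℝ E (s a)

theorem basisValues_injective (k : ℕ) : Function.Injective (basisValues E k) := by
  intro f g h
  apply ContinuousAlternatingMap.toAlternatingMap_injective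
  refine AlternatingMap.coe_multilinearMap_injective ?_
  refine Module.Basis.ext_multilinear (fun _ => Module.finBasis ℝ E) fun s => ?_
  exact congrFun h s

/-- Values on basis vectors are finitely many real coordinates, and a linear left inverse defined on
a finite-dimensional space is continuous. Smoothness of a form-valued map can therefore be tested on
fixed vectors, as in `contDiffOn_form`. -/
theorem exists_leftInverse_basisValues (k : ℕ) :
    ∃ L : ((Fin k → Fin (Module.finrank ℝ E)) → ℝ) →L[ℝ] (E [⋀^Fin k]→L[ℝ] ℝ),
      ∀ f, L (basisValues E k f) = f := by
  obtain ⟨L, hL⟩ := LinearMap.exists_leftInverse_of_injective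
    (basisValues E k).toLinearMap
    (LinearMap.ker_eq_bot.2 (basisValues_injective (E := E) k))
  exact ⟨LinearMap.toContinuousLinearMap L, fun f => congrArg (fun A => A f) hL⟩

variable {V : Type*} [NormedAddCommGroup V] [NormedSpace ℝ V]

theorem contDiffOn_form {k : ℕ} {n : WithTop ℕ∞} {f : V → E [⋀^Fin k]→L[ℝ] ℝ} {s : Set V}
    (h : ∀ v, ContDiffOn ℝ n (fun x => f x v) s) : ContDiffOn ℝ n f s := by
  obtain ⟨L, hL⟩ := exists_leftInverse_basisValues (E := E) k
  have h1 : ContDiffOn ℝ n (fun x => basisValues E k (f x)) s := contDiffOn_pi.2 fun s => h _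
  have h2 := L.contDiff.comp_contDiffOn h1
  simpa only [Function.comp_def, hL] using h2

theorem contDiffOn_form_apply {k : ℕ} {n : WithTop ℕ∞} {f : V → E [⋀^Fin k]→L[ℝ] ℝ} {s : Set V}
    (h : ContDiffOn ℝ n f s) (v : Fin k → E) : ContDiffOn ℝ n (fun x => f x v) s :=
  (evalForm k v).contDiff.comp_contDiffOn h

theorem fderiv_form_apply {k : ℕ} {f : V → E [⋀^Fin k]→L[ℝ] ℝ} {x : V}
    (h : DifferentiableAt ℝ f x) (w : V) (v : Fin k → E) :
    fderiv ℝ f x w v = fderiv ℝ (fun y => f y v) x w := by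
  have h1 := ((evalForm k v).hasFDerivAt.comp x h.hasFDerivAt).fderiv
  have h2 : fderiv ℝ (fun y => f y v) x = (evalForm k v).comp (fderiv ℝ f x) := h1
  rw [h2]; rfl

/-- A form evaluated on smooth vector fields is smooth. -/
theorem contDiffOn_form_apply_fields {k : ℕ} {n : WithTop ℕ∞} {f : V → E [⋀^Fin k]→L[ℝ] ℝ}
    {s : Set V} (h : ContDiffOn ℝ n f s) {v : V → Fin k → E}
    (hv : ∀ a, ContDiffOn ℝ n (fun x => v x a) s) : ContDiffOn ℝ n (fun x => f x (v x)) s := by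
  classical
  set b := Module.finBasis ℝ E
  have e : ∀ x, f x (v x) = ∑ r : Fin k → Fin (Module.finrank ℝ E),
      (∏ a, b.repr (v x a) (r a)) * f x (fun a => b (r a)) := by
    intro x
    have h1 : v x = fun a => ∑ c, b.repr (v x a) c • b c := by
      funext a; exact (b.sum_repr (v x a)).symm
    conv_lhs => rw [h1]
    have := (f x).toMultilinearMap.map_sum (fun a c => b.repr (v x a) c • b c)
    refine this.trans (Finset.sum_congr rfl fun r _ => ?_)
    exact (f x).toMultilinearMap.map_smul_univ (fun a => b.repr (v x a) (r a)) fun a => b (r a)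
  simp only [e]
  refine ContDiffOn.sum fun r _ => ?_
  refine (contDiffOn_prod fun a _ => ?_).mul (contDiffOn_form_apply h _)
  exact (LinearMap.toContinuousLinearMap (b.coord (r a))).contDiff.comp_contDiffOn (hv a)

theorem contDiffOn_form_comp {E' : Type*} [NormedAddCommGroup E'] [NormedSpace ℝ E']
    [FiniteDimensional ℝ E'] {k : ℕ} {n : WithTop ℕ∞} {f : V → E [⋀^Fin k]→L[ℝ] ℝ}
    {A : V → E' →L[ℝ] E} {s : Set V} (h : ContDiffOn ℝ n f s) (hA : ContDiffOn ℝ n A s) :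
    ContDiffOn ℝ n (fun x => (f x).compContinuousLinearMap (A x)) s := by
  refine contDiffOn_form fun v => ?_
  exact contDiffOn_form_apply_fields h fun a => hA.clm_apply contDiffOn_const

theorem contDiffOn_wedge {p q : ℕ} {n : WithTop ℕ∞} {f : V → E [⋀^Fin p]→L[ℝ] ℝ}
    {g : V → E [⋀^Fin q]→L[ℝ] ℝ} {s : Set V} (hf : ContDiffOn ℝ n f s) (hg : ContDiffOn ℝ n g s) :
    ContDiffOn ℝ n (fun x => wedge (f x) (g x)) s := by
  refine contDiffOn_form fun v => ?_
  simp only [wedge_apply]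
  exact contDiffOn_const.mul (ContDiffOn.sum fun σ _ => contDiffOn_const.mul
    ((contDiffOn_form_apply hf _).mul (contDiffOn_form_apply hg _)))

end AlternatingCalculus

/-! ### Algebra of the wedge product and the Leibniz rule. -/

section WedgeAlgebra

variable {E : Type v} [NormedAddCommGroup E] [NormedSpace ℝ E]

theorem wedge_comp {E' : Type*} [NormedAddCommGroup E'] [NormedSpace ℝ E'] {p q : ℕ}
    (α : E [⋀^Fin p]→L[ℝ] ℝ) (β : E [⋀^Fin q]→L[ℝ] ℝ) (A : E' →L[ℝ] E) :
    (wedge α β).compContinuousLinearMap A =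
      wedge (α.compContinuousLinearMap A) (β.compContinuousLinearMap A) := by
  ext v
  simp only [ContinuousAlternatingMap.compContinuousLinearMap_apply, wedge_apply]
  rfl

theorem oneForm_apply (θ : E →L[ℝ] ℝ) (v : Fin 1 → E) : oneForm θ v = θ (v 0) := rfl

theorem oneForm_comp {E' : Type*} [NormedAddCommGroup E'] [NormedSpace ℝ E']
    (θ : E →L[ℝ] ℝ) (A : E' →L[ℝ] E) :
    (oneForm θ).compContinuousLinearMap A = oneForm (θ.comp A) := rfl

/-- `oneForm` as a continuous linear map. -/
def oneFormL : (E →L[ℝ] ℝ) →L[ℝ] (E [⋀^Fin 1]→L[ℝ] ℝ) :=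
  LinearMap.mkContinuous
    { toFun := oneForm
      map_add' := fun _ _ => rfl
      map_smul' := fun _ _ => rfl } 1 fun θ => by
    refine ContinuousAlternatingMap.opNorm_le_bound _ (by positivity) fun v => ?_
    rw [one_mul, Fin.prod_univ_one]
    exact θ.le_opNorm (v 0)

theorem wedge_sum_left {p q : ℕ} {ι : Type*} (s : Finset ι) (α : ι → E [⋀^Fin p]→L[ℝ] ℝ)
    (β : E [⋀^Fin q]→L[ℝ] ℝ) : wedge (∑ j ∈ s, α j) β = ∑ j ∈ s, wedge (α j) β := by
  ext v
  simp only [wedge_apply, ContinuousAlternatingMap.sum_apply, Finset.sum_mul, Finset.mul_sum]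
  rw [Finset.sum_comm]

/-- Antisymmetrisation does not see a preliminary partial antisymmetrisation. -/
theorem sum_perm_partial {n k : ℕ} (ρ : Equiv.Perm (Fin k) →* Equiv.Perm (Fin n))
    (hρ : ∀ τ, Equiv.Perm.sign (ρ τ) = Equiv.Perm.sign τ) (m : Equiv.Perm (Fin n) → ℝ) :
    ∑ σ, (Equiv.Perm.sign σ : ℝ) * ∑ τ, (Equiv.Perm.sign τ : ℝ) * m (σ * ρ τ) =
      k.factorial * ∑ σ, (Equiv.Perm.sign σ : ℝ) * m σ := by
  simp only [Finset.mul_sum]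
  rw [Finset.sum_comm]
  -- The substitution σ ↦ σ · ρ(τ) absorbs the sign of τ, so the sum over σ does not depend on τ;
  -- there are k! values of τ.
  have h : ∀ τ : Equiv.Perm (Fin k), ∑ σ : Equiv.Perm (Fin n),
      (Equiv.Perm.sign σ : ℝ) * ((Equiv.Perm.sign τ : ℝ) * m (σ * ρ τ)) =
      ∑ σ : Equiv.Perm (Fin n), (Equiv.Perm.sign σ : ℝ) * m σ := by
    intro τ
    refine Fintype.sum_equiv (Equiv.mulRight (ρ τ)) _ _ fun σ => ?_
    simp only [Equiv.coe_mulRight, Equiv.Perm.sign_mul, hρ, Units.val_mul, Int.cast_mul]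
    ring
  rw [Finset.sum_congr rfl fun τ _ => h τ]
  simp [Fintype.card_perm, Finset.mul_sum]

/-- Permutations of the first block of indices. -/
def permLeft (p q : ℕ) : Equiv.Perm (Fin p) →* Equiv.Perm (Fin (p + q)) :=
  (finSumFinEquiv.permCongrHom : Equiv.Perm (Fin p ⊕ Fin q) ≃* _).toMonoidHom.comp
    ((Equiv.Perm.sumCongrHom (Fin p) (Fin q)).comp (MonoidHom.inl _ _))

/-- Permutations of the second block of indices. -/
def permRight (p q : ℕ) : Equiv.Perm (Fin q) →* Equiv.Perm (Fin (p + q)) :=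
  (finSumFinEquiv.permCongrHom : Equiv.Perm (Fin p ⊕ Fin q) ≃* _).toMonoidHom.comp
    ((Equiv.Perm.sumCongrHom (Fin p) (Fin q)).comp (MonoidHom.inr _ _))

theorem permLeft_castAdd {p q : ℕ} (τ : Equiv.Perm (Fin p)) (a : Fin p) :
    permLeft p q τ (Fin.castAdd q a) = Fin.castAdd q (τ a) := by
  simp [permLeft, Equiv.permCongrHom]

theorem permLeft_natAdd {p q : ℕ} (τ : Equiv.Perm (Fin p)) (a : Fin q) :
    permLeft p q τ (Fin.natAdd p a) = Fin.natAdd p a := by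
  simp [permLeft, Equiv.permCongrHom]

theorem permRight_castAdd {p q : ℕ} (τ : Equiv.Perm (Fin q)) (a : Fin p) :
    permRight p q τ (Fin.castAdd q a) = Fin.castAdd q a := by
  simp [permRight, Equiv.permCongrHom]

theorem permRight_natAdd {p q : ℕ} (τ : Equiv.Perm (Fin q)) (a : Fin q) :
    permRight p q τ (Fin.natAdd p a) = Fin.natAdd p (τ a) := by
  simp [permRight, Equiv.permCongrHom]

theorem sign_permLeft {p q : ℕ} (τ : Equiv.Perm (Fin p)) :
    Equiv.Perm.sign (permLeft p q τ) = Equiv.Perm.sign τ := by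
  simp [permLeft, Equiv.permCongrHom]

theorem sign_permRight {p q : ℕ} (τ : Equiv.Perm (Fin q)) :
    Equiv.Perm.sign (permRight p q τ) = Equiv.Perm.sign τ := by
  simp [permRight, Equiv.permCongrHom]

/-- Both sides equal (p! q! r!)⁻¹ times the full antisymmetrisation of the triple product. The inner
antisymmetrisation is absorbed by the outer one through `sum_perm_partial`, at the cost of a factor
(p + q)! or (q + r)! that cancels the normalisation. -/
theorem wedge_assoc {p q r : ℕ} (α : E [⋀^Fin p]→L[ℝ] ℝ) (β : E [⋀^Fin q]→L[ℝ] ℝ)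
    (γ : E [⋀^Fin r]→L[ℝ] ℝ) (v : Fin (p + q + r) → E) :
    wedge (wedge α β) γ v =
      wedge α (wedge β γ) (v ∘ Fin.cast (Nat.add_assoc p q r).symm) := by
  have hL : wedge (wedge α β) γ v = (p.factorial * q.factorial * r.factorial : ℝ)⁻¹ *
      ∑ σ : Equiv.Perm (Fin (p + q + r)), (Equiv.Perm.sign σ : ℝ) *
        (α (fun a => v (σ (Fin.castAdd r (Fin.castAdd q a)))) *
          β (fun b => v (σ (Fin.castAdd r (Fin.natAdd p b)))) *
          γ (fun c => v (σ (Fin.natAdd (p + q) c)))) := by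
    have h := sum_perm_partial (permLeft (p + q) r) sign_permLeft (fun σ =>
        α (fun a => v (σ (Fin.castAdd r (Fin.castAdd q a)))) *
          β (fun b => v (σ (Fin.castAdd r (Fin.natAdd p b)))) *
          γ (fun c => v (σ (Fin.natAdd (p + q) c))))
    simp only [Equiv.Perm.mul_apply, permLeft_castAdd, permLeft_natAdd] at h
    rw [wedge_apply]
    simp only [wedge_apply]
    have h2 : ∀ σ : Equiv.Perm (Fin (p + q + r)), (Equiv.Perm.sign σ : ℝ) *
        ((p.factorial * q.factorial : ℝ)⁻¹ * (∑ τ : Equiv.Perm (Fin (p + q)),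
          (Equiv.Perm.sign τ : ℝ) * (α (fun a => v (σ (Fin.castAdd r (τ (Fin.castAdd q a))))) *
          β (fun b => v (σ (Fin.castAdd r (τ (Fin.natAdd p b))))))) *
          γ (fun c => v (σ (Fin.natAdd (p + q) c)))) =
        (p.factorial * q.factorial : ℝ)⁻¹ * ((Equiv.Perm.sign σ : ℝ) *
          ∑ τ : Equiv.Perm (Fin (p + q)),
          (Equiv.Perm.sign τ : ℝ) * (α (fun a => v (σ (Fin.castAdd r (τ (Fin.castAdd q a))))) *
          β (fun b => v (σ (Fin.castAdd r (τ (Fin.natAdd p b))))) *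
          γ (fun c => v (σ (Fin.natAdd (p + q) c))))) := by
      intro σ
      simp only [Finset.mul_sum, Finset.sum_mul]
      exact Finset.sum_congr rfl fun τ _ => by ring
    rw [Finset.sum_congr rfl fun σ _ => h2 σ, ← Finset.mul_sum, h]
    have : ((p + q).factorial : ℝ) ≠ 0 := by positivity
    field_simp
  have hR : wedge α (wedge β γ) (v ∘ Fin.cast (Nat.add_assoc p q r).symm) =
      (p.factorial * q.factorial * r.factorial : ℝ)⁻¹ *
      ∑ σ : Equiv.Perm (Fin (p + (q + r))), (Equiv.Perm.sign σ : ℝ) *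
        (α (fun a => v (Fin.cast (Nat.add_assoc p q r).symm (σ (Fin.castAdd (q + r) a)))) *
          β (fun b => v (Fin.cast (Nat.add_assoc p q r).symm
            (σ (Fin.natAdd p (Fin.castAdd r b))))) *
          γ (fun c => v (Fin.cast (Nat.add_assoc p q r).symm
            (σ (Fin.natAdd p (Fin.natAdd q c)))))) := by
    have h := sum_perm_partial (permRight p (q + r)) sign_permRight (fun σ =>
        α (fun a => v (Fin.cast (Nat.add_assoc p q r).symm (σ (Fin.castAdd (q + r) a)))) *
          β (fun b => v (Fin.cast (Nat.add_assoc p q r).symm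
            (σ (Fin.natAdd p (Fin.castAdd r b))))) *
          γ (fun c => v (Fin.cast (Nat.add_assoc p q r).symm
            (σ (Fin.natAdd p (Fin.natAdd q c))))))
    simp only [Equiv.Perm.mul_apply, permRight_castAdd, permRight_natAdd] at h
    rw [wedge_apply]
    simp only [wedge_apply, Function.comp_apply]
    have h2 : ∀ σ : Equiv.Perm (Fin (p + (q + r))), (Equiv.Perm.sign σ : ℝ) *
        (α (fun a => v (Fin.cast (Nat.add_assoc p q r).symm (σ (Fin.castAdd (q + r) a)))) *
        ((q.factorial * r.factorial : ℝ)⁻¹ * ∑ τ : Equiv.Perm (Fin (q + r)),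
          (Equiv.Perm.sign τ : ℝ) * (β (fun b => v (Fin.cast (Nat.add_assoc p q r).symm
            (σ (Fin.natAdd p (τ (Fin.castAdd r b)))))) *
          γ (fun c => v (Fin.cast (Nat.add_assoc p q r).symm
            (σ (Fin.natAdd p (τ (Fin.natAdd q c))))))))) =
        (q.factorial * r.factorial : ℝ)⁻¹ * ((Equiv.Perm.sign σ : ℝ) *
          ∑ τ : Equiv.Perm (Fin (q + r)), (Equiv.Perm.sign τ : ℝ) *
          (α (fun a => v (Fin.cast (Nat.add_assoc p q r).symm (σ (Fin.castAdd (q + r) a)))) *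
          β (fun b => v (Fin.cast (Nat.add_assoc p q r).symm
            (σ (Fin.natAdd p (τ (Fin.castAdd r b)))))) *
          γ (fun c => v (Fin.cast (Nat.add_assoc p q r).symm
            (σ (Fin.natAdd p (τ (Fin.natAdd q c)))))))) := by
      intro σ
      simp only [Finset.mul_sum]
      exact Finset.sum_congr rfl fun τ _ => by ring
    rw [Finset.sum_congr rfl fun σ _ => h2 σ, ← Finset.mul_sum, h]
    have : ((q + r).factorial : ℝ) ≠ 0 := by positivity
    field_simp
  rw [hL, hR]
  congr 1
  -- The index types `Fin (p + q + r)` and `Fin (p + (q + r))` are only propositionally equal;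
  -- conjugation with the cast matches their permutations and keeps signs.
  refine Fintype.sum_equiv (finCongr (Nat.add_assoc p q r)).permCongr _ _ fun σ => ?_
  rw [Equiv.Perm.sign_permCongr]
  congr 3
  funext c
  simp only [Equiv.permCongr_apply, finCongr_apply, finCongr_symm, Fin.cast_cast, Fin.cast_eq_self]
  congr 2
  ext
  simp [Nat.add_assoc]

/-- The wedge product with a one-form on the left. -/
theorem oneForm_wedge {q : ℕ} (θ : E →L[ℝ] ℝ) (β : E [⋀^Fin q]→L[ℝ] ℝ) (v : Fin (q + 1) → E) :
    wedge (oneForm θ) β (v ∘ Fin.cast (Nat.add_comm 1 q)) =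
      ∑ i : Fin (q + 1), (-1 : ℝ) ^ (i : ℕ) * (θ (v i) * β (i.removeNth v)) := by
  set m : Equiv.Perm (Fin (q + 1)) → ℝ := fun σ => θ (v (σ 0)) * β (fun b => v (σ b.succ)) with hm
  have hL : wedge (oneForm θ) β (v ∘ Fin.cast (Nat.add_comm 1 q)) =
      (q.factorial : ℝ)⁻¹ * ∑ σ : Equiv.Perm (Fin (q + 1)), (Equiv.Perm.sign σ : ℝ) * m σ := by
    rw [wedge_apply]
    simp only [Nat.factorial_one, Nat.cast_one, one_mul]
    congr 1
    refine Fintype.sum_equiv (finCongr (Nat.add_comm 1 q)).permCongr _ _ fun σ => ?_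
    rw [Equiv.Perm.sign_permCongr]
    congr 1
    rw [hm]
    simp only [oneForm_apply, Function.comp_apply, Equiv.permCongr_apply, finCongr_apply,
      finCongr_symm]
    congr 1
    congr 1
    funext b
    congr 2
    congr 1
    ext
    simp [Nat.add_comm]
  rw [hL]
  set ρ := ContinuousAlternatingMap.alternatizeUncurryFin (θ.smulRight β) with hρ
  have hρv : ∀ w : Fin (q + 1) → E, ρ w =
      ∑ i : Fin (q + 1), (-1 : ℝ) ^ (i : ℕ) * (θ (w i) * β (i.removeNth w)) := by
    intro w
    rw [hρ, ContinuousAlternatingMap.alternatizeUncurryFin_apply]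
    refine Finset.sum_congr rfl fun i _ => ?_
    rw [zsmul_eq_mul]
    simp [ContinuousLinearMap.smulRight_apply]
  rw [← hρv]
  -- The antisymmetrised sum of ρ is computed twice. Since ρ is alternating it equals (q + 1)! ρ(v);
  -- expanding ρ by its defining sum gives q + 1 copies of the sum in the wedge product.
  have h1 : ∑ σ : Equiv.Perm (Fin (q + 1)), (Equiv.Perm.sign σ : ℝ) * ρ (v ∘ σ) =
      (q + 1).factorial * ρ v := by
    have : ∀ σ : Equiv.Perm (Fin (q + 1)), (Equiv.Perm.sign σ : ℝ) * ρ (v ∘ σ) = ρ v := by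
      intro σ
      have h := ρ.toAlternatingMap.map_perm v σ
      have h' : ρ (v ∘ σ) = (Equiv.Perm.sign σ : ℝ) * ρ v := by
        rw [Units.smul_def, zsmul_eq_mul] at h
        exact h
      rw [h', ← mul_assoc, ← Int.cast_mul, ← Units.val_mul, Int.units_mul_self]
      simp
    rw [Finset.sum_congr rfl fun σ _ => this σ]
    simp [Fintype.card_perm]
  have h2 : ∑ σ : Equiv.Perm (Fin (q + 1)), (Equiv.Perm.sign σ : ℝ) * ρ (v ∘ σ) =
      (q + 1) * ∑ σ : Equiv.Perm (Fin (q + 1)), (Equiv.Perm.sign σ : ℝ) * m σ := by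
    simp only [hρv, Finset.mul_sum]
    rw [Finset.sum_comm]
    have h3 : ∀ i : Fin (q + 1), ∑ σ : Equiv.Perm (Fin (q + 1)), (Equiv.Perm.sign σ : ℝ) *
        ((-1 : ℝ) ^ (i : ℕ) * (θ ((v ∘ σ) i) * β (i.removeNth (v ∘ σ)))) =
        ∑ σ : Equiv.Perm (Fin (q + 1)), (Equiv.Perm.sign σ : ℝ) * m σ := by
      intro i
      -- The permutation `i.cycleRange⁻¹` sends 0 to i and keeps the order of the other indices; its
      -- sign (-1)^i cancels the sign in ρ.
      refine Fintype.sum_equiv (Equiv.mulRight i.cycleRange⁻¹) _ _ fun σ => ?_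
      have e1 : m (σ * i.cycleRange⁻¹) = θ ((v ∘ σ) i) * β (i.removeNth (v ∘ σ)) := by
        rw [hm]
        simp only [Equiv.Perm.mul_apply, Equiv.Perm.inv_def, Fin.cycleRange_symm_zero,
          Fin.cycleRange_symm_succ]
        rfl
      rw [Equiv.coe_mulRight, e1, Equiv.Perm.sign_mul, Equiv.Perm.sign_inv, Fin.sign_cycleRange]
      push_cast
      ring
    rw [Finset.sum_congr rfl fun i _ => h3 i]
    simp [Finset.mul_sum]
  rw [h1, Nat.factorial_succ] at h2
  have hq : (q.factorial : ℝ) ≠ 0 := by positivity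
  have hq1 : (q + 1 : ℝ) ≠ 0 := by positivity
  push_cast at h2
  rw [mul_assoc] at h2
  have h4 := mul_left_cancel₀ hq1 h2
  rw [← h4]
  field_simp

/-- The product of a one-form and a `q`-form, as a form of degree `q + 1`. -/
def oneWedge {q : ℕ} (θ : E →L[ℝ] ℝ) (β : E [⋀^Fin q]→L[ℝ] ℝ) : E [⋀^Fin (q + 1)]→L[ℝ] ℝ :=
  ContinuousAlternatingMap.alternatizeUncurryFin (θ.smulRight β)

theorem oneWedge_apply {q : ℕ} (θ : E →L[ℝ] ℝ) (β : E [⋀^Fin q]→L[ℝ] ℝ) (v : Fin (q + 1) → E) :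
    oneWedge θ β v = ∑ i : Fin (q + 1), (-1 : ℝ) ^ (i : ℕ) * (θ (v i) * β (i.removeNth v)) := by
  rw [oneWedge, ContinuousAlternatingMap.alternatizeUncurryFin_apply]
  refine Finset.sum_congr rfl fun i _ => ?_
  rw [zsmul_eq_mul]
  simp [ContinuousLinearMap.smulRight_apply]

/-- Trades the degree 1 + q of `wedge` for q + 1, the degree in which `extDeriv` takes its values.
-/
theorem wedge_oneForm_left {q : ℕ} (θ : E →L[ℝ] ℝ) (β : E [⋀^Fin q]→L[ℝ] ℝ)
    (v : Fin (1 + q) → E) :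
    wedge (oneForm θ) β v = oneWedge θ β (v ∘ Fin.cast (Nat.add_comm q 1)) := by
  rw [oneWedge_apply, ← oneForm_wedge]
  rfl

theorem oneWedge_add {q : ℕ} (θ : E →L[ℝ] ℝ) (β γ : E [⋀^Fin q]→L[ℝ] ℝ) :
    oneWedge θ (β + γ) = oneWedge θ β + oneWedge θ γ := by
  ext v
  simp only [oneWedge_apply, ContinuousAlternatingMap.add_apply, mul_add, Finset.sum_add_distrib]

theorem norm_oneWedge_le {q : ℕ} (θ : E →L[ℝ] ℝ) (β : E [⋀^Fin q]→L[ℝ] ℝ) :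
    ‖oneWedge θ β‖ ≤ (q + 1) * ‖θ‖ * ‖β‖ := by
  refine (ContinuousAlternatingMap.norm_alternatizeUncurryFin_le _).trans ?_
  rw [ContinuousLinearMap.norm_smulRight_apply, mul_assoc]

/-- `oneWedge` as a continuous bilinear map. -/
def oneWedgeL {q : ℕ} :
    (E →L[ℝ] ℝ) →L[ℝ] (E [⋀^Fin q]→L[ℝ] ℝ) →L[ℝ] (E [⋀^Fin (q + 1)]→L[ℝ] ℝ) :=
  LinearMap.mkContinuous₂
    (LinearMap.mk₂ ℝ oneWedge
      (fun θ η β => by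
        ext v
        simp only [oneWedge_apply, ContinuousAlternatingMap.add_apply, add_apply, add_mul, mul_add,
          Finset.sum_add_distrib])
      (fun c θ β => by
        ext v
        simp only [oneWedge_apply, ContinuousAlternatingMap.smul_apply, smul_apply, smul_eq_mul,
          Finset.mul_sum]
        exact Finset.sum_congr rfl fun i _ => by ring)
      oneWedge_add
      (fun c θ β => by
        ext v
        simp only [oneWedge_apply, ContinuousAlternatingMap.smul_apply, smul_eq_mul,
          Finset.mul_sum]
        exact Finset.sum_congr rfl fun i _ => by ring)) (q + 1) norm_oneWedge_le

theorem oneWedgeL_apply {q : ℕ} (θ : E →L[ℝ] ℝ) (β : E [⋀^Fin q]→L[ℝ] ℝ) :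
    oneWedgeL θ β = oneWedge θ β := rfl

theorem oneWedge_sum {q : ℕ} {ι : Type*} (s : Finset ι) (θ : E →L[ℝ] ℝ)
    (β : ι → E [⋀^Fin q]→L[ℝ] ℝ) : oneWedge θ (∑ j ∈ s, β j) = ∑ j ∈ s, oneWedge θ (β j) := by
  ext v
  simp only [oneWedge_apply, ContinuousAlternatingMap.sum_apply, Finset.mul_sum]
  rw [Finset.sum_comm]

theorem oneWedge_zero {q : ℕ} (θ : E →L[ℝ] ℝ) :
    oneWedge θ (0 : E [⋀^Fin q]→L[ℝ] ℝ) = 0 := by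
  simpa using oneWedge_sum (∅ : Finset ℕ) θ fun _ => (0 : E [⋀^Fin q]→L[ℝ] ℝ)

/-- The bilinear map (u, w) ↦ θ(u)θ(w)β is symmetric, and alternating twice kills symmetric maps. -/
theorem oneWedge_oneWedge_self {q : ℕ} (θ : E →L[ℝ] ℝ) (β : E [⋀^Fin q]→L[ℝ] ℝ) :
    oneWedge θ (oneWedge θ β) = 0 := by
  have h := ContinuousAlternatingMap.alternatizeUncurryFin_alternatizeUncurryFinCLM_comp_of_symmetric
    (f := θ.smulRight (θ.smulRight β)) (by
      intro u w
      simp only [ContinuousLinearMap.smulRight_apply, smul_apply, smul_smul]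
      rw [mul_comm (θ u)])
  have e : (ContinuousAlternatingMap.alternatizeUncurryFinCLM ℝ E ℝ).comp
      (θ.smulRight (θ.smulRight β)) = θ.smulRight (oneWedge θ β) := by
    ext1 u
    simp only [ContinuousLinearMap.comp_apply, ContinuousLinearMap.smulRight_apply, map_smul]
    rfl
  rwa [e] at h

/-- Polarisation of θ ∧ θ ∧ β = 0 at θ + η. -/
theorem oneWedge_comm {q : ℕ} (θ η : E →L[ℝ] ℝ) (β : E [⋀^Fin q]→L[ℝ] ℝ) :
    oneWedge θ (oneWedge η β) = - oneWedge η (oneWedge θ β) := by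
  have h := oneWedge_oneWedge_self (θ + η) β
  simp only [← oneWedgeL_apply, map_add, add_apply] at h
  simp only [oneWedgeL_apply, oneWedge_oneWedge_self, add_zero, zero_add] at h
  exact eq_neg_of_add_eq_zero_right h

theorem wedge_oneForm_oneForm_left (θ η : E →L[ℝ] ℝ) (β : E [⋀^Fin 3]→L[ℝ] ℝ)
    (v : Fin 5 → E) :
    wedge (wedge (oneForm θ) (oneForm η)) β v = oneWedge θ (oneWedge η β) v := by
  refine (wedge_assoc (oneForm θ) (oneForm η) β v).trans ?_
  rw [wedge_oneForm_left, oneWedge_apply, oneWedge_apply]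
  refine Finset.sum_congr rfl fun i _ => ?_
  rw [wedge_oneForm_left]
  rfl

variable [FiniteDimensional ℝ E]

/-- The exterior derivative in terms of a basis and its dual basis. -/
theorem extDeriv_eq_sum_oneWedge {q : ℕ} (τ : E → E [⋀^Fin q]→L[ℝ] ℝ) (x : E) :
    extDeriv τ x = ∑ j, oneWedge (LinearMap.toContinuousLinearMap ((Module.finBasis ℝ E).coord j))
      (fderiv ℝ τ x (Module.finBasis ℝ E j)) := by
  ext v
  rw [ContinuousAlternatingMap.sum_apply]
  simp only [oneWedge_apply]
  rw [extDeriv, ContinuousAlternatingMap.alternatizeUncurryFin_apply, Finset.sum_comm]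
  refine Finset.sum_congr rfl fun i _ => ?_
  rw [zsmul_eq_mul, ← Finset.mul_sum]
  push_cast
  congr 1
  conv_lhs => rw [← (Module.finBasis ℝ E).sum_repr (v i)]
  rw [map_sum, ContinuousAlternatingMap.sum_apply]
  refine Finset.sum_congr rfl fun j _ => ?_
  rw [map_smul]
  rfl

theorem fderiv_oneWedge {q : ℕ} {η : E → E →L[ℝ] ℝ} {β : E → E [⋀^Fin q]→L[ℝ] ℝ} {x : E}
    (hη : DifferentiableAt ℝ η x) (hβ : DifferentiableAt ℝ β x) (w : E) :
    fderiv ℝ (fun y => oneWedge (η y) (β y)) x w =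
      oneWedge (fderiv ℝ η x w) (β x) + oneWedge (η x) (fderiv ℝ β x w) := by
  have h1 := (oneWedgeL.hasFDerivAt_of_bilinear hη.hasFDerivAt hβ.hasFDerivAt).fderiv
  have h2 : fderiv ℝ (fun y => oneWedge (η y) (β y)) x = _ := h1
  rw [h2]
  exact add_comm _ _

/-- The Leibniz rule for the product of a one-form and a three-form. -/
theorem extDeriv_oneWedge {η : E → E →L[ℝ] ℝ} {β : E → E [⋀^Fin 3]→L[ℝ] ℝ} {x : E}
    (hη : DifferentiableAt ℝ η x) (hβ : DifferentiableAt ℝ β x) :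
    extDeriv (fun y => oneWedge (η y) (β y)) x =
      wedge (extDeriv (fun y => oneForm (η y)) x) (β x) - oneWedge (η x) (extDeriv β x) := by
  have ho : ∀ w, fderiv ℝ (fun y => oneForm (η y)) x w = oneForm (fderiv ℝ η x w) := by
    intro w
    have h1 : HasFDerivAt (fun y => oneForm (η y)) (oneFormL.comp (fderiv ℝ η x)) x :=
      oneFormL.hasFDerivAt.comp x hη.hasFDerivAt
    rw [h1.fderiv]; rfl
  have e1 : ∀ θ ζ : E →L[ℝ] ℝ, oneWedge θ (oneForm ζ) = wedge (oneForm θ) (oneForm ζ) := by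
    intro θ ζ
    ext v
    exact (wedge_oneForm_left θ (oneForm ζ) v).symm
  -- With d = ∑ dx_j ∧ ∂_j the product rule gives two sums. The first is regrouped by associativity;
  -- in the second dx_j is moved past η, which produces the minus sign.
  rw [extDeriv_eq_sum_oneWedge, extDeriv_eq_sum_oneWedge, extDeriv_eq_sum_oneWedge, oneWedge_sum]
  simp only [fderiv_oneWedge hη hβ, oneWedge_add, ho, e1, wedge_sum_left,
    Finset.sum_add_distrib, sub_eq_add_neg]
  rw [← Finset.sum_neg_distrib]
  congr 1
  · refine Finset.sum_congr rfl fun j _ => ?_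
    ext v
    exact (wedge_oneForm_oneForm_left _ _ _ v).symm
  · exact Finset.sum_congr rfl fun j _ => oneWedge_comm _ _ _

end WedgeAlgebra

/-! ### Smoothness of integrals depending on a parameter -/

section ParametricIntegral

variable {E F : Type} [NormedAddCommGroup E] [NormedSpace ℝ E] [FiniteDimensional ℝ E]
  [NormedAddCommGroup F] [NormedSpace ℝ F] [CompleteSpace F]

theorem continuous_slice {U : Set E} {f : E × ℝ → F} (hf : ContinuousOn f (U ×ˢ Set.univ)) {x : E}
    (hx : x ∈ U) : Continuous fun t : ℝ => f (x, t) :=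
  continuousOn_univ.1 (hf.comp (by fun_prop) fun t _ => ⟨hx, trivial⟩)

/-- Differentiation under the integral sign. The partial derivative is continuous, hence bounded on
the compact product of a closed ball around x with the interval, and that bound is the dominating
function. -/
theorem hasFDerivAt_parametric_integral {U : Set E} (hU : IsOpen U) {f : E × ℝ → F}
    (hf : ContDiffOn ℝ 1 f (U ×ˢ Set.univ)) (a b : ℝ) {x : E} (hx : x ∈ U) :
    HasFDerivAt (fun y => ∫ t in a..b, f (y, t))
      (∫ t in a..b, (fderiv ℝ f (x, t)).comp (ContinuousLinearMap.inl ℝ E ℝ)) x := by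
  have hO : IsOpen (U ×ˢ (Set.univ : Set ℝ)) := hU.prod isOpen_univ
  have hc : ContinuousOn (fun p : E × ℝ => (fderiv ℝ f p).comp (ContinuousLinearMap.inl ℝ E ℝ))
      (U ×ˢ Set.univ) :=
    (hf.continuousOn_fderiv_of_isOpen hO le_rfl).clm_comp continuousOn_const
  obtain ⟨ε, hε, hball⟩ := Metric.nhds_basis_closedBall.mem_iff.1 (hU.mem_nhds hx)
  have hK : IsCompact (Metric.closedBall x ε ×ˢ Set.uIcc a b) :=
    (isCompact_closedBall x ε).prod isCompact_uIcc
  obtain ⟨C, hC⟩ := hK.exists_bound_of_continuousOn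
    (hc.mono (Set.prod_mono hball (Set.subset_univ _)))
  refine intervalIntegral.hasFDerivAt_integral_of_dominated_of_fderiv_le
    (F := fun y t => f (y, t))
    (F' := fun y t => (fderiv ℝ f (y, t)).comp (ContinuousLinearMap.inl ℝ E ℝ))
    (bound := fun _ => C) (Metric.closedBall_mem_nhds x hε) ?_ ?_ ?_ ?_ ?_ ?_
  · filter_upwards [hU.mem_nhds hx] with y hy
    exact (continuous_slice hf.continuousOn hy).aestronglyMeasurable
  · exact (continuous_slice hf.continuousOn hx).intervalIntegrable a b
  · exact (continuous_slice hc hx).aestronglyMeasurable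
  · refine Filter.Eventually.of_forall fun t ht y hy => ?_
    exact hC (y, t) ⟨hy, Set.uIoc_subset_uIcc ht⟩
  · exact intervalIntegrable_const
  · refine Filter.Eventually.of_forall fun t _ y hy => ?_
    have h1 : HasFDerivAt f (fderiv ℝ f (y, t)) (y, t) :=
      ((hf.contDiffAt (hO.mem_nhds ⟨hball hy, trivial⟩)).differentiableAt one_ne_zero).hasFDerivAt
    exact h1.comp y (hasFDerivAt_prodMk_left y t)

/-- Induction on n: the derivative is again a parametric integral, now with values in `E →L[ℝ] F`.
For this reason F is quantified inside the statement, and E and F live in one universe. -/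
theorem contDiffOn_parametric_integral_nat (n : ℕ) : ∀ {F : Type} [NormedAddCommGroup F]
    [NormedSpace ℝ F] [CompleteSpace F] {U : Set E} (_ : IsOpen U) {f : E × ℝ → F}
    (_ : ContDiffOn ℝ ∞ f (U ×ˢ Set.univ)) (a b : ℝ),
    ContDiffOn ℝ n (fun y => ∫ t in a..b, f (y, t)) U := by
  induction n with
  | zero =>
    intro F _ _ _ U hU f hf a b
    rw [Nat.cast_zero, contDiffOn_zero]
    exact fun x hx => (hasFDerivAt_parametric_integral hU (hf.of_le (by simp)) a b
      hx).continuousAt.continuousWithinAt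
  | succ n ih =>
    intro F _ _ _ U hU f hf a b
    rw [Nat.cast_succ, contDiffOn_succ_iff_fderiv_of_isOpen hU]
    refine ⟨fun x hx => (hasFDerivAt_parametric_integral hU (hf.of_le (by simp)) a b
      hx).differentiableAt.differentiableWithinAt, by simp, ?_⟩
    have hO : IsOpen (U ×ˢ (Set.univ : Set ℝ)) := hU.prod isOpen_univ
    refine ContDiffOn.congr (ih hU (f := fun p => (fderiv ℝ f p).comp
      (ContinuousLinearMap.inl ℝ E ℝ)) ?_ a b) fun x hx =>
      (hasFDerivAt_parametric_integral hU (hf.of_le (by simp)) a b hx).fderiv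
    exact (hf.fderiv_of_isOpen hO (by simp)).clm_comp contDiffOn_const

theorem contDiffOn_parametric_integral {U : Set E} (hU : IsOpen U) {f : E × ℝ → F}
    (hf : ContDiffOn ℝ ∞ f (U ×ˢ Set.univ)) (a b : ℝ) :
    ContDiffOn ℝ ∞ (fun y => ∫ t in a..b, f (y, t)) U :=
  contDiffOn_infty.2 fun n => contDiffOn_parametric_integral_nat n hU hf a b

end ParametricIntegral

/-! ### Differential forms on the bundle of anti-self-dual forms -/

section AsdForms

variable {X : Type u} [TopologicalSpace X] {Q : Orbifold E4 X} {g : Q.RiemannianMetric}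

namespace Orbifold.OrthonormalFrame

variable (e : Orbifold.OrthonormalFrame g)

theorem liftFibre_smul (i j : Q.ι) (h : OpenPartialHomeomorph E4 E4) (x : E4) (c : ℝ) (a : E3) :
    e.liftFibre i j h x (c • a) = c • e.liftFibre i j h x a := by
  ext k
  simp [liftFibre, asd, asdForm, Finset.mul_sum, mul_assoc]

/-- A family of smooth forms that is invariant under the lifts of the changes of charts of the
base is a differential form on the bundle of anti-self-dual forms. -/
theorem mem_forms_of_lift (hQ : Q.IsOriented) {k : ℕ} {α : (e.asdOrbifold hQ).LocalForms k}
    (hs : ∀ i, ContDiffOn ℝ ∞ (α i) (Q.U i ×ˢ Set.univ))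
    (hl : ∀ (i j : Q.ι) (h : OpenPartialHomeomorph E4 E4) (H : Q.IsTransition i j h) (p : E4 × E3),
      p.1 ∈ h.source → (α j (e.liftHomeo hQ H p)).compContinuousLinearMap
        (fderiv ℝ (e.liftHomeo hQ H) p) = α i p) :
    α ∈ (e.asdOrbifold hQ).forms k := by
  refine ⟨hs, fun (i : Q.ι) (j : Q.ι) h H p hp => ?_⟩
  have hpU : p.1 ∈ Q.U i := (H.source_subset hp).1
  have hqU : (h p).1 ∈ Q.U j := (H.target_subset (h.map_source hp)).1
  have hrel : e.asdChart j (h p) = e.asdChart i p := H.map p hp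
  rw [e.asdChart_of_mem hpU, e.asdChart_of_mem hqU, eq_comm, e.mkPoint_eq] at hrel
  obtain ⟨k, K, hks, hkm, hkp⟩ := hrel
  simp only at K hks hkm hkp
  -- A change of charts h of the total space need not be a lift. At p it is compared with the lift L
  -- of a change of charts of Q such that L p = h p. Then L⁻¹ ∘ h fixes p, so to first order it is
  -- the action of a group element, which is a lift; and invariance of a form at p involves first
  -- derivatives only.
  set L := e.liftHomeo hQ K with hL
  have KL : (e.asdOrbifold hQ).IsTransition i j L := e.liftHomeo_isChartChange hQ K
  have hpL : p ∈ L.source := ⟨hks, trivial⟩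
  have hLp : L p = h p := by
    refine Prod.ext hkm ?_
    rw [← hkm] at hkp
    exact (e.liftFibre_unique hQ K hks hkp).symm
  have hT := IsChartChange.trans H KL.symm
  have hpT : p ∈ (h.trans L.symm).source := by
    simp only [OpenPartialHomeomorph.trans_source, Set.mem_inter_iff, Set.mem_preimage]
    exact ⟨hp, by rw [← hLp]; exact L.map_source hpL⟩
  have hTp : (h.trans L.symm) p = p := by
    simp only [OpenPartialHomeomorph.coe_trans, Function.comp_apply]
    rw [← hLp, L.left_inv hpL]
  obtain ⟨γ, hγ, hγd⟩ := (e.asdOrbifold hQ).exists_act_eq hT hpT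
  rw [hTp] at hγ
  have hd : fderiv ℝ h p = (fderiv ℝ L p).comp (fderiv ℝ (h.trans L.symm) p) := by
    have h1 : (h : E4 × E3 → E4 × E3) =ᶠ[𝓝 p] L ∘ (h.trans L.symm) := by
      filter_upwards [(h.trans L.symm).open_source.mem_nhds hpT] with y hy
      simp only [OpenPartialHomeomorph.trans_source, Set.mem_inter_iff, Set.mem_preimage] at hy
      exact (L.right_inv hy.2).symm
    rw [h1.fderiv_eq, fderiv_comp p _ (hT.differentiableAt hpT), hTp]
    rw [hTp]
    exact KL.differentiableAt hpL
  have h1 := hl i j k K p hks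
  have h2 := hl i i (Q.actHomeo i γ) (Q.actHomeo_isTransition i γ) p hpU
  have h3 : e.liftHomeo hQ (Q.actHomeo_isTransition i γ) p = p := hγ
  have h4 : fderiv ℝ (e.liftHomeo hQ (Q.actHomeo_isTransition i γ)) p =
    fderiv ℝ (h.trans L.symm) p := hγd
  rw [h3, h4] at h2
  rw [hd, ← hLp]
  calc _ = ((α j (L p)).compContinuousLinearMap (fderiv ℝ L p)).compContinuousLinearMap
        (fderiv ℝ (h.trans L.symm) p) := rfl
    _ = _ := by rw [h1, h2]

end Orbifold.OrthonormalFrame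

end AsdForms

/-! ### The fibrewise Poincaré lemma -/

/-- The exterior derivative in the parameter commutes with the integral. Evaluation on fixed vectors
is continuous and linear, so it passes through the integral and reduces the claim to scalar
integrands. -/
theorem extDeriv_parametric_integral {E : Type} [NormedAddCommGroup E] [NormedSpace ℝ E]
    [FiniteDimensional ℝ E] {U : Set E} (hU : IsOpen U) {k : ℕ}
    {f : E × ℝ → E [⋀^Fin k]→L[ℝ] ℝ} (hf : ContDiffOn ℝ ∞ f (U ×ˢ Set.univ)) (a b : ℝ) {x : E}
    (hx : x ∈ U) (v : Fin (k + 1) → E) :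
    extDeriv (fun y => ∫ t in a..b, f (y, t)) x v = ∫ t in a..b, ∑ j : Fin (k + 1),
      (-1 : ℝ) ^ (j : ℕ) * fderiv ℝ (fun P => f P (j.removeNth v)) (x, t) (v j, 0) := by
  have hO : IsOpen (U ×ˢ (Set.univ : Set ℝ)) := hU.prod isOpen_univ
  have hd : DifferentiableAt ℝ (fun y => ∫ t in a..b, f (y, t)) x :=
    (hasFDerivAt_parametric_integral hU (hf.of_le (by simp)) a b hx).differentiableAt
  have heval : ∀ (u : Fin k → E), ∀ y ∈ U, (∫ t in a..b, f (y, t)) u = ∫ t in a..b, f (y, t) u := by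
    intro u y hy
    exact ((evalForm k u).intervalIntegral_comp_comm
      ((continuous_slice hf.continuousOn hy).intervalIntegrable (μ := MeasureTheory.volume) a b)).symm
  have hc : ∀ u : Fin k → E, Continuous fun t : ℝ =>
      (fderiv ℝ (fun P => f P u) (x, t)).comp (ContinuousLinearMap.inl ℝ E ℝ) := fun u =>
    continuous_slice (f := fun P => (fderiv ℝ (fun P => f P u) P).comp
      (ContinuousLinearMap.inl ℝ E ℝ)) (((contDiffOn_form_apply hf u).continuousOn_fderiv_of_isOpen
        hO (by simp)).clm_comp continuousOn_const) hx
  have hterm : ∀ (u : Fin k → E) (w : E), fderiv ℝ (fun y => ∫ t in a..b, f (y, t)) x w u =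
      ∫ t in a..b, fderiv ℝ (fun P => f P u) (x, t) (w, 0) := by
    intro u w
    rw [fderiv_form_apply hd]
    have h1 : (fun y => (∫ t in a..b, f (y, t)) u) =ᶠ[𝓝 x] fun y => ∫ t in a..b, f (y, t) u := by
      filter_upwards [hU.mem_nhds hx] with y hy
      exact heval u y hy
    rw [h1.fderiv_eq, (hasFDerivAt_parametric_integral (f := fun P => f P u) hU
      ((contDiffOn_form_apply hf u).of_le (by simp)) a b hx).fderiv]
    exact ((ContinuousLinearMap.apply ℝ ℝ w).intervalIntegral_comp_comm
      ((hc u).intervalIntegrable (μ := MeasureTheory.volume) a b)).symm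
  rw [extDeriv, ContinuousAlternatingMap.alternatizeUncurryFin_apply,
    intervalIntegral.integral_finsetSum]
  · refine Finset.sum_congr rfl fun j _ => ?_
    rw [hterm, intervalIntegral.integral_const_mul, zsmul_eq_mul]
    simp
  · intro j _
    refine Continuous.intervalIntegrable ?_ a b
    exact continuous_const.mul ((hc _).clm_apply continuous_const)

section Cone

theorem two_le_infty : (2 : WithTop ℕ∞) ≤ ∞ := WithTop.coe_le_coe.2 le_top

/-- The fibrewise dilation `(t, (x, a)) ↦ (x, t a)`. -/
def dilate (P : (E4 × E3) × ℝ) : E4 × E3 := (P.1.1, P.2 • P.1.2)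

theorem contDiff_dilate : ContDiff ℝ ∞ dilate :=
  (contDiff_fst.comp contDiff_fst).prodMk (contDiff_snd.smul (contDiff_snd.comp contDiff_fst))

theorem hasFDerivAt_dilate (P : (E4 × E3) × ℝ) : HasFDerivAt dilate
    (((ContinuousLinearMap.fst ℝ E4 E3).comp (ContinuousLinearMap.fst ℝ (E4 × E3) ℝ)).prod
      (P.2 • (ContinuousLinearMap.snd ℝ E4 E3).comp (ContinuousLinearMap.fst ℝ (E4 × E3) ℝ) +
        (ContinuousLinearMap.snd ℝ (E4 × E3) ℝ).smulRight P.1.2)) P := by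
  have h1 : HasFDerivAt (fun P : (E4 × E3) × ℝ => P.1.1)
      ((ContinuousLinearMap.fst ℝ E4 E3).comp (ContinuousLinearMap.fst ℝ (E4 × E3) ℝ)) P :=
    ((ContinuousLinearMap.fst ℝ E4 E3).comp (ContinuousLinearMap.fst ℝ (E4 × E3) ℝ)).hasFDerivAt
  have h2 : HasFDerivAt (fun P : (E4 × E3) × ℝ => P.1.2)
      ((ContinuousLinearMap.snd ℝ E4 E3).comp (ContinuousLinearMap.fst ℝ (E4 × E3) ℝ)) P :=
    ((ContinuousLinearMap.snd ℝ E4 E3).comp (ContinuousLinearMap.fst ℝ (E4 × E3) ℝ)).hasFDerivAt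
  have h3 : HasFDerivAt (fun P : (E4 × E3) × ℝ => P.2) (ContinuousLinearMap.snd ℝ (E4 × E3) ℝ) P :=
    (ContinuousLinearMap.snd ℝ (E4 × E3) ℝ).hasFDerivAt
  exact h1.prodMk (h3.smul h2)

theorem fderiv_dilate_apply (P V : (E4 × E3) × ℝ) :
    fderiv ℝ dilate P V = (V.1.1, P.2 • V.1.2 + V.2 • P.1.2) := by
  rw [(hasFDerivAt_dilate P).fderiv]
  simp

variable {k : ℕ}

/-- The pull-back of a form by the fibrewise dilation. -/
def dilatePullback (α : E4 × E3 → (E4 × E3) [⋀^Fin k]→L[ℝ] ℝ) (P : (E4 × E3) × ℝ) :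
    ((E4 × E3) × ℝ) [⋀^Fin k]→L[ℝ] ℝ :=
  (α (dilate P)).compContinuousLinearMap (fderiv ℝ dilate P)

/-- The contraction of the pull-back by the fibrewise dilation with `∂_t`. -/
def coneIntegrand (α : E4 × E3 → (E4 × E3) [⋀^Fin (k + 1)]→L[ℝ] ℝ) (P : (E4 × E3) × ℝ) :
    (E4 × E3) [⋀^Fin k]→L[ℝ] ℝ :=
  ((dilatePullback α P).curryLeft (0, 1)).compContinuousLinearMap
    (ContinuousLinearMap.inl ℝ (E4 × E3) ℝ)

/-- The cone operator of the fibrewise Poincaré lemma. -/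
def coneForm (α : E4 × E3 → (E4 × E3) [⋀^Fin (k + 1)]→L[ℝ] ℝ) (p : E4 × E3) :
    (E4 × E3) [⋀^Fin k]→L[ℝ] ℝ :=
  ∫ t in (0 : ℝ)..1, coneIntegrand α (p, t)

theorem coneIntegrand_apply (α : E4 × E3 → (E4 × E3) [⋀^Fin (k + 1)]→L[ℝ] ℝ)
    (P : (E4 × E3) × ℝ) (v : Fin k → E4 × E3) :
    coneIntegrand α P v =
      dilatePullback α P (Fin.cons (0, 1) fun a => (v a, 0)) := by
  simp only [coneIntegrand, ContinuousAlternatingMap.compContinuousLinearMap_apply]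
  rfl

/-- Here the cone is expressed by the radial vector and the scaling of fibre components alone, both
of which are respected by fibrewise linear maps. -/
theorem coneIntegrand_apply' (α : E4 × E3 → (E4 × E3) [⋀^Fin (k + 1)]→L[ℝ] ℝ)
    (p : E4 × E3) (t : ℝ) (v : Fin k → E4 × E3) :
    coneIntegrand α (p, t) v = α (p.1, t • p.2)
      (Fin.cons (0, p.2) fun a => ((v a).1, t • (v a).2)) := by
  rw [coneIntegrand_apply, dilatePullback,
    ContinuousAlternatingMap.compContinuousLinearMap_apply]
  change α (dilate (p, t)) _ = α (dilate (p, t)) _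
  congr 1
  funext a
  refine Fin.cases ?_ (fun b => ?_) a
  · simp [fderiv_dilate_apply]
  · simp [fderiv_dilate_apply]

variable {U : Set E4}

theorem contDiffOn_dilatePullback {α : E4 × E3 → (E4 × E3) [⋀^Fin k]→L[ℝ] ℝ}
    (hα : ContDiffOn ℝ ∞ α (U ×ˢ Set.univ)) :
    ContDiffOn ℝ ∞ (dilatePullback α) ((U ×ˢ Set.univ) ×ˢ Set.univ) :=
  contDiffOn_form_comp (hα.comp contDiff_dilate.contDiffOn fun P hP => ⟨hP.1.1, trivial⟩)
    (contDiff_dilate.fderiv_right (m := ∞) (by simp)).contDiffOn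

theorem contDiffOn_coneIntegrand {α : E4 × E3 → (E4 × E3) [⋀^Fin (k + 1)]→L[ℝ] ℝ}
    (hα : ContDiffOn ℝ ∞ α (U ×ˢ Set.univ)) :
    ContDiffOn ℝ ∞ (coneIntegrand α) ((U ×ˢ Set.univ) ×ˢ Set.univ) := by
  refine contDiffOn_form fun v => ?_
  simp only [coneIntegrand_apply]
  exact contDiffOn_form_apply (contDiffOn_dilatePullback hα) _

theorem contDiffOn_coneForm (hU : IsOpen U)
    {α : E4 × E3 → (E4 × E3) [⋀^Fin (k + 1)]→L[ℝ] ℝ} (hα : ContDiffOn ℝ ∞ α (U ×ˢ Set.univ)) :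
    ContDiffOn ℝ ∞ (coneForm α) (U ×ˢ Set.univ) :=
  contDiffOn_parametric_integral (hU.prod isOpen_univ) (contDiffOn_coneIntegrand hα) 0 1

/-- A closed form differs from its pull-back by the zero section by the derivative of its cone. -/
theorem extDeriv_coneForm (hU : IsOpen U) {α : E4 × E3 → (E4 × E3) [⋀^Fin (k + 1)]→L[ℝ] ℝ}
    (hα : ContDiffOn ℝ ∞ α (U ×ˢ Set.univ)) (hd : ∀ p ∈ U ×ˢ Set.univ, extDeriv α p = 0)
    {p : E4 × E3} (hp : p.1 ∈ U) (v : Fin (k + 1) → E4 × E3) :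
    extDeriv (coneForm α) p v = α p v - α (p.1, 0) fun a => ((v a).1, 0) := by
  have hO : IsOpen (U ×ˢ (Set.univ : Set E3)) := hU.prod isOpen_univ
  have hOO : IsOpen ((U ×ˢ (Set.univ : Set E3)) ×ˢ (Set.univ : Set ℝ)) := hO.prod isOpen_univ
  have hpp : p ∈ U ×ˢ (Set.univ : Set E3) := ⟨hp, trivial⟩
  have hβ := contDiffOn_dilatePullback hα
  have hκ := contDiffOn_coneIntegrand hα
  have hβd : ∀ t : ℝ, DifferentiableAt ℝ (dilatePullback α) (p, t) := fun t =>
    (hβ.contDiffAt (hOO.mem_nhds ⟨hpp, trivial⟩)).differentiableAt (by simp)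
  -- the pull-back is closed
  have hclosed : ∀ t : ℝ, extDeriv (dilatePullback α) (p, t) = 0 := by
    intro t
    have hm : dilate (p, t) ∈ U ×ˢ (Set.univ : Set E3) := ⟨hp, trivial⟩
    have hdα : DifferentiableAt ℝ α (dilate (p, t)) :=
      (hα.contDiffAt (hO.mem_nhds hm)).differentiableAt (by simp)
    have h1 := extDeriv_pullback (r := ∞) hdα contDiff_dilate.contDiffAt
      (by simp [minSmoothness_of_isRCLikeNormedField]; exact two_le_infty)
    rw [hd _ hm] at h1
    exact h1
  set D : ℝ → ℝ := fun t => ∑ j : Fin (k + 1), (-1 : ℝ) ^ (j : ℕ) *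
    fderiv ℝ (fun P => coneIntegrand α P (j.removeNth v)) (p, t) (v j, 0) with hD
  have h1 : extDeriv (coneForm α) p v = ∫ t in (0 : ℝ)..1, D t :=
    extDeriv_parametric_integral hO hκ 0 1 hpp v
  -- Cartan's formula for ∂_t: evaluating the closedness of the pulled-back form on (∂_t, v₀, …,
  -- v_k) shows that its t-derivative on v is the exterior derivative, in the directions of the
  -- bundle, of its contraction with ∂_t.
  have h2 : ∀ t : ℝ, HasDerivAt (fun s : ℝ => dilatePullback α (p, s) fun a => (v a, 0))
      (D t) t := by
    intro t
    have e1 : HasDerivAt (fun s : ℝ => dilatePullback α (p, s))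
        (fderiv ℝ (dilatePullback α) (p, t) (0, 1)) t := by
      have hc : HasDerivAt (fun s : ℝ => (p, s)) ((0 : E4 × E3), (1 : ℝ)) t :=
        (hasDerivAt_const t p).prodMk (hasDerivAt_id t)
      exact (hβd t).hasFDerivAt.comp_hasDerivAt t hc
    have e2 := (evalForm (k + 1) fun a => ((v a, 0) : (E4 × E3) × ℝ)).hasFDerivAt.comp_hasDerivAt
      t e1
    suffices hs : D t = fderiv ℝ (dilatePullback α) (p, t) (0, 1) fun a => (v a, 0) by
      rw [hs]; exact e2
    set W : Fin (k + 2) → (E4 × E3) × ℝ := Fin.cons (0, 1) fun a => (v a, 0) with hW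
    have hW0 : W 0 = (0, 1) := rfl
    have hWs : ∀ a, W (Fin.succ a) = (v a, 0) := fun a => rfl
    have e3 := congrArg (fun f => f W) (hclosed t)
    simp only [extDeriv, ContinuousAlternatingMap.alternatizeUncurryFin_apply,
      Fin.sum_univ_succ (n := k + 1), hW0, hWs] at e3
    simp only [Fin.val_zero, pow_zero, one_smul, Fin.val_succ] at e3
    have e5 : ∀ j : Fin (k + 1),
        fderiv ℝ (fun P => coneIntegrand α P (j.removeNth v)) (p, t) (v j, 0) =
        fderiv ℝ (dilatePullback α) (p, t) (v j, 0)
          (j.succ.removeNth W) := by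
      intro j
      rw [fderiv_form_apply (hβd t)]
      simp only [coneIntegrand_apply]
      congr 3
      funext P
      congr 1
      funext a
      refine Fin.cases rfl (fun b => ?_) a
      simp [Fin.removeNth, Fin.succ_succAbove_succ, hWs]
    have e6 : Fin.removeNth 0 W = fun a => (v a, 0) := by
      funext a; rfl
    rw [e6] at e3
    have e7 : D t = ∑ j : Fin (k + 1), (-1 : ℤ) ^ (j : ℕ) • fderiv ℝ (dilatePullback α) (p, t)
        (v j, 0) (j.succ.removeNth W) := by
      refine Finset.sum_congr rfl fun j _ => ?_
      rw [e5 j, zsmul_eq_mul]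
      simp
    rw [e7]
    simp only [pow_succ, mul_neg, mul_one, neg_smul, Finset.sum_neg_distrib] at e3
    have e8 : (0 : ((E4 × E3) × ℝ) [⋀^Fin (k + 2)]→L[ℝ] ℝ) W = 0 := rfl
    rw [e8] at e3
    linarith [e3]
  have hcont : Continuous D := by
    refine continuous_finsetSum _ fun j _ => continuous_const.mul ?_
    exact continuous_slice (f := fun P => fderiv ℝ (fun P => coneIntegrand α P (j.removeNth v)) P
      (v j, 0)) (((contDiffOn_form_apply hκ _).continuousOn_fderiv_of_isOpen hOO
        (by simp)).clm_apply continuousOn_const) hpp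
  -- The boundary term at t = 1 is α; at t = 0 the dilation collapses the fibre and leaves α on the
  -- zero section.
  rw [h1, intervalIntegral.integral_eq_sub_of_hasDerivAt (fun t _ => h2 t)
    (hcont.intervalIntegrable 0 1)]
  congr 1
  · simp [dilatePullback, ContinuousAlternatingMap.compContinuousLinearMap_apply, dilate,
      Function.comp_def, fderiv_dilate_apply]
  · simp [dilatePullback, ContinuousAlternatingMap.compContinuousLinearMap_apply, dilate,
      Function.comp_def, fderiv_dilate_apply]

/-- A five-form on `ℝ⁴ × ℝ³` vanishes on horizontal vectors. -/
theorem five_form_horizontal (β : (E4 × E3) [⋀^Fin 5]→L[ℝ] ℝ) (v : Fin 5 → E4 × E3) :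
    (β fun a => ((v a).1, 0)) = 0 := by
  -- Five vectors of ℝ⁴ are linearly dependent.
  have h := (β.compContinuousLinearMap (ContinuousLinearMap.inl ℝ E4 E3)).toAlternatingMap
    |>.map_linearDependent (fun a => (v a).1) (by
      intro hli
      have := hli.fintype_card_le_finrank
      simp at this)
  exact h

end Cone

/-! ### The cone of a form on the orbibundle, and vanishing of the fifth cohomology. -/

section Cohomology

variable {X : Type u} [TopologicalSpace X] {Q : Orbifold E4 X} {g : Q.RiemannianMetric}

namespace Orbifold.OrthonormalFrame

variable (e : Orbifold.OrthonormalFrame g)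

theorem liftHomeo_dilate (hQ : Q.IsOriented) {i j : Q.ι} {h : OpenPartialHomeomorph E4 E4}
    (H : Q.IsTransition i j h) (x : E4) (t : ℝ) (a : E3) :
    e.liftHomeo hQ H (x, t • a) = (h x, t • e.liftFibre i j h x a) := by
  change (h x, e.liftFibre i j h x (t • a)) = _
  rw [liftFibre_smul]

/-- A lifted change of charts L is linear on fibres, so it commutes with every dilation. The chain
rule for L ∘ S = S ∘ L handles the scaled arguments, and differentiating along the ray s ↦ (x, s a)
handles the radial one. -/
theorem coneIntegrand_lift (hQ : Q.IsOriented) {k : ℕ} {α : (e.asdOrbifold hQ).LocalForms (k + 1)}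
    (hα : α ∈ (e.asdOrbifold hQ).forms (k + 1)) {i j : Q.ι} {h : OpenPartialHomeomorph E4 E4}
    (H : Q.IsTransition i j h) {p : E4 × E3} (hp : p.1 ∈ h.source) (t : ℝ) :
    (coneIntegrand (α j) (e.liftHomeo hQ H p, t)).compContinuousLinearMap
      (fderiv ℝ (e.liftHomeo hQ H) p) = coneIntegrand (α i) (p, t) := by
  set L := e.liftHomeo hQ H with hL
  have HL : (e.asdOrbifold hQ).IsTransition i j L := e.liftHomeo_isChartChange hQ H
  have hpt : (p.1, t • p.2) ∈ L.source := ⟨hp, trivial⟩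
  have hdt := (HL.differentiableAt hpt).hasFDerivAt
  have hd := (HL.differentiableAt (x := p) ⟨hp, trivial⟩).hasFDerivAt
  ext v
  rw [ContinuousAlternatingMap.compContinuousLinearMap_apply, coneIntegrand_apply',
    coneIntegrand_apply']
  have h1 := hα.2 i j L HL (p.1, t • p.2) hpt
  rw [← h1, ContinuousAlternatingMap.compContinuousLinearMap_apply, hL, e.liftHomeo_dilate hQ H,
    ← hL]
  change α j (h p.1, t • e.liftFibre i j h p.1 p.2) _ = α j (h p.1, t • e.liftFibre i j h p.1 p.2) _
  congr 1
  funext a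
  refine Fin.cases ?_ (fun b => ?_) a
  · simp only [Fin.cons_zero, Function.comp_apply]
    have hc : HasDerivAt (fun s : ℝ => (p.1, s • p.2)) ((0 : E4), p.2) t := by
      have := (hasDerivAt_const t p.1).prodMk ((hasDerivAt_id t).smul_const p.2)
      simpa using this
    have h2 := hdt.comp_hasDerivAt t hc
    have h3 : HasDerivAt (fun s : ℝ => (h p.1, s • e.liftFibre i j h p.1 p.2))
        ((0 : E4), e.liftFibre i j h p.1 p.2) t := by
      have := (hasDerivAt_const t (h p.1)).prodMk
        ((hasDerivAt_id t).smul_const (e.liftFibre i j h p.1 p.2))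
      simpa using this
    have h4 : (L ∘ fun s : ℝ => (p.1, s • p.2)) =
        fun s : ℝ => (h p.1, s • e.liftFibre i j h p.1 p.2) := by
      funext s
      exact e.liftHomeo_dilate hQ H p.1 s p.2
    rw [h4] at h2
    exact h3.unique h2
  · simp only [Fin.cons_succ, Function.comp_apply]
    let S : (E4 × E3) →L[ℝ] (E4 × E3) :=
      (ContinuousLinearMap.fst ℝ E4 E3).prod (t • ContinuousLinearMap.snd ℝ E4 E3)
    have h2 : HasFDerivAt (L ∘ S) ((fderiv ℝ L (p.1, t • p.2)).comp S) p :=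
      HasFDerivAt.comp p hdt S.hasFDerivAt
    have h3 : HasFDerivAt (S ∘ L) (S.comp (fderiv ℝ L p)) p := S.hasFDerivAt.comp p hd
    have h4 : L ∘ S = S ∘ L := by
      funext q
      exact e.liftHomeo_dilate hQ H q.1 t q.2
    rw [h4] at h2
    have h5 := congrArg (fun A => A (v b)) (h3.unique h2)
    exact h5

/-- Pull-back by a fixed linear map is continuous and linear on forms, so invariance passes from the
integrand to the integral; by `mem_forms_of_lift` only lifted changes of charts have to be
considered. -/
theorem coneForm_mem_forms (hQ : Q.IsOriented) {k : ℕ}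
    {α : (e.asdOrbifold hQ).LocalForms (k + 1)} (hα : α ∈ (e.asdOrbifold hQ).forms (k + 1)) :
    (fun i => coneForm (α i) : (e.asdOrbifold hQ).LocalForms k) ∈ (e.asdOrbifold hQ).forms k := by
  refine e.mem_forms_of_lift hQ (fun i => contDiffOn_coneForm (Q.isOpen_U i) (hα.1 i)) ?_
  intro i j h H p hp
  have hO : ∀ i, IsOpen (Q.U i ×ˢ (Set.univ : Set E3)) := fun i => (Q.isOpen_U i).prod isOpen_univ
  have hq : e.liftHomeo hQ H p ∈ Q.U j ×ˢ (Set.univ : Set E3) :=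
    ⟨H.target_subset (h.map_source hp), trivial⟩
  have hc : Continuous fun t : ℝ => coneIntegrand (α j) (e.liftHomeo hQ H p, t) :=
    continuous_slice (contDiffOn_coneIntegrand (hα.1 j)).continuousOn hq
  have h1 := (ContinuousAlternatingMap.compContinuousLinearMapCLM (𝕜 := ℝ) (F := ℝ) (ι := Fin k)
    (fderiv ℝ (e.liftHomeo hQ H) p)).intervalIntegral_comp_comm (hc.intervalIntegrable (μ := MeasureTheory.volume) 0 1)
  change (∫ t in (0 : ℝ)..1, coneIntegrand (α j) (e.liftHomeo hQ H p, t)).compContinuousLinearMap _ =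
    ∫ t in (0 : ℝ)..1, coneIntegrand (α i) (p, t)
  refine h1.symm.trans ?_
  refine intervalIntegral.integral_congr fun t _ => ?_
  exact e.coneIntegrand_lift hQ hα H hp t

/-- Closed five-forms on the bundle of anti-self-dual forms are exact. -/
theorem closed_five_form_exact (hQ : Q.IsOriented) {α : (e.asdOrbifold hQ).LocalForms 5}
    (hα : α ∈ (e.asdOrbifold hQ).closedForms 5) : α ∈ (e.asdOrbifold hQ).exactForms 5 := by
  refine ⟨fun i => coneForm (α i), e.coneForm_mem_forms hQ hα.1, fun i p hp => ?_⟩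
  ext v
  rw [extDeriv_coneForm (Q.isOpen_U i) (hα.1.1 i) (hα.2 i) hp.1, five_form_horizontal, sub_zero]

theorem subsingleton_cohomology_five (hQ : Q.IsOriented) :
    Subsingleton ((e.asdOrbifold hQ).cohomology 5) := by
  rw [Submodule.Quotient.subsingleton_iff, eq_top_iff]
  rintro ⟨α, hα⟩ _
  exact e.closed_five_form_exact hQ hα

end Orbifold.OrthonormalFrame

end Cohomology

/-! ### Slices of Seifert bundles -/

section Slices

variable {E : Type v} [NormedAddCommGroup E] [NormedSpace ℝ E] {X : Type u} [TopologicalSpace X]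
  {O : Orbifold E X}

namespace SeifertBundle

section Basic

variable (P : SeifertBundle O)

theorem contMDiff_action : ContMDiff ((𝓡 1).prod 𝓘(ℝ, E × ℝ)) 𝓘(ℝ, E × ℝ) ∞
    (fun p : Circle × P.M => p.1 • p.2) :=
  ContMDiffSMul.contMDiff_smul

instance continuousSMul : ContinuousSMul Circle P.M := ⟨P.contMDiff_action.continuous⟩

theorem contMDiff_smul_const (z : Circle) :
    ContMDiff 𝓘(ℝ, E × ℝ) 𝓘(ℝ, E × ℝ) ∞ (fun m : P.M => z • m) :=
  P.contMDiff_action.comp (contMDiff_const.prodMk contMDiff_id)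

theorem contMDiff_exp_smul : ContMDiff (𝓘(ℝ, ℝ).prod 𝓘(ℝ, E × ℝ)) 𝓘(ℝ, E × ℝ) ∞
    (fun p : ℝ × P.M => Circle.exp p.1 • p.2) :=
  P.contMDiff_action.comp ((contMDiff_circleExp.comp contMDiff_fst).prodMk contMDiff_snd)

theorem π_smul (z : Circle) (m : P.M) : P.π (z • m) = P.π m :=
  ((P.fiber m (z • m)).2 ⟨z, rfl⟩).symm

end Basic

/-- A slice of a Seifert bundle over a chart of the orbifold: a diffeomorphism of
`base × (-width, width)` onto an open set of the total space, equivariant for (small) rotations,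
that covers the parametrisation of the orbifold. -/
structure Slice (P : SeifertBundle O) (i : O.ι) where
  chart : OpenPartialHomeomorph (E × ℝ) P.M
  base : Set E
  width : ℝ
  width_pos : 0 < width
  isOpen_base : IsOpen base
  base_subset : base ⊆ O.U i
  source_eq : chart.source = base ×ˢ Set.Ioo (-width) width
  smooth : ContMDiffOn 𝓘(ℝ, E × ℝ) 𝓘(ℝ, E × ℝ) ∞ chart chart.source
  smooth_symm : ContMDiffOn 𝓘(ℝ, E × ℝ) 𝓘(ℝ, E × ℝ) ∞ chart.symm chart.target
  exp_smul : ∀ y ∈ base, ∀ t ∈ Set.Ioo (-width) width, chart (y, t) = Circle.exp t • chart (y, 0)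
  proj : ∀ y ∈ base, P.π (chart (y, 0)) = O.φ i y

namespace Slice

variable {P : SeifertBundle O} {i j : O.ι}

theorem mem_source (S : P.Slice i) {y : E} {t : ℝ} :
    (y, t) ∈ S.chart.source ↔ y ∈ S.base ∧ -S.width < t ∧ t < S.width := by
  rw [S.source_eq]; exact Iff.rfl

theorem zero_mem_source (S : P.Slice i) {y : E} (hy : y ∈ S.base) : (y, 0) ∈ S.chart.source :=
  S.mem_source.2 ⟨hy, neg_lt_zero.2 S.width_pos, S.width_pos⟩

theorem π_chart (S : P.Slice i) {p : E × ℝ} (hp : p ∈ S.chart.source) :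
    P.π (S.chart p) = O.φ i p.1 := by
  have h := S.mem_source.1 hp
  rw [show p = (p.1, p.2) from rfl, S.exp_smul p.1 h.1 p.2 h.2, π_smul, S.proj p.1 h.1]

theorem exp_smul_chart (S : P.Slice i) {y : E} {s t : ℝ} (ht : (y, t) ∈ S.chart.source)
    (hst : (y, s + t) ∈ S.chart.source) : Circle.exp s • S.chart (y, t) = S.chart (y, s + t) := by
  have h := S.mem_source.1 ht
  have h' := S.mem_source.1 hst
  rw [S.exp_smul y h.1 t h.2, S.exp_smul y h.1 _ h'.2, Circle.exp_add, mul_smul]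

theorem contMDiffAt (S : P.Slice i) {p : E × ℝ} (hp : p ∈ S.chart.source) :
    ContMDiffAt 𝓘(ℝ, E × ℝ) 𝓘(ℝ, E × ℝ) ∞ S.chart p :=
  S.smooth.contMDiffAt (S.chart.open_source.mem_nhds hp)

theorem contMDiffAt_symm (S : P.Slice i) {m : P.M} (hm : m ∈ S.chart.target) :
    ContMDiffAt 𝓘(ℝ, E × ℝ) 𝓘(ℝ, E × ℝ) ∞ S.chart.symm m :=
  S.smooth_symm.contMDiffAt (S.chart.open_target.mem_nhds hm)

theorem contMDiffOn_zero (S : P.Slice i) :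
    ContMDiffOn 𝓘(ℝ, E) 𝓘(ℝ, E × ℝ) ∞ (fun y => S.chart (y, 0)) S.base :=
  S.smooth.comp (contDiff_id.prodMk contDiff_const).contMDiff.contMDiffOn
    fun _ hy => S.zero_mem_source hy

/-- The translate of a slice by a rotation. -/
def smul (z : Circle) (S : P.Slice i) : P.Slice i where
  chart := S.chart.transHomeomorph (Homeomorph.smul z)
  base := S.base
  width := S.width
  width_pos := S.width_pos
  isOpen_base := S.isOpen_base
  base_subset := S.base_subset
  source_eq := S.source_eq
  smooth := (P.contMDiff_smul_const z).comp_contMDiffOn S.smooth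
  smooth_symm := S.smooth_symm.comp (P.contMDiff_smul_const z⁻¹).contMDiffOn fun _ hm => hm
  exp_smul y hy t ht := by
    change z • S.chart (y, t) = Circle.exp t • z • S.chart (y, 0)
    rw [S.exp_smul y hy t ht, smul_comm]
  proj y hy := by
    change P.π (z • S.chart (y, 0)) = _
    rw [π_smul, S.proj y hy]

theorem smul_chart_symm (z : Circle) (S : P.Slice i) (m : P.M) :
    (S.smul z).chart.symm m = S.chart.symm (z⁻¹ • m) := rfl

end Slice

variable (P : SeifertBundle O)

/-- The local diffeomorphism provided by the bundle is shrunk to a product neighbourhood. It passes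
through some point of the orbit over `O.φ i x`, and a rotation moves it to the prescribed point m.
-/
theorem exists_slice {i : O.ι} {x : E} (hx : x ∈ O.U i) {m : P.M} (hm : P.π m = O.φ i x) :
    ∃ S : P.Slice i, x ∈ S.base ∧ S.chart (x, 0) = m := by
  obtain ⟨σ, hσ, Φ, hΦ, heq⟩ := P.slice i x hx
  have hN : {p : E × ℝ | p ∈ Φ.source ∧ p.1 ∈ O.U i ∧ P.π (σ p.1) = O.φ i p.1} ∈ 𝓝 (x, (0 : ℝ)) := by
    have h1 := Φ.open_source.mem_nhds hΦ
    have h2 : ∀ᶠ p : E × ℝ in 𝓝 (x, (0 : ℝ)), p.1 ∈ O.U i :=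
      continuousAt_fst.eventually ((O.isOpen_U i).mem_nhds hx)
    have h3 : ∀ᶠ p : E × ℝ in 𝓝 (x, (0 : ℝ)), P.π (σ p.1) = O.φ i p.1 :=
      (continuousAt_fst (p := (x, (0 : ℝ)))).eventually (p := fun y => P.π (σ y) = O.φ i y) hσ
    filter_upwards [h1, h2, h3] with p a b c using ⟨a, b, c⟩
  rw [nhds_prod_eq, Filter.mem_prod_iff] at hN
  obtain ⟨V', hV', I', hI', hsub⟩ := hN
  obtain ⟨V, hVV', hV, hxV⟩ := mem_nhds_iff.1 hV'
  obtain ⟨ε, hε, hεI⟩ := Metric.mem_nhds_iff.1 hI'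
  rw [Real.ball_eq_Ioo, zero_sub, zero_add] at hεI
  have h0 : (0 : ℝ) ∈ Set.Ioo (-ε) ε := ⟨neg_lt_zero.2 hε, hε⟩
  have hsub' : V ×ˢ Set.Ioo (-ε) ε ⊆ Φ.source := fun p hp => (hsub ⟨hVV' hp.1, hεI hp.2⟩).1
  have hop : IsOpen (V ×ˢ Set.Ioo (-ε) ε) := hV.prod isOpen_Ioo
  have hval : ∀ p ∈ V ×ˢ Set.Ioo (-ε) ε, Φ p = Circle.exp p.2 • σ p.1 :=
    fun p hp => (heq (hsub' hp)).symm
  have hval0 : ∀ y ∈ V, Φ (y, 0) = σ y := fun y hy => by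
    rw [hval (y, 0) ⟨hy, h0⟩, Circle.exp_zero, one_smul]
  let S : P.Slice i :=
    { chart := Φ.toOpenPartialHomeomorph.restrOpen (V ×ˢ Set.Ioo (-ε) ε) hop
      base := V
      width := ε
      width_pos := hε
      isOpen_base := hV
      base_subset := fun y hy => (hsub (a := (y, 0)) ⟨hVV' hy, hεI h0⟩).2.1
      source_eq := Set.inter_eq_right.2 hsub'
      smooth := Φ.contMDiffOn_toFun.mono fun p hp => hp.1
      smooth_symm := Φ.contMDiffOn_invFun.mono fun p hp => hp.1
      exp_smul := fun y hy t ht => by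
        change Φ (y, t) = Circle.exp t • Φ (y, 0)
        rw [hval (y, t) ⟨hy, ht⟩, hval0 y hy]
      proj := fun y hy => by
        change P.π (Φ (y, 0)) = _
        rw [hval0 y hy]
        exact (hsub (a := (y, 0)) ⟨hVV' hy, hεI h0⟩).2.2 }
  have hS : P.π (S.chart (x, 0)) = P.π m := by rw [S.proj x hxV, hm]
  obtain ⟨z, hz⟩ := (P.fiber _ _).1 hS
  exact ⟨S.smul z, hxV, hz⟩

theorem exists_slice_mem (m : P.M) : ∃ (i : O.ι) (S : P.Slice i) (x : E), x ∈ S.base ∧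
    S.chart (x, 0) = m := by
  obtain ⟨i, x, hx, h⟩ := O.cover (P.π m)
  obtain ⟨S, hS⟩ := P.exists_slice hx h.symm
  exact ⟨i, S, x, hS⟩

end SeifertBundle

/-! ### Local homeomorphisms from local inverses -/

/-- Two smooth maps that are inverse to each other near a point define a local homeomorphism. -/
theorem exists_openPartialHomeomorph {A B : E → E} {N₁ N₂ : Set E} (hN₁ : IsOpen N₁)
    (hN₂ : IsOpen N₂) (hA : ContDiffOn ℝ ∞ A N₁) (hB : ContDiffOn ℝ ∞ B N₂)
    (hBA : ∀ y ∈ N₁, A y ∈ N₂ → B (A y) = y) (hAB : ∀ y ∈ N₂, B y ∈ N₁ → A (B y) = y) :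
    ∃ h : OpenPartialHomeomorph E E, h.source = N₁ ∩ A ⁻¹' N₂ ∧ h.target = N₂ ∩ B ⁻¹' N₁ ∧
      (h : E → E) = A ∧ (h.symm : E → E) = B :=
  ⟨{  toFun := A
      invFun := B
      source := N₁ ∩ A ⁻¹' N₂
      target := N₂ ∩ B ⁻¹' N₁
      map_source' := fun y hy => ⟨hy.2, by rw [Set.mem_preimage, hBA y hy.1 hy.2]; exact hy.1⟩
      map_target' := fun y hy => ⟨hy.2, by rw [Set.mem_preimage, hAB y hy.1 hy.2]; exact hy.1⟩
      left_inv' := fun y hy => hBA y hy.1 hy.2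
      right_inv' := fun y hy => hAB y hy.1 hy.2
      open_source := hA.continuousOn.isOpen_inter_preimage hN₁ hN₂
      open_target := hB.continuousOn.isOpen_inter_preimage hN₂ hN₁
      continuousOn_toFun := hA.continuousOn.mono Set.inter_subset_left
      continuousOn_invFun := hB.continuousOn.mono Set.inter_subset_left }, rfl, rfl, rfl, rfl⟩

/-! ### Generic points -/

namespace Orbifold

variable (O)

/-- The points of a chart with trivial isotropy group. -/
def generic (i : O.ι) : Set E := {x ∈ O.U i | ∀ γ, O.act i γ x = x → γ = 1}

/-- The points of a chart with trivial isotropy group are dense. -/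
theorem subset_closure_generic (i : O.ι) {W : Set E} (hW : IsOpen W) (hWU : W ⊆ O.U i) :
    W ⊆ closure (W ∩ O.generic i) := by
  classical
  have := Fintype.ofFinite (O.G i)
  -- The fixed sets of the elements γ ≠ 1 are removed from W one at a time. Each is relatively
  -- closed and has empty interior by effectiveness, so the remainder stays open and dense in W.
  have key : ∀ s : Finset (O.G i), (∀ γ ∈ s, γ ≠ 1) →
      IsOpen (W ∩ {x | ∀ γ ∈ s, O.act i γ x ≠ x}) ∧
        W ⊆ closure (W ∩ {x | ∀ γ ∈ s, O.act i γ x ≠ x}) := by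
    intro s
    induction s using Finset.induction_on with
    | empty => intro _; simpa using ⟨hW, subset_closure⟩
    | insert a s _ ih =>
      intro hs
      obtain ⟨ho, hd⟩ := ih fun γ hγ => hs γ (Finset.mem_insert_of_mem hγ)
      set D := W ∩ {x | ∀ γ ∈ s, O.act i γ x ≠ x}
      have hDW : D ⊆ W := Set.inter_subset_left
      have heq : W ∩ {x | ∀ γ ∈ insert a s, O.act i γ x ≠ x} = D ∩ {x | O.act i a x ≠ x} := by
        ext x
        simp only [Finset.mem_insert, forall_eq_or_imp, D, Set.mem_inter_iff, Set.mem_ofPred_eq]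
        tauto
      rw [heq]
      have hc : ContinuousOn (O.act i a) D :=
        (O.act_contDiffOn i a).continuousOn.mono (hDW.trans hWU)
      have ho' : IsOpen (D ∩ {x | O.act i a x ≠ x}) := by
        have := (hc.prodMk continuousOn_id).isOpen_inter_preimage ho
          (isClosed_diagonal (X := E)).isOpen_compl
        exact this
      refine ⟨ho', fun x hx => ?_⟩
      have hDc : D ⊆ closure (D ∩ {x | O.act i a x ≠ x}) := by
        intro y hy
        by_contra hcl
        have hmem : y ∈ interior {x ∈ O.U i | O.act i a x = x} := by
          refine interior_maximal ?_ (ho.inter isClosed_closure.isOpen_compl) ⟨hy, hcl⟩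
          rintro x ⟨hxD, hxc⟩
          refine ⟨hWU (hDW hxD), ?_⟩
          by_contra hne
          exact hxc (subset_closure ⟨hxD, hne⟩)
        rw [O.effective i a (hs a (Finset.mem_insert_self a s))] at hmem
        exact hmem
      exact closure_minimal hDc isClosed_closure (hd hx)
  have h := (key (Finset.univ.filter (· ≠ 1)) (by simp)).2
  intro x hx
  refine closure_mono ?_ (h hx)
  rintro y ⟨hy, hy'⟩
  refine ⟨hy, hWU hy, fun γ hγ => ?_⟩
  by_contra hne
  exact hy' γ (by simp [hne]) hγ

variable {O}

/-- Near a point with trivial isotropy group a continuous lift of the identity that fixes the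
point is the identity. -/
theorem eventually_eq_of_generic {i : O.ι} {x : E} (hx : x ∈ O.generic i) {k : E → E}
    (hk : ContinuousAt k x) (hkx : k x = x) (hφ : ∀ᶠ y in 𝓝 x, O.φ i (k y) = O.φ i y) :
    ∀ᶠ y in 𝓝 x, k y = y := by
  have hU := (O.isOpen_U i).mem_nhds hx.1
  have h1 : ∀ᶠ y in 𝓝 x, k y ∈ O.U i := hk.eventually (by rw [hkx]; exact hU)
  -- By continuity no γ ≠ 1 can carry y to k y near x, because γ x ≠ x = k x. The group element
  -- relating y and k y must therefore be 1.
  have h2 : ∀ γ : O.G i, ∀ᶠ y in 𝓝 x, γ ≠ 1 → O.act i γ y ≠ k y := by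
    intro γ
    by_cases hγ : γ = 1
    · exact Filter.Eventually.of_forall fun y h => absurd hγ h
    · have hne : O.act i γ x ≠ k x := by
        rw [hkx]; exact fun h => hγ (hx.2 γ h)
      have hc : ContinuousAt (O.act i γ) x := (O.act_contDiffOn i γ).continuousOn.continuousAt hU
      have hop : {p : E × E | p.1 ≠ p.2} ∈ 𝓝 (O.act i γ x, k x) :=
        (isClosed_diagonal (X := E)).isOpen_compl.mem_nhds hne
      filter_upwards [(hc.prodMk hk).eventually hop] with y hy _ using hy
  filter_upwards [h1, hφ, hU, Filter.eventually_all.2 h2] with y a b c d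
  obtain ⟨γ, hγ⟩ := (O.fiber i y c _ a).1 b.symm
  by_cases h : γ = 1
  · rw [← hγ, h, O.act_one i y c]
  · exact absurd hγ (d γ h)

/-- Composing k with h⁻¹ gives a lift of the identity that fixes the generic point x. -/
theorem eventually_eq_of_generic_of_transition {i j : O.ι} {h : OpenPartialHomeomorph E E}
    (H : O.IsTransition i j h) {x : E} (hx : x ∈ O.generic i) (hxs : x ∈ h.source) {k : E → E}
    (hk : ContinuousAt k x) (hkx : k x = h x) (hφ : ∀ᶠ y in 𝓝 x, O.φ j (k y) = O.φ i y) :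
    ∀ᶠ y in 𝓝 x, k y = h y := by
  have ht : ∀ᶠ y in 𝓝 x, k y ∈ h.target :=
    hk.eventually (by rw [hkx]; exact h.open_target.mem_nhds (h.map_source hxs))
  have hc : ContinuousAt (fun y => h.symm (k y)) x :=
    ContinuousAt.comp (g := h.symm) (by rw [hkx]; exact h.continuousAt_symm (h.map_source hxs)) hk
  have := eventually_eq_of_generic hx hc (by rw [hkx, h.left_inv hxs]) (by
    filter_upwards [ht, hφ] with y a b
    rw [H.symm.map _ a, b])
  filter_upwards [this, ht] with y a b
  rw [← h.right_inv b, a]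

end Orbifold

end Slices

/-! ### One-forms on manifolds -/

section OneForms

variable {F : Type*} [NormedAddCommGroup F] [NormedSpace ℝ F] {M : Type*} [TopologicalSpace M]
  [ChartedSpace F M]

/-- The pull-back of a one-form on `M` by a map of a vector space into `M`. -/
def pullbackOne {F' : Type*} [NormedAddCommGroup F'] [NormedSpace ℝ F']
    (θ : ∀ m : M, TangentSpace 𝓘(ℝ, F) m →L[ℝ] ℝ) (σ : F' → M) (y : F') : F' →L[ℝ] ℝ :=
  (θ (σ y)).comp (mfderiv 𝓘(ℝ, F') 𝓘(ℝ, F) σ y)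

theorem pullbackOne_comp {F' F'' : Type*} [NormedAddCommGroup F'] [NormedSpace ℝ F']
    [NormedAddCommGroup F''] [NormedSpace ℝ F''] (θ : ∀ m : M, TangentSpace 𝓘(ℝ, F) m →L[ℝ] ℝ)
    {σ : F' → M} {h : F'' → F'} {y : F''} (hσ : MDifferentiableAt 𝓘(ℝ, F') 𝓘(ℝ, F) σ (h y))
    (hh : DifferentiableAt ℝ h y) :
    pullbackOne θ (fun y => σ (h y)) y = (pullbackOne θ σ (h y)).comp (fderiv ℝ h y) := by
  have := mfderiv_comp y hσ hh.mdifferentiableAt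
  rw [mfderiv_eq_fderiv] at this
  have e : mfderiv 𝓘(ℝ, F'') 𝓘(ℝ, F) (fun y => σ (h y)) y = _ := this
  rw [pullbackOne, e]
  rfl

variable [IsManifold 𝓘(ℝ, F) ∞ M]

/-- Smoothness of a one-form on a manifold at a point. -/
abbrev IsSmoothFormAt (θ : ∀ m : M, TangentSpace 𝓘(ℝ, F) m →L[ℝ] ℝ) (m₀ : M) : Prop :=
  ContMDiffAt 𝓘(ℝ, F) (𝓘(ℝ, F).prod 𝓘(ℝ, F →L[ℝ] ℝ)) ∞
    (fun m => Bundle.TotalSpace.mk' (F →L[ℝ] ℝ)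
      (E := fun m : M => TangentSpace 𝓘(ℝ, F) m →L[ℝ] ℝ) m (θ m)) m₀

/-- The target line bundle of a one-form is trivial, so in the coordinates of the bundle of
homomorphisms only the trivialisation of the tangent bundle remains. -/
theorem isSmoothFormAt_iff (θ : ∀ m : M, TangentSpace 𝓘(ℝ, F) m →L[ℝ] ℝ) (m₀ : M) :
    IsSmoothFormAt θ m₀ ↔ ContMDiffAt 𝓘(ℝ, F) 𝓘(ℝ, F →L[ℝ] ℝ) ∞ (fun m => (θ m).comp
      ((trivializationAt F (TangentSpace 𝓘(ℝ, F)) m₀).symmL ℝ m)) m₀ := by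
  unfold IsSmoothFormAt
  refine (contMDiffAt_hom_bundle (E₂ := fun _ => ℝ) (IB := 𝓘(ℝ, F)) (F₂ := ℝ) _).trans ?_
  refine (and_iff_right contMDiffAt_id).trans ?_
  refine Filter.EventuallyEq.contMDiffAt_iff ?_
  refine Filter.Eventually.of_forall fun m => ?_
  ext w
  simp [ContinuousLinearMap.inCoordinates]

/-- Near a point the pull-back is the coordinate expression of θ along σ composed with the
derivative of σ read in a chart of M; both factors are smooth. -/
theorem contDiffOn_pullbackOne {F' : Type*} [NormedAddCommGroup F'] [NormedSpace ℝ F']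
    {θ : ∀ m : M, TangentSpace 𝓘(ℝ, F) m →L[ℝ] ℝ} {σ : F' → M} {s : Set F'} (hs : IsOpen s)
    (hσ : ContMDiffOn 𝓘(ℝ, F') 𝓘(ℝ, F) ∞ σ s) (h : ∀ y ∈ s, IsSmoothFormAt θ (σ y)) :
    ContDiffOn ℝ ∞ (pullbackOne θ σ) s := by
  intro y₀ hy₀
  refine ContDiffAt.contDiffWithinAt ?_
  have hσ₀ := hσ.contMDiffAt (hs.mem_nhds hy₀)
  have h1 := (isSmoothFormAt_iff θ _).1 (h y₀ hy₀)
  have h2 := (h1.comp y₀ hσ₀).contDiffAt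
  have h3 : ContDiffAt ℝ ∞ (fun y => extChartAt 𝓘(ℝ, F) (σ y₀) (σ y)) y₀ :=
    (contMDiffAt_extChartAt.comp y₀ hσ₀).contDiffAt
  have h4 : ContDiffAt ℝ ∞ (fderiv ℝ fun y => extChartAt 𝓘(ℝ, F) (σ y₀) (σ y)) y₀ :=
    h3.fderiv_right (by simp)
  refine (h2.clm_comp h4).congr_of_eventuallyEq ?_
  have hc : ∀ᶠ y in 𝓝 y₀, σ y ∈ (chartAt F (σ y₀)).source :=
    hσ₀.continuousAt.eventually ((chartAt F (σ y₀)).open_source.mem_nhds (mem_chart_source F _))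
  filter_upwards [hc, hs.mem_nhds hy₀] with y hy hys
  have hdy := (hσ.contMDiffAt (hs.mem_nhds hys)).mdifferentiableAt (by simp)
  have e1 : fderiv ℝ (fun y => extChartAt 𝓘(ℝ, F) (σ y₀) (σ y)) y =
      ((trivializationAt F (TangentSpace 𝓘(ℝ, F)) (σ y₀)).continuousLinearMapAt ℝ (σ y)).comp
        (mfderiv 𝓘(ℝ, F') 𝓘(ℝ, F) σ y) := by
    rw [TangentBundle.continuousLinearMapAt_trivializationAt hy, ← mfderiv_eq_fderiv]
    exact mfderiv_comp y (mdifferentiableAt_extChartAt hy) hdy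
  rw [e1]
  ext w
  have e2 := (trivializationAt F (TangentSpace 𝓘(ℝ, F)) (σ y₀)).symmL_continuousLinearMapAt
    (R := ℝ) (b := σ y) (by simpa using hy) (mfderiv 𝓘(ℝ, F') 𝓘(ℝ, F) σ y w)
  exact congrArg (θ (σ y)) e2.symm

/-- A one-form is smooth if its expression in the charts is smooth. -/
theorem isSmoothFormAt_of_chart {θ : ∀ m : M, TangentSpace 𝓘(ℝ, F) m →L[ℝ] ℝ} {m₀ : M}
    (h : ContDiffAt ℝ ∞ (pullbackOne θ (extChartAt 𝓘(ℝ, F) m₀).symm)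
      (extChartAt 𝓘(ℝ, F) m₀ m₀)) : IsSmoothFormAt θ m₀ := by
  rw [isSmoothFormAt_iff]
  have h1 := ContMDiffAt.comp m₀ h.contMDiffAt (contMDiffAt_extChartAt (I := 𝓘(ℝ, F)) (n := ∞))
  refine h1.congr_of_eventuallyEq ?_
  filter_upwards [(chartAt F m₀).open_source.mem_nhds (mem_chart_source F m₀)] with m hm
  rw [TangentBundle.symmL_trivializationAt hm]
  simp only [Function.comp_apply, pullbackOne]
  have e : (extChartAt 𝓘(ℝ, F) m₀).symm (extChartAt 𝓘(ℝ, F) m₀ m) = m :=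
    (extChartAt 𝓘(ℝ, F) m₀).left_inv (by rwa [extChartAt_source])
  rw [e]
  simp


end OneForms

/-! ### Changes of slices and the changes of charts that they cover. -/

section Transitions

variable {E : Type v} [NormedAddCommGroup E] [NormedSpace ℝ E] {X : Type u} [TopologicalSpace X]
  {O : Orbifold E X} {P : SeifertBundle O} {i j : O.ι}

namespace SeifertBundle.Slice

/-- The change of coordinates between two slices. -/
def change (S : P.Slice i) (S' : P.Slice j) : OpenPartialHomeomorph (E × ℝ) (E × ℝ) :=
  S.chart.trans S'.chart.symm

theorem change_apply (S : P.Slice i) (S' : P.Slice j) (p : E × ℝ) :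
    S.change S' p = S'.chart.symm (S.chart p) := rfl

theorem mem_change_source {S : P.Slice i} {S' : P.Slice j} {p : E × ℝ} :
    p ∈ (S.change S').source ↔ p ∈ S.chart.source ∧ S.chart p ∈ S'.chart.target := by
  simp [change]

theorem change_mem_source {S : P.Slice i} {S' : P.Slice j} {p : E × ℝ}
    (hp : p ∈ (S.change S').source) : S.change S' p ∈ S'.chart.source :=
  S'.chart.map_target (mem_change_source.1 hp).2

theorem chart_change {S : P.Slice i} {S' : P.Slice j} {p : E × ℝ}
    (hp : p ∈ (S.change S').source) : S'.chart (S.change S' p) = S.chart p :=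
  S'.chart.right_inv (mem_change_source.1 hp).2

theorem contDiffOn_change (S : P.Slice i) (S' : P.Slice j) :
    ContDiffOn ℝ ∞ (S.change S') (S.change S').source := by
  rw [← contMDiffOn_iff_contDiffOn]
  exact S'.smooth_symm.comp (S.smooth.mono fun p hp => (mem_change_source.1 hp).1)
    fun p hp => (mem_change_source.1 hp).2

/-- A change of slices commutes with small rotations. -/
theorem change_add {S : P.Slice i} {S' : P.Slice j} {y : E} {t s : ℝ}
    (h : (y, t) ∈ (S.change S').source) (h1 : (y, s + t) ∈ S.chart.source)
    (h2 : ((S.change S' (y, t)).1, s + (S.change S' (y, t)).2) ∈ S'.chart.source) :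
    (y, s + t) ∈ (S.change S').source ∧
      S.change S' (y, s + t) = ((S.change S' (y, t)).1, s + (S.change S' (y, t)).2) := by
  have e : S.chart (y, s + t) =
      S'.chart ((S.change S' (y, t)).1, s + (S.change S' (y, t)).2) := by
    rw [← S.exp_smul_chart (mem_change_source.1 h).1 h1,
      ← S'.exp_smul_chart (y := (S.change S' (y, t)).1) (t := (S.change S' (y, t)).2)
        (change_mem_source h) h2, Prod.mk.eta,
      chart_change h]
  refine ⟨mem_change_source.2 ⟨h1, by rw [e]; exact S'.chart.map_source h2⟩, ?_⟩
  rw [change_apply, e, S'.chart.left_inv h2]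

/-- A change of slices covers a change of charts of the orbifold. -/
theorem exists_transition (S : P.Slice i) (S' : P.Slice j) {p₀ : E × ℝ}
    (hp₀ : p₀ ∈ (S.change S').source) :
    ∃ h, O.IsTransition i j h ∧ p₀.1 ∈ h.source ∧ h p₀.1 = (S.change S' p₀).1 ∧
      ∀ᶠ p in 𝓝 p₀, p ∈ (S.change S').source ∧ (S.change S' p).1 = h p.1 := by
  obtain ⟨y₀, t₀⟩ := p₀
  set T := S.change S' with hT
  set T' := S'.change S with hT'
  have hTT' : ∀ p ∈ T.source, T p ∈ T'.source ∧ T' (T p) = p := by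
    intro p hp
    refine ⟨mem_change_source.2 ⟨change_mem_source hp, ?_⟩, ?_⟩
    · rw [chart_change hp]; exact S.chart.map_source (mem_change_source.1 hp).1
    · rw [hT', change_apply, chart_change hp]; exact S.chart.left_inv (mem_change_source.1 hp).1
  set t₁ := (T (y₀, t₀)).2 with ht₁
  -- The candidate for h is y ↦ (T (y, t₀)).1, with inverse y ↦ (T' (y, t₁)).1. Since T may alter
  -- the angle, the two maps become inverse only after a rotation that brings the angle back to t₁,
  -- respectively t₀; the extra conditions in N₁ and N₂ keep the points inside the slices during
  -- this rotation.
  let N₁ : Set E := (fun y => (y, t₀)) ⁻¹' (T.source ∩ T ⁻¹' {q | (q.1, t₁) ∈ S'.chart.source ∧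
    t₁ - q.2 + t₀ ∈ Set.Ioo (-S.width) S.width})
  let N₂ : Set E := (fun y => (y, t₁)) ⁻¹' (T'.source ∩ T' ⁻¹' {q | (q.1, t₀) ∈ S.chart.source ∧
    t₀ - q.2 + t₁ ∈ Set.Ioo (-S'.width) S'.width})
  have hN₁ : IsOpen N₁ := by
    refine IsOpen.preimage (by fun_prop) (T.continuousOn.isOpen_inter_preimage T.open_source ?_)
    exact (S'.chart.open_source.preimage (by fun_prop)).inter (isOpen_Ioo.preimage (by fun_prop))
  have hN₂ : IsOpen N₂ := by
    refine IsOpen.preimage (by fun_prop) (T'.continuousOn.isOpen_inter_preimage T'.open_source ?_)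
    exact (S.chart.open_source.preimage (by fun_prop)).inter (isOpen_Ioo.preimage (by fun_prop))
  have hA : ContDiffOn ℝ ∞ (fun y => (T (y, t₀)).1) N₁ :=
    contDiff_fst.comp_contDiffOn ((S.contDiffOn_change S').comp
      (contDiff_id.prodMk contDiff_const).contDiffOn fun y hy => hy.1)
  have hB : ContDiffOn ℝ ∞ (fun y => (T' (y, t₁)).1) N₂ :=
    contDiff_fst.comp_contDiffOn ((S'.contDiffOn_change S).comp
      (contDiff_id.prodMk contDiff_const).contDiffOn fun y hy => hy.1)
  have hBA : ∀ y ∈ N₁, (T' ((T (y, t₀)).1, t₁)).1 = y := by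
    intro y hy
    have h1 := hTT' _ hy.1
    have hm : (y, t₁ - (T (y, t₀)).2 + t₀) ∈ S.chart.source :=
      S.mem_source.2 ⟨(S.mem_source.1 (mem_change_source.1 hy.1).1).1, hy.2.2⟩
    have h2 := (change_add (S := S') (S' := S) (y := (T (y, t₀)).1) (t := (T (y, t₀)).2)
      (s := t₁ - (T (y, t₀)).2) h1.1 (by rw [sub_add_cancel]; exact hy.2.1)
      (by rw [Prod.mk.eta, ← hT', h1.2]; exact hm)).2
    rw [sub_add_cancel, Prod.mk.eta, ← hT', h1.2] at h2
    rw [h2]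
  have hT'T : ∀ p ∈ T'.source, T' p ∈ T.source ∧ T (T' p) = p := by
    intro p hp
    refine ⟨mem_change_source.2 ⟨change_mem_source hp, ?_⟩, ?_⟩
    · rw [chart_change hp]; exact S'.chart.map_source (mem_change_source.1 hp).1
    · rw [hT, change_apply, chart_change hp]; exact S'.chart.left_inv (mem_change_source.1 hp).1
  have hAB : ∀ y ∈ N₂, (T ((T' (y, t₁)).1, t₀)).1 = y := by
    intro y hy
    have h1 := hT'T _ hy.1
    have hm : (y, t₀ - (T' (y, t₁)).2 + t₁) ∈ S'.chart.source :=
      S'.mem_source.2 ⟨(S'.mem_source.1 (mem_change_source.1 hy.1).1).1, hy.2.2⟩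
    have h2 := (change_add (S := S) (S' := S') (y := (T' (y, t₁)).1) (t := (T' (y, t₁)).2)
      (s := t₀ - (T' (y, t₁)).2) h1.1 (by rw [sub_add_cancel]; exact hy.2.1)
      (by rw [Prod.mk.eta, ← hT, h1.2]; exact hm)).2
    rw [sub_add_cancel, Prod.mk.eta, ← hT, h1.2] at h2
    rw [h2]
  obtain ⟨h, hs, ht, hf, hf'⟩ := exists_openPartialHomeomorph hN₁ hN₂ hA hB
    (fun y hy _ => hBA y hy) (fun y hy _ => hAB y hy)
  have hy₀ : y₀ ∈ N₁ := by
    refine ⟨hp₀, ?_, ?_⟩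
    · exact change_mem_source hp₀
    · change t₁ - t₁ + t₀ ∈ _
      rw [sub_self, zero_add]
      exact (S.mem_source.1 (mem_change_source.1 hp₀).1).2
  have hy₁ : (T (y₀, t₀)).1 ∈ N₂ := by
    have h1 := hTT' _ hp₀
    refine ⟨h1.1, ?_⟩
    change ((T' (T (y₀, t₀))).1, t₀) ∈ _ ∧ t₀ - (T' (T (y₀, t₀))).2 + t₁ ∈ _
    rw [h1.2, sub_self, zero_add]
    exact ⟨(mem_change_source.1 hp₀).1, (S'.mem_source.1 (change_mem_source hp₀)).2⟩
  have hsU : h.source ⊆ N₁ := by rw [hs]; exact Set.inter_subset_left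
  have htU : h.target ⊆ N₂ := by rw [ht]; exact Set.inter_subset_left
  refine ⟨h, ⟨?_, ?_, ?_, ?_, ?_⟩, ?_, ?_, ?_⟩
  · exact fun y hy => S.base_subset (S.mem_source.1 (mem_change_source.1 (hsU hy).1).1).1
  · exact fun y hy => S'.base_subset (S'.mem_source.1 (mem_change_source.1 (htU hy).1).1).1
  · rw [hf]; exact hA.mono hsU
  · rw [hf']; exact hB.mono htU
  · intro y hy
    have h1 := (hsU hy).1
    rw [hf]
    have h2 := S'.π_chart (change_mem_source h1)
    rw [chart_change h1, S.π_chart (mem_change_source.1 h1).1] at h2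
    exact h2.symm
  · rw [hs]; exact ⟨hy₀, hy₁⟩
  · rw [hf]
  · rw [hf]
    -- By equivariance the base component of T (y, t) does not change with t near t₀, so h describes
    -- it on a full neighbourhood of (y₀, t₀).
    have hc : ContinuousAt (fun p : E × ℝ => T (p.1, t₀)) (y₀, t₀) :=
      ContinuousAt.comp (g := T) (f := fun p : E × ℝ => (p.1, t₀)) (T.continuousAt hp₀)
        (by fun_prop)
    have e1 : ∀ᶠ p : E × ℝ in 𝓝 (y₀, t₀), (p.1, t₀) ∈ T.source :=
      (show ContinuousAt (fun p : E × ℝ => (p.1, t₀)) (y₀, t₀) by fun_prop).eventually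
        (T.open_source.mem_nhds hp₀)
    have e2 : ∀ᶠ p : E × ℝ in 𝓝 (y₀, t₀), p ∈ S.chart.source :=
      S.chart.open_source.mem_nhds (mem_change_source.1 hp₀).1
    have e3 : ∀ᶠ p : E × ℝ in 𝓝 (y₀, t₀),
        ((T (p.1, t₀)).1, p.2 - t₀ + (T (p.1, t₀)).2) ∈ S'.chart.source := by
      refine (show ContinuousAt (fun p : E × ℝ => ((T (p.1, t₀)).1,
        p.2 - t₀ + (T (p.1, t₀)).2)) (y₀, t₀) from
          (continuousAt_fst.comp hc).prodMk ((continuousAt_snd.sub continuousAt_const).add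
            (continuousAt_snd.comp hc))).eventually
        (S'.chart.open_source.mem_nhds ?_)
      simp only [sub_self, zero_add]
      exact change_mem_source hp₀
    filter_upwards [e1, e2, e3] with p h1 h2 h3
    have := change_add (s := p.2 - t₀) h1 (by rw [sub_add_cancel]; exact h2) h3
    rw [sub_add_cancel] at this
    exact ⟨this.1, by rw [hT, this.2]⟩

end SeifertBundle.Slice

end Transitions

/-! ### Existence of connections -/

section Connections

variable {E : Type} [NormedAddCommGroup E] [NormedSpace ℝ E] {X : Type u} [TopologicalSpace X]
  {O : Orbifold E X} (P : SeifertBundle O)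

namespace SeifertBundle

theorem contMDiff_exp_curve (m : P.M) :
    ContMDiff 𝓘(ℝ, ℝ) 𝓘(ℝ, E × ℝ) ∞ (fun t : ℝ => Circle.exp t • m) :=
  P.contMDiff_exp_smul.comp (contMDiff_id.prodMk contMDiff_const)

theorem mdifferentiableAt_smul (z : Circle) (m : P.M) :
    MDifferentiableAt 𝓘(ℝ, E × ℝ) 𝓘(ℝ, E × ℝ) (fun m : P.M => z • m) m :=
  (P.contMDiff_smul_const z).mdifferentiableAt (by simp)

theorem mdifferentiableAt_exp_curve (m : P.M) (t : ℝ) :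
    MDifferentiableAt 𝓘(ℝ, ℝ) 𝓘(ℝ, E × ℝ) (fun t : ℝ => Circle.exp t • m) t :=
  (P.contMDiff_exp_curve m).mdifferentiableAt (by simp)

/-- The generator is invariant. -/
theorem mfderiv_smul_generator (z : Circle) (m : P.M) :
    mfderiv 𝓘(ℝ, E × ℝ) 𝓘(ℝ, E × ℝ) (fun m' : P.M => z • m') m (P.generator m) =
      P.generator (z • m) := by
  -- The curve passes through `Circle.exp 0 • m`, which equals m only propositionally, while tangent
  -- spaces depend on the point. The derivative is therefore stated at every m' equal to m.
  have hg : ∀ m' : P.M, m' = m → HasMFDerivAt 𝓘(ℝ, E × ℝ) 𝓘(ℝ, E × ℝ) (fun m : P.M => z • m) m'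
      (mfderiv 𝓘(ℝ, E × ℝ) 𝓘(ℝ, E × ℝ) (fun m' : P.M => z • m') m :
        (E × ℝ) →L[ℝ] (E × ℝ)) := by
    rintro _ rfl
    exact (P.mdifferentiableAt_smul z _).hasMFDerivAt
  have h1 := (hg (Circle.exp 0 • m) (by simp)).comp (0 : ℝ)
    (P.mdifferentiableAt_exp_curve m 0).hasMFDerivAt
  have h2 : (fun m' : P.M => z • m') ∘ (fun t : ℝ => Circle.exp t • m) =
      fun t : ℝ => Circle.exp t • z • m := by
    funext t; exact smul_comm _ _ _
  rw [h2] at h1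
  exact (congrArg (fun A : ℝ →L[ℝ] E × ℝ => A 1) h1.mfderiv).symm

/-- The flow property: up to a shift of time the curve is the orbit curve that starts at `Circle.exp
t • m`. -/
theorem mfderiv_exp_curve (m : P.M) (t : ℝ) :
    mfderiv 𝓘(ℝ, ℝ) 𝓘(ℝ, E × ℝ) (fun t : ℝ => Circle.exp t • m) t (1 : ℝ) =
      P.generator (Circle.exp t • m) := by
  have hg : ∀ s : ℝ, s = 0 → HasMFDerivAt 𝓘(ℝ, ℝ) 𝓘(ℝ, E × ℝ)
      (fun s : ℝ => Circle.exp s • Circle.exp t • m) s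
      (mfderiv 𝓘(ℝ, ℝ) 𝓘(ℝ, E × ℝ) (fun s : ℝ => Circle.exp s • Circle.exp t • m) 0 :
        ℝ →L[ℝ] (E × ℝ)) := by
    rintro _ rfl
    exact (P.mdifferentiableAt_exp_curve _ _).hasMFDerivAt
  have hf : HasMFDerivAt 𝓘(ℝ, ℝ) 𝓘(ℝ, ℝ) (fun s : ℝ => s - t) t (ContinuousLinearMap.id ℝ ℝ) :=
    ((hasFDerivAt_id t).sub_const t).hasMFDerivAt
  have h1 := HasMFDerivAt.comp (f := fun s : ℝ => s - t) t (hg (t - t) (sub_self t)) hf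
  have h2 : (fun s : ℝ => Circle.exp s • Circle.exp t • m) ∘ (fun s : ℝ => s - t) =
      fun s : ℝ => Circle.exp s • m := by
    funext s
    simp only [Function.comp_apply]
    rw [← mul_smul, ← Circle.exp_add, sub_add_cancel]
  rw [h2] at h1
  exact congrArg (fun A : ℝ →L[ℝ] E × ℝ => A 1) h1.mfderiv

variable {P}

theorem pullbackOne_exp_curve {θ : ∀ m : P.M, TangentSpace 𝓘(ℝ, E × ℝ) m →L[ℝ] ℝ}
    (hθ : ∀ m, θ m (P.generator m) = 1) (m : P.M) (t s : ℝ) :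
    pullbackOne θ (fun t : ℝ => Circle.exp t • m) t s = s := by
  have h := P.mfderiv_exp_curve m t
  have h1 : pullbackOne θ (fun t : ℝ => Circle.exp t • m) t 1 = 1 := by
    have := hθ (Circle.exp t • m)
    rw [← h] at this
    exact this
  have h2 := (pullbackOne θ (fun t : ℝ => Circle.exp t • m) t).map_smul s 1
  rw [h1] at h2
  simpa using h2

theorem pullbackOne_smul {F' : Type*} [NormedAddCommGroup F'] [NormedSpace ℝ F']
    {θ : ∀ m : P.M, TangentSpace 𝓘(ℝ, E × ℝ) m →L[ℝ] ℝ} {z : Circle}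
    (hθ : ∀ (m : P.M) (w : TangentSpace 𝓘(ℝ, E × ℝ) m),
      θ (z • m) (mfderiv 𝓘(ℝ, E × ℝ) 𝓘(ℝ, E × ℝ) (fun m' : P.M => z • m') m w) = θ m w)
    {σ : F' → P.M} {y : F'} (hσ : MDifferentiableAt 𝓘(ℝ, F') 𝓘(ℝ, E × ℝ) σ y) :
    pullbackOne θ (fun y => z • σ y) y = pullbackOne θ σ y := by
  have h1 : mfderiv 𝓘(ℝ, F') 𝓘(ℝ, E × ℝ) (fun y => z • σ y) y = _ :=
    mfderiv_comp y (P.mdifferentiableAt_smul z (σ y)) hσ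
  ext w
  rw [pullbackOne, h1]
  exact hθ (σ y) (mfderiv 𝓘(ℝ, F') 𝓘(ℝ, E × ℝ) σ y w)

/-- Gauge transformations change the pull-back of a connection by an exact form. -/
theorem pullbackOne_exp_smul {F' : Type*} [NormedAddCommGroup F'] [NormedSpace ℝ F']
    (θ : P.Connection) {σ : F' → P.M} {τ : F' → ℝ} {y : F'}
    (hσ : ContMDiffAt 𝓘(ℝ, F') 𝓘(ℝ, E × ℝ) ∞ σ y) (hτ : DifferentiableAt ℝ τ y) :
    pullbackOne θ.form (fun y => Circle.exp (τ y) • σ y) y =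
      pullbackOne θ.form σ y + fderiv ℝ τ y := by
  let G : ℝ × F' → P.M := fun p => Circle.exp p.1 • σ p.2
  have hG : MDifferentiableAt 𝓘(ℝ, ℝ × F') 𝓘(ℝ, E × ℝ) G (τ y, y) := by
    have h1 : ContMDiffAt 𝓘(ℝ, ℝ × F') (𝓘(ℝ, ℝ).prod 𝓘(ℝ, E × ℝ)) ∞
        (fun p : ℝ × F' => (p.1, σ p.2)) (τ y, y) :=
      contDiff_fst.contMDiff.contMDiffAt.prodMk
        (ContMDiffAt.comp (τ y, y) (g := σ) hσ contDiff_snd.contMDiff.contMDiffAt)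
    exact (P.contMDiff_exp_smul.contMDiffAt.comp _ h1).mdifferentiableAt (by simp)
  have hσ' := hσ.mdifferentiableAt (by simp)
  -- The map factors through G on ℝ × F', and its derivative on w is (dτ(w), 0) + (0, w). The first
  -- vector runs along the orbit and contributes dτ(w) by normalisation on the generator; the second
  -- contributes the pull-back by σ because θ is invariant.
  have e1 := pullbackOne_comp θ.form (σ := G) (h := fun y => (τ y, y)) hG
    (hτ.prodMk differentiableAt_id)
  have e2 := pullbackOne_comp θ.form (σ := G) (h := fun s : ℝ => (s, y)) (y := τ y) hG
    (differentiableAt_id.prodMk (differentiableAt_const y))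
  have e3 := pullbackOne_comp θ.form (σ := G) (h := fun y' => (τ y, y')) (y := y) hG
    ((differentiableAt_const _).prodMk differentiableAt_id)
  have e4 : pullbackOne θ.form (fun y' => G (τ y, y')) y = pullbackOne θ.form σ y :=
    pullbackOne_smul (θ.invariant _) hσ'
  have d1 : HasFDerivAt (fun y => (τ y, y)) ((fderiv ℝ τ y).prod (ContinuousLinearMap.id ℝ F')) y :=
    hτ.hasFDerivAt.prodMk (hasFDerivAt_id y)
  have d2 : HasFDerivAt (fun s : ℝ => (s, y))
      ((ContinuousLinearMap.id ℝ ℝ).prod (0 : ℝ →L[ℝ] F')) (τ y) :=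
    (hasFDerivAt_id _).prodMk (hasFDerivAt_const y _)
  have d3 : HasFDerivAt (fun y' => (τ y, y'))
      ((0 : F' →L[ℝ] ℝ).prod (ContinuousLinearMap.id ℝ F')) y :=
    (hasFDerivAt_const _ _).prodMk (hasFDerivAt_id y)
  rw [d1.fderiv] at e1
  rw [d2.fderiv] at e2
  rw [d3.fderiv] at e3
  ext w
  have f1 := congrArg (fun A => A w) e1
  have f2 := congrArg (fun A => A (fderiv ℝ τ y w)) e2
  have f3 := congrArg (fun A => A w) e3
  have f4 := pullbackOne_exp_curve θ.generator (σ y) (τ y) (fderiv ℝ τ y w)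
  simp only [ContinuousLinearMap.comp_apply, ContinuousLinearMap.prod_apply,
    ContinuousLinearMap.id_apply] at f1 f2 f3
  rw [e4] at f3
  have f5 : pullbackOne θ.form G (τ y, y) (fderiv ℝ τ y w, w) =
      pullbackOne θ.form G (τ y, y) (fderiv ℝ τ y w, 0) + pullbackOne θ.form G (τ y, y) (0, w) := by
    rw [← map_add]; simp
  refine f1.trans ?_
  rw [f5, add_apply, add_comm]
  exact congrArg₂ (· + ·) f3.symm (f2.symm.trans f4)

variable (P)

/-- There is a smooth one-form with value `1` on the generator. -/
theorem exists_form [FiniteDimensional ℝ E] :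
    ∃ θ : ∀ m : P.M, TangentSpace 𝓘(ℝ, E × ℝ) m →L[ℝ] ℝ,
      (∀ m, IsSmoothFormAt θ m) ∧ ∀ m, θ m (P.generator m) = 1 := by
  have : LocallyCompactSpace P.M := ChartedSpace.locallyCompactSpace (E × ℝ) P.M
  have : SigmaCompactSpace P.M := inferInstance
  suffices h : ∃ s : Cₛ^∞⟮𝓘(ℝ, E × ℝ); (E × ℝ) →L[ℝ] ℝ,
      fun m : P.M => TangentSpace 𝓘(ℝ, E × ℝ) m →L[ℝ] ℝ⟯, ∀ m, s m ∈ {η | η (P.generator m) = 1} by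
    obtain ⟨s, hs⟩ := h
    exact ⟨s, fun m => s.contMDiff m, hs⟩
  -- Value 1 on the generator is an affine, hence convex, condition, so a partition of unity glues
  -- local solutions. A local solution is dt in the coordinates (y, t) of a slice, because rotations
  -- shift t.
  refine exists_contMDiffSection_forall_mem_convex_of_local (n := ⊤) 𝓘(ℝ, E × ℝ)
    (F_fiber := (E × ℝ) →L[ℝ] ℝ)
    (V := fun m : P.M => TangentSpace 𝓘(ℝ, E × ℝ) m →L[ℝ] ℝ)
    (fun m => {η | η (P.generator m) = 1}) (fun m => ?_) (fun m => ?_)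
  · intro η hη ζ hζ a b _ _ hab
    change a * η (P.generator m) + b * ζ (P.generator m) = 1
    rw [show η (P.generator m) = 1 from hη, show ζ (P.generator m) = 1 from hζ, mul_one, mul_one,
      hab]
  · obtain ⟨i, S, x, hx, hm⟩ := P.exists_slice_mem m
    have hmt : m ∈ S.chart.target := hm ▸ S.chart.map_source (S.zero_mem_source hx)
    let η : ∀ m : P.M, TangentSpace 𝓘(ℝ, E × ℝ) m →L[ℝ] ℝ := fun m =>
      (ContinuousLinearMap.snd ℝ E ℝ).comp (mfderiv 𝓘(ℝ, E × ℝ) 𝓘(ℝ, E × ℝ) S.chart.symm m :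
        (E × ℝ) →L[ℝ] (E × ℝ))
    have hd : ∀ m ∈ S.chart.target,
        MDifferentiableAt 𝓘(ℝ, E × ℝ) 𝓘(ℝ, E × ℝ) S.chart.symm m := fun m hm =>
      (S.contMDiffAt_symm hm).mdifferentiableAt (by simp)
    refine ⟨S.chart.target, S.chart.open_target.mem_nhds hmt, η, fun m hm => ?_, fun m hm => ?_⟩
    · refine ContMDiffAt.contMDiffWithinAt (isSmoothFormAt_of_chart ?_)
      set χ := extChartAt 𝓘(ℝ, E × ℝ) m with hχ
      have hχs : ∀ᶠ p in 𝓝 (χ m), p ∈ χ.target := extChartAt_target_mem_nhds (I := 𝓘(ℝ, E × ℝ)) m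
      have hχc : ContMDiffOn 𝓘(ℝ, E × ℝ) 𝓘(ℝ, E × ℝ) ∞ χ.symm χ.target :=
        contMDiffOn_extChartAt_symm m
      have hχm : χ.symm (χ m) = m := extChartAt_to_inv (I := 𝓘(ℝ, E × ℝ)) m
      have hop : IsOpen χ.target := isOpen_extChartAt_target (I := 𝓘(ℝ, E × ℝ)) m
      have hmχ : χ m ∈ χ.target := mem_extChartAt_target (I := 𝓘(ℝ, E × ℝ)) m
      have h1 : ContMDiffAt 𝓘(ℝ, E × ℝ) 𝓘(ℝ, E × ℝ) ∞ (fun p => S.chart.symm (χ.symm p)) (χ m) :=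
        ContMDiffAt.comp (g := S.chart.symm) (χ m)
          (by rw [hχm]; exact S.contMDiffAt_symm hm) (hχc.contMDiffAt (hop.mem_nhds hmχ))
      have h2 : ContDiffAt ℝ ∞ (fun p => (S.chart.symm (χ.symm p)).2) (χ m) :=
        contDiffAt_snd.comp _ h1.contDiffAt
      refine (h2.fderiv_right (m := ∞) (by simp)).congr_of_eventuallyEq ?_
      have h3 : ∀ᶠ p in 𝓝 (χ m), χ.symm p ∈ S.chart.target :=
        (hχc.contMDiffAt (hop.mem_nhds hmχ)).continuousAt.eventually
          (by rw [hχm]; exact S.chart.open_target.mem_nhds hm)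
      filter_upwards [hχs, h3] with p hp hpt
      have h4 : HasMFDerivAt 𝓘(ℝ, E × ℝ) 𝓘(ℝ, E × ℝ) (fun p => S.chart.symm (χ.symm p)) p
          ((mfderiv 𝓘(ℝ, E × ℝ) 𝓘(ℝ, E × ℝ) S.chart.symm (χ.symm p)).comp
            (mfderiv 𝓘(ℝ, E × ℝ) 𝓘(ℝ, E × ℝ) χ.symm p)) :=
        (hd _ hpt).hasMFDerivAt.comp p
          ((hχc.contMDiffAt (hop.mem_nhds hp)).mdifferentiableAt (by simp)).hasMFDerivAt
      have h5 := ((ContinuousLinearMap.snd ℝ E ℝ).hasFDerivAt.comp p h4.hasFDerivAt).fderiv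
      exact h5.symm
    · have hp := S.chart.map_target hm
      set p := S.chart.symm m with hpdef
      have hmp : S.chart p = m := S.chart.right_inv hm
      have h0 : ∀ m' : P.M, m' = m → HasMFDerivAt 𝓘(ℝ, E × ℝ) 𝓘(ℝ, E × ℝ) S.chart.symm m'
          (mfderiv 𝓘(ℝ, E × ℝ) 𝓘(ℝ, E × ℝ) S.chart.symm m : (E × ℝ) →L[ℝ] (E × ℝ)) := by
        rintro _ rfl
        exact (hd _ hm).hasMFDerivAt
      have h1 := HasMFDerivAt.comp (f := fun t : ℝ => Circle.exp t • m) (0 : ℝ)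
        (h0 (Circle.exp 0 • m) (by simp)) (P.mdifferentiableAt_exp_curve m 0).hasMFDerivAt
      have h2 : (S.chart.symm ∘ fun t : ℝ => Circle.exp t • m) =ᶠ[𝓝 0] fun t => (p.1, t + p.2) := by
        have hc : ∀ᶠ t : ℝ in 𝓝 0, (p.1, t + p.2) ∈ S.chart.source :=
          (show ContinuousAt (fun t : ℝ => (p.1, t + p.2)) 0 by fun_prop).eventually
            (S.chart.open_source.mem_nhds (by simpa using hp))
        filter_upwards [hc] with t ht
        simp only [Function.comp_apply]
        have e : Circle.exp t • m = S.chart (p.1, t + p.2) := by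
          rw [← hmp]; exact S.exp_smul_chart (y := p.1) (t := p.2) hp ht
        rw [e, S.chart.left_inv ht]
      have h4 : HasFDerivAt (fun t : ℝ => t + p.2) (ContinuousLinearMap.id ℝ ℝ) 0 :=
        (hasFDerivAt_id (0 : ℝ)).add_const p.2
      have h4 : HasFDerivAt (fun t : ℝ => (p.1, t + p.2))
          ((0 : ℝ →L[ℝ] E).prod (ContinuousLinearMap.id ℝ ℝ)) 0 :=
        (hasFDerivAt_const p.1 (0 : ℝ)).prodMk h4
      have h5 := hasMFDerivAt_unique h1 (h4.congr_of_eventuallyEq h2).hasMFDerivAt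
      have h6 := congrArg (fun A : ℝ →L[ℝ] E × ℝ => (A 1).2) h5
      exact h6

variable {P}

/-- The pull-back of a one-form by a self-map of the total space. -/
def mapPullback (θ : ∀ m : P.M, TangentSpace 𝓘(ℝ, E × ℝ) m →L[ℝ] ℝ) (m : P.M) (f : P.M → P.M) :
    (E × ℝ) →L[ℝ] ℝ :=
  (θ (f m)).comp (mfderiv 𝓘(ℝ, E × ℝ) 𝓘(ℝ, E × ℝ) f m)

/-- The pull-back of a one-form by a rotation. -/
def rotatePullback (θ : ∀ m : P.M, TangentSpace 𝓘(ℝ, E × ℝ) m →L[ℝ] ℝ) (m : P.M) (t : ℝ) :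
    (E × ℝ) →L[ℝ] ℝ :=
  mapPullback θ m fun m' => Circle.exp t • m'

/-- The average of a one-form over the circle. -/
def average (θ : ∀ m : P.M, TangentSpace 𝓘(ℝ, E × ℝ) m →L[ℝ] ℝ) (m : P.M) :
    TangentSpace 𝓘(ℝ, E × ℝ) m →L[ℝ] ℝ :=
  ((2 * Real.pi)⁻¹ • ∫ t in (0 : ℝ)..2 * Real.pi, rotatePullback θ m t : (E × ℝ) →L[ℝ] ℝ)

variable {θ : ∀ m : P.M, TangentSpace 𝓘(ℝ, E × ℝ) m →L[ℝ] ℝ}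

theorem rotatePullback_comp {F' : Type*} [NormedAddCommGroup F'] [NormedSpace ℝ F'] {σ : F' → P.M}
    {y : F'} (hσ : MDifferentiableAt 𝓘(ℝ, F') 𝓘(ℝ, E × ℝ) σ y) (t : ℝ) :
    (rotatePullback θ (σ y) t).comp (mfderiv 𝓘(ℝ, F') 𝓘(ℝ, E × ℝ) σ y : F' →L[ℝ] (E × ℝ)) =
      pullbackOne θ (fun y => Circle.exp t • σ y) y := by
  have h1 : mfderiv 𝓘(ℝ, F') 𝓘(ℝ, E × ℝ) (fun y => Circle.exp t • σ y) y = _ :=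
    mfderiv_comp y (P.mdifferentiableAt_smul (Circle.exp t) (σ y)) hσ
  rw [pullbackOne, h1]
  rfl

/-- Realises the family of rotated pull-backs inside a single one-form on F' × ℝ, which gives
smoothness jointly in the point and the angle. -/
theorem pullbackOne_rotate_slice {F' : Type*} [NormedAddCommGroup F'] [NormedSpace ℝ F']
    {σ : F' → P.M} {y : F'} (hσ : ContMDiffAt 𝓘(ℝ, F') 𝓘(ℝ, E × ℝ) ∞ σ y) (t : ℝ) :
    pullbackOne θ (fun y => Circle.exp t • σ y) y =
      (pullbackOne θ (fun p : F' × ℝ => Circle.exp p.2 • σ p.1) (y, t)).comp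
        (ContinuousLinearMap.inl ℝ F' ℝ) := by
  have h1 : ContMDiffAt 𝓘(ℝ, F' × ℝ) (𝓘(ℝ, ℝ).prod 𝓘(ℝ, E × ℝ)) ∞
      (fun p : F' × ℝ => (p.2, σ p.1)) (y, t) :=
    contDiff_snd.contMDiff.contMDiffAt.prodMk
      (ContMDiffAt.comp (y, t) (g := σ) hσ contDiff_fst.contMDiff.contMDiffAt)
  have hG : MDifferentiableAt 𝓘(ℝ, F' × ℝ) 𝓘(ℝ, E × ℝ)
      (fun p : F' × ℝ => Circle.exp p.2 • σ p.1) (y, t) :=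
    (P.contMDiff_exp_smul.contMDiffAt.comp _ h1).mdifferentiableAt (by simp)
  have e := pullbackOne_comp θ (h := fun y' : F' => (y', t)) (y := y) hG
    (differentiableAt_id.prodMk (differentiableAt_const t))
  rw [(hasFDerivAt_prodMk_left y t).fderiv] at e
  exact e

theorem contDiffOn_rotate (hθ : ∀ m, IsSmoothFormAt θ m) {F' : Type*} [NormedAddCommGroup F']
    [NormedSpace ℝ F'] {σ : F' → P.M} {s : Set F'} (hs : IsOpen s)
    (hσ : ContMDiffOn 𝓘(ℝ, F') 𝓘(ℝ, E × ℝ) ∞ σ s) :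
    ContDiffOn ℝ ∞ (fun p : F' × ℝ => (pullbackOne θ (fun p : F' × ℝ => Circle.exp p.2 • σ p.1)
      p).comp (ContinuousLinearMap.inl ℝ F' ℝ)) (s ×ˢ Set.univ) := by
  have h1 : ContMDiffOn 𝓘(ℝ, F' × ℝ) (𝓘(ℝ, ℝ).prod 𝓘(ℝ, E × ℝ)) ∞
      (fun p : F' × ℝ => (p.2, σ p.1)) (s ×ˢ Set.univ) :=
    contDiff_snd.contMDiff.contMDiffOn.prodMk
      (ContMDiffOn.comp (g := σ) (t := s) hσ contDiff_fst.contMDiff.contMDiffOn fun p hp => hp.1)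
  have h2 : ContMDiffOn 𝓘(ℝ, F' × ℝ) 𝓘(ℝ, E × ℝ) ∞
      (fun p : F' × ℝ => Circle.exp p.2 • σ p.1) (s ×ˢ Set.univ) :=
    P.contMDiff_exp_smul.comp_contMDiffOn h1
  exact (contDiffOn_pullbackOne (hs.prod isOpen_univ) h2 fun y _ => hθ _).clm_comp contDiffOn_const

/-- The inverse of the preferred chart at m has derivative the identity at the image of m, so
`rotatePullback θ m` is a restriction of the jointly smooth family of `contDiffOn_rotate`. -/
theorem continuous_rotatePullback (hθ : ∀ m, IsSmoothFormAt θ m) (m : P.M) :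
    Continuous (rotatePullback θ m) := by
  set χ := extChartAt 𝓘(ℝ, E × ℝ) m with hχ
  have hop : IsOpen χ.target := isOpen_extChartAt_target (I := 𝓘(ℝ, E × ℝ)) m
  have hmχ : χ m ∈ χ.target := mem_extChartAt_target (I := 𝓘(ℝ, E × ℝ)) m
  have hχc : ContMDiffOn 𝓘(ℝ, E × ℝ) 𝓘(ℝ, E × ℝ) ∞ χ.symm χ.target :=
    contMDiffOn_extChartAt_symm m
  have hχm : χ.symm (χ m) = m := extChartAt_to_inv (I := 𝓘(ℝ, E × ℝ)) m
  have hid : (mfderiv 𝓘(ℝ, E × ℝ) 𝓘(ℝ, E × ℝ) χ.symm (χ m) : (E × ℝ) →L[ℝ] (E × ℝ)) =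
      ContinuousLinearMap.id ℝ (E × ℝ) := by
    have := mfderivWithin_range_extChartAt_symm (I := 𝓘(ℝ, E × ℝ)) (x := m)
    rw [ModelWithCorners.Boundaryless.range_eq_univ, mfderivWithin_univ] at this
    exact this
  have h1 := (contDiffOn_rotate hθ hop hχc).continuousOn
  have h2 : Continuous fun t : ℝ => (pullbackOne θ (fun p : (E × ℝ) × ℝ =>
      Circle.exp p.2 • χ.symm p.1) (χ m, t)).comp (ContinuousLinearMap.inl ℝ (E × ℝ) ℝ) :=
    continuousOn_univ.1 (h1.comp (f := fun t : ℝ => (χ m, t)) (by fun_prop)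
      fun t _ => ⟨hmχ, trivial⟩)
  refine h2.congr fun t => ?_
  have hc := hχc.contMDiffAt (hop.mem_nhds hmχ)
  rw [← pullbackOne_rotate_slice hc, ← rotatePullback_comp (hc.mdifferentiableAt (by simp)), hid,
    hχm]
  rfl

theorem average_apply (hθ : ∀ m, IsSmoothFormAt θ m) (m : P.M) (w : E × ℝ) :
    average θ m w = (2 * Real.pi)⁻¹ * ∫ t in (0 : ℝ)..2 * Real.pi, rotatePullback θ m t w := by
  have h := ((ContinuousLinearMap.apply ℝ ℝ w).intervalIntegral_comp_comm
    ((continuous_rotatePullback hθ m).intervalIntegrable (μ := MeasureTheory.volume) 0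
      (2 * Real.pi)))
  change (2 * Real.pi)⁻¹ * (ContinuousLinearMap.apply ℝ ℝ w)
    (∫ t in (0 : ℝ)..2 * Real.pi, rotatePullback θ m t) = _
  rw [← h]
  rfl

theorem isSmoothFormAt_average [FiniteDimensional ℝ E] (hθ : ∀ m, IsSmoothFormAt θ m) (m : P.M) :
    IsSmoothFormAt (average θ) m := by
  refine isSmoothFormAt_of_chart ?_
  set χ := extChartAt 𝓘(ℝ, E × ℝ) m with hχ
  have hop : IsOpen χ.target := isOpen_extChartAt_target (I := 𝓘(ℝ, E × ℝ)) m
  have hmχ : χ m ∈ χ.target := mem_extChartAt_target (I := 𝓘(ℝ, E × ℝ)) m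
  have hχc : ContMDiffOn 𝓘(ℝ, E × ℝ) 𝓘(ℝ, E × ℝ) ∞ χ.symm χ.target :=
    contMDiffOn_extChartAt_symm m
  have h1 := contDiffOn_parametric_integral hop (contDiffOn_rotate hθ hop hχc) 0 (2 * Real.pi)
  have h2 := (h1.const_smul (2 * Real.pi)⁻¹).contDiffAt (hop.mem_nhds hmχ)
  refine h2.congr_of_eventuallyEq ?_
  filter_upwards [hop.mem_nhds hmχ] with p hp
  have hc := hχc.contMDiffAt (hop.mem_nhds hp)
  -- Composition with the derivative of the chart is linear in the form and moves under the
  -- integral; the integrand becomes the family whose parametric integral is already known to be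
  -- smooth.
  have h3 := (((ContinuousLinearMap.compL ℝ (E × ℝ) (E × ℝ) ℝ).flip
    (mfderiv 𝓘(ℝ, E × ℝ) 𝓘(ℝ, E × ℝ) χ.symm p : (E × ℝ) →L[ℝ] (E × ℝ)))).intervalIntegral_comp_comm
    ((continuous_rotatePullback hθ (χ.symm p)).intervalIntegrable (μ := MeasureTheory.volume) 0
      (2 * Real.pi))
  have h4 : ∀ t : ℝ, ((ContinuousLinearMap.compL ℝ (E × ℝ) (E × ℝ) ℝ).flip
    (mfderiv 𝓘(ℝ, E × ℝ) 𝓘(ℝ, E × ℝ) χ.symm p : (E × ℝ) →L[ℝ] (E × ℝ)))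
      (rotatePullback θ (χ.symm p) t) = (pullbackOne θ (fun p : (E × ℝ) × ℝ =>
      Circle.exp p.2 • χ.symm p.1) (p, t)).comp (ContinuousLinearMap.inl ℝ (E × ℝ) ℝ) := by
    intro t
    rw [← pullbackOne_rotate_slice hc, ← rotatePullback_comp (hc.mdifferentiableAt (by simp))]
    rfl
  simp only [h4] at h3
  rw [h3]
  rfl

theorem average_generator (hθ : ∀ m, IsSmoothFormAt θ m) (hg : ∀ m, θ m (P.generator m) = 1)
    (m : P.M) : average θ m (P.generator m) = 1 := by
  refine (average_apply hθ m (P.generator m)).trans ?_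
  have h : ∀ t : ℝ, rotatePullback θ m t (P.generator m) = 1 := by
    intro t
    have := hg (Circle.exp t • m)
    rw [← P.mfderiv_smul_generator] at this
    exact this
  simp only [h]
  rw [intervalIntegral.integral_const, sub_zero, smul_eq_mul, mul_one,
    inv_mul_cancel₀ (by positivity)]

/-- Rotating by s and then by t is rotating by t + s. Translating m thus shifts the integration
variable of the average. -/
theorem rotatePullback_add (m : P.M) (s t : ℝ) (w : E × ℝ) :
    rotatePullback θ (Circle.exp s • m) t
      (mfderiv 𝓘(ℝ, E × ℝ) 𝓘(ℝ, E × ℝ) (fun m' : P.M => Circle.exp s • m') m w) =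
      rotatePullback θ m (t + s) w := by
  have h1 : mfderiv 𝓘(ℝ, E × ℝ) 𝓘(ℝ, E × ℝ) (fun m' : P.M => Circle.exp t • Circle.exp s • m') m =
    _ := mfderiv_comp m (P.mdifferentiableAt_smul (Circle.exp t) _)
      (P.mdifferentiableAt_smul (Circle.exp s) m)
  have h2 : rotatePullback θ m (t + s) =
      mapPullback θ m fun m' : P.M => Circle.exp t • Circle.exp s • m' := by
    refine congrArg (mapPullback θ m) ?_
    funext m'
    rw [← mul_smul, ← Circle.exp_add]
  rw [h2, mapPullback, h1]
  rfl

theorem average_invariant (hθ : ∀ m, IsSmoothFormAt θ m) (z : Circle) (m : P.M)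
    (w : TangentSpace 𝓘(ℝ, E × ℝ) m) :
    average θ (z • m) (mfderiv 𝓘(ℝ, E × ℝ) 𝓘(ℝ, E × ℝ) (fun m' : P.M => z • m') m w) =
      average θ m w := by
  obtain ⟨s, rfl⟩ : ∃ s : ℝ, Circle.exp s = z := ⟨_, Circle.exp_arg z⟩
  refine (average_apply hθ _ _).trans ((congrArg _ ?_).trans (average_apply hθ _ _).symm)
  -- The integrand has period 2π, so the integral over the shifted interval [s, s + 2π] equals the
  -- one over [0, 2π].
  have hp : Function.Periodic (fun t => rotatePullback θ m t w) (2 * Real.pi) := by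
    intro t
    refine congrArg (fun f => mapPullback θ m f w) ?_
    funext m'
    rw [show Circle.exp (t + 2 * Real.pi) = Circle.exp t from Circle.periodic_exp t]
  have h1 : (∫ t in (0 : ℝ)..2 * Real.pi, rotatePullback θ (Circle.exp s • m) t
      (mfderiv 𝓘(ℝ, E × ℝ) 𝓘(ℝ, E × ℝ) (fun m' : P.M => Circle.exp s • m') m w)) =
      ∫ t in (0 : ℝ)..2 * Real.pi, rotatePullback θ m (t + s) w :=
    intervalIntegral.integral_congr fun t _ => rotatePullback_add m s t w
  refine h1.trans ?_
  rw [intervalIntegral.integral_comp_add_right (fun t => rotatePullback θ m t w), zero_add,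
    add_comm, hp.intervalIntegral_add_eq s 0, zero_add]

variable (P) in
/-- Connections exist. -/
theorem nonempty_connection [FiniteDimensional ℝ E] : Nonempty P.Connection := by
  obtain ⟨θ, hθ, hg⟩ := P.exists_form
  exact ⟨{  form := average θ
            smooth := isSmoothFormAt_average hθ
            generator := average_generator hθ hg
            invariant := average_invariant hθ }⟩

end SeifertBundle

end Connections

/-! ### The curvature of a connection -/

section ExtDeriv

variable {E : Type v} [NormedAddCommGroup E] [NormedSpace ℝ E]

theorem fderiv_oneForm {η : E → E →L[ℝ] ℝ} {x : E} (hη : DifferentiableAt ℝ η x) (w : E) :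
    fderiv ℝ (fun y => oneForm (η y)) x w = oneForm (fderiv ℝ η x w) := by
  have h1 : HasFDerivAt (fun y => oneForm (η y)) (oneFormL.comp (fderiv ℝ η x)) x :=
    oneFormL.hasFDerivAt.comp x hη.hasFDerivAt
  rw [h1.fderiv]
  rfl

theorem extDeriv_oneForm_apply {η : E → E →L[ℝ] ℝ} {x : E} (hη : DifferentiableAt ℝ η x)
    (v : Fin 2 → E) : extDeriv (fun y => oneForm (η y)) x v =
      fderiv ℝ η x (v 0) (v 1) - fderiv ℝ η x (v 1) (v 0) := by
  rw [extDeriv, ContinuousAlternatingMap.alternatizeUncurryFin_apply, Fin.sum_univ_two]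
  rw [fderiv_oneForm hη, fderiv_oneForm hη, oneForm_apply, oneForm_apply, sub_eq_add_neg]
  simp [Fin.removeNth]

/-- d(dτ) = 0 by symmetry of second derivatives. This is gauge invariance of the curvature in local
form. -/
theorem extDeriv_oneForm_add_fderiv {η : E → E →L[ℝ] ℝ} {τ : E → ℝ} {x : E}
    (hη : DifferentiableAt ℝ η x) (hτ : ContDiffAt ℝ ∞ τ x) :
    extDeriv (fun y => oneForm (η y + fderiv ℝ τ y)) x = extDeriv (fun y => oneForm (η y)) x := by
  have hd : DifferentiableAt ℝ (fderiv ℝ τ) x :=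
    (hτ.fderiv_right (m := ∞) (by simp)).differentiableAt (by simp)
  ext v
  rw [extDeriv_oneForm_apply (η := fun y => η y + fderiv ℝ τ y) (hη.add hd),
    extDeriv_oneForm_apply hη, fderiv_fun_add hη hd]
  have hs : IsSymmSndFDerivAt ℝ τ x :=
    hτ.isSymmSndFDerivAt (by simp [minSmoothness_of_isRCLikeNormedField]; exact two_le_infty)
  simp only [add_apply]
  rw [hs (v 0) (v 1)]
  ring

theorem contDiffOn_extDeriv {k : ℕ} {α : E → E [⋀^Fin k]→L[ℝ] ℝ} {s : Set E} (hs : IsOpen s)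
    (hα : ContDiffOn ℝ ∞ α s) : ContDiffOn ℝ ∞ (extDeriv α) s := by
  have h := (ContinuousAlternatingMap.alternatizeUncurryFinCLM ℝ E ℝ (n := k)).contDiff.comp_contDiffOn
    (hα.fderiv_of_isOpen hs (m := ∞) (by simp))
  exact h

end ExtDeriv

section Curvature

variable {E : Type} [NormedAddCommGroup E] [NormedSpace ℝ E] {X : Type u} [TopologicalSpace X]
  {O : Orbifold E X} {P : SeifertBundle O} (θ : P.Connection)

namespace SeifertBundle.Connection

theorem pullback_eq (σ : E → P.M) : θ.pullback σ = fun y => oneForm (pullbackOne θ.form σ y) := rfl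

/-- A smooth lift of a chart of the orbifold to the total space. -/
structure IsLift (P : SeifertBundle O) (i : O.ι) (σ : E → P.M) (V : Set E) : Prop where
  isOpen : IsOpen V
  subset : V ⊆ O.U i
  smooth : ContMDiffOn 𝓘(ℝ, E) 𝓘(ℝ, E × ℝ) ∞ σ V
  proj : ∀ y ∈ V, P.π (σ y) = O.φ i y

theorem _root_.SeifertBundle.Slice.isLift {i : O.ι} (S : P.Slice i) :
    IsLift P i (fun y => S.chart (y, 0)) S.base :=
  ⟨S.isOpen_base, S.base_subset, S.contMDiffOn_zero, S.proj⟩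

theorem contDiffOn_lift {i : O.ι} {σ : E → P.M} {V : Set E} (hσ : IsLift P i σ V) :
    ContDiffOn ℝ ∞ (pullbackOne θ.form σ) V :=
  contDiffOn_pullbackOne hσ.isOpen hσ.smooth fun y _ => θ.smooth (σ y)

theorem contDiffOn_pullback {i : O.ι} {σ : E → P.M} {V : Set E} (hσ : IsLift P i σ V) :
    ContDiffOn ℝ ∞ (θ.pullback σ) V := by
  have h := (oneFormL (E := E)).contDiff.comp_contDiffOn (θ.contDiffOn_lift hσ)
  exact h

/-- Read in the slice S, the lift σ has a base component that covers the identity and fixes the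
generic point, hence is the identity nearby. So σ(y) = exp(iτ(y)) S(y, 0) with a smooth τ, the
pulled-back connection changes by dτ, and its exterior derivative does not change. -/
theorem extDeriv_lift_eq_slice {i : O.ι} {σ : E → P.M} {V : Set E} (hσ : IsLift P i σ V) {y₀ : E}
    (hy₀ : y₀ ∈ V) (hg : y₀ ∈ O.generic i) (S : P.Slice i) (hS : y₀ ∈ S.base)
    (hm : S.chart (y₀, 0) = σ y₀) :
    extDeriv (θ.pullback σ) y₀ = extDeriv (θ.pullback fun y => S.chart (y, 0)) y₀ := by
  have hV := hσ.isOpen.mem_nhds hy₀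
  have hc := hσ.smooth.contMDiffAt hV
  have hmt : σ y₀ ∈ S.chart.target := hm ▸ S.chart.map_source (S.zero_mem_source hS)
  have hk : ContDiffAt ℝ ∞ (fun y => S.chart.symm (σ y)) y₀ :=
    (ContMDiffAt.comp (g := S.chart.symm) y₀ (S.contMDiffAt_symm hmt) hc).contDiffAt
  have hk0 : S.chart.symm (σ y₀) = (y₀, 0) := by rw [← hm, S.chart.left_inv (S.zero_mem_source hS)]
  have ht : ∀ᶠ y in 𝓝 y₀, σ y ∈ S.chart.target :=
    hc.continuousAt.eventually (S.chart.open_target.mem_nhds hmt)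
  have hid : ∀ᶠ y in 𝓝 y₀, (S.chart.symm (σ y)).1 = y := by
    refine Orbifold.eventually_eq_of_generic hg (continuousAt_fst.comp hk.continuousAt) (by
      simp [hk0]) ?_
    filter_upwards [ht, hV] with y h1 h2
    have := S.π_chart (S.chart.map_target h1)
    rw [S.chart.right_inv h1, hσ.proj y h2] at this
    exact this.symm
  have hτ : ContDiffAt ℝ ∞ (fun y => (S.chart.symm (σ y)).2) y₀ := contDiffAt_snd.comp y₀ hk
  have hσeq : ∀ᶠ y in 𝓝 y₀, σ y = Circle.exp (S.chart.symm (σ y)).2 • S.chart (y, 0) := by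
    filter_upwards [ht, hid] with y h1 h2
    have h3 := S.chart.map_target h1
    have h4 := S.mem_source.1 h3
    have h5 : S.chart (S.chart.symm (σ y)) = Circle.exp (S.chart.symm (σ y)).2 •
        S.chart ((S.chart.symm (σ y)).1, 0) := S.exp_smul _ h4.1 _ h4.2
    rw [ S.chart.right_inv h1, h2] at h5
    exact h5
  have hd : ∀ᶠ y in 𝓝 y₀, DifferentiableAt ℝ (fun y => (S.chart.symm (σ y)).2) y := by
    filter_upwards [(hτ.of_le (show (1 : WithTop ℕ∞) ≤ ∞ by simp)).eventually (by simp)] with y hy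
    exact hy.differentiableAt (by simp)
  have heq : θ.pullback σ =ᶠ[𝓝 y₀] fun y => oneForm (pullbackOne θ.form (fun y => S.chart (y, 0)) y +
      fderiv ℝ (fun y => (S.chart.symm (σ y)).2) y) := by
    filter_upwards [hσeq.eventually_nhds, hd, S.isOpen_base.mem_nhds hS] with y h1 h2 h3
    have e1 := pullbackOne_exp_smul θ (S.contMDiffOn_zero.contMDiffAt (S.isOpen_base.mem_nhds h3)) h2
    rw [pullback_eq, ← e1]
    have h1' : σ =ᶠ[𝓝 y] fun y => Circle.exp (S.chart.symm (σ y)).2 • S.chart (y, 0) := h1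
    have e2 : ∀ τ : E → P.M, σ =ᶠ[𝓝 y] τ → pullbackOne θ.form σ y = pullbackOne θ.form τ y := by
      intro τ hτ
      rw [pullbackOne, pullbackOne, hτ.mfderiv_eq]
      have : ∀ m m' : P.M, m = m' → ∀ A : E →L[ℝ] (E × ℝ),
          (θ.form m : (E × ℝ) →L[ℝ] ℝ).comp A = (θ.form m' : (E × ℝ) →L[ℝ] ℝ).comp A := by
        rintro m _ rfl A; rfl
      exact this _ _ hτ.eq_of_nhds _
    exact congrArg oneForm (e2 _ h1')
  rw [heq.extDeriv_eq]
  exact extDeriv_oneForm_add_fderiv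
    (((θ.contDiffOn_lift S.isLift).contDiffAt (S.isOpen_base.mem_nhds hS)).differentiableAt
      (by simp)) hτ

/-- The curvature does not depend on the lift. -/
theorem extDeriv_lift_eq {i : O.ι} {σ τ : E → P.M} {V : Set E} (hσ : IsLift P i σ V)
    (hτ : IsLift P i τ V) {y₀ : E} (hy₀ : y₀ ∈ V) :
    extDeriv (θ.pullback σ) y₀ = extDeriv (θ.pullback τ) y₀ := by
  -- At a generic point the slice is taken through σ y, and τ is first rotated to pass through the
  -- same point, which leaves its pulled-back connection unchanged.
  have key : ∀ y ∈ V ∩ O.generic i, extDeriv (θ.pullback σ) y = extDeriv (θ.pullback τ) y := by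
    rintro y ⟨hy, hg⟩
    obtain ⟨S, hS, hm⟩ := P.exists_slice (hσ.subset hy) (hσ.proj y hy)
    obtain ⟨z, hz⟩ := (P.fiber (τ y) (σ y)).1 (by rw [hσ.proj y hy, hτ.proj y hy])
    have hτz : IsLift P i (fun y => z • τ y) V :=
      ⟨hτ.isOpen, hτ.subset, (P.contMDiff_smul_const z).comp_contMDiffOn hτ.smooth, fun y hy => by
        rw [P.π_smul, hτ.proj y hy]⟩
    have e1 := θ.extDeriv_lift_eq_slice hσ hy hg S hS hm
    have e2 := θ.extDeriv_lift_eq_slice hτz hy hg S hS (hm.trans hz.symm)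
    have e3 : θ.pullback (fun y => z • τ y) =ᶠ[𝓝 y] θ.pullback τ := by
      filter_upwards [hτ.isOpen.mem_nhds hy] with y' hy'
      rw [pullback_eq, pullback_eq]
      simp only
      rw [pullbackOne_smul (θ.invariant z)
        ((hτ.smooth.contMDiffAt (hτ.isOpen.mem_nhds hy')).mdifferentiableAt (by simp))]
    rw [e1, ← e2, e3.extDeriv_eq]
  have hc : ∀ {ρ : E → P.M}, IsLift P i ρ V → ContinuousOn (extDeriv (θ.pullback ρ)) V :=
    fun hρ => (contDiffOn_extDeriv hρ.isOpen (θ.contDiffOn_pullback hρ)).continuousOn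
  -- At a singular point the two lifts need not differ by a smooth gauge function obtained as above;
  -- density of generic points and continuity of both curvatures settle the equality there.
  have hcl := O.subset_closure_generic i hσ.isOpen hσ.subset hy₀
  have hmem := mem_closure_iff_nhdsWithin_neBot.1 hcl
  have hle : 𝓝[V ∩ O.generic i] y₀ ≤ 𝓝[V] y₀ := nhdsWithin_mono _ Set.inter_subset_left
  have l1 := (hc hσ y₀ hy₀).tendsto.mono_left hle
  have l2 := (hc hτ y₀ hy₀).tendsto.mono_left hle
  refine tendsto_nhds_unique l1 (l2.congr' ?_)
  filter_upwards [self_mem_nhdsWithin] with y hy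
  exact (key y hy).symm

theorem _root_.SeifertBundle.exists_slice' (P : SeifertBundle O) {i : O.ι} {x : E} (hx : x ∈ O.U i) :
    ∃ S : P.Slice i, x ∈ S.base := by
  obtain ⟨m, hm⟩ := P.surjective (O.φ i x)
  obtain ⟨S, hS, _⟩ := P.exists_slice hx hm
  exact ⟨S, hS⟩

open Classical in
/-- The curvature of a connection, as a two-form on the orbifold. -/
def curvature : O.LocalForms 2 := fun i x =>
  if hx : x ∈ O.U i then
    extDeriv (θ.pullback fun y => (P.exists_slice' hx).choose.chart (y, 0)) x
  else 0

theorem curvature_eq {i : O.ι} {σ : E → P.M} {V : Set E} (hσ : IsLift P i σ V) {x : E} (hx : x ∈ V) :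
    θ.curvature i x = extDeriv (θ.pullback σ) x := by
  rw [curvature, dif_pos (hσ.subset hx)]
  set S := (P.exists_slice' (hσ.subset hx)).choose
  have hS : x ∈ S.base := (P.exists_slice' (hσ.subset hx)).choose_spec
  have hop := hσ.isOpen.inter S.isOpen_base
  have h1 : IsLift P i (fun y => S.chart (y, 0)) (V ∩ S.base) :=
    ⟨hop, fun y hy => hσ.subset hy.1, S.isLift.smooth.mono fun y hy => hy.2,
      fun y hy => S.proj y hy.2⟩
  have h2 : IsLift P i σ (V ∩ S.base) :=
    ⟨hop, fun y hy => hσ.subset hy.1, hσ.smooth.mono fun y hy => hy.1, fun y hy => hσ.proj y hy.1⟩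
  exact θ.extDeriv_lift_eq h1 h2 ⟨hx, hS⟩

/-- Precomposing a slice over the chart j with a change of charts h gives a lift over the chart i.
Independence of the lift together with naturality of d under h then yields the invariance of the
curvature. -/
theorem isCurvature_curvature : θ.IsCurvature θ.curvature := by
  refine ⟨⟨fun i x hx => ?_, fun i j h H x hx => ?_⟩, ?_⟩
  · obtain ⟨S, hS⟩ := P.exists_slice' hx
    refine ContDiffAt.contDiffWithinAt ?_
    refine ((contDiffOn_extDeriv S.isOpen_base (θ.contDiffOn_pullback S.isLift)).contDiffAt
      (S.isOpen_base.mem_nhds hS)).congr_of_eventuallyEq ?_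
    filter_upwards [S.isOpen_base.mem_nhds hS] with y hy
    exact θ.curvature_eq S.isLift hy
  · obtain ⟨S, hS⟩ := P.exists_slice' (H.target_subset (h.map_source hx))
    have hop : IsOpen (h.source ∩ h ⁻¹' S.base) :=
      h.continuousOn.isOpen_inter_preimage h.open_source S.isOpen_base
    have hl : IsLift P i (fun y => S.chart (h y, 0)) (h.source ∩ h ⁻¹' S.base) := by
      refine ⟨hop, fun y hy => H.source_subset hy.1, ?_, fun y hy => ?_⟩
      · exact S.contMDiffOn_zero.comp (H.contDiffOn.contMDiffOn.mono fun y hy => hy.1)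
          fun y hy => hy.2
      · rw [S.proj _ hy.2, H.map y hy.1]
    rw [θ.curvature_eq hl ⟨hx, hS⟩, θ.curvature_eq S.isLift hS]
    have hdiff : DifferentiableAt ℝ (θ.pullback fun y => S.chart (y, 0)) (h x) :=
      ((θ.contDiffOn_pullback S.isLift).contDiffAt (S.isOpen_base.mem_nhds hS)).differentiableAt
        (by simp)
    have e1 := extDeriv_pullback (r := ∞) hdiff
      (H.contDiffOn.contDiffAt (h.open_source.mem_nhds hx))
      (by simp [minSmoothness_of_isRCLikeNormedField]; exact two_le_infty)
    rw [← e1]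
    refine Filter.EventuallyEq.extDeriv_eq ?_
    filter_upwards [hop.mem_nhds ⟨hx, hS⟩] with y hy
    rw [pullback_eq, pullback_eq]
    simp only
    rw [oneForm_comp, ← pullbackOne_comp θ.form (σ := fun y => S.chart (y, 0)) (h := h)
      ((S.contMDiffOn_zero.contMDiffAt (S.isOpen_base.mem_nhds hy.2)).mdifferentiableAt (by simp))
      (H.differentiableAt hy.1)]
  · intro i V hV hop σ hσ hp y hy
    exact θ.curvature_eq ⟨hop, hV, hσ, hp⟩ hy

/-- The product of the curvature with a closed three-form is closed. -/
theorem wedge_curvature_mem_closedForms [FiniteDimensional ℝ E] {φ : O.LocalForms 3}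
    (hφ : φ ∈ O.closedForms 3) :
    (fun i x => wedge (θ.curvature i x) (φ i x) : O.LocalForms 5) ∈ O.closedForms 5 := by
  have hF := θ.isCurvature_curvature.1
  refine ⟨⟨fun i => contDiffOn_wedge (hF.1 i) (hφ.1.1 i), fun i j h H x hx => ?_⟩,
    fun i x hx => ?_⟩
  · have := wedge_comp (θ.curvature j (h x)) (φ j (h x)) (fderiv ℝ h x)
    rw [hF.2 i j h H x hx, hφ.1.2 i j h H x hx] at this
    exact this
  · obtain ⟨S, hS⟩ := P.exists_slice' hx
    set η := pullbackOne θ.form (fun y => S.chart (y, 0)) with hη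
    have hηc : ContDiffOn ℝ ∞ η S.base := θ.contDiffOn_lift S.isLift
    have hβ : ContDiffOn ℝ ∞ (fun y => oneWedge (η y) (φ i y)) S.base := by
      have h := (oneWedgeL (E := E) (q := 3)).isBoundedBilinearMap.contDiff.comp_contDiffOn
        (hηc.prodMk ((hφ.1.1 i).mono S.base_subset)) (n := ∞)
      exact h
    -- Near x one has F = dη for the local connection form η, so the Leibniz rule and dφ = 0 give F
    -- ∧ φ = d(η ∧ φ).
    have heq : (fun y => wedge (θ.curvature i y) (φ i y)) =ᶠ[𝓝 x]
        extDeriv fun y => oneWedge (η y) (φ i y) := by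
      filter_upwards [S.isOpen_base.mem_nhds hS] with y hy
      have h1 := extDeriv_oneWedge
        ((hηc.contDiffAt (S.isOpen_base.mem_nhds hy)).differentiableAt (by simp))
        (Orbifold.forms_differentiableAt hφ.1 (S.base_subset hy))
      rw [hφ.2 i y (S.base_subset hy), oneWedge_zero, sub_zero] at h1
      rw [h1, θ.curvature_eq S.isLift hy]
      rfl
    have h2 : extDeriv (extDeriv fun y => oneWedge (η y) (φ i y)) x = 0 :=
      extDeriv_extDeriv_apply (r := ∞) (hβ.contDiffAt (S.isOpen_base.mem_nhds hS))
        (by simp [minSmoothness_of_isRCLikeNormedField]; exact two_le_infty)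
    exact (Filter.EventuallyEq.extDeriv_eq heq).trans h2

end SeifertBundle.Connection

/-- The Chern class of a Seifert bundle over the bundle of anti-self-dual forms has vanishing product
with closed three-forms. -/
theorem SeifertBundle.chernCupVanishes {X : Type u} [TopologicalSpace X] {Q : Orbifold E4 X}
    {g : Q.RiemannianMetric} (e : Orbifold.OrthonormalFrame g) (hQ : Q.IsOriented)
    (P : SeifertBundle (e.asdOrbifold hQ)) {φ : (e.asdOrbifold hQ).LocalForms 3}
    (hφ : φ ∈ (e.asdOrbifold hQ).closedForms 3) : P.ChernCupVanishes φ := by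
  obtain ⟨θ⟩ := P.nonempty_connection
  exact ⟨θ, θ.curvature, θ.isCurvature_curvature,
    e.closed_five_form_exact hQ (θ.wedge_curvature_mem_closedForms hφ)⟩

end Curvature

/-! ### Stabilisers over generic points -/

section Stabilisers

variable {E : Type} [NormedAddCommGroup E] [NormedSpace ℝ E] {X : Type u} [TopologicalSpace X]
  {O : Orbifold E X}

namespace SeifertBundle

/-- An element of a discrete stabiliser has finite order. -/
theorem exists_pow_eq_one {P : SeifertBundle O} {m : P.M} {ε : ℝ} (hε : 0 < ε)
    (h : ∀ t : ℝ, 0 < t → t < ε → Circle.exp t • m ≠ m) {z : Circle} (hz : z • m = m) :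
    ∃ n : ℕ, 0 < n ∧ z ^ n = 1 := by
  let H : AddSubgroup ℝ :=
    { carrier := {t | Circle.exp t • m = m}
      zero_mem' := by simp
      add_mem' := by
        intro s t hs ht
        change Circle.exp (s + t) • m = m
        rw [Circle.exp_add, mul_smul, show Circle.exp t • m = m from ht]
        exact hs
      neg_mem' := by
        intro t ht
        change Circle.exp (-t) • m = m
        rw [Circle.exp_neg, inv_smul_eq_iff]
        exact (show Circle.exp t • m = m from ht).symm }
  have hmem : ∀ t, t ∈ H ↔ Circle.exp t • m = m := fun t => Iff.rfl
  -- H is the preimage of the stabiliser in ℝ. It avoids (0, ε), so it is not dense but generated by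
  -- one element; it contains 2π ≠ 0 and an angle of z, so a nonzero multiple of that angle is a
  -- multiple of 2π.
  rcases AddSubgroup.dense_or_cyclic H with hd | ⟨a, ha⟩
  · obtain ⟨t, ht, htH⟩ := hd.exists_mem_open isOpen_Ioo (Set.nonempty_Ioo.2 hε)
    exact absurd ((hmem t).1 ht) (h t htH.1 htH.2)
  · have h1 : 2 * Real.pi ∈ H := by
      rw [hmem, Circle.exp_two_pi, one_smul]
    have h2 : Complex.arg z ∈ H := by rw [hmem, Circle.exp_arg, hz]
    rw [ha, AddSubgroup.mem_closure_singleton] at h1 h2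
    obtain ⟨k, hk⟩ := h1
    obtain ⟨l, hl⟩ := h2
    have hk0 : k ≠ 0 := by
      rintro rfl
      rw [zero_smul] at hk
      exact absurd hk.symm (by positivity)
    have h3 : z ^ k = 1 := by
      rw [← Circle.exp_arg z, ← Circle.exp_zsmul, ← hl, smul_comm, hk, Circle.exp_zsmul,
        Circle.exp_two_pi, one_zpow]
    refine ⟨k.natAbs, Int.natAbs_pos.2 hk0, ?_⟩
    rw [← zpow_natCast]
    rcases Int.natAbs_eq k with h4 | h4
    · rw [← h4, h3]
    · have h5 : ((k.natAbs : ℕ) : ℤ) = -k := by omega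
      rw [h5, zpow_neg, h3, inv_one]

/-- The stabilisers over generic points are trivial. -/
theorem eq_one_of_smul_eq {P : SeifertBundle O} {i : O.ι} (S : P.Slice i) {p₀ : E}
    (hp₀ : p₀ ∈ S.base) (hg : p₀ ∈ O.generic i) {z : Circle}
    (hz : z • S.chart (p₀, 0) = S.chart (p₀, 0)) : z = 1 := by
  have hs₀ := S.zero_mem_source hp₀
  have hinj : ∀ p ∈ S.base, ∀ t : ℝ, |t| < S.width → Circle.exp t • S.chart (p, 0) = S.chart (p, 0) →
      t = 0 := by
    intro p hp t ht h
    rw [abs_lt] at ht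
    rw [← S.exp_smul p hp t ht] at h
    have := S.chart.injOn (S.mem_source.2 ⟨hp, ht⟩) (S.zero_mem_source hp) h
    exact congrArg Prod.snd this
  obtain ⟨n, hn, hzn⟩ := exists_pow_eq_one S.width_pos
    (fun t h1 h2 h3 => h1.ne' (hinj p₀ hp₀ t (by rw [abs_of_pos h1]; exact h2) h3)) hz
  -- `z` acts near the point through small rotations
  have hcσ : ContinuousAt (fun p => z • S.chart (p, 0)) p₀ :=
    (ContinuousAt.comp (g := S.chart) (f := fun p => (p, (0 : ℝ))) (S.chart.continuousAt hs₀)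
      (by fun_prop)).const_smul z
  have hk : ContinuousAt (fun p => S.chart.symm (z • S.chart (p, 0))) p₀ :=
    ContinuousAt.comp (g := S.chart.symm)
      (by rw [hz]; exact S.chart.continuousAt_symm (S.chart.map_source hs₀)) hcσ
  have hk0 : S.chart.symm (z • S.chart (p₀, 0)) = (p₀, 0) := by rw [hz, S.chart.left_inv hs₀]
  have ht : ∀ᶠ p in 𝓝 p₀, z • S.chart (p, 0) ∈ S.chart.target :=
    hcσ.eventually (S.chart.open_target.mem_nhds (by
      simp only [hz]; exact S.chart.map_source hs₀))
  have hb : ∀ᶠ p in 𝓝 p₀, p ∈ S.base := S.isOpen_base.mem_nhds hp₀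
  have hid : ∀ᶠ p in 𝓝 p₀, (S.chart.symm (z • S.chart (p, 0))).1 = p := by
    refine Orbifold.eventually_eq_of_generic hg (continuousAt_fst.comp hk) (by simp [hk0]) ?_
    filter_upwards [ht, hb] with p h1 h2
    have := S.π_chart (S.chart.map_target h1)
    rw [S.chart.right_inv h1, P.π_smul, S.proj p h2] at this
    exact this.symm
  have hsmall : ∀ᶠ p in 𝓝 p₀, |n * (S.chart.symm (z • S.chart (p, 0))).2| < S.width := by
    have hc : ContinuousAt (fun p => |n * (S.chart.symm (z • S.chart (p, 0))).2|) p₀ :=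
      (continuousAt_const.mul (continuousAt_snd.comp hk)).abs
    refine hc.eventually (gt_mem_nhds ?_)
    simp only [hk0]
    simpa using S.width_pos
  -- As p₀ is generic, z acts on nearby slice points as a small rotation exp(is). From zⁿ = 1 the
  -- rotation by n s fixes the point, and n s lies below the width of the slice, where rotations act
  -- freely; hence s = 0.
  have hfix : ∀ᶠ p in 𝓝 p₀, p ∈ S.base ∧ z • S.chart (p, 0) = S.chart (p, 0) := by
    filter_upwards [ht, hb, hid, hsmall] with p h1 h2 h3 h4
    refine ⟨h2, ?_⟩
    set s := (S.chart.symm (z • S.chart (p, 0))).2 with hs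
    have h5 : z • S.chart (p, 0) = Circle.exp s • S.chart (p, 0) := by
      have h6 := S.mem_source.1 (S.chart.map_target h1)
      have h7 : S.chart (S.chart.symm (z • S.chart (p, 0))) = Circle.exp s •
        S.chart ((S.chart.symm (z • S.chart (p, 0))).1, 0) := S.exp_smul _ h6.1 _ h6.2
      rwa [S.chart.right_inv h1, h3] at h7
    have h6 : ∀ k : ℕ, z ^ k • S.chart (p, 0) = Circle.exp (k * s) • S.chart (p, 0) := by
      intro k
      induction k with
      | zero => simp
      | succ k ih =>
        rw [pow_succ', mul_smul, ih, smul_comm, h5, ← mul_smul, ← Circle.exp_add]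
        congr 2
        push_cast
        ring
    have h7 := h6 n
    rw [hzn, one_smul] at h7
    have h8 := hinj p h2 _ h4 h7.symm
    have h9 : s = 0 := by
      rcases mul_eq_zero.1 h8 with h | h
      · exact absurd h (Nat.cast_ne_zero.2 hn.ne')
      · exact h
    rw [h5, h9, Circle.exp_zero, one_smul]
  by_contra hne
  obtain ⟨N, hNsub, hN, hpN⟩ := mem_nhds_iff.1 hfix
  -- z commutes with rotations, so it fixes the open set swept out by the nearby slice points, and
  -- effectiveness excludes z ≠ 1.
  have hop : IsOpen (S.chart '' (S.chart.source ∩ N ×ˢ Set.univ)) :=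
    S.chart.isOpen_image_source_inter (hN.prod isOpen_univ)
  have hmem : S.chart (p₀, 0) ∈ interior {m : P.M | z • m = m} := by
    refine interior_maximal ?_ hop ⟨(p₀, 0), ⟨hs₀, hpN, trivial⟩, rfl⟩
    rintro _ ⟨⟨p, t⟩, ⟨hp1, hp2⟩, rfl⟩
    have h1 := S.mem_source.1 hp1
    change z • S.chart (p, t) = S.chart (p, t)
    rw [S.exp_smul p h1.1 t h1.2, smul_comm, (hNsub hp2.1).2]
  rw [P.effective z hne] at hmem
  exact hmem

end SeifertBundle

end Stabilisers

/-! ### The restriction of a Seifert bundle to the zero section -/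

section ZeroSection

variable {X : Type u} [TopologicalSpace X] {Q : Orbifold E4 X} {g : Q.RiemannianMetric}

namespace Orbifold.OrthonormalFrame

variable (e : Orbifold.OrthonormalFrame g)

/-- The projection of the bundle of anti-self-dual forms to the base. -/
def asdProj : e.AsdSpace → X :=
  Quotient.lift (s := ChartPoint.setoid e) (fun p => Q.φ p.1 p.2.1.1) (by
    rintro p q ⟨h, H, hs, hm, _⟩
    rw [← hm, H.map _ hs])

theorem asdProj_asdChart {i : Q.ι} {p : E4 × E3} (hp : p.1 ∈ Q.U i) :
    e.asdProj (e.asdChart i p) = Q.φ i p.1 := by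
  rw [e.asdChart_of_mem hp]; rfl

/-- The zero section of the bundle of anti-self-dual forms. -/
def zeroSection : Set e.AsdSpace := {q | ∃ i, ∃ x ∈ Q.U i, e.asdChart i (x, 0) = q}

theorem asd_zero (i : Q.ι) (x : E4) : e.asd i x 0 = 0 := by
  simp [asd, asdForm]

/-- Changes of charts carry zero vectors to zero vectors, so the zero section has the same gluing as
Q. -/
theorem asdChart_zero_eq_iff {i j : Q.ι} {x y : E4} (hx : x ∈ Q.U i) (hy : y ∈ Q.U j) :
    e.asdChart i (x, 0) = e.asdChart j (y, 0) ↔ Q.φ i x = Q.φ j y := by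
  constructor
  · intro h
    have := congrArg e.asdProj h
    rwa [e.asdProj_asdChart (p := (x, 0)) hx, e.asdProj_asdChart (p := (y, 0)) hy] at this
  · intro h
    obtain ⟨k, K, hk, hky⟩ := Q.compat i j x hx y hy h
    rw [e.asdChart_of_mem (p := (x, 0)) hx, e.asdChart_of_mem (p := (y, 0)) hy, e.mkPoint_eq]
    refine ⟨k, K, hk, hky, ?_⟩
    simp only [asd_zero]
    rfl

/-- The derivative of a change of charts is invertible, so an anti-self-dual form whose pull-back
vanishes is itself zero and membership can be read off in any chart. -/
theorem asdChart_mem_zeroSection {i : Q.ι} {p : E4 × E3} (hp : p.1 ∈ Q.U i) :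
    e.asdChart i p ∈ e.zeroSection ↔ p.2 = 0 := by
  constructor
  · rintro ⟨j, y, hy, h⟩
    rw [e.asdChart_of_mem hp, e.asdChart_of_mem (p := (y, 0)) hy, e.mkPoint_eq] at h
    obtain ⟨k, K, hk, hky, hb⟩ := h
    simp only [asd_zero] at hb
    have hT := K.symm.fderiv_symm (x := p.1) (by
      have h1 : k y = p.1 := hky
      rw [← h1]; exact k.map_source hk)
    refine e.asd_inj hp (a := p.2) (b := 0) ?_
    rw [asd_zero]
    have hkp : k.symm p.1 = y := by
      have h1 : k y = p.1 := hky
      rw [← h1, k.left_inv hk]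
    ext v
    have h2 := congrArg (fun β => β fun r => fderiv ℝ k.symm p.1 (v r)) hb
    simp only [ContinuousAlternatingMap.compContinuousLinearMap_apply] at h2
    have h3 : (fderiv ℝ k y ∘ fun r => fderiv ℝ k.symm p.1 (v r)) = v := by
      funext r
      have := hT (v r)
      rw [hkp] at this
      exact this
    rw [h3] at h2
    exact h2
  · intro h
    exact ⟨i, p.1, hp, by rw [← h]⟩

end Orbifold.OrthonormalFrame

namespace SeifertBundle

variable {e : Orbifold.OrthonormalFrame g} {hQ : Q.IsOriented}
  (P : SeifertBundle (e.asdOrbifold hQ))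

/-- The part of a Seifert bundle over the zero section. -/
structure Zero : Type u where
  val : P.M
  mem : P.π val ∈ e.zeroSection

namespace Zero

variable {P}

theorem ext {m m' : P.Zero} (h : m.1 = m'.1) : m = m' := by
  cases m; cases m'; cases h; rfl

instance : TopologicalSpace P.Zero := .induced Zero.val inferInstance

theorem isEmbedding_val : Topology.IsEmbedding (Zero.val : P.Zero → P.M) :=
  ⟨⟨rfl⟩, fun _ _ h => ext h⟩

instance : T2Space P.Zero := isEmbedding_val.t2Space

instance : SecondCountableTopology P.Zero := isEmbedding_val.secondCountableTopology

theorem continuous_val : Continuous (Zero.val : P.Zero → P.M) := isEmbedding_val.continuous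

instance : MulAction Circle P.Zero where
  smul z m := ⟨z • m.1, by rw [P.π_smul]; exact m.2⟩
  one_smul m := ext (one_smul _ m.1)
  mul_smul z w m := ext (mul_smul z w m.1)

theorem val_smul (z : Circle) (m : P.Zero) : (z • m).1 = z • m.1 := rfl

/-- The inclusion of the zero section in coordinates. -/
def emb (p : E4 × ℝ) : (E4 × E3) × ℝ := ((p.1, 0), p.2)

/-- The projection to the zero section in coordinates. -/
def prj (p : (E4 × E3) × ℝ) : E4 × ℝ := (p.1.1, p.2)

theorem contDiff_emb : ContDiff ℝ ∞ emb := (contDiff_fst.prodMk contDiff_const).prodMk contDiff_snd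

theorem contDiff_prj : ContDiff ℝ ∞ prj :=
  (contDiff_fst.comp contDiff_fst).prodMk contDiff_snd

theorem chart_emb_mem {i : (e.asdOrbifold hQ).ι} (S : P.Slice i) {p : E4 × ℝ} (hp : emb p ∈ S.chart.source) :
    P.π (S.chart (emb p)) ∈ e.zeroSection := by
  rw [S.π_chart hp]
  exact (e.asdChart_mem_zeroSection (p := (p.1, 0)) (S.base_subset (S.mem_source.1 hp).1).1).2 rfl

/-- Over the zero section the fibre coordinate in every slice vanishes, so base point and angle
recover the full slice coordinates. -/
theorem emb_prj {i : (e.asdOrbifold hQ).ι} (S : P.Slice i) {m : P.Zero} (hm : m.1 ∈ S.chart.target) :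
    emb (prj (S.chart.symm m.1)) = S.chart.symm m.1 := by
  have h1 := S.chart.map_target hm
  have h2 := S.π_chart h1
  rw [S.chart.right_inv hm] at h2
  have h3 : (S.chart.symm m.1).1.1 ∈ Q.U i := (S.base_subset (S.mem_source.1 h1).1).1
  have h4 := m.2
  rw [h2] at h4
  have h5 : (S.chart.symm m.1).1.2 = 0 := (e.asdChart_mem_zeroSection h3).1 h4
  refine Prod.ext (Prod.ext rfl h5.symm) rfl

open Classical in
/-- The chart of the part over the zero section defined by a slice. -/
def chart {i : (e.asdOrbifold hQ).ι} (S : P.Slice i) (m₀ : P.Zero) : OpenPartialHomeomorph P.Zero (E4 × ℝ) where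
  toFun m := prj (S.chart.symm m.1)
  -- Outside the target the value m₀ is a mere default.
  invFun p := if hp : emb p ∈ S.chart.source then ⟨S.chart (emb p), chart_emb_mem S hp⟩ else m₀
  source := {m | m.1 ∈ S.chart.target}
  target := {p | emb p ∈ S.chart.source}
  map_source' m hm := by
    change emb (prj (S.chart.symm m.1)) ∈ S.chart.source
    rw [emb_prj S hm]; exact S.chart.map_target hm
  map_target' p hp := by
    have hp' : emb p ∈ S.chart.source := hp
    rw [dif_pos hp']
    exact S.chart.map_source hp
  left_inv' m hm := by
    have h : emb (prj (S.chart.symm m.1)) ∈ S.chart.source := by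
      rw [emb_prj S hm]; exact S.chart.map_target hm
    rw [dif_pos h]
    refine Zero.ext ?_
    change S.chart (emb (prj _)) = _
    rw [emb_prj S hm, S.chart.right_inv hm]
  right_inv' p hp := by
    have hp' : emb p ∈ S.chart.source := hp
    rw [dif_pos hp']
    change prj (S.chart.symm (S.chart (emb p))) = p
    rw [S.chart.left_inv hp]
    rfl
  open_source := S.chart.open_target.preimage continuous_val
  open_target := S.chart.open_source.preimage contDiff_emb.continuous
  continuousOn_toFun := contDiff_prj.continuous.comp_continuousOn
    (S.chart.symm.continuousOn.comp continuous_val.continuousOn fun _ hm => hm)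
  continuousOn_invFun := by
    rw [continuousOn_iff_continuous_domRestrict]
    have h1 : Continuous fun p : {p | emb p ∈ S.chart.source} => S.chart (emb p.1) :=
      S.chart.continuousOn.comp_continuous (contDiff_emb.continuous.comp continuous_subtype_val)
        fun p => p.2
    have h2 : Continuous fun p : {p | emb p ∈ S.chart.source} =>
        (⟨S.chart (emb p.1), chart_emb_mem S p.2⟩ : P.Zero) :=
      isEmbedding_val.isInducing.continuous_iff.2 h1
    refine h2.congr fun p => ?_
    have hp' : emb p.1 ∈ S.chart.source := p.2
    simp only [Set.domRestrict_apply]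
    rw [dif_pos hp']

theorem chart_apply {i : (e.asdOrbifold hQ).ι} (S : P.Slice i) (m₀ m : P.Zero) :
    chart S m₀ m = prj (S.chart.symm m.1) := rfl

theorem chart_symm_val {i : (e.asdOrbifold hQ).ι} (S : P.Slice i) (m₀ : P.Zero) {p : E4 × ℝ}
    (hp : emb p ∈ S.chart.source) : ((chart S m₀).symm p).1 = S.chart (emb p) := by
  have h : (chart S m₀).symm p = ⟨S.chart (emb p), chart_emb_mem S hp⟩ := dif_pos hp
  rw [h]

theorem exists_chart (m : P.Zero) : ∃ (i : (e.asdOrbifold hQ).ι) (S : P.Slice i) (x : E4), (x, (0 : E3)) ∈ S.base ∧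
    S.chart ((x, 0), 0) = m.1 := by
  obtain ⟨i, x, hx, h⟩ := m.2
  have hx' : (x, (0 : E3)) ∈ (e.asdOrbifold hQ).U i := ⟨hx, trivial⟩
  obtain ⟨S, hS, hm⟩ := P.exists_slice hx' h.symm
  exact ⟨i, S, x, hS, hm⟩

theorem exists_chart_source (m : P.Zero) : ∃ (i : (e.asdOrbifold hQ).ι) (S : P.Slice i), m.1 ∈ S.chart.target := by
  obtain ⟨i, S, x, hx, hm⟩ := exists_chart m
  exact ⟨i, S, hm ▸ S.chart.map_source (S.zero_mem_source hx)⟩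

instance : ChartedSpace (E4 × ℝ) P.Zero where
  atlas := {c | ∃ (i : (e.asdOrbifold hQ).ι) (S : P.Slice i) (m₀ : P.Zero), c = chart S m₀}
  chartAt m := chart (exists_chart_source m).choose_spec.choose m
  mem_chart_source m := (exists_chart_source m).choose_spec.choose_spec
  chart_mem_atlas m := ⟨_, _, m, rfl⟩

theorem chart_mem_atlas {i : (e.asdOrbifold hQ).ι} (S : P.Slice i) (m₀ : P.Zero) :
    chart S m₀ ∈ atlas (E4 × ℝ) P.Zero := ⟨i, S, m₀, rfl⟩

instance : IsManifold 𝓘(ℝ, E4 × ℝ) ∞ P.Zero := by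
  refine isManifold_of_contDiffOn _ _ _ ?_
  rintro _ _ ⟨i, S, m₀, rfl⟩ ⟨j, S', m₁, rfl⟩
  have h1 : ContDiffOn ℝ ∞ (fun p => prj (S.change S' (emb p)))
      (emb ⁻¹' (S.change S').source) :=
    contDiff_prj.comp_contDiffOn ((S.contDiffOn_change S').comp contDiff_emb.contDiffOn
      fun p hp => hp)
  have hs : ∀ p, p ∈ ((chart S m₀).symm ≫ₕ chart S' m₁).source →
      emb p ∈ S.chart.source ∧ S.chart (emb p) ∈ S'.chart.target := by
    intro p hp
    rw [OpenPartialHomeomorph.trans_source] at hp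
    have hp1 : emb p ∈ S.chart.source := hp.1
    refine ⟨hp1, ?_⟩
    have hp2 : ((chart S m₀).symm p).1 ∈ S'.chart.target := hp.2
    rwa [chart_symm_val S m₀ hp1] at hp2
  refine ContDiffOn.congr (h1.mono ?_) ?_
  · rintro p ⟨hp, _⟩
    exact Slice.mem_change_source.2 (hs p hp)
  · rintro p ⟨hp, _⟩
    have := (hs p hp).1
    change prj (S'.chart.symm ((chart S m₀).symm p).1) = _
    rw [chart_symm_val S m₀ this]
    rfl

theorem contMDiffOn_chart {i : (e.asdOrbifold hQ).ι} (S : P.Slice i) (m₀ : P.Zero) :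
    ContMDiffOn 𝓘(ℝ, E4 × ℝ) 𝓘(ℝ, E4 × ℝ) ∞ (chart S m₀) (chart S m₀).source :=
  contMDiffOn_of_mem_maximalAtlas (IsManifold.subset_maximalAtlas (chart_mem_atlas S m₀))

theorem contMDiffOn_chart_symm {i : (e.asdOrbifold hQ).ι} (S : P.Slice i) (m₀ : P.Zero) :
    ContMDiffOn 𝓘(ℝ, E4 × ℝ) 𝓘(ℝ, E4 × ℝ) ∞ (chart S m₀).symm (chart S m₀).target :=
  contMDiffOn_symm_of_mem_maximalAtlas (IsManifold.subset_maximalAtlas (chart_mem_atlas S m₀))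

theorem contMDiff_val : ContMDiff 𝓘(ℝ, E4 × ℝ) 𝓘(ℝ, (E4 × E3) × ℝ) ∞
    (Zero.val : P.Zero → P.M) := by
  intro m
  obtain ⟨i, S, hm⟩ := exists_chart_source m
  have hms : m ∈ (chart S m).source := hm
  have hmt : emb (chart S m m) ∈ S.chart.source := (chart S m).map_source hms
  have h1 := (contMDiffOn_chart S m).contMDiffAt ((chart S m).open_source.mem_nhds hms)
  have h2 : ContMDiffAt 𝓘(ℝ, E4 × ℝ) 𝓘(ℝ, (E4 × E3) × ℝ) ∞ (fun p => S.chart (emb p))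
      (chart S m m) :=
    ContMDiffAt.comp (g := S.chart) _ (S.contMDiffAt hmt) contDiff_emb.contMDiff.contMDiffAt
  refine (ContMDiffAt.comp (g := fun p => S.chart (emb p)) m h2 h1).congr_of_eventuallyEq ?_
  filter_upwards [(chart S m).open_source.mem_nhds hms] with m' hm'
  have hm't : m'.1 ∈ S.chart.target := hm'
  simp only [Function.comp_apply]
  rw [chart_apply, emb_prj S hm', S.chart.right_inv hm't]

/-- The part over the zero section is an embedded submanifold: in the coordinates of a slice it is
cut out by the vanishing of the fibre coordinate, so smoothness can be tested in P. -/
theorem contMDiff_of_val {F H N : Type*} [NormedAddCommGroup F] [NormedSpace ℝ F]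
    [TopologicalSpace H] {I : ModelWithCorners ℝ F H} [TopologicalSpace N] [ChartedSpace H N]
    {f : N → P.Zero} (hf : ContMDiff I 𝓘(ℝ, (E4 × E3) × ℝ) ∞ fun n => (f n).1) :
    ContMDiff I 𝓘(ℝ, E4 × ℝ) ∞ f := by
  intro n
  obtain ⟨i, S, hm⟩ := exists_chart_source (f n)
  have hms : f n ∈ (chart S (f n)).source := hm
  have h1 := (contMDiffOn_chart_symm S (f n)).contMDiffAt
    ((chart S (f n)).open_target.mem_nhds ((chart S (f n)).map_source hms))
  have h2 : ContMDiffAt I 𝓘(ℝ, E4 × ℝ) ∞ (fun n' => prj (S.chart.symm (f n').1)) n :=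
    ContMDiffAt.comp (g := prj) n contDiff_prj.contMDiff.contMDiffAt
      (ContMDiffAt.comp (g := S.chart.symm) n (S.contMDiffAt_symm hm) (hf n))
  have h3 : ∀ᶠ n' in 𝓝 n, (f n').1 ∈ S.chart.target :=
    (hf n).continuousAt.eventually (S.chart.open_target.mem_nhds hm)
  refine (ContMDiffAt.comp (g := (chart S (f n)).symm) n h1 h2).congr_of_eventuallyEq ?_
  filter_upwards [h3] with n' hn'
  exact ((chart S (f n)).left_inv hn').symm

instance : ContMDiffSMul (𝓡 1) 𝓘(ℝ, E4 × ℝ) ∞ Circle P.Zero where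
  contMDiff_smul := contMDiff_of_val
    (P.contMDiff_action.comp (contMDiff_fst.prodMk (contMDiff_val.comp contMDiff_snd)))

theorem chart_symm_exp {i : (e.asdOrbifold hQ).ι} (S : P.Slice i) (m₀ : P.Zero) {p : E4 × ℝ}
    (hp : emb p ∈ S.chart.source) :
    Circle.exp p.2 • (chart S m₀).symm (p.1, 0) = (chart S m₀).symm p := by
  have h := S.mem_source.1 hp
  have h0 : emb (p.1, 0) ∈ S.chart.source := S.zero_mem_source h.1
  refine Zero.ext ?_
  rw [val_smul, chart_symm_val S m₀ hp, chart_symm_val S m₀ h0]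
  exact (S.exp_smul _ h.1 _ h.2).symm

end Zero

/-- The restriction of a Seifert bundle to the zero section. -/
def restrictZero : SeifertBundle Q where
  M := P.Zero
  effective z hz := by
    refine Set.eq_empty_of_forall_notMem fun m hm => hz ?_
    obtain ⟨i, S, x, hx, hxm⟩ := Zero.exists_chart m
    let c := Zero.chart S m
    have hx0 : (x, (0 : ℝ)) ∈ c.target := S.zero_mem_source hx
    have hcx : c.symm (x, 0) = m := Zero.ext ((Zero.chart_symm_val S m hx0).trans hxm)
    have hW : IsOpen (c.target ∩ c.symm ⁻¹' interior {m : P.Zero | z • m = m}) :=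
      c.symm.continuousOn.isOpen_inter_preimage c.open_target isOpen_interior
    have hV : IsOpen ((fun y : E4 => (y, (0 : ℝ))) ⁻¹'
        (c.target ∩ c.symm ⁻¹' interior {m : P.Zero | z • m = m})) :=
      hW.preimage (by fun_prop)
    have hb : ∀ y : E4, (y, (0 : ℝ)) ∈ c.target → (y, (0 : E3)) ∈ S.base :=
      fun y hy => (S.mem_source.1 (show Zero.emb (y, 0) ∈ S.chart.source from hy)).1
    -- An open set fixed by z contains points over generic points y of Q. A group element fixing (y,
    -- 0) fixes y, so (y, 0) is generic in the total space and `eq_one_of_smul_eq` applies there.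
    have hcl := Q.subset_closure_generic i hV (fun y hy => (S.base_subset (hb y hy.1)).1)
      (show x ∈ _ from ⟨hx0, by rw [Set.mem_preimage, hcx]; exact hm⟩)
    obtain ⟨y, hy, hyg⟩ := closure_nonempty_iff.1 ⟨x, hcl⟩
    have hgen : (y, (0 : E3)) ∈ (e.asdOrbifold hQ).generic i :=
      ⟨S.base_subset (hb y hy.1), fun γ hγ => hyg.2 γ (congrArg Prod.fst hγ)⟩
    refine eq_one_of_smul_eq S (hb y hy.1) hgen ?_
    have h1 : z • c.symm (y, 0) = c.symm (y, 0) := interior_subset (s := {m : P.Zero | z • m = m}) hy.2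
    have h2 := congrArg Zero.val h1
    rw [Zero.val_smul, Zero.chart_symm_val S m (p := (y, 0)) hy.1] at h2
    exact h2
  π m := e.asdProj (P.π m.1)
  surjective x := by
    obtain ⟨i, y, hy, rfl⟩ := Q.cover x
    obtain ⟨m, hm⟩ := P.surjective (e.asdChart i (y, 0))
    refine ⟨⟨m, i, y, hy, hm.symm⟩, ?_⟩
    change e.asdProj (P.π m) = _
    rw [hm, e.asdProj_asdChart (p := (y, 0)) hy]
  fiber m m' := by
    constructor
    · intro h
      obtain ⟨i, x, hx, hm⟩ := m.2
      obtain ⟨j, y, hy, hm'⟩ := m'.2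
      rw [← hm, ← hm', e.asdProj_asdChart (p := (x, 0)) hx, e.asdProj_asdChart (p := (y, 0)) hy,
        ← e.asdChart_zero_eq_iff hx hy, hm, hm'] at h
      obtain ⟨z, hz⟩ := (P.fiber m.1 m'.1).1 h
      exact ⟨z, Zero.ext hz⟩
    · rintro ⟨z, rfl⟩
      rw [Zero.val_smul, P.π_smul]
  slice i x hx := by
    obtain ⟨m, hm⟩ := P.surjective (e.asdChart i (x, 0))
    have hx' : (x, (0 : E3)) ∈ (e.asdOrbifold hQ).U i := ⟨hx, trivial⟩
    obtain ⟨S, hS, hSm⟩ := P.exists_slice hx' hm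
    let m₀ : P.Zero := ⟨m, i, x, hx, hm.symm⟩
    let c := Zero.chart S m₀
    refine ⟨fun y => c.symm (y, 0), ?_, ?_⟩
    · have h1 : ∀ᶠ y in 𝓝 x, (y, (0 : E3)) ∈ S.base :=
        (show ContinuousAt (fun y : E4 => (y, (0 : E3))) x by fun_prop).eventually
          (S.isOpen_base.mem_nhds hS)
      filter_upwards [h1] with y hy
      rw [Zero.chart_symm_val S m₀ (p := (y, 0)) (S.zero_mem_source hy)]
      change e.asdProj (P.π (S.chart ((y, 0), 0))) = _
      rw [S.proj _ hy]
      exact e.asdProj_asdChart (p := (y, 0)) (S.base_subset hy).1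
    · refine ⟨⟨c.symm.toPartialEquiv, c.open_target, c.open_source,
        Zero.contMDiffOn_chart_symm S m₀, Zero.contMDiffOn_chart S m₀⟩, S.zero_mem_source hS, ?_⟩
      intro p hp
      exact Zero.chart_symm_exp S m₀ hp

end SeifertBundle

end ZeroSection

/-! ### The lift of a Seifert bundle to the bundle of anti-self-dual forms -/

section Lift

variable {X : Type u} [TopologicalSpace X] {Q : Orbifold E4 X} {g : Q.RiemannianMetric}

namespace SeifertBundle

variable {P : SeifertBundle Q}

/-- The change of charts `h` relates the slices `S` and `S'` near the point `m`. -/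
structure Slice.Covers {i j : Q.ι} (S : P.Slice i) (S' : P.Slice j) (m : P.M)
    (h : OpenPartialHomeomorph E4 E4) : Prop where
  isTransition : Q.IsTransition i j h
  mem_source : (S.chart.symm m).1 ∈ h.source
  eventually : ∀ᶠ m' in 𝓝 m, (S'.chart.symm m').1 = h (S.chart.symm m').1

namespace Slice.Covers

variable {i j k : Q.ι} {S : P.Slice i} {S' : P.Slice j} {S'' : P.Slice k} {m : P.M}
  {h h' : OpenPartialHomeomorph E4 E4}

theorem apply_eq (H : S.Covers S' m h) : h (S.chart.symm m).1 = (S'.chart.symm m).1 :=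
  H.eventually.self_of_nhds.symm

theorem continuousAt_fst_symm (S : P.Slice i) (hm : m ∈ S.chart.target) :
    ContinuousAt (fun m' => (S.chart.symm m').1) m :=
  continuousAt_fst.comp (S.chart.continuousAt_symm hm)

theorem symm (H : S.Covers S' m h) (hm : m ∈ S.chart.target) : S'.Covers S m h.symm where
  isTransition := H.isTransition.symm
  mem_source := by rw [← H.apply_eq]; exact h.map_source H.mem_source
  eventually := by
    filter_upwards [H.eventually, (continuousAt_fst_symm S hm).eventually
      (h.open_source.mem_nhds H.mem_source)] with m' h1 h2
    rw [h1, h.left_inv h2]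

theorem trans (H : S.Covers S' m h) (H' : S'.Covers S'' m h') : S.Covers S'' m (h.trans h') where
  isTransition := H.isTransition.trans H'.isTransition
  mem_source := by
    rw [OpenPartialHomeomorph.trans_source]
    exact ⟨H.mem_source, by rw [Set.mem_preimage, H.apply_eq]; exact H'.mem_source⟩
  eventually := by
    filter_upwards [H.eventually, H'.eventually] with m' h1 h2
    rw [h2, h1]; rfl

theorem of_eventually_eq {S S' : P.Slice i} (hm : m ∈ S.chart.target)
    (h : ∀ᶠ m' in 𝓝 m, (S'.chart.symm m').1 = (S.chart.symm m').1) :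
    S.Covers S' m (OpenPartialHomeomorph.ofSet (Q.U i) (Q.isOpen_U i)) where
  isTransition := IsChartChange.refl _ _
  mem_source := S.base_subset (S.mem_source.1 (S.chart.map_target hm)).1
  eventually := h

theorem smul (H : S.Covers S' m h) (z : Circle) : (S.smul z).Covers (S'.smul z) (z • m) h where
  isTransition := H.isTransition
  mem_source := by
    rw [smul_chart_symm, inv_smul_smul]; exact H.mem_source
  eventually := by
    have hc : ContinuousAt (fun m' : P.M => z⁻¹ • m') (z • m) := (continuous_const_smul _).continuousAt
    have := hc.eventually (p := fun m' => (S'.chart.symm m').1 = h (S.chart.symm m').1)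
      (by simp only [inv_smul_smul]; exact H.eventually)
    exact this

end Slice.Covers

/-- `Slice.exists_transition` read on M. One h serves at all points near m, so the changes of
coordinates of the lift are locally lifts of a single map. -/
theorem Slice.exists_covers {i j : Q.ι} (S : P.Slice i) (S' : P.Slice j) {m : P.M}
    (hm : m ∈ S.chart.target) (hm' : m ∈ S'.chart.target) :
    ∃ h, S.Covers S' m h ∧ ∀ᶠ m' in 𝓝 m, S.Covers S' m' h := by
  obtain ⟨h, H, hs, -, hev⟩ := S.exists_transition S' (p₀ := S.chart.symm m)
    (Slice.mem_change_source.2 ⟨S.chart.map_target hm, by rwa [S.chart.right_inv hm]⟩)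
  have h1 : ∀ᶠ m' in 𝓝 m, (S'.chart.symm m').1 = h (S.chart.symm m').1 := by
    filter_upwards [(S.chart.continuousAt_symm hm).eventually hev,
      S.chart.open_target.mem_nhds hm] with m' h1 h2
    rw [← h1.2, Slice.change_apply, S.chart.right_inv h2]
  refine ⟨h, ⟨H, hs, h1⟩, ?_⟩
  filter_upwards [h1.eventually_nhds, (Slice.Covers.continuousAt_fst_symm S hm).eventually
    (h.open_source.mem_nhds hs)] with m' h2 h3
  exact ⟨H, h3, h2⟩

variable (P) in
/-- The points `((y, b), t)` of the charts of the lift of a Seifert bundle to the bundle of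
anti-self-dual forms. -/
structure LiftPoint : Type u where
  i : Q.ι
  S : P.Slice i
  p : (E4 × E3) × ℝ
  mem : (p.1.1, p.2) ∈ S.chart.source

namespace LiftPoint

/-- The projection to the Seifert bundle. -/
def pt (a : P.LiftPoint) : P.M := a.S.chart (a.p.1.1, a.p.2)

theorem pt_mem (a : P.LiftPoint) : a.pt ∈ a.S.chart.target := a.S.chart.map_source a.mem

theorem symm_pt (a : P.LiftPoint) : a.S.chart.symm a.pt = (a.p.1.1, a.p.2) :=
  a.S.chart.left_inv a.mem

theorem mem_U (a : P.LiftPoint) : a.p.1.1 ∈ Q.U a.i := a.S.base_subset (a.S.mem_source.1 a.mem).1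

variable (e : Orbifold.OrthonormalFrame g)

/-- Two points of charts represent the same point of the lift. -/
def Rel (a b : P.LiftPoint) : Prop :=
  -- Two slices through the same point of M determine the germ of h. The fibre over a point of M is
  -- thus ℝ³ itself and not its quotient by an isotropy group.
  a.pt = b.pt ∧ ∃ h, a.S.Covers b.S a.pt h ∧
    (e.asd b.i b.p.1.1 b.p.1.2).compContinuousLinearMap (fderiv ℝ h a.p.1.1) =
      e.asd a.i a.p.1.1 a.p.1.2

variable {e}

theorem Rel.of_eventually_eq {a b : P.LiftPoint} (hab : a.pt = b.pt) (hi : a.i = b.i)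
    (hp : a.p.1 = b.p.1)
    (h : ∀ᶠ m' in 𝓝 a.pt, (b.S.chart.symm m').1 = (a.S.chart.symm m').1) : Rel e a b := by
  obtain ⟨i, S, p, hS⟩ := a
  obtain ⟨j, S', p', hS'⟩ := b
  cases hi
  refine ⟨hab, _, Slice.Covers.of_eventually_eq (pt_mem _) h, ?_⟩
  have h1 : fderiv ℝ (OpenPartialHomeomorph.ofSet (Q.U i) (Q.isOpen_U i)) p.1.1 =
      ContinuousLinearMap.id ℝ E4 := fderiv_id
  rw [h1]
  simp only at hp
  rw [← hp]
  rfl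

theorem Rel.toChartPoint {a b : P.LiftPoint} (H : Rel e a b) :
    e.asdChart a.i a.p.1 = e.asdChart b.i b.p.1 := by
  obtain ⟨hab, h, Hh, hb⟩ := H
  rw [e.asdChart_of_mem a.mem_U, e.asdChart_of_mem b.mem_U, e.mkPoint_eq]
  refine ⟨h, Hh.isTransition, ?_, ?_, hb⟩
  · have := Hh.mem_source
    rwa [a.symm_pt] at this
  · have := Hh.apply_eq
    rw [a.symm_pt, hab, b.symm_pt] at this
    exact this

variable (e)

theorem rel_refl (a : P.LiftPoint) : Rel e a a :=
  Rel.of_eventually_eq rfl rfl rfl (Filter.Eventually.of_forall fun _ => rfl)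

theorem rel_symm {a b : P.LiftPoint} (H : Rel e a b) : Rel e b a := by
  obtain ⟨hab, h, Hh, hb⟩ := H
  refine ⟨hab.symm, h.symm, hab ▸ Hh.symm a.pt_mem, ?_⟩
  have h1 := Hh.apply_eq
  have h2 := Hh.mem_source
  rw [a.symm_pt] at h1 h2
  rw [hab, b.symm_pt] at h1
  rw [← hb]
  ext v
  simp only [ContinuousAlternatingMap.compContinuousLinearMap_apply]
  congr 1
  funext r
  have := Hh.isTransition.symm.fderiv_symm (x := b.p.1.1) (by
    rw [show b.p.1.1 = h a.p.1.1 from h1.symm]; exact h.map_source h2) (v r)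
  rw [show h.symm b.p.1.1 = a.p.1.1 by
    rw [show b.p.1.1 = h a.p.1.1 from h1.symm, h.left_inv h2]] at this
  exact this

theorem rel_trans {a b c : P.LiftPoint} (H : Rel e a b) (K : Rel e b c) : Rel e a c := by
  obtain ⟨hab, h, Hh, hb⟩ := H
  obtain ⟨hbc, k, Hk, hc⟩ := K
  refine ⟨hab.trans hbc, h.trans k, Hh.trans (hab ▸ Hk), ?_⟩
  have h1 := Hh.apply_eq
  have h2 := Hh.mem_source
  have h3 := Hk.mem_source
  rw [a.symm_pt] at h1 h2
  rw [hab, b.symm_pt] at h1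
  rw [b.symm_pt] at h3
  have h1' : h a.p.1.1 = b.p.1.1 := h1
  have hd : fderiv ℝ (h.trans k) a.p.1.1 = (fderiv ℝ k b.p.1.1).comp (fderiv ℝ h a.p.1.1) := by
    rw [OpenPartialHomeomorph.coe_trans, fderiv_comp _
      (Hk.isTransition.differentiableAt (by rw [h1']; exact h3))
      (Hh.isTransition.differentiableAt h2), h1']
  rw [hd, ← hb, ← hc]
  rfl

variable (P) in
/-- The equivalence relation that glues the charts of the lift. -/
abbrev setoid : Setoid P.LiftPoint where
  r := Rel e
  iseqv := ⟨rel_refl e, rel_symm e, rel_trans e⟩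

end LiftPoint

variable (P) (e : Orbifold.OrthonormalFrame g)

/-- The total space of the lift of a Seifert bundle to the bundle of anti-self-dual forms. -/
def Lift : Type u := Quotient (LiftPoint.setoid P e)

namespace Lift

variable {P} {i j : Q.ι}

/-- The class of a point of a chart. -/
def mk (a : P.LiftPoint) : P.Lift e := Quotient.mk (LiftPoint.setoid P e) a

variable {e}

theorem mk_eq {a b : P.LiftPoint} : mk e a = mk e b ↔ LiftPoint.Rel e a b :=
  Quotient.eq (r := LiftPoint.setoid P e)

/-- The projection to the Seifert bundle. -/
def pr : P.Lift e → P.M :=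
  Quotient.lift (s := LiftPoint.setoid P e) LiftPoint.pt fun _ _ h => h.1

theorem exists_mk (w : P.Lift e) : ∃ a, mk e a = w := Quotient.exists_rep w

/-- The domain of the chart of the lift defined by a slice. -/
def dom (S : P.Slice i) : Set ((E4 × E3) × ℝ) := {p | (p.1.1, p.2) ∈ S.chart.source}

theorem isOpen_dom (S : P.Slice i) : IsOpen (dom S) :=
  S.chart.open_source.preimage (by fun_prop)

variable (e) in
open Classical in
/-- The parametrisation of the lift defined by a slice. Its values outside of the domain `dom S` are
arbitrary. -/
def par [Nonempty (P.Lift e)] (S : P.Slice i) (p : (E4 × E3) × ℝ) : P.Lift e :=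
  if hp : p ∈ dom S then mk e ⟨i, S, p, hp⟩ else Classical.arbitrary _

section Nonempty

variable [Nonempty (P.Lift e)]

theorem par_of_mem (S : P.Slice i) {p : (E4 × E3) × ℝ} (hp : p ∈ dom S) :
    par e S p = mk e ⟨i, S, p, hp⟩ := dif_pos hp

theorem pr_par (S : P.Slice i) {p : (E4 × E3) × ℝ} (hp : p ∈ dom S) :
    pr (par e S p) = S.chart (p.1.1, p.2) := by
  rw [par_of_mem S hp]; rfl

/-- Two points of one slice that represent the same class have the same image in M, hence the same
base point and angle. A change of charts covering the identity of the slice is the identity near the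
base point, so its derivative is the identity and the fibre components agree. -/
theorem injOn_par (S : P.Slice i) : Set.InjOn (par e S) (dom S) := by
  intro p hp q hq h
  rw [par_of_mem S hp, par_of_mem S hq, mk_eq] at h
  obtain ⟨hpq, k, K, hb⟩ := h
  have h1 : ((p.1.1, p.2) : E4 × ℝ) = (q.1.1, q.2) := S.chart.injOn hp hq hpq
  have h2 : ∀ᶠ y in 𝓝 p.1.1, k y = y := by
    have hc : ContinuousAt (fun y : E4 => S.chart (y, p.2)) p.1.1 :=
      ContinuousAt.comp (g := S.chart) (f := fun y => (y, p.2)) (S.chart.continuousAt hp)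
        (by fun_prop)
    have hs : ∀ᶠ y in 𝓝 p.1.1, (y, p.2) ∈ S.chart.source :=
      (show ContinuousAt (fun y : E4 => (y, p.2)) p.1.1 by fun_prop).eventually
        (S.chart.open_source.mem_nhds hp)
    filter_upwards [hc.eventually K.eventually, hs] with y h3 h4
    simp only [S.chart.left_inv h4] at h3
    exact h3.symm
  have h3 : fderiv ℝ k p.1.1 = ContinuousLinearMap.id ℝ E4 := by
    rw [Filter.EventuallyEq.fderiv_eq (f₁ := k) (f := id) h2, fderiv_id]
  simp only [h3] at hb
  have h4 : q.1.1 = p.1.1 := (congrArg Prod.fst h1).symm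
  rw [h4] at hb
  have h5 : q.1.2 = p.1.2 :=
    e.asd_inj (S.base_subset (S.mem_source.1 hp).1) hb
  exact Prod.ext (Prod.ext h4.symm h5.symm) (congrArg Prod.snd h1 :)

/-- Near a point of the domain, the change between two parametrisations is the lift of a change of
slices. -/
theorem exists_par_eq (hQ : Q.IsOriented) (S : P.Slice i) (S' : P.Slice j) {p₀ : (E4 × E3) × ℝ}
    (hp₀ : p₀ ∈ dom S) (hm : S.chart (p₀.1.1, p₀.2) ∈ S'.chart.target) :
    ∃ h, Q.IsTransition i j h ∧ p₀.1.1 ∈ h.source ∧ ∀ᶠ p in 𝓝 p₀,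
      ((h p.1.1, e.liftFibre i j h p.1.1 p.1.2), (S.change S' (p.1.1, p.2)).2) ∈ dom S' ∧
      par e S' ((h p.1.1, e.liftFibre i j h p.1.1 p.1.2), (S.change S' (p.1.1, p.2)).2) =
        par e S p := by
  obtain ⟨h, H, hev⟩ := S.exists_covers S' (S.chart.map_source hp₀) hm
  refine ⟨h, H.isTransition, by simpa only [S.chart.left_inv hp₀] using H.mem_source, ?_⟩
  have hc1 : ContinuousAt (fun p : (E4 × E3) × ℝ => S.chart (p.1.1, p.2)) p₀ :=
    ContinuousAt.comp (g := S.chart) (f := fun p : (E4 × E3) × ℝ => (p.1.1, p.2))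
      (S.chart.continuousAt hp₀) (by fun_prop)
  filter_upwards [(isOpen_dom S).mem_nhds hp₀, hc1.eventually hev,
    hc1.eventually (S'.chart.open_target.mem_nhds hm)] with p hp hcov hpm
  have hpm' : S.chart (p.1.1, p.2) ∈ S'.chart.target := hpm
  have h1 := hcov.apply_eq
  have h2 := hcov.mem_source
  simp only [S.chart.left_inv (show (p.1.1, p.2) ∈ S.chart.source from hp)] at h1 h2
  have h3 : ((h p.1.1, (S.change S' (p.1.1, p.2)).2) : E4 × ℝ) =
      S'.chart.symm (S.chart (p.1.1, p.2)) := Prod.ext h1 rfl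
  have h4 : (h p.1.1, (S.change S' (p.1.1, p.2)).2) ∈ S'.chart.source := by
    rw [h3]; exact S'.chart.map_target hpm'
  refine ⟨h4, ?_⟩
  rw [par_of_mem S' h4, par_of_mem S hp, eq_comm, mk_eq]
  refine ⟨?_, h, hcov, e.liftFibre_spec hQ H.isTransition h2 p.1.2⟩
  change S.chart (p.1.1, p.2) = S'.chart (h p.1.1, (S.change S' (p.1.1, p.2)).2)
  rw [h3, S'.chart.right_inv hpm']

theorem mem_image_par (hQ : Q.IsOriented) (S : P.Slice i) {w : P.Lift e} :
    w ∈ par e S '' dom S ↔ pr w ∈ S.chart.target := by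
  constructor
  · rintro ⟨p, hp, rfl⟩
    rw [pr_par S hp]; exact S.chart.map_source hp
  · intro hw
    obtain ⟨a, rfl⟩ := exists_mk w
    obtain ⟨h, -, -, hev⟩ := exists_par_eq (e := e) hQ a.S S (p₀ := a.p) a.mem hw
    have := hev.self_of_nhds
    exact ⟨_, this.1, this.2.trans (par_of_mem a.S a.mem)⟩

/-- The chart of the lift defined by a slice. -/
def coord (S : P.Slice i) : PartialEquiv (P.Lift e) ((E4 × E3) × ℝ) :=
  ((injOn_par S).toPartialEquiv (par e S) (dom S)).symm

theorem coord_symm_apply (S : P.Slice i) (p : (E4 × E3) × ℝ) :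
    (coord S).symm p = par e S p := rfl

theorem coord_target (S : P.Slice i) : (coord S : PartialEquiv (P.Lift e) _).target = dom S := rfl

theorem mem_coord_source (hQ : Q.IsOriented) (S : P.Slice i) {w : P.Lift e} :
    w ∈ (coord S).source ↔ pr w ∈ S.chart.target := mem_image_par hQ S

theorem coord_par (S : P.Slice i) {p : (E4 × E3) × ℝ} (hp : p ∈ dom S) :
    coord S (par e S p) = p :=
  (coord S : PartialEquiv (P.Lift e) _).right_inv hp

theorem mem_coord_change_source (hQ : Q.IsOriented) (S : P.Slice i) (S' : P.Slice j)
    {p : (E4 × E3) × ℝ} :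
    p ∈ ((coord S : PartialEquiv (P.Lift e) _).symm.trans (coord S')).source ↔
      p ∈ dom S ∧ S.chart (p.1.1, p.2) ∈ S'.chart.target := by
  rw [PartialEquiv.trans_source, PartialEquiv.symm_source, coord_target, Set.mem_inter_iff,
    Set.mem_preimage, coord_symm_apply, mem_coord_source hQ]
  exact and_congr_right fun hp => by rw [pr_par S hp]

/-- Locally the change of coordinates consists of the lift of one change of charts of Q and the
angle component of the change of slices. -/
theorem contDiffAt_coord_change (hQ : Q.IsOriented) (S : P.Slice i) (S' : P.Slice j)
    {p : (E4 × E3) × ℝ} (hp : p ∈ dom S) (hm : S.chart (p.1.1, p.2) ∈ S'.chart.target) :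
    ContDiffAt ℝ ∞ ((coord S : PartialEquiv (P.Lift e) _).symm.trans (coord S')) p := by
  obtain ⟨h, H, hs, hev⟩ := exists_par_eq (e := e) hQ S S' hp hm
  have h1 : ContDiffAt ℝ ∞ (fun p : (E4 × E3) × ℝ =>
      ((h p.1.1, e.liftFibre i j h p.1.1 p.1.2), (S.change S' (p.1.1, p.2)).2)) p := by
    refine ContDiffAt.prodMk ?_ ?_
    · have h2 := (e.liftHomeo_isChartChange hQ H).contDiffOn.contDiffAt
        ((e.liftHomeo hQ H).open_source.mem_nhds (x := p.1) ⟨hs, trivial⟩)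
      exact ContDiffAt.comp (g := e.liftHomeo hQ H) p h2 contDiffAt_fst
    · have h2 := (S.contDiffOn_change S').contDiffAt ((S.change S').open_source.mem_nhds
        (Slice.mem_change_source.2 ⟨hp, hm⟩))
      have h3 : ContDiffAt ℝ ∞ (fun p : (E4 × E3) × ℝ => ((p.1.1, p.2) : E4 × ℝ)) p := by
        fun_prop
      exact contDiffAt_snd.comp p (ContDiffAt.comp (g := S.change S') p h2 h3)
  refine h1.congr_of_eventuallyEq ?_
  filter_upwards [hev] with q hq
  change coord S' (par e S q) = _
  rw [← hq.2, coord_par S' hq.1]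

end Nonempty

end Lift

end SeifertBundle

end Lift

/-! ### The manifold structure of the lift. -/

section LiftManifold

variable {X : Type u} [TopologicalSpace X] {Q : Orbifold E4 X} {g : Q.RiemannianMetric}

namespace SeifertBundle.Lift

variable {P : SeifertBundle Q} {e : Orbifold.OrthonormalFrame g} {i j : Q.ι}

theorem exists_slice_target (m : P.M) : ∃ a : Σ i, P.Slice i, m ∈ a.2.chart.target := by
  obtain ⟨i, S, x, hx, hm⟩ := P.exists_slice_mem m
  exact ⟨⟨i, S⟩, hm ▸ S.chart.map_source (S.zero_mem_source hx)⟩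

theorem pr_surjective : Function.Surjective (pr : P.Lift e → P.M) := by
  intro m
  obtain ⟨⟨i, S⟩, hS⟩ := exists_slice_target m
  refine ⟨mk e ⟨i, S, (((S.chart.symm m).1, 0), (S.chart.symm m).2), S.chart.map_target hS⟩, ?_⟩
  exact S.chart.right_inv hS

variable [hQ : Fact Q.IsOriented] [Nonempty (P.Lift e)]

variable (P e) in
/-- The atlas of the lift. -/
def core : ChartedSpaceCore ((E4 × E3) × ℝ) (P.Lift e) where
  atlas := {c | ∃ (i : Q.ι) (S : P.Slice i), c = coord S}
  chartAt w := coord (exists_slice_target (pr w)).choose.2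
  mem_chart_source w := (mem_coord_source hQ.1 _).2 (exists_slice_target (pr w)).choose_spec
  chart_mem_atlas _ := ⟨_, _, rfl⟩
  open_source := by
    rintro _ _ ⟨i, S, rfl⟩ ⟨j, S', rfl⟩
    have h : ((coord S : PartialEquiv (P.Lift e) _).symm.trans (coord S')).source =
        (fun p : (E4 × E3) × ℝ => ((p.1.1, p.2) : E4 × ℝ)) ⁻¹' (S.change S').source := by
      ext p
      rw [mem_coord_change_source hQ.1, Set.mem_preimage, Slice.mem_change_source]
      rfl
    rw [h]
    exact (S.change S').open_source.preimage (by fun_prop)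
  continuousOn_toFun := by
    rintro _ _ ⟨i, S, rfl⟩ ⟨j, S', rfl⟩ p hp
    rw [mem_coord_change_source hQ.1] at hp
    exact (contDiffAt_coord_change hQ.1 S S' hp.1 hp.2).continuousAt.continuousWithinAt

instance : TopologicalSpace (P.Lift e) := (core P e).toTopologicalSpace

instance : ChartedSpace ((E4 × E3) × ℝ) (P.Lift e) := (core P e).toChartedSpace

/-- The chart of the lift defined by a slice. -/
def chart (S : P.Slice i) : OpenPartialHomeomorph (P.Lift e) ((E4 × E3) × ℝ) :=
  (core P e).openPartialHomeomorph (coord S) ⟨i, S, rfl⟩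

theorem mem_chart_source (S : P.Slice i) {w : P.Lift e} :
    w ∈ (chart S).source ↔ pr w ∈ S.chart.target := mem_coord_source hQ.1 S

theorem par_chart (S : P.Slice i) {w : P.Lift e} (hw : pr w ∈ S.chart.target) :
    par e S (chart S w) = w := (chart S).left_inv ((mem_chart_source S).2 hw)

theorem chart_mem_dom (S : P.Slice i) {w : P.Lift e} (hw : pr w ∈ S.chart.target) :
    chart S w ∈ dom S := (chart S).map_source ((mem_chart_source S).2 hw)

theorem chart_mem_atlas (S : P.Slice i) : chart S ∈ atlas ((E4 × E3) × ℝ) (P.Lift e) :=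
  Set.mem_iUnion₂.2 ⟨coord S, ⟨i, S, rfl⟩, rfl⟩

theorem mem_atlas {c : OpenPartialHomeomorph (P.Lift e) ((E4 × E3) × ℝ)}
    (hc : c ∈ atlas ((E4 × E3) × ℝ) (P.Lift e)) : ∃ (i : Q.ι) (S : P.Slice i), c = chart S := by
  obtain ⟨_, ⟨i, S, rfl⟩, h⟩ := Set.mem_iUnion₂.1 hc
  exact ⟨i, S, h⟩

instance : IsManifold 𝓘(ℝ, (E4 × E3) × ℝ) ∞ (P.Lift e) := by
  refine isManifold_of_contDiffOn _ _ _ ?_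
  intro c c' hc hc'
  obtain ⟨i, S, rfl⟩ := mem_atlas hc
  obtain ⟨j, S', rfl⟩ := mem_atlas hc'
  rintro p ⟨hp, -⟩
  have hp' : p ∈ ((coord S : PartialEquiv (P.Lift e) _).symm.trans (coord S')).source := hp
  rw [mem_coord_change_source hQ.1] at hp'
  exact (contDiffAt_coord_change hQ.1 S S' hp'.1 hp'.2).contDiffWithinAt

theorem contMDiffOn_chart (S : P.Slice i) :
    ContMDiffOn 𝓘(ℝ, (E4 × E3) × ℝ) 𝓘(ℝ, (E4 × E3) × ℝ) ∞ (chart S : P.Lift e → _)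
      (chart S).source :=
  contMDiffOn_of_mem_maximalAtlas (IsManifold.subset_maximalAtlas (chart_mem_atlas S))

theorem contMDiffOn_par (S : P.Slice i) :
    ContMDiffOn 𝓘(ℝ, (E4 × E3) × ℝ) 𝓘(ℝ, (E4 × E3) × ℝ) ∞ (par e S) (dom S) :=
  contMDiffOn_symm_of_mem_maximalAtlas (e := chart S)
    (IsManifold.subset_maximalAtlas (chart_mem_atlas S))

theorem contMDiffAt_chart (S : P.Slice i) {w : P.Lift e} (hw : pr w ∈ S.chart.target) :
    ContMDiffAt 𝓘(ℝ, (E4 × E3) × ℝ) 𝓘(ℝ, (E4 × E3) × ℝ) ∞ (chart S) w :=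
  (contMDiffOn_chart S).contMDiffAt ((chart S).open_source.mem_nhds ((mem_chart_source S).2 hw))

theorem contMDiffAt_par (S : P.Slice i) {p : (E4 × E3) × ℝ} (hp : p ∈ dom S) :
    ContMDiffAt 𝓘(ℝ, (E4 × E3) × ℝ) 𝓘(ℝ, (E4 × E3) × ℝ) ∞ (par e S) p :=
  (contMDiffOn_par S).contMDiffAt ((isOpen_dom S).mem_nhds hp)

theorem continuous_pr : Continuous (pr : P.Lift e → P.M) := by
  rw [continuous_iff_continuousAt]
  intro w
  obtain ⟨⟨i, S⟩, hS⟩ := exists_slice_target (pr w)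
  have h1 := (contMDiffAt_chart (e := e) S hS).continuousAt
  have h2 : ContinuousAt (fun p : (E4 × E3) × ℝ => S.chart (p.1.1, p.2)) (chart S w) :=
    ContinuousAt.comp (g := S.chart) (f := fun p : (E4 × E3) × ℝ => (p.1.1, p.2))
      (S.chart.continuousAt (chart_mem_dom S hS)) (by fun_prop)
  refine (ContinuousAt.comp h2 h1).congr ?_
  filter_upwards [(chart S).open_source.mem_nhds ((mem_chart_source S).2 hS)] with w' hw'
  have hw'' := (mem_chart_source S).1 hw'
  change S.chart ((chart S w').1.1, (chart S w').2) = _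
  rw [← pr_par (e := e) S (chart_mem_dom S hw''), par_chart S hw'']

instance : T2Space (P.Lift e) := by
  refine ⟨fun w w' hne => ?_⟩
  -- Two points over the same point of M lie in one chart and are separated there; points with
  -- distinct projections are separated in M.
  by_cases h : pr w = pr w'
  · obtain ⟨⟨i, S⟩, hS⟩ := exists_slice_target (pr w)
    have hw := (mem_chart_source (e := e) S).2 hS
    have hw' := (mem_chart_source (e := e) S).2 (h ▸ hS)
    obtain ⟨A, A', hA, hA', hwA, hwA', hd⟩ :=
      t2_separation (fun h => hne ((chart S).injOn hw hw' h))
    refine ⟨_, _, (chart S).isOpen_inter_preimage hA, (chart S).isOpen_inter_preimage hA',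
      ⟨hw, hwA⟩, ⟨hw', hwA'⟩, ?_⟩
    exact (hd.preimage _).mono Set.inter_subset_right Set.inter_subset_right
  · obtain ⟨A, A', hA, hA', hwA, hwA', hd⟩ := t2_separation h
    exact ⟨_, _, hA.preimage continuous_pr, hA'.preimage continuous_pr, hwA, hwA', hd.preimage _⟩

instance : SecondCountableTopology (P.Lift e) := by
  obtain ⟨s, hs, hcov⟩ := TopologicalSpace.countable_cover_nhds (α := P.M)
    (f := fun m => (exists_slice_target m).choose.2.chart.target)
    (fun m => (exists_slice_target m).choose.2.chart.open_target.mem_nhds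
      (exists_slice_target m).choose_spec)
  -- Countably many slices cover M. The point σ m lies over m, so its preferred chart is the one
  -- given by the slice selected at m, and these charts cover the lift.
  let σ : P.M → P.Lift e := Function.surjInv pr_surjective
  have hσ : ∀ m, pr (σ m) = m := Function.surjInv_eq _
  refine ChartedSpace.secondCountable_of_countable_cover ((E4 × E3) × ℝ) (s := σ '' s) ?_
    (hs.image σ)
  refine Set.eq_univ_of_forall fun w => ?_
  have hw : pr w ∈ ⋃ m ∈ s, (exists_slice_target m).choose.2.chart.target := by
    rw [hcov]; trivial
  obtain ⟨m, hm, hwm⟩ := Set.mem_iUnion₂.1 hw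
  refine Set.mem_iUnion₂.2 ⟨σ m, ⟨m, hm, rfl⟩, ?_⟩
  refine (mem_coord_source hQ.1 (exists_slice_target (pr (σ m))).choose.2).2 ?_
  rw [hσ]; exact hwm

end SeifertBundle.Lift

end LiftManifold

/-! ### The circle action on the lift and its projection to the bundle of anti-self-dual forms. -/

section LiftAction

variable {X : Type u} [TopologicalSpace X] {Q : Orbifold E4 X} {g : Q.RiemannianMetric}

namespace SeifertBundle

variable {P : SeifertBundle Q} {e : Orbifold.OrthonormalFrame g} {i j : Q.ι}

/-- The rotation of a point of a chart of the lift. -/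
def LiftPoint.rotate (z : Circle) (a : P.LiftPoint) : P.LiftPoint := ⟨a.i, a.S.smul z, a.p, a.mem⟩

namespace Lift

instance : MulAction Circle (P.Lift e) where
  -- A rotation keeps the coordinates and rotates the slice, which is compatible with the gluing
  -- since `Slice.Covers` is equivariant.
  smul z := Quotient.map' (s₁ := LiftPoint.setoid P e) (s₂ := LiftPoint.setoid P e)
    (LiftPoint.rotate z) (by
      rintro a b ⟨hab, h, H, hb⟩
      exact ⟨congrArg (z • ·) hab, h, H.smul z, hb⟩)
  one_smul w := by
    obtain ⟨a, rfl⟩ := exists_mk w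
    refine mk_eq.2 (LiftPoint.Rel.of_eventually_eq (one_smul _ a.pt) rfl rfl
      (Filter.Eventually.of_forall fun m => ?_))
    change (a.S.chart.symm m).1 = (a.S.chart.symm ((1 : Circle)⁻¹ • m)).1
    rw [inv_one, one_smul]
  mul_smul z z' w := by
    obtain ⟨a, rfl⟩ := exists_mk w
    refine mk_eq.2 (LiftPoint.Rel.of_eventually_eq (mul_smul z z' a.pt) rfl rfl
      (Filter.Eventually.of_forall fun m => ?_))
    change (a.S.chart.symm (z'⁻¹ • z⁻¹ • m)).1 = (a.S.chart.symm ((z * z')⁻¹ • m)).1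
    rw [mul_inv_rev, mul_smul]

theorem smul_mk (z : Circle) (a : P.LiftPoint) : z • mk e a = mk e (a.rotate z) := rfl

theorem pr_smul (z : Circle) (w : P.Lift e) : pr (z • w) = z • pr w := by
  obtain ⟨a, rfl⟩ := exists_mk w
  rfl

variable (e) in
/-- The projection of the lift to the bundle of anti-self-dual forms. -/
def proj : P.Lift e → e.AsdSpace :=
  Quotient.lift (s := LiftPoint.setoid P e) (fun a => e.asdChart a.i a.p.1)
    fun _ _ h => LiftPoint.Rel.toChartPoint h

theorem proj_mk (a : P.LiftPoint) : proj e (mk e a) = e.asdChart a.i a.p.1 := rfl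

theorem proj_smul (z : Circle) (w : P.Lift e) : proj e (z • w) = proj e w := by
  obtain ⟨a, rfl⟩ := exists_mk w
  rfl

theorem proj_surjective (hQ : Q.IsOriented) : Function.Surjective (proj e : P.Lift e → _) := by
  intro q
  obtain ⟨i, p, hp, rfl⟩ := (e.asdOrbifold hQ).cover q
  obtain ⟨m, hm⟩ := P.surjective (Q.φ i p.1)
  obtain ⟨S, hS, -⟩ := P.exists_slice hp.1 hm
  exact ⟨mk e ⟨i, S, (p, 0), S.zero_mem_source hS⟩, rfl⟩

/-- Two points over the same point of the bundle of anti-self-dual forms lie on one orbit. -/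
theorem exists_smul_eq {i j : Q.ι} (S : P.Slice i) (S' : P.Slice j) {p p' : E4 × E3}
    (hp : p.1 ∈ S.base) (hp' : p'.1 ∈ S'.base) (h : e.asdChart i p = e.asdChart j p') :
    ∃ z : Circle, z • mk e ⟨i, S, (p, 0), S.zero_mem_source hp⟩ =
      mk e ⟨j, S', (p', 0), S'.zero_mem_source hp'⟩ := by
  have hU := S.base_subset hp
  have hU' := S'.base_subset hp'
  rw [e.asdChart_of_mem hU, e.asdChart_of_mem hU', e.mkPoint_eq] at h
  obtain ⟨h, H, hs, hm, hb⟩ := h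
  simp only at H hs hm hb
  -- a sequence of generic points
  let W : Set E4 := S.base ∩ (h.source ∩ h ⁻¹' S'.base)
  have hW : IsOpen W := S.isOpen_base.inter (h.isOpen_inter_preimage S'.isOpen_base)
  have hpW : p.1 ∈ W := ⟨hp, hs, by rw [Set.mem_preimage, hm]; exact hp'⟩
  obtain ⟨y, hy, hyp⟩ := mem_closure_iff_seq_limit.1
    (Q.subset_closure_generic i hW (fun x hx => S.base_subset hx.1) hpW)
  -- Over a point with isotropy several rotations match the two slices, and they need not induce the
  -- derivative of the given h. Matching rotations at nearby generic points converge along a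
  -- subsequence, by compactness of the circle, to a ζ that is compatible with h.
  have hz : ∀ n, ∃ z : Circle, z • S.chart (y n, 0) = S'.chart (h (y n), 0) := by
    intro n
    refine (P.fiber _ _).1 ?_
    rw [S.proj _ (hy n).1.1, S'.proj _ (hy n).1.2.2, H.map _ (hy n).1.2.1]
  choose z hz using hz
  obtain ⟨ζ, -, ν, hν, hlim⟩ := isCompact_univ.tendsto_subseq (x := z) fun _ => trivial
  have hyν : Filter.Tendsto (fun n => y (ν n)) Filter.atTop (𝓝 p.1) := hyp.comp hν.tendsto_atTop
  have hcS : ContinuousAt (fun x => S.chart (x, 0)) p.1 :=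
    ContinuousAt.comp (g := S.chart) (f := fun x => (x, (0 : ℝ)))
      (S.chart.continuousAt (S.zero_mem_source hp)) (by fun_prop)
  have hcS' : ContinuousAt (fun x => S'.chart (h x, 0)) p.1 :=
    ContinuousAt.comp (g := S'.chart) (f := fun x => (h x, (0 : ℝ)))
      (S'.chart.continuousAt (by rw [hm]; exact S'.zero_mem_source hp'))
      ((h.continuousAt hs).prodMk continuousAt_const)
  have hζ : ζ • S.chart (p.1, 0) = S'.chart (p'.1, 0) := by
    have h1 := hlim.smul (hcS.tendsto.comp hyν)
    have h2 := hcS'.tendsto.comp hyν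
    rw [← hm]
    refine tendsto_nhds_unique (h1.congr fun n => ?_) h2
    exact hz (ν n)
  have hζt : ζ • S.chart (p.1, 0) ∈ (S.smul ζ).chart.target :=
    (S.smul ζ).chart.map_source (S.zero_mem_source hp)
  obtain ⟨k, K, -⟩ := (S.smul ζ).exists_covers S' hζt
    (by rw [hζ]; exact S'.chart.map_source (S'.zero_mem_source hp'))
  have hsymm : (S.smul ζ).chart.symm (ζ • S.chart (p.1, 0)) = (p.1, 0) :=
    (S.smul ζ).chart.left_inv (S.zero_mem_source hp)
  have hks : p.1 ∈ k.source := by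
    have := K.mem_source
    rwa [hsymm] at this
  have hkev : ∀ᶠ x in 𝓝 p.1, k x = (S'.chart.symm (ζ • S.chart (x, 0))).1 := by
    have hc : ContinuousAt (fun x => ζ • S.chart (x, 0)) p.1 := hcS.const_smul ζ
    filter_upwards [hc.eventually K.eventually, S.isOpen_base.mem_nhds hp] with x h1 h2
    rw [h1]
    congr 1
    have : (S.smul ζ).chart.symm (ζ • S.chart (x, 0)) = (x, 0) :=
      (S.smul ζ).chart.left_inv (S.zero_mem_source h2)
    rw [this]
  -- the two changes of charts agree to first order at the points of the sequence
  have hs0 : Filter.Tendsto (fun n => Complex.arg ((ζ * (z (ν n))⁻¹ : Circle) : ℂ))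
      Filter.atTop (𝓝 0) := by
    have h1 : Filter.Tendsto (fun n => ζ * (z (ν n))⁻¹) Filter.atTop (𝓝 1) := by
      have := (tendsto_const_nhds (x := ζ)).mul hlim.inv
      rwa [mul_inv_cancel] at this
    have h2 : ContinuousAt Complex.arg ((1 : Circle) : ℂ) :=
      Complex.continuousAt_arg (by simp)
    have h3 : Filter.Tendsto (fun z : Circle => Complex.arg (z : ℂ)) (𝓝 1) (𝓝 0) := by
      have := h2.tendsto.comp ((show Continuous fun z : Circle => (z : ℂ) by fun_prop).tendsto 1)
      rwa [Circle.coe_one, Complex.arg_one] at this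
    exact h3.comp h1
  -- For large n the rotation ζ · z⁻¹ at y (ν n) is small, so it stays within the slice S' and does
  -- not move the base component; hence k and h agree at this generic point, and therefore near it.
  have hD : ∀ᶠ n in Filter.atTop, fderiv ℝ k (y (ν n)) = fderiv ℝ h (y (ν n)) := by
    filter_upwards [hyν.eventually hkev, hyν.eventually hkev.eventually_nhds,
      hyν.eventually (k.open_source.mem_nhds hks),
      hs0.eventually (Ioo_mem_nhds (neg_lt_zero.2 S'.width_pos) S'.width_pos)] with n h1 _ h2 h3
    have hyn := hy (ν n)
    refine Filter.EventuallyEq.fderiv_eq ?_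
    refine Orbifold.eventually_eq_of_generic_of_transition H hyn.2 hyn.1.2.1
      (k.continuousAt h2) ?_ ?_
    · have h4 : ζ • S.chart (y (ν n), 0) =
          S'.chart (h (y (ν n)), Complex.arg ((ζ * (z (ν n))⁻¹ : Circle) : ℂ)) := by
        rw [S'.exp_smul _ hyn.1.2.2 _ h3, Circle.exp_arg, ← hz, ← mul_smul, inv_mul_cancel_right]
      rw [h1, h4, S'.chart.left_inv (S'.mem_source.2 ⟨hyn.1.2.2, h3⟩)]
    · filter_upwards [k.open_source.mem_nhds h2] with x hx
      exact K.isTransition.map x hx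
  have hDp : fderiv ℝ k p.1 = fderiv ℝ h p.1 := by
    have c1 : ContinuousAt (fderiv ℝ k) p.1 :=
      (K.isTransition.contDiffOn.continuousOn_fderiv_of_isOpen k.open_source
        (by simp)).continuousAt (k.open_source.mem_nhds hks)
    have c2 : ContinuousAt (fderiv ℝ h) p.1 :=
      (H.contDiffOn.continuousOn_fderiv_of_isOpen h.open_source
        (by simp)).continuousAt (h.open_source.mem_nhds hs)
    exact tendsto_nhds_unique ((c1.tendsto.comp hyν).congr' hD) (c2.tendsto.comp hyν)
  refine ⟨ζ, mk_eq.2 ⟨hζ, k, K, ?_⟩⟩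
  change (e.asd j p'.1 p'.2).compContinuousLinearMap (fderiv ℝ k p.1) = e.asd i p.1 p.2
  rw [hDp, hb]

variable [Nonempty (P.Lift e)]

/-- A small rotation can be absorbed in the angle: the rotated slice and S have the same base
component near the point, so the change of charts relating them is the identity. -/
theorem exp_smul_par (S : P.Slice i) {q : E4 × E3} {s t : ℝ} (ht : (q, t) ∈ dom S)
    (hst : (q, s + t) ∈ dom S) : Circle.exp s • par e S (q, t) = par e S (q, s + t) := by
  rw [par_of_mem S ht, par_of_mem S hst, smul_mk, mk_eq]
  have hpt : Circle.exp s • S.chart (q.1, t) = S.chart (q.1, s + t) := S.exp_smul_chart ht hst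
  refine LiftPoint.Rel.of_eventually_eq hpt rfl rfl ?_
  change ∀ᶠ m' in 𝓝 (Circle.exp s • S.chart (q.1, t)), (S.chart.symm m').1 =
    (S.chart.symm ((Circle.exp s)⁻¹ • m')).1
  rw [hpt]
  have hst' : (q.1, s + t) ∈ S.chart.source := hst
  have hmt := S.chart.map_source hst'
  have h0 : S.chart.symm (S.chart (q.1, s + t)) = (q.1, s + t) := S.chart.left_inv hst'
  have hc : ContinuousAt (fun m' => ((S.chart.symm m').1, -s + (S.chart.symm m').2))
      (S.chart (q.1, s + t)) :=
    (continuousAt_fst.comp (S.chart.continuousAt_symm hmt)).prodMk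
      (continuousAt_const.add (continuousAt_snd.comp (S.chart.continuousAt_symm hmt)))
  have hev := hc.eventually (S.chart.open_source.mem_nhds (by
    simp only [h0, neg_add_cancel_left]; exact ht))
  filter_upwards [S.chart.open_target.mem_nhds hmt, hev] with m' h1 h2
  have h3 := S.exp_smul_chart (y := (S.chart.symm m').1) (s := -s) (t := (S.chart.symm m').2)
    (S.chart.map_target h1) h2
  have h4 : S.chart ((S.chart.symm m').1, (S.chart.symm m').2) = m' := S.chart.right_inv h1
  rw [h4] at h3
  rw [← Circle.exp_neg, h3, S.chart.left_inv h2]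

theorem smul_par (z : Circle) (S : P.Slice i) {p : (E4 × E3) × ℝ} (hp : p ∈ dom S) :
    z • par e S p = par e (S.smul z) p := by
  rw [par_of_mem S hp, par_of_mem (S.smul z) hp]
  rfl

theorem exp_smul_par_zero (S : P.Slice i) {p : (E4 × E3) × ℝ} (hp : p ∈ dom S) :
    Circle.exp p.2 • par e S (p.1, 0) = par e S p := by
  have h0 : (p.1, (0 : ℝ)) ∈ dom S := S.zero_mem_source (S.mem_source.1 hp).1
  have := exp_smul_par (e := e) S (q := p.1) (s := p.2) h0 (by rw [add_zero]; exact hp)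
  rwa [add_zero] at this

theorem exists_exp_smul_mk (w : P.Lift e) : ∃ (i : Q.ι) (S : P.Slice i) (q : E4 × E3)
    (hq : q.1 ∈ S.base) (t : ℝ), w = Circle.exp t • mk e ⟨i, S, (q, 0), S.zero_mem_source hq⟩ := by
  obtain ⟨a, rfl⟩ := exists_mk w
  have hq := (a.S.mem_source.1 a.mem).1
  refine ⟨a.i, a.S, a.p.1, hq, a.p.2, ?_⟩
  have h := exp_smul_par_zero (e := e) a.S (p := a.p) a.mem
  rw [par_of_mem a.S (p := a.p) a.mem, par_of_mem a.S (p := (a.p.1, 0)) (a.S.zero_mem_source hq)]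
    at h
  exact h.symm

variable [hQ : Fact Q.IsOriented]

attribute [local instance] finrank_real_complex_fact'

instance : ContMDiffSMul (𝓡 1) 𝓘(ℝ, (E4 × E3) × ℝ) ∞ Circle (P.Lift e) where
  contMDiff_smul := by
    rintro ⟨z₀, w₀⟩
    obtain ⟨⟨i, S⟩, hS⟩ := exists_slice_target (pr w₀)
    have hp₀ := chart_mem_dom (e := e) S hS
    set p₀ := chart S w₀ with hp₀def
    -- Near z₀ every z is z₀ · exp(is) with s the argument of z₀⁻¹z, which is smooth near 0 because
    -- this quotient stays close to 1. In coordinates the action is a shift of the angle by s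
    -- followed by the rotated slice of z₀.
    let s : Circle × P.Lift e → ℝ := fun a => Complex.arg ((z₀⁻¹ * a.1 : Circle) : ℂ)
    have hs : ContMDiffAt ((𝓡 1).prod 𝓘(ℝ, (E4 × E3) × ℝ)) 𝓘(ℝ, ℝ) ∞ s (z₀, w₀) := by
      have h1 : ContDiffAt ℝ ∞ (fun u : ℂ => (Complex.log u).im) (((z₀⁻¹ * z₀ : Circle)) : ℂ) :=
        Complex.imCLM.contDiff.contDiffAt.comp _
          ((Complex.contDiffAt_log (by simp)).restrict_scalars ℝ)
      have : ContMDiffMul (𝓡 1) ∞ Circle := ContMDiffMul.of_le (n := ω) le_top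
      have hmul : ContMDiff (𝓡 1) (𝓡 1) ∞ (fun z : Circle => z₀⁻¹ * z) := contMDiff_mul_left
      have hcoe : ContMDiff (𝓡 1) 𝓘(ℝ, ℂ) ∞ (fun z : Circle => (z : ℂ)) :=
        contMDiff_coe_sphere (E := ℂ) (n := 1)
      have h2 : ContMDiff ((𝓡 1).prod 𝓘(ℝ, (E4 × E3) × ℝ)) 𝓘(ℝ, ℂ) ∞
          (fun a : Circle × P.Lift e => ((z₀⁻¹ * a.1 : Circle) : ℂ)) :=
        hcoe.comp (hmul.comp contMDiff_fst)
      have h3 : s = (fun u : ℂ => (Complex.log u).im) ∘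
          fun a : Circle × P.Lift e => ((z₀⁻¹ * a.1 : Circle) : ℂ) := by
        funext a
        simp only [s, Function.comp_apply, Complex.log_im]
      rw [h3]
      exact ContMDiffAt.comp (g := fun u : ℂ => (Complex.log u).im) (z₀, w₀) h1.contMDiffAt
        h2.contMDiffAt
    have hs0 : s (z₀, w₀) = 0 := by simp [s]
    have hc : ContMDiffAt ((𝓡 1).prod 𝓘(ℝ, (E4 × E3) × ℝ)) 𝓘(ℝ, (E4 × E3) × ℝ) ∞
        (fun a : Circle × P.Lift e => chart S a.2) (z₀, w₀) :=
      ContMDiffAt.comp (g := chart S) (z₀, w₀) (contMDiffAt_chart S hS) contMDiffAt_snd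
    have hadd : ContDiff ℝ ∞ (fun q : ℝ × ((E4 × E3) × ℝ) => ((q.2.1, q.1 + q.2.2) :
        (E4 × E3) × ℝ)) := by fun_prop
    have hF : ContMDiffAt ((𝓡 1).prod 𝓘(ℝ, (E4 × E3) × ℝ)) 𝓘(ℝ, (E4 × E3) × ℝ) ∞
        (fun a : Circle × P.Lift e => (((chart S a.2).1, s a + (chart S a.2).2) :
          (E4 × E3) × ℝ)) (z₀, w₀) :=
      ContMDiffAt.comp (g := fun q : ℝ × ((E4 × E3) × ℝ) => ((q.2.1, q.1 + q.2.2) :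
        (E4 × E3) × ℝ)) (z₀, w₀) hadd.contMDiff.contMDiffAt (hs.prodMk_space hc)
    have hF0 : (((chart S w₀).1, s (z₀, w₀) + (chart S w₀).2) : (E4 × E3) × ℝ) ∈ dom S := by
      rw [hs0, zero_add]; exact hp₀
    have hpar := contMDiffAt_par (e := e) (S.smul z₀)
      (p := ((chart S w₀).1, s (z₀, w₀) + (chart S w₀).2)) hF0
    refine (ContMDiffAt.comp (g := par e (S.smul z₀)) (z₀, w₀) hpar hF).congr_of_eventuallyEq ?_
    have hcs : ∀ᶠ a : Circle × P.Lift e in 𝓝 (z₀, w₀), pr a.2 ∈ S.chart.target :=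
      (continuous_pr.comp continuous_snd).continuousAt.eventually (S.chart.open_target.mem_nhds hS)
    filter_upwards [hcs, hF.continuousAt.eventually ((isOpen_dom S).mem_nhds hF0)] with a h1 h2
    have h3 : a.1 • a.2 = z₀ • Circle.exp (s a) • a.2 := by
      rw [Circle.exp_arg, ← mul_smul, mul_inv_cancel_left]
    have h4 := exp_smul_par (e := e) S (q := (chart S a.2).1) (t := (chart S a.2).2)
      (s := s a) (chart_mem_dom S h1) h2
    rw [Prod.mk.eta, par_chart S h1] at h4
    change a.1 • a.2 = par e (S.smul z₀) ((chart S a.2).1, s a + (chart S a.2).2)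
    rw [h3, h4, smul_par z₀ S h2]

/-- A chart gives a continuous local section of `pr` through w, so an open set of fixed points near
w produces one near `pr w` in P, where the action is effective. -/
theorem interior_fixed (z : Circle) (hz : z ≠ 1) : interior {w : P.Lift e | z • w = w} = ∅ := by
  refine Set.eq_empty_of_forall_notMem fun w hw => ?_
  obtain ⟨⟨i, S⟩, hS⟩ := exists_slice_target (pr w)
  have hS' : pr w ∈ S.chart.target := hS
  let σ : P.M → P.Lift e := fun m =>
    par e S (((S.chart.symm m).1, (chart S w).1.2), (S.chart.symm m).2)
  have hpr : ∀ m ∈ S.chart.target, pr (σ m) = m := fun m hm => by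
    have h1 : (((S.chart.symm m).1, (chart S w).1.2), (S.chart.symm m).2) ∈ dom S :=
      S.chart.map_target hm
    rw [pr_par S h1]
    exact S.chart.right_inv hm
  have hσw : σ (pr w) = w := by
    have h1 := pr_par (e := e) S (chart_mem_dom (e := e) S hS)
    rw [par_chart S hS] at h1
    have h2 : S.chart.symm (pr w) = ((chart S w).1.1, (chart S w).2) := by
      rw [h1]; exact S.chart.left_inv (chart_mem_dom S hS)
    change par e S (((S.chart.symm (pr w)).1, (chart S w).1.2), (S.chart.symm (pr w)).2) = w
    rw [h2]
    exact par_chart S hS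
  have hc : ContinuousAt σ (pr w) := by
    have h1 : (((S.chart.symm (pr w)).1, (chart S w).1.2), (S.chart.symm (pr w)).2) ∈ dom S :=
      S.chart.map_target hS
    have h2 := S.chart.continuousAt_symm hS'
    exact ContinuousAt.comp (g := par e S)
      (f := fun m => (((S.chart.symm m).1, (chart S w).1.2), (S.chart.symm m).2))
      (contMDiffAt_par (e := e) S h1).continuousAt
      (((continuousAt_fst.comp h2).prodMk continuousAt_const).prodMk (continuousAt_snd.comp h2))
  have hev : ∀ᶠ m in 𝓝 (pr w), z • m = m := by
    filter_upwards [hc.eventually (p := fun w' => z • w' = w')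
      (by rw [hσw]; exact mem_interior_iff_mem_nhds.1 hw), S.chart.open_target.mem_nhds hS']
      with m h1 h2
    have := congrArg pr h1
    rwa [pr_smul, hpr m h2] at this
  have h1 : pr w ∈ interior {m : P.M | z • m = m} := mem_interior_iff_mem_nhds.2 hev
  rw [P.effective z hz] at h1
  exact h1

end Lift

/-- The lift of a Seifert bundle to the bundle of anti-self-dual forms. -/
def lift (P : SeifertBundle Q) (e : Orbifold.OrthonormalFrame g) (hQ : Fact Q.IsOriented)
    (_ : Nonempty (P.Lift e)) : SeifertBundle (e.asdOrbifold hQ.1) where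
  M := P.Lift e
  effective := Lift.interior_fixed
  π := Lift.proj e
  surjective := Lift.proj_surjective hQ.1
  fiber w w' := by
    constructor
    · intro h
      obtain ⟨i, S, q, hq, t, rfl⟩ := Lift.exists_exp_smul_mk w
      obtain ⟨j, S', q', hq', t', rfl⟩ := Lift.exists_exp_smul_mk w'
      rw [Lift.proj_smul, Lift.proj_smul, Lift.proj_mk, Lift.proj_mk] at h
      obtain ⟨z, hz⟩ := Lift.exists_smul_eq S S' hq hq' h
      refine ⟨Circle.exp t' * z * (Circle.exp t)⁻¹, ?_⟩
      rw [mul_smul, inv_smul_smul, mul_smul, hz]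
    · rintro ⟨z, rfl⟩
      rw [Lift.proj_smul]
  slice i x hx := by
    obtain ⟨m, hm⟩ := P.surjective (Q.φ i x.1)
    obtain ⟨S, hS, -⟩ := P.exists_slice hx.1 hm
    refine ⟨fun q => Lift.par e S (q, 0), ?_, ?_⟩
    · have h1 : ∀ᶠ q : E4 × E3 in 𝓝 x, q.1 ∈ S.base :=
        continuousAt_fst.eventually (S.isOpen_base.mem_nhds hS)
      filter_upwards [h1] with q hq
      rw [Lift.par_of_mem S (p := (q, 0)) (S.zero_mem_source hq)]
      rfl
    · refine ⟨⟨(Lift.coord S).symm, Lift.isOpen_dom S, (Lift.chart S).open_source,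
        Lift.contMDiffOn_par S, Lift.contMDiffOn_chart S⟩, S.zero_mem_source hS, ?_⟩
      intro p hp
      exact Lift.exp_smul_par_zero S hp

/-- Covers the degenerate case of an empty base, in which the parametrisations `Lift.par` have no
default value; the empty manifold is then a Seifert bundle. -/
theorem nonempty_of_isEmpty {E : Type} [NormedAddCommGroup E] [NormedSpace ℝ E] {Y : Type u}
    [TopologicalSpace Y] [IsEmpty Y] (O : Orbifold E Y) : Nonempty (SeifertBundle O) := by
  let _ : ChartedSpace (E × ℝ) PEmpty.{u + 1} := ChartedSpace.empty _ _
  let _ : MulAction Circle PEmpty.{u + 1} :=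
    { smul := fun _ m => m, one_smul := fun m => m.elim, mul_smul := fun _ _ m => m.elim }
  have : IsManifold 𝓘(ℝ, E × ℝ) ∞ PEmpty.{u + 1} := IsManifold.empty _
  have : ContMDiffSMul (𝓡 1) 𝓘(ℝ, E × ℝ) ∞ Circle PEmpty.{u + 1} := ⟨fun m => m.2.elim⟩
  exact ⟨{ M := PEmpty
           effective := fun _ _ => Set.eq_empty_of_isEmpty _
           π := fun m => m.elim
           surjective := fun y => isEmptyElim y
           fiber := fun m => m.elim
           slice := fun i x _ => isEmptyElim (O.φ i x) }⟩

theorem nonempty_lift (P : SeifertBundle Q) (e : Orbifold.OrthonormalFrame g) (hQ : Q.IsOriented) :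
    Nonempty (SeifertBundle (e.asdOrbifold hQ)) := by
  by_cases h : Nonempty (P.Lift e)
  · exact ⟨P.lift e ⟨hQ⟩ h⟩
  · have : IsEmpty e.AsdSpace := ⟨fun q => h ⟨(Lift.proj_surjective (P := P) hQ q).choose⟩⟩
    exact nonempty_of_isEmpty _

end SeifertBundle

end LiftAction

/-! ### The Levi-Civita connection in an orthonormal frame -/

section LeviCivita

variable {X : Type u} [TopologicalSpace X] {Q : Orbifold E4 X} {g : Q.RiemannianMetric}

theorem ContinuousLinearMap.surjective_of_det_pos {f : E4 →L[ℝ] E4} (hf : 0 < f.det) :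
    Function.Surjective f := by
  have hu : IsUnit (LinearMap.det (f : E4 →ₗ[ℝ] E4)) := by
    rw [isUnit_iff_ne_zero]; exact hf.ne'
  rw [← LinearMap.isUnit_iff_isUnit_det, Module.End.isUnit_iff] at hu
  exact hu.2

theorem asdBasis_zero_apply (G : E4 →L[ℝ] E4 →L[ℝ] ℝ) (f : E4 →L[ℝ] E4) (v : Fin 2 → E4) :
    asdBasis G f 0 v = coframe G f 0 (v 0) * coframe G f 1 (v 1) -
      coframe G f 0 (v 1) * coframe G f 1 (v 0) - (coframe G f 2 (v 0) * coframe G f 3 (v 1) -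
      coframe G f 2 (v 1) * coframe G f 3 (v 0)) := by
  simp [asdBasis, wedge_oneForm]

theorem asdBasis_one_apply (G : E4 →L[ℝ] E4 →L[ℝ] ℝ) (f : E4 →L[ℝ] E4) (v : Fin 2 → E4) :
    asdBasis G f 1 v = coframe G f 0 (v 0) * coframe G f 2 (v 1) -
      coframe G f 0 (v 1) * coframe G f 2 (v 0) - (coframe G f 3 (v 0) * coframe G f 1 (v 1) -
      coframe G f 3 (v 1) * coframe G f 1 (v 0)) := by
  simp [asdBasis, wedge_oneForm]

theorem asdBasis_two_apply (G : E4 →L[ℝ] E4 →L[ℝ] ℝ) (f : E4 →L[ℝ] E4) (v : Fin 2 → E4) :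
    asdBasis G f 2 v = coframe G f 0 (v 0) * coframe G f 3 (v 1) -
      coframe G f 0 (v 1) * coframe G f 3 (v 0) - (coframe G f 1 (v 0) * coframe G f 2 (v 1) -
      coframe G f 1 (v 1) * coframe G f 2 (v 0)) := by
  simp [asdBasis, wedge_oneForm]

namespace Orbifold.OrthonormalFrame

variable (e : Orbifold.OrthonormalFrame g) {i : Q.ι} {x : E4}

theorem differentiableAt_metric (hx : x ∈ Q.U i) : DifferentiableAt ℝ (g.val i) x :=
  ((g.contDiffOn i).contDiffAt ((Q.isOpen_U i).mem_nhds hx)).differentiableAt (by simp)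

theorem differentiableAt_val (hx : x ∈ Q.U i) : DifferentiableAt ℝ (e.val i) x :=
  ((e.contDiffOn i).contDiffAt ((Q.isOpen_U i).mem_nhds hx)).differentiableAt (by simp)

theorem coframe_vec (hx : x ∈ Q.U i) (a b : Fin 4) :
    coframe (g.val i x) (e.val i x) a (e.vec i x b) = if a = b then 1 else 0 := by
  rw [coframe, vec, e.orthonormal i x hx, stdVec_inner]

theorem eq_sum_vec (hx : x ∈ Q.U i) (y : E4) :
    y = ∑ a, coframe (g.val i x) (e.val i x) a y • e.vec i x a := by
  obtain ⟨s, rfl⟩ := ContinuousLinearMap.surjective_of_det_pos (e.oriented i x hx) y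
  have h : ∀ a, coframe (g.val i x) (e.val i x) a (e.val i x s) = s a := by
    intro a
    rw [coframe, e.orthonormal i x hx]
    simp [stdVec, EuclideanSpace.inner_single_left]
  simp only [h, vec]
  conv_lhs => rw [E4_eq_sum s]
  simp only [map_add, map_smul, Fin.sum_univ_four]

theorem metric_eq_sum (hx : x ∈ Q.U i) (y z : E4) :
    g.val i x y z = ∑ a, coframe (g.val i x) (e.val i x) a y *
      coframe (g.val i x) (e.val i x) a z := by
  conv_lhs => rw [e.eq_sum_vec hx y]
  simp only [map_sum, map_smul, sum_apply, smul_apply, smul_eq_mul]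
  rfl

theorem metric_inj (e : Orbifold.OrthonormalFrame g) (hx : x ∈ Q.U i) {y z : E4} (h : ∀ w, g.val i x y w = g.val i x z w) :
    y = z := by
  rw [e.eq_sum_vec hx y, e.eq_sum_vec hx z]
  refine Finset.sum_congr rfl fun a _ => ?_
  congr 1
  rw [coframe, g.symm i x hx, g.symm i x hx _ z]
  exact h _

theorem fderiv_metric_symm (hx : x ∈ Q.U i) (w y z : E4) :
    fderiv ℝ (g.val i) x w y z = fderiv ℝ (g.val i) x w z y := by
  have hd := differentiableAt_metric (g := g) hx
  have h : ∀ y z, fderiv ℝ (g.val i) x w y z = fderiv ℝ (fun t => g.val i t y z) x w := by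
    intro y z
    have h1 := (((hd.hasFDerivAt.clm_apply (hasFDerivAt_const y x)).clm_apply
      (hasFDerivAt_const z x)).fderiv)
    rw [h1]
    simp
  rw [h, h]
  congr 1
  refine Filter.EventuallyEq.fderiv_eq ?_
  filter_upwards [(Q.isOpen_U i).mem_nhds hx] with t ht using g.symm i t ht y z

/-- Koszul's formula for an arbitrary y. The Christoffel symbols are defined by their components in
the orthonormal frame, and the right side is linear in y, so expanding y in the frame suffices. -/
theorem metric_christoffel (hx : x ∈ Q.U i) (w z y : E4) :
    g.val i x (e.christoffel i x w z) y = (1 / 2 : ℝ) * (fderiv ℝ (g.val i) x w z y +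
      fderiv ℝ (g.val i) x z w y - fderiv ℝ (g.val i) x y w z) := by
  have h1 : g.val i x (e.christoffel i x w z) y = ∑ a, ((1 / 2 : ℝ) *
      (fderiv ℝ (g.val i) x w z (e.vec i x a) + fderiv ℝ (g.val i) x z w (e.vec i x a) -
        fderiv ℝ (g.val i) x (e.vec i x a) w z)) * coframe (g.val i x) (e.val i x) a y := by
    simp only [christoffel, map_sum, map_smul, sum_apply, smul_apply, smul_eq_mul]
    rfl
  have h2 : ∀ L : E4 →L[ℝ] ℝ, L y = ∑ a, L (e.vec i x a) * coframe (g.val i x) (e.val i x) a y := by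
    intro L
    conv_lhs => rw [e.eq_sum_vec hx y]
    simp only [map_sum, map_smul, smul_eq_mul, mul_comm]
  have h3 : fderiv ℝ (g.val i) x y w z = ∑ a, fderiv ℝ (g.val i) x (e.vec i x a) w z *
      coframe (g.val i x) (e.val i x) a y :=
    h2 (((fderiv ℝ (g.val i) x).flip w).flip z)
  rw [h1, h2 (fderiv ℝ (g.val i) x w z), h2 (fderiv ℝ (g.val i) x z w), h3,
    ← Finset.sum_add_distrib, ← Finset.sum_sub_distrib, Finset.mul_sum]
  refine Finset.sum_congr rfl fun a _ => ?_
  ring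

theorem christoffel_symm (hx : x ∈ Q.U i) (w z : E4) :
    e.christoffel i x w z = e.christoffel i x z w := by
  refine e.metric_inj hx fun y => ?_
  rw [e.metric_christoffel hx, e.metric_christoffel hx, fderiv_metric_symm hx y w z]
  ring

/-- The Levi-Civita connection is metric. -/
theorem fderiv_metric (hx : x ∈ Q.U i) (w y z : E4) :
    fderiv ℝ (g.val i) x w y z = g.val i x (e.christoffel i x w y) z +
      g.val i x y (e.christoffel i x w z) := by
  rw [g.symm i x hx y, e.metric_christoffel hx, e.metric_christoffel hx,
    fderiv_metric_symm hx w z y]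
  ring

/-- The connection forms `A_{ab} = g(e_a, ∇e_b)` of the frame. -/
def connForm (i : Q.ι) (x : E4) (a b : Fin 4) : E4 →L[ℝ] ℝ :=
  (g.val i x (e.vec i x a)).comp ((fderiv ℝ (e.val i) x).flip (stdVec b)) +
    (1 / 2 : ℝ) • (((fderiv ℝ (g.val i) x).flip (e.vec i x b)).flip (e.vec i x a) +
      (fderiv ℝ (g.val i) x (e.vec i x b)).flip (e.vec i x a) -
      (fderiv ℝ (g.val i) x (e.vec i x a)).flip (e.vec i x b))

/-- The covariant derivative of a vector of the frame. -/
def nablaVec (i : Q.ι) (x : E4) (b : Fin 4) (w : E4) : E4 :=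
  fderiv ℝ (e.val i) x w (stdVec b) + e.christoffel i x w (e.vec i x b)

/-- The definition of `connForm` spells out Koszul's formula so that linearity in w and smoothness
in x are visible; this is its geometric meaning, the coefficient of e_a in ∇e_b. -/
theorem connForm_apply (hx : x ∈ Q.U i) (a b : Fin 4) (w : E4) :
    e.connForm i x a b w = coframe (g.val i x) (e.val i x) a (e.nablaVec i x b w) := by
  rw [nablaVec, map_add, coframe, g.symm i x hx _ (e.christoffel i x w _),
    e.metric_christoffel hx]
  simp only [connForm, add_apply, ContinuousLinearMap.comp_apply, ContinuousLinearMap.flip_apply,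
    smul_apply, sub_apply, smul_eq_mul, vec]

theorem nablaVec_eq_sum (hx : x ∈ Q.U i) (b : Fin 4) (w : E4) :
    e.nablaVec i x b w = ∑ a, e.connForm i x a b w • e.vec i x a := by
  conv_lhs => rw [e.eq_sum_vec hx (e.nablaVec i x b w)]
  simp only [e.connForm_apply hx]

theorem hasFDerivAt_metric_vec (hx : x ∈ Q.U i) (a : Fin 4) :
    HasFDerivAt (fun t => e.vec i t a) ((fderiv ℝ (e.val i) x).flip (stdVec a)) x := by
  have h := (e.differentiableAt_val hx).hasFDerivAt.clm_apply (hasFDerivAt_const (stdVec a) x)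
  refine h.congr_fderiv ?_
  ext w : 1
  simp

/-- Differentiate g(e_a, e_b) = δ_ab and use that the connection is metric. -/
theorem connForm_antisymm (hx : x ∈ Q.U i) (a b : Fin 4) (w : E4) :
    e.connForm i x a b w = - e.connForm i x b a w := by
  have h1 := ((differentiableAt_metric (g := g) hx).hasFDerivAt.clm_apply
    (e.hasFDerivAt_metric_vec hx a)).clm_apply (e.hasFDerivAt_metric_vec hx b)
  have h2 : HasFDerivAt (fun t => g.val i t (e.vec i t a) (e.vec i t b)) (0 : E4 →L[ℝ] ℝ) x := by
    refine (hasFDerivAt_const (if a = b then (1 : ℝ) else 0) x).congr_of_eventuallyEq ?_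
    filter_upwards [(Q.isOpen_U i).mem_nhds hx] with t ht using e.coframe_vec ht a b
  have h3 := congrArg (fun L => L w) (h1.unique h2)
  simp only [add_apply, ContinuousLinearMap.comp_apply, ContinuousLinearMap.flip_apply,
    zero_apply, e.fderiv_metric hx w] at h3
  rw [e.connForm_apply hx, e.connForm_apply hx, nablaVec, nablaVec, map_add, map_add, coframe,
    coframe, g.symm i x hx (e.val i x (stdVec b)), g.symm i x hx (e.val i x (stdVec b))]
  simp only [vec] at h3 ⊢
  linarith

/-- Differentiating g(e_a, z) with the metric connection gives g(∇e_a, z) + g(e_a, Γ(w, z)); the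
first term is expanded in the frame. -/
theorem hasFDerivAt_coframe (hx : x ∈ Q.U i) (a : Fin 4) (z : E4) :
    ∃ L : E4 →L[ℝ] ℝ, HasFDerivAt (fun t => coframe (g.val i t) (e.val i t) a z) L x ∧
      ∀ w, L w = coframe (g.val i x) (e.val i x) a (e.christoffel i x w z) +
        ∑ b, e.connForm i x b a w * coframe (g.val i x) (e.val i x) b z := by
  refine ⟨_, ((differentiableAt_metric (g := g) hx).hasFDerivAt.clm_apply
    (e.hasFDerivAt_metric_vec hx a)).clm_apply (hasFDerivAt_const z x), fun w => ?_⟩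
  have h := e.metric_eq_sum hx (e.nablaVec i x a w) z
  simp only [← e.connForm_apply hx] at h
  rw [← h]
  simp only [add_apply, ContinuousLinearMap.comp_apply, ContinuousLinearMap.flip_apply,
    zero_apply, map_zero, e.fderiv_metric hx w, nablaVec, map_add, coframe]
  simp only [vec]
  ring

/-- The connection forms of the bundle of anti-self-dual forms. -/
def asdConn (i : Q.ι) (x : E4) : Fin 3 → E4 →L[ℝ] ℝ :=
  ![e.connForm i x 0 1 - e.connForm i x 2 3, e.connForm i x 0 2 - e.connForm i x 3 1,
    e.connForm i x 0 3 - e.connForm i x 1 2]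

/-- Covariant differentiation rotates the coframe by the antisymmetric matrix A. On Λ⁻ only the
anti-self-dual combinations of A act, by the vector product of ℝ³, which gives this formula with
indices modulo 3; the Christoffel terms cancel. -/
theorem covDerivAsd_eq (hx : x ∈ Q.U i) (k : Fin 3) (w z y : E4) :
    e.covDerivAsd i x k w z y =
      e.asdConn i x (k + 2) w * asdBasis (g.val i x) (e.val i x) (k + 1) ![z, y] -
      e.asdConn i x (k + 1) w * asdBasis (g.val i x) (e.val i x) (k + 2) ![z, y] := by
  choose L hL hLw using e.hasFDerivAt_coframe hx
  have han := e.connForm_antisymm hx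
  have hd : ∀ a, e.connForm i x a a w = 0 := fun a => by linarith [han a a w]
  have key : ∀ a b c d : Fin 4, fderiv ℝ (fun t =>
      coframe (g.val i t) (e.val i t) a z * coframe (g.val i t) (e.val i t) b y -
      coframe (g.val i t) (e.val i t) a y * coframe (g.val i t) (e.val i t) b z -
      (coframe (g.val i t) (e.val i t) c z * coframe (g.val i t) (e.val i t) d y -
      coframe (g.val i t) (e.val i t) c y * coframe (g.val i t) (e.val i t) d z)) x w =
      coframe (g.val i x) (e.val i x) a z * L b y w + coframe (g.val i x) (e.val i x) b y * L a z w -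
      (coframe (g.val i x) (e.val i x) a y * L b z w +
        coframe (g.val i x) (e.val i x) b z * L a y w) -
      (coframe (g.val i x) (e.val i x) c z * L d y w +
        coframe (g.val i x) (e.val i x) d y * L c z w -
      (coframe (g.val i x) (e.val i x) c y * L d z w +
        coframe (g.val i x) (e.val i x) d z * L c y w)) := by
    intro a b c d
    refine (congrArg (fun L : E4 →L[ℝ] ℝ => L w)
      (((((hL a z).mul (hL b y)).sub ((hL a y).mul (hL b z))).sub
        (((hL c z).mul (hL d y)).sub ((hL c y).mul (hL d z))))).fderiv).trans ?_
    simp only [add_apply, sub_apply, smul_apply, smul_eq_mul]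
  fin_cases k
  · simp only [covDerivAsd, Fin.zero_eta, Fin.isValue, zero_add, asdBasis_zero_apply,
      asdBasis_one_apply, asdBasis_two_apply, Matrix.cons_val_zero, Matrix.cons_val_one, key,
      asdConn, Matrix.cons_val, sub_apply, hLw,
      Fin.sum_univ_four, hd]
    rw [han 1 0, han 2 0, han 3 0, han 2 1, han 3 1, han 3 2]
    ring
  · simp only [covDerivAsd, Fin.mk_one, Fin.isValue, Fin.reduceAdd, asdBasis_zero_apply,
      asdBasis_one_apply, asdBasis_two_apply, Matrix.cons_val_zero, Matrix.cons_val_one, key,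
      asdConn, Matrix.cons_val, sub_apply, hLw,
      Fin.sum_univ_four, hd]
    rw [han 1 0, han 2 0, han 3 0, han 2 1, han 3 1, han 3 2]
    ring
  · simp only [covDerivAsd, Fin.reduceFinMk, Fin.isValue, Fin.reduceAdd, asdBasis_zero_apply,
      asdBasis_one_apply, asdBasis_two_apply, Matrix.cons_val_zero, Matrix.cons_val_one, key,
      asdConn, sub_apply, hLw,
      Fin.sum_univ_four, hd]
    rw [han 1 0, han 2 0, han 3 0, han 2 1, han 3 1, han 3 2]
    ring

theorem sum_asdBasis_mul (hx : x ∈ Q.U i) (k l : Fin 3) :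
    ∑ a, ∑ b, asdBasis (g.val i x) (e.val i x) k ![e.vec i x a, e.vec i x b] *
      asdBasis (g.val i x) (e.val i x) l ![e.vec i x a, e.vec i x b] = if k = l then 4 else 0 := by
  fin_cases k <;> fin_cases l <;>
    simp [asdBasis_zero_apply, asdBasis_one_apply, asdBasis_two_apply, e.coframe_vec hx,
      Fin.sum_univ_four] <;> norm_num

/-- The forms ω_k are orthogonal and the double sum of ω_k ω_k over the frame is 4, so contraction
with ω_l and the factor 1/4 read off the coefficient of ω_l. -/
theorem asdConnection_eq (hx : x ∈ Q.U i) (l k : Fin 3) (w : E4) :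
    e.asdConnection i x l k w = e.asdConn i x (k + 2) w * (if k + 1 = l then 1 else 0) -
      e.asdConn i x (k + 1) w * (if k + 2 = l then 1 else 0) := by
  have h1 := e.sum_asdBasis_mul hx (k + 1) l
  have h2 := e.sum_asdBasis_mul hx (k + 2) l
  simp only [asdConnection, e.covDerivAsd_eq hx, sub_mul, mul_assoc, Finset.sum_sub_distrib,
    ← Finset.mul_sum, h1, h2]
  split_ifs <;> ring

/-- The cyclic formula α_k = da_k + a_{k+2} A_{k+1} - a_{k+1} A_{k+2}, in which the later algebra is
carried out. -/
theorem verticalForm_apply {p : E4 × E3} (hp : p.1 ∈ Q.U i) (k : Fin 3) (v : E4 × E3) :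
    e.verticalForm i k p v = v.2 k + p.2 (k + 2) * e.asdConn i p.1 (k + 1) v.1 -
      p.2 (k + 1) * e.asdConn i p.1 (k + 2) v.1 := by
  have hlin : ∀ c : E4 →L[ℝ] ℝ, c v.1 = ∑ m, c (stdVec m) * v.1 m := by
    intro c
    conv_lhs => rw [E4_eq_sum v.1]
    simp only [map_add, map_smul, smul_eq_mul, Fin.sum_univ_four]
    ring
  have h1 : e.verticalForm i k p v = v.2 k + ∑ l, p.2 l * ∑ m, e.asdConnection i p.1 k l (stdVec m) *
      v.1 m := by
    simp only [verticalForm, add_apply, sum_apply, smul_apply, ContinuousLinearMap.comp_apply,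
      smul_eq_mul, Finset.mul_sum, mul_assoc]
    rfl
  have h2 : ∀ l, ∑ m, e.asdConnection i p.1 k l (stdVec m) * v.1 m =
      e.asdConn i p.1 (l + 2) v.1 * (if l + 1 = k then 1 else 0) -
        e.asdConn i p.1 (l + 1) v.1 * (if l + 2 = k then 1 else 0) := by
    intro l
    rw [hlin (e.asdConn i p.1 (l + 2)), hlin (e.asdConn i p.1 (l + 1)), Finset.sum_mul,
      Finset.sum_mul, ← Finset.sum_sub_distrib]
    refine Finset.sum_congr rfl fun m _ => ?_
    rw [e.asdConnection_eq hp]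
    ring
  rw [h1]
  simp only [h2, Fin.sum_univ_three]
  fin_cases k <;> simp <;> ring

end Orbifold.OrthonormalFrame

end LeviCivita

/-! ### Structure equations -/

section StructureEquations

variable {X : Type u} [TopologicalSpace X] {Q : Orbifold E4 X} {g : Q.RiemannianMetric}

theorem asdBasis_swap (G : E4 →L[ℝ] E4 →L[ℝ] ℝ) (f : E4 →L[ℝ] E4) (k : Fin 3) (z y : E4) :
    asdBasis G f k ![z, y] = - asdBasis G f k ![y, z] := by
  fin_cases k <;>
    simp only [Fin.zero_eta, Fin.mk_one, Fin.reduceFinMk, asdBasis_zero_apply, asdBasis_one_apply,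
      asdBasis_two_apply, Matrix.cons_val_zero, Matrix.cons_val_one] <;> ring

namespace Orbifold.OrthonormalFrame

variable (e : Orbifold.OrthonormalFrame g) {i : Q.ι} {x : E4}

set_option maxSynthPendingDepth 3 in
theorem contDiffOn_fderiv_metric_apply {i : Q.ι} {w y z : E4 → E4}
    (hw : ContDiffOn ℝ ∞ w (Q.U i)) (hy : ContDiffOn ℝ ∞ y (Q.U i))
    (hz : ContDiffOn ℝ ∞ z (Q.U i)) :
    ContDiffOn ℝ ∞ (fun t => fderiv ℝ (g.val i) t (w t) (y t) (z t)) (Q.U i) :=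
  ((((g.contDiffOn i).fderiv_of_isOpen (Q.isOpen_U i) (m := ∞) (by simp)).clm_apply hw).clm_apply
    hy).clm_apply hz

theorem contDiffOn_fderiv_val (i : Q.ι) : ContDiffOn ℝ ∞ (fderiv ℝ (e.val i)) (Q.U i) :=
  (e.contDiffOn i).fderiv_of_isOpen (Q.isOpen_U i) (by simp)

theorem contDiffOn_vec (i : Q.ι) (a : Fin 4) : ContDiffOn ℝ ∞ (fun t => e.vec i t a) (Q.U i) :=
  (e.contDiffOn i).clm_apply contDiffOn_const

theorem contDiffOn_coframe (i : Q.ι) (a : Fin 4) :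
    ContDiffOn ℝ ∞ (fun t => coframe (g.val i t) (e.val i t) a) (Q.U i) :=
  (g.contDiffOn i).clm_apply (e.contDiffOn_vec i a)

theorem contDiffOn_asdBasis (i : Q.ι) (k : Fin 3) :
    ContDiffOn ℝ ∞ (fun t => asdBasis (g.val i t) (e.val i t) k) (Q.U i) := by
  refine contDiffOn_form fun v => ?_
  have h : ∀ a y, ContDiffOn ℝ ∞ (fun t => coframe (g.val i t) (e.val i t) a y) (Q.U i) :=
    fun a y => (e.contDiffOn_coframe i a).clm_apply contDiffOn_const
  fin_cases k <;>
    simp only [Fin.zero_eta, Fin.mk_one, Fin.reduceFinMk, asdBasis_zero_apply, asdBasis_one_apply,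
      asdBasis_two_apply] <;>
    exact (((h _ _).mul (h _ _)).sub ((h _ _).mul (h _ _))).sub
      (((h _ _).mul (h _ _)).sub ((h _ _).mul (h _ _)))

theorem connForm_apply_eq (i : Q.ι) (t : E4) (a b : Fin 4) (w : E4) :
    e.connForm i t a b w = coframe (g.val i t) (e.val i t) a (fderiv ℝ (e.val i) t w (stdVec b)) +
      (1 / 2 : ℝ) * (fderiv ℝ (g.val i) t w (e.vec i t b) (e.vec i t a) +
        fderiv ℝ (g.val i) t (e.vec i t b) w (e.vec i t a) -
        fderiv ℝ (g.val i) t (e.vec i t a) w (e.vec i t b)) := by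
  simp only [connForm, add_apply, ContinuousLinearMap.comp_apply, ContinuousLinearMap.flip_apply,
    smul_apply, sub_apply, smul_eq_mul]
  rfl

theorem contDiffOn_connForm_apply (i : Q.ι) (a b : Fin 4) (w : E4) :
    ContDiffOn ℝ ∞ (fun t => e.connForm i t a b w) (Q.U i) := by
  simp only [connForm_apply_eq]
  have ha := e.contDiffOn_vec i a
  have hb := e.contDiffOn_vec i b
  have hw : ContDiffOn ℝ ∞ (fun _ : E4 => w) (Q.U i) := contDiffOn_const
  have h1 : ContDiffOn ℝ ∞ (fun t => coframe (g.val i t) (e.val i t) a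
      (fderiv ℝ (e.val i) t w (stdVec b))) (Q.U i) :=
    (e.contDiffOn_coframe i a).clm_apply (((e.contDiffOn_fderiv_val i).clm_apply
      contDiffOn_const).clm_apply contDiffOn_const)
  have h2 := contDiffOn_fderiv_metric_apply (g := g) hw hb ha
  have h3 := contDiffOn_fderiv_metric_apply (g := g) hb hw ha
  have h4 := contDiffOn_fderiv_metric_apply (g := g) ha hw hb
  exact h1.add (contDiffOn_const.mul ((h2.add h3).sub h4))

theorem contDiffOn_connForm (i : Q.ι) (a b : Fin 4) :
    ContDiffOn ℝ ∞ (fun t => e.connForm i t a b) (Q.U i) :=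
  contDiffOn_clm_apply.2 (e.contDiffOn_connForm_apply i a b)

theorem contDiffOn_asdConn (i : Q.ι) (k : Fin 3) :
    ContDiffOn ℝ ∞ (fun t => e.asdConn i t k) (Q.U i) := by
  fin_cases k <;> exact (e.contDiffOn_connForm i _ _).sub (e.contDiffOn_connForm i _ _)

theorem contDiffOn_christoffel (i : Q.ι) (w z : E4) :
    ContDiffOn ℝ ∞ (fun t => e.christoffel i t w z) (Q.U i) := by
  refine ContDiffOn.sum fun a _ => ?_
  have ha := e.contDiffOn_vec i a
  exact (contDiffOn_const.mul
    (((contDiffOn_fderiv_metric_apply contDiffOn_const contDiffOn_const ha).add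
      (contDiffOn_fderiv_metric_apply contDiffOn_const contDiffOn_const ha)).sub
      (contDiffOn_fderiv_metric_apply ha contDiffOn_const contDiffOn_const))).smul ha

/-- The Christoffel symbols as a linear map in the second argument. -/
def christoffelL (i : Q.ι) (x w : E4) : E4 →L[ℝ] E4 :=
  LinearMap.toContinuousLinearMap
    { toFun := e.christoffel i x w
      map_add' := fun y z => by
        simp only [christoffel, ← Finset.sum_add_distrib, ← add_smul, map_add, add_apply]
        refine Finset.sum_congr rfl fun a _ => ?_
        congr 1
        ring
      map_smul' := fun c y => by
        simp only [christoffel, Finset.smul_sum, smul_smul, map_smul, smul_apply, smul_eq_mul,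
          RingHom.id_apply]
        refine Finset.sum_congr rfl fun a _ => ?_
        congr 1
        ring }

theorem christoffelL_apply (i : Q.ι) (x w z : E4) :
    e.christoffelL i x w z = e.christoffel i x w z := rfl

theorem differentiableAt_christoffelL (hx : x ∈ Q.U i) (w : E4) :
    DifferentiableAt ℝ (fun t => e.christoffelL i t w) x := by
  have h : ContDiffOn ℝ ∞ (fun t => e.christoffelL i t w) (Q.U i) := by
    rw [contDiffOn_clm_apply]
    exact e.contDiffOn_christoffel i w
  exact (h.contDiffAt ((Q.isOpen_U i).mem_nhds hx)).differentiableAt (by simp)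

theorem fderiv_christoffel (hx : x ∈ Q.U i) (z y w : E4) :
    fderiv ℝ (fun t => e.christoffel i t z y) x w =
      fderiv ℝ (fun t => e.christoffelL i t z) x w y := by
  have h := ((e.differentiableAt_christoffelL hx z).hasFDerivAt.clm_apply
    (hasFDerivAt_const y x)).fderiv
  simp only [christoffelL_apply] at h
  rw [h]
  simp

theorem differentiableAt_connForm (hx : x ∈ Q.U i) (a b : Fin 4) :
    DifferentiableAt ℝ (fun t => e.connForm i t a b) x :=
  ((e.contDiffOn_connForm i a b).contDiffAt ((Q.isOpen_U i).mem_nhds hx)).differentiableAt (by simp)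

/-- The derivative of the covariant derivative of a vector of the frame, computed in two ways. -/
theorem fderiv_nablaVec (hx : x ∈ Q.U i) (b : Fin 4) (z w : E4) :
    fderiv ℝ (fderiv ℝ (e.val i)) x w z (stdVec b) +
        (fderiv ℝ (fun t => e.christoffelL i t z) x w (e.vec i x b) +
          e.christoffel i x z (fderiv ℝ (e.val i) x w (stdVec b))) =
      ∑ a, (fderiv ℝ (fun t => e.connForm i t a b) x w z • e.vec i x a +
        e.connForm i x a b z • fderiv ℝ (e.val i) x w (stdVec a)) := by
  have hf : DifferentiableAt ℝ (fderiv ℝ (e.val i)) x :=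
    ((e.contDiffOn_fderiv_val i).contDiffAt ((Q.isOpen_U i).mem_nhds hx)).differentiableAt (by simp)
  have h1 := ((hf.hasFDerivAt.clm_apply (hasFDerivAt_const z x)).clm_apply
    (hasFDerivAt_const (stdVec b) x)).add
    ((e.differentiableAt_christoffelL hx z).hasFDerivAt.clm_apply (e.hasFDerivAt_metric_vec hx b))
  have h2 := HasFDerivAt.fun_sum (u := Finset.univ) fun a _ =>
    ((e.differentiableAt_connForm hx a b).hasFDerivAt.clm_apply (hasFDerivAt_const z x)).fun_smul
      (e.hasFDerivAt_metric_vec hx a)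
  have h3 := h1.unique (h2.congr_of_eventuallyEq (by
    filter_upwards [(Q.isOpen_U i).mem_nhds hx] with t ht
    exact e.nablaVec_eq_sum ht b z))
  have h4 := congrArg (fun L => L w) h3
  simp only [add_apply, ContinuousLinearMap.comp_apply, ContinuousLinearMap.flip_apply,
    zero_apply, map_zero, zero_add, sum_apply, smul_apply, ContinuousLinearMap.smulRight_apply,
    christoffelL_apply] at h4
  rw [add_comm (e.christoffel i x z _) _] at h4
  rw [h4]
  refine Finset.sum_congr rfl fun a _ => ?_
  rw [add_comm]

/-- Cartan's second structure equation. -/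
theorem coframe_curvature (hx : x ∈ Q.U i) (a b : Fin 4) (w z : E4) :
    coframe (g.val i x) (e.val i x) a (e.curvature i x w z (e.vec i x b)) =
      fderiv ℝ (fun t => e.connForm i t a b) x w z - fderiv ℝ (fun t => e.connForm i t a b) x z w +
        ∑ c, (e.connForm i x a c w * e.connForm i x c b z -
          e.connForm i x a c z * e.connForm i x c b w) := by
  set T := coframe (g.val i x) (e.val i x) a
  -- The identity `fderiv_nablaVec` is used with (z, w) and (w, z). In the difference the second
  -- derivatives of the frame cancel by symmetry, and the Christoffel terms assemble to the
  -- curvature.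
  have hsymm : fderiv ℝ (fderiv ℝ (e.val i)) x w z = fderiv ℝ (fderiv ℝ (e.val i)) x z w :=
    (((e.contDiffOn i).contDiffAt ((Q.isOpen_U i).mem_nhds hx)).isSymmSndFDerivAt
      (by simp [minSmoothness_of_isRCLikeNormedField]; exact two_le_infty)).eq w z
  have h1 := congrArg T (e.fderiv_nablaVec hx b z w)
  have h2 := congrArg T (e.fderiv_nablaVec hx b w z)
  have hN : ∀ c v, T (fderiv ℝ (e.val i) x v (stdVec c)) = e.connForm i x a c v -
      T (e.christoffel i x v (e.vec i x c)) := by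
    intro c v
    rw [e.connForm_apply hx, nablaVec, map_add]
    ring
  have hΓ : ∀ v v', T (e.christoffel i x v (fderiv ℝ (e.val i) x v' (stdVec b))) =
      ∑ c, e.connForm i x c b v' * T (e.christoffel i x v (e.vec i x c)) -
        T (e.christoffel i x v (e.christoffel i x v' (e.vec i x b))) := by
    intro v v'
    have h3 : fderiv ℝ (e.val i) x v' (stdVec b) = e.nablaVec i x b v' -
        e.christoffel i x v' (e.vec i x b) := by
      rw [nablaVec, add_sub_cancel_right]
    rw [h3, e.nablaVec_eq_sum hx, ← christoffelL_apply, map_sub, map_sub, map_sum, map_sum]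
    simp only [map_smul, smul_eq_mul, christoffelL_apply]
  have hTv : ∀ c, T (e.vec i x c) = if a = c then 1 else 0 := e.coframe_vec hx a
  simp only [map_add, map_sum, map_smul, smul_eq_mul, hN, hΓ, hTv] at h1 h2
  rw [curvature, map_sub, map_add, map_sub, e.fderiv_christoffel hx, e.fderiv_christoffel hx]
  rw [hsymm] at h1
  simp only [mul_ite, mul_one, mul_zero, Finset.sum_add_distrib, Finset.sum_ite_eq,
    Finset.mem_univ, if_true, mul_sub, Finset.sum_sub_distrib] at h1 h2 ⊢
  simp only [mul_comm (e.connForm i x a _ _)]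
  linarith

/-- The derivative of the anti-self-dual forms of the frame. -/
theorem fderiv_asdBasis (hx : x ∈ Q.U i) (k : Fin 3) (w z y : E4) :
    fderiv ℝ (fun t => asdBasis (g.val i t) (e.val i t) k ![z, y]) x w =
      e.asdConn i x (k + 2) w * asdBasis (g.val i x) (e.val i x) (k + 1) ![z, y] -
      e.asdConn i x (k + 1) w * asdBasis (g.val i x) (e.val i x) (k + 2) ![z, y] +
      asdBasis (g.val i x) (e.val i x) k ![e.christoffel i x w z, y] +
      asdBasis (g.val i x) (e.val i x) k ![z, e.christoffel i x w y] := by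
  rw [← e.covDerivAsd_eq hx, covDerivAsd]
  ring

/-- The exterior derivative of the anti-self-dual forms of the frame. -/
theorem cyclic_fderiv_asdBasis (hx : x ∈ Q.U i) (k : Fin 3) (w z y : E4) :
    fderiv ℝ (fun t => asdBasis (g.val i t) (e.val i t) k ![z, y]) x w -
      fderiv ℝ (fun t => asdBasis (g.val i t) (e.val i t) k ![w, y]) x z +
      fderiv ℝ (fun t => asdBasis (g.val i t) (e.val i t) k ![w, z]) x y =
    (e.asdConn i x (k + 2) w * asdBasis (g.val i x) (e.val i x) (k + 1) ![z, y] -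
      e.asdConn i x (k + 2) z * asdBasis (g.val i x) (e.val i x) (k + 1) ![w, y] +
      e.asdConn i x (k + 2) y * asdBasis (g.val i x) (e.val i x) (k + 1) ![w, z]) -
    (e.asdConn i x (k + 1) w * asdBasis (g.val i x) (e.val i x) (k + 2) ![z, y] -
      e.asdConn i x (k + 1) z * asdBasis (g.val i x) (e.val i x) (k + 2) ![w, y] +
      e.asdConn i x (k + 1) y * asdBasis (g.val i x) (e.val i x) (k + 2) ![w, z]) := by
  -- Since the connection has no torsion, the Christoffel terms cancel in the cyclic sum, and only
  -- the rotation by A is left.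
  rw [e.fderiv_asdBasis hx, e.fderiv_asdBasis hx, e.fderiv_asdBasis hx,
    e.christoffel_symm hx z w, e.christoffel_symm hx z y, e.christoffel_symm hx y w,
    asdBasis_swap _ _ k (e.christoffel i x w y) z]
  ring

/-- The curvature of the bundle of anti-self-dual forms of a self-dual Einstein metric. -/
theorem curvature_asdConn {l : ℝ} (hE : e.IsEinstein l) (hW : e.IsSelfDual) (hx : x ∈ Q.U i)
    (k : Fin 3) (w z : E4) :
    fderiv ℝ (fun t => e.asdConn i t k) x w z - fderiv ℝ (fun t => e.asdConn i t k) x z w =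
      l / 3 * asdBasis (g.val i x) (e.val i x) k ![w, z] -
      (e.asdConn i x (k + 1) w * e.asdConn i x (k + 2) z -
        e.asdConn i x (k + 1) z * e.asdConn i x (k + 2) w) := by
  have hscal : e.scal i x = 4 * l := by
    have h : ∀ a, g.val i x (e.vec i x a) (e.vec i x a) = 1 := fun a =>
      (e.coframe_vec hx a a).trans (if_pos rfl)
    simp only [scal, hE i x hx, h, Fin.sum_univ_four]
    ring
  -- For Ric = l g and scalar curvature 4l the corrections in the Weyl tensor add up to the
  -- curvature of a space form: -l + 4l/6 = -l/3.
  have hweyl : ∀ a b, e.weyl i x w z (e.vec i x a) (e.vec i x b) =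
      coframe (g.val i x) (e.val i x) a (e.curvature i x w z (e.vec i x b)) -
      l / 3 * (coframe (g.val i x) (e.val i x) a w * coframe (g.val i x) (e.val i x) b z -
        coframe (g.val i x) (e.val i x) b w * coframe (g.val i x) (e.val i x) a z) := by
    intro a b
    have hs : ∀ v c, g.val i x v (e.vec i x c) = coframe (g.val i x) (e.val i x) c v :=
      fun v c => g.symm i x hx _ _
    simp only [weyl, hE i x hx, hscal, hs]
    ring
  have han := e.connForm_antisymm hx
  have hd : ∀ a v, e.connForm i x a a v = 0 := fun a v => by linarith [han a a v]
  have hdan : ∀ a b v v', fderiv ℝ (fun t => e.connForm i t a b) x v v' =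
      - fderiv ℝ (fun t => e.connForm i t b a) x v v' := by
    intro a b v v'
    have h1 : (fun t => e.connForm i t a b) =ᶠ[𝓝 x] fun t => - e.connForm i t b a := by
      filter_upwards [(Q.isOpen_U i).mem_nhds hx] with t ht
      ext y
      exact e.connForm_antisymm ht a b y
    rw [h1.fderiv_eq, fderiv_fun_neg]
    rfl
  have hsub : ∀ a b a' b' v v', fderiv ℝ (fun t => e.connForm i t a b - e.connForm i t a' b') x v v' =
      fderiv ℝ (fun t => e.connForm i t a b) x v v' -
        fderiv ℝ (fun t => e.connForm i t a' b') x v v' := by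
    intro a b a' b' v v'
    rw [fderiv_fun_sub (e.differentiableAt_connForm hx a b) (e.differentiableAt_connForm hx a' b')]
    rfl
  -- Contraction with ω_k selects the anti-self-dual part of the curvature two-forms, where the Weyl
  -- tensor drops out and only the space form part remains.
  have hk := hW i x hx w z k
  simp only [hweyl, e.coframe_curvature hx, Fin.sum_univ_four, hd] at hk
  fin_cases k
  · simp only [Fin.zero_eta, zero_add, Fin.isValue, asdBasis_zero_apply, Matrix.cons_val_zero,
      Matrix.cons_val_one, e.coframe_vec hx, asdConn, Matrix.cons_val, sub_apply, hsub] at hk ⊢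
    simp only [Fin.reduceEq, if_true, if_false, han 1 0, han 2 0, han 3 0, han 2 1, han 3 1, han 3 2,
      hdan 1 0, hdan 2 0, hdan 3 0, hdan 2 1, hdan 3 1, hdan 3 2] at hk ⊢
    linarith
  · simp only [Fin.mk_one, Fin.reduceAdd, Fin.isValue, asdBasis_one_apply, Matrix.cons_val_zero,
      Matrix.cons_val_one, e.coframe_vec hx, asdConn, Matrix.cons_val, sub_apply, hsub] at hk ⊢
    simp only [Fin.reduceEq, if_true, if_false, han 1 0, han 2 0, han 3 0, han 2 1, han 3 1, han 3 2,
      hdan 1 0, hdan 2 0, hdan 3 0, hdan 2 1, hdan 3 1, hdan 3 2] at hk ⊢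
    linarith
  · simp only [Fin.reduceFinMk, Fin.reduceAdd, Fin.isValue, asdBasis_two_apply, Matrix.cons_val_zero,
      Matrix.cons_val_one, e.coframe_vec hx, asdConn, Matrix.cons_val, sub_apply, hsub] at hk ⊢
    simp only [Fin.reduceEq, if_true, if_false, han 1 0, han 2 0, han 3 0, han 2 1, han 3 1, han 3 2,
      hdan 1 0, hdan 2 0, hdan 3 0, hdan 2 1, hdan 3 1, hdan 3 2] at hk ⊢
    linarith

end Orbifold.OrthonormalFrame

end StructureEquations

/-! ### The Bryant–Salamon form is closed -/

section BryantSalamonClosed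

variable {X : Type u} [TopologicalSpace X] {Q : Orbifold E4 X} {g : Q.RiemannianMetric}

theorem wedge_oneForm_two {E : Type v} [NormedAddCommGroup E] [NormedSpace ℝ E] (θ : E →L[ℝ] ℝ)
    (β : E [⋀^Fin 2]→L[ℝ] ℝ) (v : Fin 3 → E) :
    wedge (oneForm θ) β v =
      θ (v 0) * β ![v 1, v 2] - θ (v 1) * β ![v 0, v 2] + θ (v 2) * β ![v 0, v 1] := by
  have h0 : Fin.removeNth 0 v = ![v 1, v 2] := by funext j; fin_cases j <;> rfl
  have h1 : Fin.removeNth 1 v = ![v 0, v 2] := by funext j; fin_cases j <;> rfl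
  have h2 : Fin.removeNth 2 v = ![v 0, v 1] := by funext j; fin_cases j <;> rfl
  refine (wedge_oneForm_left θ β v).trans ?_
  refine (oneWedge_apply θ β v).trans ?_
  rw [Fin.sum_univ_three, h0, h1, h2]
  simp
  ring

theorem wedge_oneForm_three {E : Type v} [NormedAddCommGroup E] [NormedSpace ℝ E]
    (θ₀ θ₁ θ₂ : E →L[ℝ] ℝ) (v : Fin 3 → E) :
    wedge (wedge (oneForm θ₀) (oneForm θ₁)) (oneForm θ₂) v =
      θ₀ (v 0) * (θ₁ (v 1) * θ₂ (v 2) - θ₁ (v 2) * θ₂ (v 1)) -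
      θ₀ (v 1) * (θ₁ (v 0) * θ₂ (v 2) - θ₁ (v 2) * θ₂ (v 0)) +
      θ₀ (v 2) * (θ₁ (v 0) * θ₂ (v 1) - θ₁ (v 1) * θ₂ (v 0)) := by
  refine (wedge_assoc (oneForm θ₀) (oneForm θ₁) (oneForm θ₂) v).trans ?_
  refine (wedge_oneForm_two θ₀ (wedge (oneForm θ₁) (oneForm θ₂)) v).trans ?_
  simp only [wedge_oneForm, Matrix.cons_val_zero, Matrix.cons_val_one]

/-- The determinant of the values of three linear functionals on three of the given vectors. -/
def detVal {J : Type*} (a b c : J → ℝ) (j₀ j₁ j₂ : J) : ℝ :=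
  a j₀ * (b j₁ * c j₂ - b j₂ * c j₁) - a j₁ * (b j₀ * c j₂ - b j₂ * c j₀) +
    a j₂ * (b j₀ * c j₁ - b j₁ * c j₀)

/-- The wedge product of a linear functional and a two-form. -/
def wedgeVal {J : Type*} (a : J → ℝ) (w : J → J → ℝ) (j₀ j₁ j₂ : J) : ℝ :=
  a j₀ * w j₁ j₂ - a j₁ * w j₀ j₂ + a j₂ * w j₀ j₁

/-! ### Multilinear identities behind the closedness of the form. -/

section Algebra

variable {a c : Fin 3 → Fin 4 → ℝ} {x : Fin 3 → ℝ} {D w : Fin 3 → Fin 4 → Fin 4 → ℝ} {l : ℝ}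
  {Dw : Fin 3 → Fin 4 → Fin 4 → Fin 4 → ℝ}

/-- Here a_k, c_k and w_k are the values of α_k, A_k and ω_k on four vectors, x is the fibre point,
and D k m j is the derivative of α_k(v_j) along v_m. Then `hD` is dα_k = α_{k+2}∧A_{k+1} -
α_{k+1}∧A_{k+2} + (l/3)(x_{k+2} ω_{k+1} - x_{k+1} ω_{k+2}). In d(α₀∧α₁∧α₂) the connection terms
repeat a factor α and vanish; the curvature terms give -(l/3)(∑ x_k α_k) ∧ ∑ α_k∧ω_k. -/
theorem alternate_det (hD : ∀ k m j, D k j m = D k m j -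
      ((a (k + 2) m * c (k + 1) j - a (k + 2) j * c (k + 1) m) -
        (a (k + 1) m * c (k + 2) j - a (k + 1) j * c (k + 2) m) +
        l / 3 * (x (k + 2) * w (k + 1) m j - x (k + 1) * w (k + 2) m j)))
    {T : Fin 4 → Fin 4 → Fin 4 → Fin 4 → ℝ}
    (hT : ∀ m j₀ j₁ j₂, T m j₀ j₁ j₂ = detVal (D 0 m) (a 1) (a 2) j₀ j₁ j₂ +
      detVal (a 0) (D 1 m) (a 2) j₀ j₁ j₂ + detVal (a 0) (a 1) (D 2 m) j₀ j₁ j₂)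
    {S : Fin 4 → Fin 4 → Fin 4 → ℝ} (hS : ∀ j₀ j₁ j₂, S j₀ j₁ j₂ = wedgeVal (a 0) (w 0) j₀ j₁ j₂ +
      wedgeVal (a 1) (w 1) j₀ j₁ j₂ + wedgeVal (a 2) (w 2) j₀ j₁ j₂)
    {z : Fin 4 → ℝ} (hz : ∀ j, z j = x 0 * a 0 j + x 1 * a 1 j + x 2 * a 2 j) :
    T 0 1 2 3 - T 1 0 2 3 + T 2 0 1 3 - T 3 0 1 2 =
      -(l / 3) * (z 0 * S 1 2 3 - z 1 * S 0 2 3 + z 2 * S 0 1 3 - z 3 * S 0 1 2) := by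
  simp only [hT, hS, hz, detVal, wedgeVal]
  -- Only the derivatives with j > m are rewritten; the antisymmetric differences are thereby
  -- eliminated and `ring` can close the goal.
  rw [hD 0 0 1, hD 0 0 2, hD 0 0 3, hD 0 1 2, hD 0 1 3, hD 0 2 3, hD 1 0 1, hD 1 0 2, hD 1 0 3,
    hD 1 1 2, hD 1 1 3, hD 1 2 3, hD 2 0 1, hD 2 0 2, hD 2 0 3, hD 2 1 2, hD 2 1 3, hD 2 2 3]
  simp only [Fin.isValue, zero_add, Fin.reduceAdd]
  ring

/-- This is d(∑ α_k∧ω_k) = 0, where `hDw` is dω_k = A_{k+2}∧ω_{k+1} - A_{k+1}∧ω_{k+2}. The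
connection terms of dα_k and dω_k cancel, and the curvature terms cancel in the cyclic sum because
two-forms commute. -/
theorem alternate_wedge (hD : ∀ k m j, D k j m = D k m j -
      ((a (k + 2) m * c (k + 1) j - a (k + 2) j * c (k + 1) m) -
        (a (k + 1) m * c (k + 2) j - a (k + 1) j * c (k + 2) m) +
        l / 3 * (x (k + 2) * w (k + 1) m j - x (k + 1) * w (k + 2) m j)))
    (hDw : ∀ k j₀ j₁ j₂, Dw k j₀ j₁ j₂ = Dw k j₁ j₀ j₂ - Dw k j₂ j₀ j₁ +
      wedgeVal (c (k + 2)) (w (k + 1)) j₀ j₁ j₂ - wedgeVal (c (k + 1)) (w (k + 2)) j₀ j₁ j₂)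
    {S : Fin 4 → Fin 4 → Fin 4 → Fin 4 → ℝ}
    (hS : ∀ m j₀ j₁ j₂, S m j₀ j₁ j₂ = ∑ k, (wedgeVal (D k m) (w k) j₀ j₁ j₂ +
      wedgeVal (a k) (Dw k m) j₀ j₁ j₂)) :
    S 0 1 2 3 - S 1 0 2 3 + S 2 0 1 3 - S 3 0 1 2 = 0 := by
  simp only [hS, wedgeVal, Fin.sum_univ_three] at hDw ⊢
  rw [hD 0 0 1, hD 0 0 2, hD 0 0 3, hD 0 1 2, hD 0 1 3, hD 0 2 3, hD 1 0 1, hD 1 0 2, hD 1 0 3,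
    hD 1 1 2, hD 1 1 3, hD 1 2 3, hD 2 0 1, hD 2 0 2, hD 2 0 3, hD 2 1 2, hD 2 1 3, hD 2 2 3,
    hDw 0 0 1 2, hDw 0 0 1 3, hDw 0 0 2 3, hDw 0 1 2 3, hDw 1 0 1 2, hDw 1 0 1 3, hDw 1 0 2 3,
    hDw 1 1 2 3, hDw 2 0 1 2, hDw 2 0 1 3, hDw 2 0 2 3, hDw 2 1 2 3]
  simp only [Fin.isValue, zero_add, Fin.reduceAdd]
  ring

/-- The one-form ∑ x_k α_k is a combination of the three factors of α₀∧α₁∧α₂. -/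
theorem alternate_mul_det {z : Fin 4 → ℝ} (hz : ∀ j, z j = x 0 * a 0 j + x 1 * a 1 j + x 2 * a 2 j) :
    z 0 * detVal (a 0) (a 1) (a 2) 1 2 3 - z 1 * detVal (a 0) (a 1) (a 2) 0 2 3 +
      z 2 * detVal (a 0) (a 1) (a 2) 0 1 3 - z 3 * detVal (a 0) (a 1) (a 2) 0 1 2 = 0 := by
  simp only [hz, detVal]
  ring

theorem hasFDerivAt_detVal {F J : Type*} [NormedAddCommGroup F] [NormedSpace ℝ F]
    {a b c : F → J → ℝ} {La Lb Lc : J → F →L[ℝ] ℝ} {p : F}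
    (ha : ∀ j, HasFDerivAt (fun q => a q j) (La j) p)
    (hb : ∀ j, HasFDerivAt (fun q => b q j) (Lb j) p)
    (hc : ∀ j, HasFDerivAt (fun q => c q j) (Lc j) p) (j₀ j₁ j₂ : J) :
    ∃ L : F →L[ℝ] ℝ, HasFDerivAt (fun q => detVal (a q) (b q) (c q) j₀ j₁ j₂) L p ∧
      ∀ w, L w = detVal (fun j => La j w) (b p) (c p) j₀ j₁ j₂ +
        detVal (a p) (fun j => Lb j w) (c p) j₀ j₁ j₂ +
        detVal (a p) (b p) (fun j => Lc j w) j₀ j₁ j₂ := by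
  have h : ∀ k l m, _ := fun k l m => (ha k).mul (((hb l).mul (hc m)).sub ((hb m).mul (hc l)))
  refine ⟨_, ((h j₀ j₁ j₂).sub (h j₁ j₀ j₂)).add (h j₂ j₀ j₁), fun w => ?_⟩
  simp only [add_apply, sub_apply, smul_apply, smul_eq_mul, detVal, Pi.mul_apply, Pi.sub_apply]
  ring

theorem hasFDerivAt_wedgeVal {F J : Type*} [NormedAddCommGroup F] [NormedSpace ℝ F]
    {a : F → J → ℝ} {b : F → J → J → ℝ} {La : J → F →L[ℝ] ℝ} {Lb : J → J → F →L[ℝ] ℝ} {p : F}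
    (ha : ∀ j, HasFDerivAt (fun q => a q j) (La j) p)
    (hb : ∀ j j', HasFDerivAt (fun q => b q j j') (Lb j j') p) (j₀ j₁ j₂ : J) :
    ∃ L : F →L[ℝ] ℝ, HasFDerivAt (fun q => wedgeVal (a q) (b q) j₀ j₁ j₂) L p ∧
      ∀ w, L w = wedgeVal (fun j => La j w) (b p) j₀ j₁ j₂ +
        wedgeVal (a p) (fun j j' => Lb j j' w) j₀ j₁ j₂ := by
  have h : ∀ k l m, _ := fun k l m => (ha k).mul (hb l m)
  refine ⟨_, ((h j₀ j₁ j₂).sub (h j₁ j₀ j₂)).add (h j₂ j₀ j₁), fun w => ?_⟩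
  simp only [add_apply, sub_apply, smul_apply, smul_eq_mul, wedgeVal]
  ring

end Algebra

namespace Orbifold.OrthonormalFrame

variable (e : Orbifold.OrthonormalFrame g) {i : Q.ι}

theorem bryantSalamon_apply (l r : ℝ) (i : Q.ι) (p : E4 × E3) (v : Fin 3 → E4 × E3) :
    e.bryantSalamon l r i p v =
      (r + 2 / 3 * l * ‖p.2‖ ^ 2) ^ (-(3 / 4) : ℝ) * detVal (fun j => e.verticalForm i 0 p (v j))
        (fun j => e.verticalForm i 1 p (v j)) (fun j => e.verticalForm i 2 p (v j)) 0 1 2 +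
      (r + 2 / 3 * l * ‖p.2‖ ^ 2) ^ (1 / 4 : ℝ) * ∑ k, wedgeVal (fun j => e.verticalForm i k p (v j))
        (fun j j' => asdBasis (g.val i p.1) (e.val i p.1) k ![(v j).1, (v j').1]) 0 1 2 := by
  have h : ∀ (k : Fin 3) (y z : E4 × E3),
      (asdBasis (g.val i p.1) (e.val i p.1) k).compContinuousLinearMap
        (ContinuousLinearMap.fst ℝ E4 E3) ![y, z] =
      asdBasis (g.val i p.1) (e.val i p.1) k ![y.1, z.1] := by
    intro k y z
    rw [ContinuousAlternatingMap.compContinuousLinearMap_apply]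
    congr 1
    funext j
    fin_cases j <;> rfl
  have h1 := wedge_oneForm_three (e.verticalForm i 0 p) (e.verticalForm i 1 p)
    (e.verticalForm i 2 p) v
  have h2 : ∀ k, wedge (oneForm (e.verticalForm i k p))
      ((asdBasis (g.val i p.1) (e.val i p.1) k).compContinuousLinearMap
        (ContinuousLinearMap.fst ℝ E4 E3)) v = wedgeVal (fun j => e.verticalForm i k p (v j))
        (fun j j' => asdBasis (g.val i p.1) (e.val i p.1) k ![(v j).1, (v j').1]) 0 1 2 := by
    intro k
    refine (wedge_oneForm_two (e.verticalForm i k p) _ v).trans ?_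
    simp only [h, wedgeVal]
  rw [detVal, ← h1]
  simp only [← h2]
  simp only [bryantSalamon, ContinuousAlternatingMap.add_apply,
    ContinuousAlternatingMap.smul_apply, smul_eq_mul]
  congr 1

theorem hasFDerivAt_verticalForm {p : E4 × E3} (hp : p.1 ∈ Q.U i) (k : Fin 3) (v : E4 × E3) :
    ∃ L : (E4 × E3) →L[ℝ] ℝ, HasFDerivAt (fun q => e.verticalForm i k q v) L p ∧
      ∀ w, L w = w.2 (k + 2) * e.asdConn i p.1 (k + 1) v.1 +
        p.2 (k + 2) * fderiv ℝ (fun t => e.asdConn i t (k + 1)) p.1 w.1 v.1 -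
        (w.2 (k + 1) * e.asdConn i p.1 (k + 2) v.1 +
          p.2 (k + 1) * fderiv ℝ (fun t => e.asdConn i t (k + 2)) p.1 w.1 v.1) := by
  have hc : ∀ m, HasFDerivAt (fun q : E4 × E3 => e.asdConn i q.1 m v.1)
      (((fderiv ℝ (fun t => e.asdConn i t m) p.1).flip v.1).comp
        (ContinuousLinearMap.fst ℝ E4 E3)) p := by
    intro m
    have h1 : DifferentiableAt ℝ (fun t => e.asdConn i t m) p.1 :=
      ((e.contDiffOn_asdConn i m).contDiffAt ((Q.isOpen_U i).mem_nhds hp)).differentiableAt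
        (by simp)
    have h2 : HasFDerivAt (fun t => e.asdConn i t m v.1)
        ((fderiv ℝ (fun t => e.asdConn i t m) p.1).flip v.1) p.1 := by
      refine (h1.hasFDerivAt.clm_apply (hasFDerivAt_const v.1 p.1)).congr_fderiv ?_
      ext w : 1
      simp
    exact HasFDerivAt.comp (g := fun t => e.asdConn i t m v.1) p h2 hasFDerivAt_fst
  have ha : ∀ m : Fin 3, HasFDerivAt (fun q : E4 × E3 => q.2 m)
      ((EuclideanSpace.proj m : E3 →L[ℝ] ℝ).comp (ContinuousLinearMap.snd ℝ E4 E3)) p :=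
    fun m => ((EuclideanSpace.proj m : E3 →L[ℝ] ℝ).comp
      (ContinuousLinearMap.snd ℝ E4 E3)).hasFDerivAt
  have h := (((ha (k + 2)).mul (hc (k + 1))).const_add (v.2 k)).sub ((ha (k + 1)).mul (hc (k + 2)))
  refine ⟨_, h.congr_of_eventuallyEq ?_, fun w => ?_⟩
  · filter_upwards [((Q.isOpen_U i).preimage continuous_fst).mem_nhds hp] with q hq
    exact e.verticalForm_apply hq k v
  · simp only [add_apply, sub_apply, smul_apply, smul_eq_mul, ContinuousLinearMap.comp_apply,
      ContinuousLinearMap.flip_apply]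
    change p.2 (k + 2) * fderiv ℝ (fun t => e.asdConn i t (k + 1)) p.1 w.1 v.1 +
      e.asdConn i p.1 (k + 1) v.1 * w.2 (k + 2) -
      (p.2 (k + 1) * fderiv ℝ (fun t => e.asdConn i t (k + 2)) p.1 w.1 v.1 +
      e.asdConn i p.1 (k + 2) v.1 * w.2 (k + 1)) = _
    ring

theorem hasFDerivAt_asdBasis {p : E4 × E3} (hp : p.1 ∈ Q.U i) (k : Fin 3) (y z : E4) :
    HasFDerivAt (fun q : E4 × E3 => asdBasis (g.val i q.1) (e.val i q.1) k ![y, z])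
      ((fderiv ℝ (fun t => asdBasis (g.val i t) (e.val i t) k ![y, z]) p.1).comp
        (ContinuousLinearMap.fst ℝ E4 E3)) p := by
  have h1 : DifferentiableAt ℝ (fun t => asdBasis (g.val i t) (e.val i t) k ![y, z]) p.1 :=
    ((contDiffOn_form_apply (e.contDiffOn_asdBasis i k) _).contDiffAt
      ((Q.isOpen_U i).mem_nhds hp)).differentiableAt (by simp)
  exact HasFDerivAt.comp (g := fun t => asdBasis (g.val i t) (e.val i t) k ![y, z]) p
    h1.hasFDerivAt hasFDerivAt_fst

theorem hasFDerivAt_rpow_norm {l r : ℝ} (hl : 0 < l) (hr : 0 < r) (s : ℝ) (p : E4 × E3) :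
    ∃ L : (E4 × E3) →L[ℝ] ℝ, HasFDerivAt (fun q : E4 × E3 => (r + 2 / 3 * l * ‖q.2‖ ^ 2) ^ s) L p ∧
      ∀ w, L w = s * (r + 2 / 3 * l * ‖p.2‖ ^ 2) ^ (s - 1) *
        (4 / 3 * l * (p.2 0 * w.2 0 + p.2 1 * w.2 1 + p.2 2 * w.2 2)) := by
  have h1 : HasFDerivAt (fun q : E4 × E3 => ‖q.2‖ ^ 2)
      ((2 • (innerSL ℝ p.2)).comp (ContinuousLinearMap.snd ℝ E4 E3)) p :=
    HasFDerivAt.comp (g := fun a : E3 => ‖a‖ ^ 2) p (hasStrictFDerivAt_norm_sq p.2).hasFDerivAt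
      hasFDerivAt_snd
  have hpos : 0 < r + 2 / 3 * l * ‖p.2‖ ^ 2 := by positivity
  have h2 := ((h1.const_mul (2 / 3 * l)).const_add r).rpow_const (p := s) (Or.inl hpos.ne')
  refine ⟨_, h2, fun w => ?_⟩
  have h3 : inner ℝ p.2 w.2 = p.2 0 * w.2 0 + p.2 1 * w.2 1 + p.2 2 * w.2 2 := by
    rw [PiLp.inner_apply, Fin.sum_univ_three]
    simp [mul_comm]
  simp only [smul_apply, ContinuousLinearMap.comp_apply, smul_eq_mul,
    innerSL_apply_apply, ContinuousLinearMap.coe_snd', h3, nsmul_eq_mul]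
  push_cast
  ring

theorem contDiffOn_verticalForm_apply (i : Q.ι) (k : Fin 3) (v : E4 × E3) :
    ContDiffOn ℝ ∞ (fun q => e.verticalForm i k q v) (Q.U i ×ˢ Set.univ) := by
  have hc : ∀ m, ContDiffOn ℝ ∞ (fun q : E4 × E3 => e.asdConn i q.1 m v.1)
      (Q.U i ×ˢ Set.univ) := by
    intro m
    have h : ContDiffOn ℝ ∞ (fun t => e.asdConn i t m v.1) (Q.U i) :=
      (e.contDiffOn_asdConn i m).clm_apply contDiffOn_const
    exact h.comp contDiffOn_fst fun _ hq => hq.1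
  have ha : ∀ m : Fin 3, ContDiffOn ℝ ∞ (fun q : E4 × E3 => (q.2 m : ℝ)) (Q.U i ×ˢ Set.univ) :=
    fun m => ((EuclideanSpace.proj m : E3 →L[ℝ] ℝ).contDiff.comp contDiff_snd).contDiffOn
  have hv : ContDiffOn ℝ ∞ (fun _ : E4 × E3 => (v.2 k : ℝ)) (Q.U i ×ˢ Set.univ) :=
    contDiffOn_const
  refine ((hv.add ((ha (k + 2)).mul (hc (k + 1)))).sub
    ((ha (k + 1)).mul (hc (k + 2)))).congr fun q hq => ?_
  exact e.verticalForm_apply hq.1 k v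

theorem contDiffOn_bryantSalamon {l r : ℝ} (hl : 0 < l) (hr : 0 < r) (i : Q.ι) :
    ContDiffOn ℝ ∞ (e.bryantSalamon l r i) (Q.U i ×ˢ Set.univ) := by
  refine contDiffOn_form fun v => ?_
  simp only [bryantSalamon_apply, detVal, wedgeVal]
  have hα := e.contDiffOn_verticalForm_apply i
  have hb : ∀ (k : Fin 3) (y z : E4), ContDiffOn ℝ ∞ (fun q : E4 × E3 =>
      asdBasis (g.val i q.1) (e.val i q.1) k ![y, z]) (Q.U i ×ˢ Set.univ) := by
    intro k y z
    have h := contDiffOn_form_apply (e.contDiffOn_asdBasis i k) ![y, z]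
    exact h.comp contDiffOn_fst fun _ hq => hq.1
  have hn : ∀ s : ℝ, ContDiffOn ℝ ∞ (fun q : E4 × E3 => (r + 2 / 3 * l * ‖q.2‖ ^ 2) ^ s)
      (Q.U i ×ˢ Set.univ) := by
    intro s
    have h1 : ContDiff ℝ ∞ (fun q : E4 × E3 => r + 2 / 3 * l * ‖q.2‖ ^ 2) :=
      contDiff_const.add (contDiff_const.mul (contDiff_snd.norm_sq ℝ))
    refine h1.contDiffOn.rpow_const_of_ne fun q _ => ?_
    have : 0 < r + 2 / 3 * l * ‖q.2‖ ^ 2 := by positivity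
    exact this.ne'
  have hD : ∀ a b c : E4 × E3, ContDiffOn ℝ ∞ (fun q => e.verticalForm i 0 q a *
      (e.verticalForm i 1 q b * e.verticalForm i 2 q c -
        e.verticalForm i 1 q c * e.verticalForm i 2 q b)) (Q.U i ×ˢ Set.univ) :=
    fun a b c => (hα 0 a).mul (((hα 1 b).mul (hα 2 c)).sub ((hα 1 c).mul (hα 2 b)))
  exact ((hn _).mul (((hD _ _ _).sub (hD _ _ _)).add (hD _ _ _))).add
    ((hn _).mul (ContDiffOn.sum fun k _ => (((hα k _).mul (hb k _ _)).sub
      ((hα k _).mul (hb k _ _))).add ((hα k _).mul (hb k _ _))))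

/-- Write φ₀ = U α₀∧α₁∧α₂ + V ∑ α_k∧ω_k. Both dU and dV are multiples of z = ∑ a_k α_k, so dU ∧
α₀∧α₁∧α₂ = 0 and d(∑ α_k∧ω_k) = 0 leave U d(α₀∧α₁∧α₂) + dV ∧ ∑ α_k∧ω_k, and these cancel since dV =
(l/3) U z. -/
theorem extDeriv_bryantSalamon {l r : ℝ} (hl : 0 < l) (hr : 0 < r) (hE : e.IsEinstein l)
    (hW : e.IsSelfDual) {p : E4 × E3} (hp : p.1 ∈ Q.U i) :
    extDeriv (e.bryantSalamon l r i) p = 0 := by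
  have hdiff : DifferentiableAt ℝ (e.bryantSalamon l r i) p :=
    ((e.contDiffOn_bryantSalamon hl hr i).contDiffAt
      (((Q.isOpen_U i).prod isOpen_univ).mem_nhds ⟨hp, trivial⟩)).differentiableAt (by simp)
  ext v
  let c : Fin 3 → Fin 4 → ℝ := fun k j => e.asdConn i p.1 k (v j).1
  let w : E4 × E3 → Fin 3 → Fin 4 → Fin 4 → ℝ := fun q k j j' =>
    asdBasis (g.val i q.1) (e.val i q.1) k ![(v j).1, (v j').1]
  let a : E4 × E3 → Fin 3 → Fin 4 → ℝ := fun q k j => e.verticalForm i k q (v j)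
  choose La hLa hLaw using fun k j => e.hasFDerivAt_verticalForm hp k (v j)
  have hLb : ∀ k j j', HasFDerivAt (fun q => w q k j j') _ p :=
    fun k j j' => e.hasFDerivAt_asdBasis hp k (v j).1 (v j').1
  obtain ⟨LU, hLU, hLUw⟩ := hasFDerivAt_rpow_norm hl hr (-(3 / 4)) p
  obtain ⟨LV, hLV, hLVw⟩ := hasFDerivAt_rpow_norm hl hr (1 / 4) p
  set U := (r + 2 / 3 * l * ‖p.2‖ ^ 2) ^ (-(3 / 4) : ℝ)
  set V := (r + 2 / 3 * l * ‖p.2‖ ^ 2) ^ (1 / 4 : ℝ)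
  let D : Fin 3 → Fin 4 → Fin 4 → ℝ := fun k m j => La k j (v m)
  let Dw : Fin 3 → Fin 4 → Fin 4 → Fin 4 → ℝ := fun k m j j' =>
    fderiv ℝ (fun t => asdBasis (g.val i t) (e.val i t) k ![(v j).1, (v j').1]) p.1 (v m).1
  let z : Fin 4 → ℝ := fun j => p.2 0 * a p 0 j + p.2 1 * a p 1 j + p.2 2 * a p 2 j
  have ha : ∀ k j, a p k j = (v j).2 k + p.2 (k + 2) * c (k + 1) j - p.2 (k + 1) * c (k + 2) j :=
    fun k j => e.verticalForm_apply hp k (v j)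
  -- In ∑ a_k α_k the connection terms cancel by antisymmetry, so z is half the differential of
  -- |a|².
  have hz : ∀ j, p.2 0 * (v j).2 0 + p.2 1 * (v j).2 1 + p.2 2 * (v j).2 2 = z j := by
    intro j
    simp only [z, ha, Fin.isValue, zero_add, Fin.reduceAdd]
    ring
  let T : Fin 4 → Fin 4 → Fin 4 → Fin 4 → ℝ := fun m j₀ j₁ j₂ =>
    detVal (D 0 m) (a p 1) (a p 2) j₀ j₁ j₂ + detVal (a p 0) (D 1 m) (a p 2) j₀ j₁ j₂ +
      detVal (a p 0) (a p 1) (D 2 m) j₀ j₁ j₂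
  let S : Fin 4 → Fin 4 → Fin 4 → ℝ := fun j₀ j₁ j₂ => wedgeVal (a p 0) (w p 0) j₀ j₁ j₂ +
      wedgeVal (a p 1) (w p 1) j₀ j₁ j₂ + wedgeVal (a p 2) (w p 2) j₀ j₁ j₂
  let R : Fin 4 → Fin 4 → Fin 4 → Fin 4 → ℝ := fun m j₀ j₁ j₂ =>
    ∑ k, (wedgeVal (D k m) (w p k) j₀ j₁ j₂ + wedgeVal (a p k) (Dw k m) j₀ j₁ j₂)
  have hval : ∀ m j₀ j₁ j₂ : Fin 4, fderiv ℝ (fun q => e.bryantSalamon l r i q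
      ![v j₀, v j₁, v j₂]) p (v m) = LU (v m) * detVal (a p 0) (a p 1) (a p 2) j₀ j₁ j₂ +
        U * T m j₀ j₁ j₂ + (LV (v m) * S j₀ j₁ j₂ + V * R m j₀ j₁ j₂) := by
    intro m j₀ j₁ j₂
    obtain ⟨LD, hLD, hLDw⟩ := hasFDerivAt_detVal (a := fun q => a q 0) (b := fun q => a q 1)
      (c := fun q => a q 2) (hLa 0) (hLa 1) (hLa 2) j₀ j₁ j₂
    choose LS hLS hLSw using fun k => hasFDerivAt_wedgeVal (a := fun q => a q k)
      (b := fun q => w q k) (hLa k) (hLb k) j₀ j₁ j₂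
    have h1 := (hLU.mul hLD).add (hLV.mul (HasFDerivAt.fun_sum (u := Finset.univ)
      fun k _ => hLS k))
    have h2 : HasFDerivAt (fun q => e.bryantSalamon l r i q ![v j₀, v j₁, v j₂]) _ p :=
      h1.congr_of_eventuallyEq (Filter.Eventually.of_forall fun q =>
        (e.bryantSalamon_apply l r i q _).trans rfl)
    rw [h2.fderiv]
    simp only [add_apply, smul_apply, smul_eq_mul, sum_apply, hLDw, hLSw]
    simp only [S, T, R, Fin.sum_univ_three]
    change U * _ + detVal (a p 0) (a p 1) (a p 2) j₀ j₁ j₂ * _ + (V * _ +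
      (wedgeVal (a p 0) (w p 0) j₀ j₁ j₂ + wedgeVal (a p 1) (w p 1) j₀ j₁ j₂ +
        wedgeVal (a p 2) (w p 2) j₀ j₁ j₂) * _) = _
    ring!
  have hD : ∀ k m j, D k j m = D k m j -
      ((a p (k + 2) m * c (k + 1) j - a p (k + 2) j * c (k + 1) m) -
        (a p (k + 1) m * c (k + 2) j - a p (k + 1) j * c (k + 2) m) +
        l / 3 * (p.2 (k + 2) * w p (k + 1) m j - p.2 (k + 1) * w p (k + 2) m j)) := by
    intro k m j
    have h1 := e.curvature_asdConn hE hW hp (k + 1) (v m).1 (v j).1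
    have h2 := e.curvature_asdConn hE hW hp (k + 2) (v m).1 (v j).1
    simp only [D, hLaw, ha, w, c]
    have e1 : k + 1 + 1 = k + 2 := by rw [add_assoc]; rfl
    have e2 : k + 1 + 2 = k := by rw [add_assoc]; exact add_zero k
    have e3 : k + 2 + 1 = k := by rw [add_assoc]; exact add_zero k
    have e4 : k + 2 + 2 = k + 1 := by rw [add_assoc]; rfl
    rw [e1, e2] at h1
    rw [e3, e4] at h2
    simp only [e1, e2, e3, e4]
    linear_combination p.2 (k + 2) * (-h1) + p.2 (k + 1) * h2
  have hDw : ∀ k j₀ j₁ j₂, Dw k j₀ j₁ j₂ = Dw k j₁ j₀ j₂ - Dw k j₂ j₀ j₁ +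
      wedgeVal (c (k + 2)) (w p (k + 1)) j₀ j₁ j₂ - wedgeVal (c (k + 1)) (w p (k + 2)) j₀ j₁ j₂ := by
    intro k j₀ j₁ j₂
    have h := e.cyclic_fderiv_asdBasis hp k (v j₀).1 (v j₁).1 (v j₂).1
    simp only [Dw, wedgeVal, c, w]
    linear_combination h
  have k1 := alternate_det (T := T) (S := S) (z := z) hD (fun _ _ _ _ => rfl) (fun _ _ _ => rfl)
    (fun _ => rfl)
  have k2 := alternate_wedge (S := R) hD hDw (fun _ _ _ _ => rfl)
  have k3 := alternate_mul_det (a := a p) (x := fun k => p.2 k) (z := z) fun _ => rfl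
  have r0 : Fin.removeNth 0 v = ![v 1, v 2, v 3] := by funext j; fin_cases j <;> rfl
  have r1 : Fin.removeNth 1 v = ![v 0, v 2, v 3] := by funext j; fin_cases j <;> rfl
  have r2 : Fin.removeNth 2 v = ![v 0, v 1, v 3] := by funext j; fin_cases j <;> rfl
  have r3 : Fin.removeNth 3 v = ![v 0, v 1, v 2] := by funext j; fin_cases j <;> rfl
  rw [extDeriv, ContinuousAlternatingMap.alternatizeUncurryFin_apply]
  change _ = (0 : ℝ)
  refine (Fin.sum_univ_four _).trans ?_
  simp only [fderiv_form_apply hdiff, r0, r1, r2, r3, hval, hLUw, hLVw, hz]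
  -- This is where the exponents matter: differentiating the power 1/4 returns the power -3/4, and
  -- (1/4)(4/3)l = l/3 is the curvature constant in `alternate_det`.
  have hVU : (r + 2 / 3 * l * ‖p.2‖ ^ 2) ^ ((1 / 4 : ℝ) - 1) = U := by norm_num [U]
  rw [hVU]
  simp only [Fin.isValue, Fin.val_zero, Fin.val_one, Fin.val_two, pow_zero, pow_one, one_smul]
  have h3 : (((3 : Fin 4) : ℕ)) = 3 := rfl
  rw [h3]
  simp only [Int.reduceNeg, neg_smul, one_smul, even_two, Even.neg_pow, one_pow,
    show ((-1 : ℤ) ^ 3) = -1 by norm_num]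
  linear_combination (-(3 / 4) * (r + 2 / 3 * l * ‖p.2‖ ^ 2) ^ (-(3 / 4) - 1 : ℝ) * (4 / 3 * l)) * k3 +
    U * k1 + V * k2

end Orbifold.OrthonormalFrame

end BryantSalamonClosed

/-! ### Invariance of the Bryant–Salamon form under changes of charts -/

section BryantSalamonInvariance

variable {X : Type u} [TopologicalSpace X] {Q : Orbifold E4 X} {g : Q.RiemannianMetric}

theorem hasFDerivAt_twoForm_apply {E T : Type*} [NormedAddCommGroup E] [NormedSpace ℝ E]
    [NormedAddCommGroup T] [NormedSpace ℝ T] {F : T → E [⋀^Fin 2]→L[ℝ] ℝ}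
    {F' : T →L[ℝ] E [⋀^Fin 2]→L[ℝ] ℝ} {Z Y : T → E} {Z' Y' : T →L[ℝ] E} {p : T}
    (hF : HasFDerivAt F F' p) (hZ : HasFDerivAt Z Z' p) (hY : HasFDerivAt Y Y' p) :
    ∃ L : T →L[ℝ] ℝ, HasFDerivAt (fun t => F t ![Z t, Y t]) L p ∧
      ∀ v, L v = F' v ![Z p, Y p] + F p ![Z' v, Y p] + F p ![Z p, Y' v] := by
  have h1 := ((ContinuousAlternatingMap.toContinuousMultilinearMapCLM (𝕜 := ℝ) (E := E) (F := ℝ)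
    (ι := Fin 2) ℝ).hasFDerivAt.comp p hF)
  have h2 := h1.continuousMultilinearMap_apply (g := ![Z, Y]) (g' := ![Z', Y']) (fun i => by
    fin_cases i
    · exact hZ
    · exact hY)
  have h3 : ∀ t, (fun i => (![Z, Y] : Fin 2 → T → E) i t) = ![Z t, Y t] := by
    intro t; funext i; fin_cases i <;> rfl
  simp only [h3] at h2
  refine ⟨_, h2, fun v => ?_⟩
  rw [add_apply, sum_apply, Fin.sum_univ_two, ← add_assoc]
  have u0 : Function.update ![Z p, Y p] 0 (Z' v) = ![Z' v, Y p] := by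
    funext i; fin_cases i <;> rfl
  have u1 : Function.update ![Z p, Y p] 1 (Y' v) = ![Z p, Y' v] := by
    funext i; fin_cases i <;> rfl
  rw [← u0, ← u1]
  rfl

/-- The matrix of the standard anti-self-dual form with components `a`. -/
def asdMatrix (a : E3) : Matrix (Fin 4) (Fin 4) ℝ :=
  !![0, a 0, a 1, a 2; -a 0, 0, -a 2, a 1; -a 1, a 2, 0, -a 0; -a 2, -a 1, a 0, 0]

theorem stdAsd_eq_sum (a : E3) (y z : E4) :
    stdAsd a y z = ∑ c, ∑ d, y c * asdMatrix a c d * z d := by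
  simp [Fin.sum_univ_four, stdAsd, asdMatrix]
  ring

/-- Together with `trace_asdMatrix_mul_mul` this expresses norm and determinant on ℝ³ by traces of 4
× 4 matrices, which are unchanged under conjugation by orthogonal matrices. -/
theorem trace_asdMatrix_mul_self (a : E3) : (asdMatrix a * asdMatrix a).trace = -4 * ‖a‖ ^ 2 := by
  rw [EuclideanSpace.real_norm_sq_eq]
  simp [Matrix.trace, Fin.sum_univ_four, Fin.sum_univ_three, asdMatrix]
  ring

theorem trace_asdMatrix_mul_mul (a b c : E3) :
    (asdMatrix a * asdMatrix b * asdMatrix c).trace =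
      -4 * (a 0 * (b 1 * c 2 - b 2 * c 1) - a 1 * (b 0 * c 2 - b 2 * c 0) +
        a 2 * (b 0 * c 1 - b 1 * c 0)) := by
  simp [Matrix.trace, Fin.sum_univ_four, asdMatrix]
  ring

namespace Orbifold.OrthonormalFrame

variable (e : Orbifold.OrthonormalFrame g) {i j : Q.ι} {h : OpenPartialHomeomorph E4 E4} {x : E4}

theorem asd_apply (i : Q.ι) (x : E4) (a : E3) (v : Fin 2 → E4) :
    e.asd i x a v = ∑ k, a k * asdBasis (g.val i x) (e.val i x) k v := by
  simp [asd, asdForm]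

theorem hasFDerivAt_fderiv_transition (H : Q.IsTransition i j h) (hx : x ∈ h.source) :
    HasFDerivAt (fderiv ℝ h) (fderiv ℝ (fderiv ℝ h) x) x :=
  (((H.contDiffOn.fderiv_of_isOpen h.open_source (m := ∞) (by simp)).contDiffAt
    (h.open_source.mem_nhds hx)).differentiableAt (by simp)).hasFDerivAt

theorem fderiv_fderiv_transition_symm (H : Q.IsTransition i j h) (hx : x ∈ h.source) (w z : E4) :
    fderiv ℝ (fderiv ℝ h) x w z = fderiv ℝ (fderiv ℝ h) x z w :=
  ((H.contDiffOn.contDiffAt (h.open_source.mem_nhds hx)).isSymmSndFDerivAt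
    (by simp [minSmoothness_of_isRCLikeNormedField]; exact two_le_infty)).eq w z

theorem fderiv_transition_surjective (H : Q.IsTransition i j h) (hx : x ∈ h.source) :
    Function.Surjective (fderiv ℝ h x) := by
  intro w
  have := H.symm.fderiv_symm (h.map_source hx) w
  rw [h.left_inv hx] at this
  exact ⟨_, this⟩

set_option maxSynthPendingDepth 3 in
theorem fderiv_metric_transition (H : Q.IsTransition i j h) (hx : x ∈ h.source) (w y z : E4) :
    fderiv ℝ (g.val i) x w y z =
      fderiv ℝ (g.val j) (h x) (fderiv ℝ h x w) (fderiv ℝ h x y) (fderiv ℝ h x z) +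
      g.val j (h x) (fderiv ℝ (fderiv ℝ h) x w y) (fderiv ℝ h x z) +
      g.val j (h x) (fderiv ℝ h x y) (fderiv ℝ (fderiv ℝ h) x w z) := by
  have hg := (differentiableAt_metric (g := g) (H.target_subset (h.map_source hx))).hasFDerivAt
  have hD := hasFDerivAt_fderiv_transition H hx
  have hgh : HasFDerivAt (fun t => g.val j (h t))
      ((fderiv ℝ (g.val j) (h x)).comp (fderiv ℝ h x)) x :=
    HasFDerivAt.comp (g := g.val j) x hg (H.differentiableAt hx).hasFDerivAt
  have h1 := (hgh.clm_apply
    (hD.clm_apply (hasFDerivAt_const y x))).clm_apply (hD.clm_apply (hasFDerivAt_const z x))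
  have h2 := ((differentiableAt_metric (g := g) (H.source_subset hx)).hasFDerivAt.clm_apply
    (hasFDerivAt_const y x)).clm_apply (hasFDerivAt_const z x)
  have h3 := h2.unique (h1.congr_of_eventuallyEq (by
    filter_upwards [h.open_source.mem_nhds hx] with t ht
    exact (g.invariant i j h H t ht y z).symm))
  have h4 := congrArg (fun L : E4 →L[ℝ] ℝ => L w) h3
  simp at h4
  rw [h4]
  ring

/-- The transformation of the Christoffel symbols under a change of charts. -/
theorem fderiv_transition_christoffel (H : Q.IsTransition i j h) (hx : x ∈ h.source) (w z : E4) :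
    fderiv ℝ h x (e.christoffel i x w z) = e.christoffel j (h x) (fderiv ℝ h x w) (fderiv ℝ h x z) +
      fderiv ℝ (fderiv ℝ h) x w z := by
  have hy := H.target_subset (h.map_source hx)
  refine e.metric_inj hy fun y' => ?_
  obtain ⟨y, rfl⟩ := fderiv_transition_surjective H hx y'
  rw [g.invariant i j h H x hx, e.metric_christoffel (H.source_subset hx), map_add, add_apply,
    e.metric_christoffel hy, fderiv_metric_transition H hx, fderiv_metric_transition H hx,
    fderiv_metric_transition H hx, fderiv_fderiv_transition_symm H hx z w,
    fderiv_fderiv_transition_symm H hx y w, fderiv_fderiv_transition_symm H hx y z,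
    g.symm j _ hy (fderiv ℝ h x z) (fderiv ℝ (fderiv ℝ h) x w y)]
  ring

/-- The vertical part of a tangent vector of the bundle of anti-self-dual forms. -/
def verticalPart (i : Q.ι) (p v : E4 × E3) : E3 :=
  WithLp.toLp 2 fun k => e.verticalForm i k p v

/-- Up to Christoffel terms, the derivative of the tautological two-form in the direction v is the
anti-self-dual form whose components are α_k(v). This characterises the vertical part without
reference to the frame. -/
theorem hasFDerivAt_asd {p : E4 × E3} (hp : p.1 ∈ Q.U i) :
    ∃ L : (E4 × E3) →L[ℝ] E4 [⋀^Fin 2]→L[ℝ] ℝ,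
      HasFDerivAt (fun q : E4 × E3 => e.asd i q.1 q.2) L p ∧ ∀ v z y, L v ![z, y] =
        e.asd i p.1 (e.verticalPart i p v) ![z, y] +
        e.asd i p.1 p.2 ![e.christoffel i p.1 v.1 z, y] +
        e.asd i p.1 p.2 ![z, e.christoffel i p.1 v.1 y] := by
  have hB : ∀ k, DifferentiableAt ℝ (fun t => asdBasis (g.val i t) (e.val i t) k) p.1 := fun k =>
    ((e.contDiffOn_asdBasis i k).contDiffAt ((Q.isOpen_U i).mem_nhds hp)).differentiableAt (by simp)
  have ha : ∀ m : Fin 3, HasFDerivAt (fun q : E4 × E3 => q.2 m)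
      ((EuclideanSpace.proj m : E3 →L[ℝ] ℝ).comp (ContinuousLinearMap.snd ℝ E4 E3)) p :=
    fun m => ((EuclideanSpace.proj m : E3 →L[ℝ] ℝ).comp
      (ContinuousLinearMap.snd ℝ E4 E3)).hasFDerivAt
  have hBp : ∀ k, HasFDerivAt (fun q : E4 × E3 => asdBasis (g.val i q.1) (e.val i q.1) k)
      ((fderiv ℝ (fun t => asdBasis (g.val i t) (e.val i t) k) p.1).comp
        (ContinuousLinearMap.fst ℝ E4 E3)) p := fun k =>
    HasFDerivAt.comp (g := fun t => asdBasis (g.val i t) (e.val i t) k) p (hB k).hasFDerivAt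
      hasFDerivAt_fst
  refine ⟨_, HasFDerivAt.fun_sum (u := Finset.univ) fun k _ => (ha k).smul (hBp k),
    fun v z y => ?_⟩
  have h1 : ∀ k, fderiv ℝ (fun t => asdBasis (g.val i t) (e.val i t) k) p.1 v.1 ![z, y] = _ :=
    fun k => (fderiv_form_apply (hB k) v.1 ![z, y]).trans (e.fderiv_asdBasis hp k v.1 z y)
  have hproj : ∀ (k : Fin 3) (a : E3), (EuclideanSpace.proj k : E3 →L[ℝ] ℝ) a = a k :=
    fun _ _ => rfl
  simp only [asd_apply, verticalPart, e.verticalForm_apply hp, Fin.sum_univ_three]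
  simp only [add_apply, ContinuousAlternatingMap.add_apply, smul_apply,
    ContinuousLinearMap.comp_apply, ContinuousLinearMap.smulRight_apply,
    ContinuousAlternatingMap.smul_apply, ContinuousLinearMap.coe_fst', ContinuousLinearMap.coe_snd',
    h1, smul_eq_mul, hproj, Fin.isValue, zero_add, Fin.reduceAdd]
  ring

theorem asd_liftFibre_apply (hQ : Q.IsOriented) (H : Q.IsTransition i j h) (hx : x ∈ h.source)
    (a : E3) (z y : E4) : e.asd j (h x) (e.liftFibre i j h x a) ![fderiv ℝ h x z, fderiv ℝ h x y] =
      e.asd i x a ![z, y] := by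
  rw [← e.liftFibre_spec hQ H hx a, ContinuousAlternatingMap.compContinuousLinearMap_apply]
  congr 1
  funext k; fin_cases k <;> rfl

theorem fst_fderiv_liftHomeo (hQ : Q.IsOriented) (H : Q.IsTransition i j h) {p : E4 × E3}
    (hp : p.1 ∈ h.source) (v : E4 × E3) :
    (fderiv ℝ (e.liftHomeo hQ H) p v).1 = fderiv ℝ h p.1 v.1 := by
  have hL := ((e.liftHomeo_isChartChange hQ H).differentiableAt
    (x := p) ⟨hp, trivial⟩).hasFDerivAt
  have h1 : HasFDerivAt (fun q : E4 × E3 => h q.1)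
      ((fderiv ℝ h p.1).comp (ContinuousLinearMap.fst ℝ E4 E3)) p :=
    HasFDerivAt.comp (g := h) p (H.differentiableAt hp).hasFDerivAt hasFDerivAt_fst
  exact congrArg (fun L : (E4 × E3) →L[ℝ] E4 => L v) (hL.fst.unique h1)

/-- The vertical part is equivariant under changes of charts. -/
theorem verticalPart_lift (hQ : Q.IsOriented) (H : Q.IsTransition i j h) {p : E4 × E3}
    (hp : p.1 ∈ h.source) (v : E4 × E3) :
    e.verticalPart j (e.liftHomeo hQ H p) (fderiv ℝ (e.liftHomeo hQ H) p v) =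
      e.liftFibre i j h p.1 (e.verticalPart i p v) := by
  have hpi := H.source_subset hp
  have hpj := H.target_subset (h.map_source hp)
  have hL := ((e.liftHomeo_isChartChange hQ H).differentiableAt
    (x := p) ⟨hp, trivial⟩).hasFDerivAt
  refine e.liftFibre_unique hQ H hp ?_
  ext u
  obtain ⟨z, y, rfl⟩ : ∃ z y, u = ![z, y] :=
    ⟨u 0, u 1, by funext k; fin_cases k <;> rfl⟩
  obtain ⟨Li, hLi, hLiv⟩ := e.hasFDerivAt_asd hpi
  obtain ⟨Lj, hLj, hLjv⟩ := e.hasFDerivAt_asd (p := e.liftHomeo hQ H p) hpj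
  have hD : ∀ z, HasFDerivAt (fun q : E4 × E3 => fderiv ℝ h q.1 z)
      (((fderiv ℝ (fderiv ℝ h) p.1).flip z).comp (ContinuousLinearMap.fst ℝ E4 E3)) p := by
    intro z
    have h1 : HasFDerivAt (fun t => fderiv ℝ h t z) ((fderiv ℝ (fderiv ℝ h) p.1).flip z) p.1 := by
      refine ((hasFDerivAt_fderiv_transition H hp).clm_apply (hasFDerivAt_const z p.1)).congr_fderiv
        ?_
      ext w : 1
      simp
    exact HasFDerivAt.comp (g := fun t => fderiv ℝ h t z) p h1 hasFDerivAt_fst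
  obtain ⟨A, hA, hAv⟩ := hasFDerivAt_twoForm_apply hLi (hasFDerivAt_const z p)
    (hasFDerivAt_const y p)
  obtain ⟨B, hB, hBv⟩ := hasFDerivAt_twoForm_apply (hLj.comp p hL) (hD z) (hD y)
  -- The tautological two-form is preserved by the lifted change of charts; this identity is
  -- differentiated. Second derivatives of h are absorbed by the transformation law of the
  -- Christoffel symbols, and the vertical parts remain.
  have hAB : A = B := hA.unique (hB.congr_of_eventuallyEq (by
    filter_upwards [(h.open_source.preimage continuous_fst).mem_nhds hp] with q hq
    exact (e.asd_liftFibre_apply hQ H hq q.2 z y).symm))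
  have hv := congrArg (fun L : (E4 × E3) →L[ℝ] ℝ => L v) hAB
  have z0 : ∀ (β : E4 [⋀^Fin 2]→L[ℝ] ℝ) (y : E4), β ![0, y] = 0 := fun β y =>
    β.map_coord_zero (0 : Fin 2) rfl
  have z1 : ∀ (β : E4 [⋀^Fin 2]→L[ℝ] ℝ) (y : E4), β ![y, 0] = 0 := fun β y =>
    β.map_coord_zero (1 : Fin 2) rfl
  have a0 : ∀ (β : E4 [⋀^Fin 2]→L[ℝ] ℝ) (a b y : E4), β ![a + b, y] = β ![a, y] + β ![b, y] := by
    intro β a b y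
    have u : ∀ c, Function.update ![a, y] 0 c = ![c, y] := fun c => by
      funext k; fin_cases k <;> rfl
    have := β.map_update_add ![a, y] 0 a b
    rwa [u, u, u] at this
  have a1 : ∀ (β : E4 [⋀^Fin 2]→L[ℝ] ℝ) (a b y : E4), β ![y, a + b] = β ![y, a] + β ![y, b] := by
    intro β a b y
    have u : ∀ c, Function.update ![y, a] 1 c = ![y, c] := fun c => by
      funext k; fin_cases k <;> rfl
    have := β.map_update_add ![y, a] 1 a b
    rwa [u, u, u] at this
  simp only [hAv, hBv, hLiv, ContinuousLinearMap.comp_apply, hLjv, zero_apply, z0, z1, add_zero,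
    ContinuousLinearMap.flip_apply, ContinuousLinearMap.coe_fst'] at hv
  have e1 := e.asd_liftFibre_apply hQ H hp p.2 (e.christoffel i p.1 v.1 z) y
  have e2 := e.asd_liftFibre_apply hQ H hp p.2 z (e.christoffel i p.1 v.1 y)
  rw [e.fderiv_transition_christoffel H hp, a0] at e1
  rw [e.fderiv_transition_christoffel H hp, a1] at e2
  have hc : (e.asd j (h p.1) (e.verticalPart j (e.liftHomeo hQ H p)
      (fderiv ℝ (e.liftHomeo hQ H) p v))).compContinuousLinearMap (fderiv ℝ h p.1) ![z, y] =
      e.asd j (h p.1) (e.verticalPart j (e.liftHomeo hQ H p)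
      (fderiv ℝ (e.liftHomeo hQ H) p v)) ![fderiv ℝ h p.1 z, fderiv ℝ h p.1 y] := by
    rw [ContinuousAlternatingMap.compContinuousLinearMap_apply]
    congr 1
    funext k; fin_cases k <;> rfl
  rw [hc]
  have hL0 : (e.liftHomeo hQ H p).1 = h p.1 := rfl
  rw [e.fst_fderiv_liftHomeo hQ H hp, hL0] at hv
  change _ = e.asd j (h p.1) _ _ + e.asd j (h p.1) (e.liftFibre i j h p.1 p.2) _ +
    e.asd j (h p.1) (e.liftFibre i j h p.1 p.2) _ +
    e.asd j (h p.1) (e.liftFibre i j h p.1 p.2) _ +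
    e.asd j (h p.1) (e.liftFibre i j h p.1 p.2) _ at hv
  linear_combination -hv - e1 - e2

/-- N is the matrix of the derivative of h in the two orthonormal frames. It is orthogonal because h
is an isometry, and pulling back a two-form conjugates its matrix by N. -/
theorem exists_asdMatrix_liftFibre (hQ : Q.IsOriented) (H : Q.IsTransition i j h)
    (hx : x ∈ h.source) : ∃ N : Matrix (Fin 4) (Fin 4) ℝ, N * N.transpose = 1 ∧
      ∀ a, asdMatrix a = N.transpose * asdMatrix (e.liftFibre i j h x a) * N := by
  have hxi := H.source_subset hx
  have hxj := H.target_subset (h.map_source hx)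
  refine ⟨Matrix.of fun c d => coframe (g.val j (h x)) (e.val j (h x)) c
    (fderiv ℝ h x (e.vec i x d)), ?_, fun a => ?_⟩
  · rw [mul_eq_one_comm]
    ext c d
    simp only [Matrix.mul_apply, Matrix.transpose_apply, Matrix.of_apply, Matrix.one_apply]
    rw [← e.metric_eq_sum hxj, g.invariant i j h H x hx]
    exact e.coframe_vec hxi c d
  · ext c d
    have h1 : frameCoords (g.val i x) (e.val i x) (e.vec i x c) = stdVec c := by
      ext k
      simp [frameCoords, e.coframe_vec hxi, stdVec]
    have h2 : frameCoords (g.val i x) (e.val i x) (e.vec i x d) = stdVec d := by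
      ext k
      simp [frameCoords, e.coframe_vec hxi, stdVec]
    have h3 := congrArg (fun β => β ![e.vec i x c, e.vec i x d]) (e.liftFibre_spec hQ H hx a)
    simp only [ContinuousAlternatingMap.compContinuousLinearMap_apply, asd, asdForm_apply,
      Function.comp_apply, Matrix.cons_val_zero, Matrix.cons_val_one, h1, h2] at h3
    rw [stdAsd_eq_sum, stdAsd_eq_sum] at h3
    have h4 : ∑ c', ∑ d', stdVec c c' * asdMatrix a c' d' * stdVec d d' = asdMatrix a c d := by
      simp [stdVec]
    rw [h4] at h3
    rw [← h3, Matrix.mul_apply, Finset.sum_comm]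
    refine Finset.sum_congr rfl fun d' _ => ?_
    rw [Matrix.mul_apply, Finset.sum_mul]
    rfl

theorem norm_liftFibre (hQ : Q.IsOriented) (H : Q.IsTransition i j h) (hx : x ∈ h.source) (a : E3) :
    ‖e.liftFibre i j h x a‖ = ‖a‖ := by
  obtain ⟨N, hN, ha⟩ := e.exists_asdMatrix_liftFibre hQ H hx
  have h1 := trace_asdMatrix_mul_self a
  rw [ha a] at h1
  set M := asdMatrix (e.liftFibre i j h x a) with hM
  have h2 : N.transpose * M * N * (N.transpose * M * N) = N.transpose * (M * M * N) := by
    calc _ = N.transpose * M * (N * N.transpose) * M * N := by simp only [Matrix.mul_assoc]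
      _ = _ := by rw [hN, Matrix.mul_one]; simp only [Matrix.mul_assoc]
  rw [h2, Matrix.trace_mul_comm, Matrix.mul_assoc, hN, Matrix.mul_one, hM,
    trace_asdMatrix_mul_self] at h1
  have h3 : ‖e.liftFibre i j h x a‖ ^ 2 = ‖a‖ ^ 2 := by linarith
  exact (pow_left_inj₀ (norm_nonneg _) (norm_nonneg _) two_ne_zero).1 h3

/-- The trace of the triple product of matrices is -4 times the determinant, with sign, and is
invariant under conjugation by N. So the lifts preserve the orientation of the fibres as well as
their norm. -/
theorem detVal_liftFibre (hQ : Q.IsOriented) (H : Q.IsTransition i j h) (hx : x ∈ h.source)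
    (a : Fin 3 → E3) :
    detVal (fun m => e.liftFibre i j h x (a m) 0) (fun m => e.liftFibre i j h x (a m) 1)
        (fun m => e.liftFibre i j h x (a m) 2) 0 1 2 =
      detVal (fun m => a m 0) (fun m => a m 1) (fun m => a m 2) 0 1 2 := by
  obtain ⟨N, hN, ha⟩ := e.exists_asdMatrix_liftFibre hQ H hx
  have h1 := trace_asdMatrix_mul_mul (a 0) (a 1) (a 2)
  have h3 := trace_asdMatrix_mul_mul (e.liftFibre i j h x (a 0)) (e.liftFibre i j h x (a 1))
    (e.liftFibre i j h x (a 2))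
  rw [ha (a 0), ha (a 1), ha (a 2)] at h1
  set M₀ := asdMatrix (e.liftFibre i j h x (a 0))
  set M₁ := asdMatrix (e.liftFibre i j h x (a 1))
  set M₂ := asdMatrix (e.liftFibre i j h x (a 2))
  have h2 : N.transpose * M₀ * N * (N.transpose * M₁ * N) * (N.transpose * M₂ * N) =
      N.transpose * (M₀ * M₁ * M₂ * N) := by
    calc _ = N.transpose * M₀ * (N * N.transpose) * M₁ * (N * N.transpose) * M₂ * N := by
          simp only [Matrix.mul_assoc]
      _ = _ := by rw [hN, Matrix.mul_one, Matrix.mul_one]; simp only [Matrix.mul_assoc]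
  rw [h2, Matrix.trace_mul_comm, Matrix.mul_assoc _ N, hN, Matrix.mul_one, h3] at h1
  simp only [detVal]
  linear_combination -(1 / 4 : ℝ) * h1

/-- The Bryant–Salamon form is invariant under changes of charts. -/
theorem bryantSalamon_lift (hQ : Q.IsOriented) (H : Q.IsTransition i j h) (l r : ℝ) {p : E4 × E3}
    (hp : p.1 ∈ h.source) :
    (e.bryantSalamon l r j (e.liftHomeo hQ H p)).compContinuousLinearMap
      (fderiv ℝ (e.liftHomeo hQ H) p) = e.bryantSalamon l r i p := by
  ext v
  rw [ContinuousAlternatingMap.compContinuousLinearMap_apply, bryantSalamon_apply,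
    bryantSalamon_apply]
  have hα : ∀ k m, e.verticalForm j k (e.liftHomeo hQ H p) (fderiv ℝ (e.liftHomeo hQ H) p (v m)) =
      e.liftFibre i j h p.1 (e.verticalPart i p (v m)) k := fun k m =>
    congrArg (fun a : E3 => a k) (e.verticalPart_lift hQ H hp (v m))
  have hn : ‖(e.liftHomeo hQ H p).2‖ = ‖p.2‖ := e.norm_liftFibre hQ H hp p.2
  have hL1 := e.fst_fderiv_liftHomeo hQ H hp
  have hL0 : (e.liftHomeo hQ H p).1 = h p.1 := rfl
  -- The individual ω_k depend on the frames. The contraction of a fibre vector with them does not,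
  -- and ∑ α_k∧ω_k is the contraction of the vertical part with the ω_k.
  have hs : ∀ a (z y : E4), ∑ k, e.liftFibre i j h p.1 a k * asdBasis (g.val j (h p.1))
      (e.val j (h p.1)) k ![fderiv ℝ h p.1 z, fderiv ℝ h p.1 y] =
      ∑ k, a k * asdBasis (g.val i p.1) (e.val i p.1) k ![z, y] := by
    intro a z y
    rw [← asd_apply, ← asd_apply, e.asd_liftFibre_apply hQ H hp]
  have hw : ∀ (a : Fin 3 → Fin 3 → ℝ) (b : Fin 3 → Fin 3 → Fin 3 → ℝ),
      ∑ k, wedgeVal (a k) (b k) 0 1 2 = ∑ k, a k 0 * b k 1 2 - ∑ k, a k 1 * b k 0 2 +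
        ∑ k, a k 2 * b k 0 1 := fun a b => by
    rw [← Finset.sum_sub_distrib, ← Finset.sum_add_distrib]
    rfl
  simp only [Function.comp_apply, hα, hn, hL0, hL1, e.detVal_liftFibre hQ H hp, hw, hs]
  rfl

/-- The Bryant–Salamon form of a self-dual Einstein metric is a closed form. -/
theorem bryantSalamon_mem_closedForms (hQ : Q.IsOriented) {l r : ℝ} (hl : 0 < l) (hr : 0 < r)
    (hE : e.IsEinstein l) (hW : e.IsSelfDual) :
    e.bryantSalamon l r ∈ (e.asdOrbifold hQ).closedForms 3 :=
  ⟨e.mem_forms_of_lift hQ (fun i => e.contDiffOn_bryantSalamon hl hr i)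
    fun _ _ _ H _ hp => e.bryantSalamon_lift hQ H l r hp,
    fun _ _ hx => e.extDeriv_bryantSalamon hl hr hE hW hx.1⟩

end Orbifold.OrthonormalFrame

end BryantSalamonInvariance

end

theorem mainTheorem8 {X : Type*} [TopologicalSpace X] [T2Space X] [SecondCountableTopology X]
    (Q : Orbifold E4 X) (hQ : Q.IsOriented) (g : Q.RiemannianMetric)
    (e : Orbifold.OrthonormalFrame g) (l : ℝ) (hl : 0 < l) (hE : e.IsEinstein l)
    (hW : e.IsSelfDual) (r : ℝ) (hr : 0 < r) :
    (e.bryantSalamon l r ∈ (e.asdOrbifold hQ).closedForms 3) ∧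
    Subsingleton ((e.asdOrbifold hQ).cohomology 5) ∧
    (Nonempty (SeifertBundle Q) ↔
      ∃ P : SeifertBundle (e.asdOrbifold hQ), P.ChernCupVanishes (e.bryantSalamon l r)) ∧
    (∀ P : SeifertBundle (e.asdOrbifold hQ), P.ChernCupVanishes (e.bryantSalamon l r)) := by
  have hφ : e.bryantSalamon l r ∈ (e.asdOrbifold hQ).closedForms 3 :=
    e.bryantSalamon_mem_closedForms hQ hl hr hE hW
  have hall : ∀ P : SeifertBundle (e.asdOrbifold hQ), P.ChernCupVanishes (e.bryantSalamon l r) :=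
    fun P => SeifertBundle.chernCupVanishes e hQ P hφ
  refine ⟨hφ, e.subsingleton_cohomology_five hQ, ⟨?_, ?_⟩, hall⟩
  · rintro ⟨P⟩
    obtain ⟨P'⟩ := P.nonempty_lift e hQ
    exact ⟨P', hall P'⟩
  · rintro ⟨P, -⟩
    exact ⟨P.restrictZero⟩
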